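/- Let $m\in\mathbb Z$, $\varepsilon\in\mathbb C$, $M=m-\varepsilon$, $D=2M$, $P=-p^2>0$, $c_\Gamma=\Gamma(1+\varepsilon)\Gamma(1-\varepsilon)^2/\Gamma(1-2\varepsilon)$, and write $\nu_{ij\dots}=\nu_i+\nu_j+\dots$. With $k_3=k_2-p$, $k_4=k_1-p$, $k_5=k_2-k_1$ put $$\hat I^{(2,5)}(M,\nu_1,\dots,\nu_5)=c_\Gamma^{-2}P^{\nu_{12345}-2M}\int\frac{d^Dk_1}{i\pi^{D/2}}\int\frac{d^Dk_2}{i\pi^{D/2}}\prod_{j=1}^5(-k_j^2)^{-\nu_j},$$ $$\hat I^{(1,2)}(M,\nu_1,\nu_4)=c_\Gamma^{-1}P^{\nu_{14}-M}\int\frac{d^Dk_1}{i\pi^{D/2}}(-k_1^2)^{-\nu_1}(-k_4^2)^{-\nu_4},$$ $$I^{(1,3)}(M,\nu_2,\nu_3,\nu_5;x,y)=c_\Gamma^{-1}P^{\nu_{235}-M}\int\frac{d^Dk_2}{i\pi^{D/2}}(-k_2^2)^{-\nu_2}(-k_3^2)^{-\nu_3}(-k_5^2)^{-\nu_5},\qquad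 x=\frac{P}{-k_1^2},\quad y=\frac{P}{-k_4^2},$$ $$\hat I^{(1,3)}(M,\nu_2,\nu_3,\nu_5;\tau,\sigma)=\int_0^\infty dx\int_0^\infty dy\,x^{\tau-1}y^{\sigma-1}I^{(1,3)}(M,\nu_2,\nu_3,\nu_5;x,y).$$ Integrals in complex dimension $D$ are defined by writing each factor as $(-q^2)^{-\nu}=\Gamma(\nu)^{-1}\int_0^\infty\alpha^{\nu-1}e^{-\alpha(-q^2)}d\alpha$ and using the $D$-dimensional Gaussian integral: if $\sum_j\alpha_j(-q_j^2)$ has quadratic, linear and constant parts $A,B,C$ in the loop momenta, then $\int\prod_l\frac{d^Dk_l}{i\pi^{D/2}}\,e^{-\sum_j\alpha_j(-q_j^2)}=(\det A)^{-D/2}e^{-(C-B^TA^{-1}B)}$. (1) Let $\nu_1,\dots,\nu_5\in\mathbb C$ with $\operatorname{Re}\nu_1,\operatorname{Re}\nu_4>0$, and let $\gamma_1,\gamma_2\in\mathbb R$ be such that for $\operatorname{Re}\sigma=\gamma_1$, $\operatorname{Re}\tau=\gamma_2$ the numbers $-\sigma$, $-\sigma+M-\nu_{35}$, $-\tau$,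 $-\tau+M-\nu_{25}$, $\sigma+\tau-M+\nu_{235}$, $\sigma+\tau+\nu_5$, $\sigma+M-\nu_4$, $\tau+M-\nu_1$, $-\sigma-\tau-M+\nu_{14}$ have positive real part. Then all integrals involved converge absolutely, $$\hat I^{(2,5)}(M,\nu_1,\dots,\nu_5)=\frac1{(2\pi i)^2}\int_{\gamma_1-i\infty}^{\gamma_1+i\infty}d\sigma\int_{\gamma_2-i\infty}^{\gamma_2+i\infty}d\tau\;\hat I^{(1,2)}(M,\nu_1-\tau,\nu_4-\sigma)\,\hat I^{(1,3)}(M,\nu_2,\nu_3,\nu_5;\tau,\sigma),$$ and on the contours $$\hat I^{(1,2)}(M,a,b)=c_\Gamma^{-1}\frac{\Gamma(a+b-M)\Gamma(M-a)\Gamma(M-b)}{\Gamma(a)\Gamma(b)\Gamma(2M-a-b)}\quad(a=\nu_1-\tau,\ b=\nu_4-\sigma),$$ $$\hat I^{(1,3)}(M,\nu_2,\nu_3,\nu_5;\tau,\sigma)=c_\Gamma^{-1}\frac{\Gamma(-\sigma)\Gamma(-\sigma+M-\nu_{35})\Gamma(-\tau)\Gamma(-\tau+M-\nu_{25})\Gamma(\sigma+\tau-M+\nu_{235})\Gamma(\sigma+\tau+\nu_5)}{\Gamma(\nu_2)\Gamma(\nu_3)\Gamma(\nu_5)\Gamma(2M-\nu_{235})}.$$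 (2) Let $R$ be the set of $(\varepsilon,\nu_1,\dots,\nu_5)\in\mathbb C^6$ with $0<\operatorname{Re}\nu_j<\operatorname{Re}M$, $\operatorname{Re}\nu_{125},\operatorname{Re}\nu_{345}<2\operatorname{Re}M$, $\operatorname{Re}\nu_{145},\operatorname{Re}\nu_{235}>\operatorname{Re}M$, $\operatorname{Re}\nu_{12345}>2\operatorname{Re}M$. Let $G\subset\mathbb C^6$ be the set where none of $1-2\varepsilon$, $M-\nu_1,\dots,M-\nu_5$, $\nu_2$, $\nu_3$, $\nu_5$, $2M-\nu_{125}$, $2M-\nu_{345}$, $2M-\nu_{235}$, $\nu_{145}-M$, $\nu_{235}-M$, $\nu_{12345}-2M$ lies in $\{0,-1,-2,\dots\}$. On $R$ the integral $\hat I^{(2,5)}$ converges absolutely, and it continues from $R\cap G$ to a holomorphic function on $G$. At every point of $G$ the continued $\hat I^{(2,5)}$ is given by the formula of (1) as an iterated integral, with the Gamma function expressions for $\hat I^{(1,2)}$ and $\hat I^{(1,3)}$ in the integrand and with any finitely indented vertical $C^1$ contours with the following properties, on which the inner and the outer integral converge absolutely. For each $\sigma$ on its contour, the $\tau$-contour (which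 may depend on $\sigma$) has the poles of $\Gamma(-\tau)$, $\Gamma(-\tau+M-\nu_{25})$, $\Gamma(-\sigma-\tau-M+\nu_{14})$ on its right and those of $\Gamma(\tau+M-\nu_1)$, $\Gamma(\sigma+\tau-M+\nu_{235})$, $\Gamma(\sigma+\tau+\nu_5)$ on its left. The $\sigma$-contour has the points $n$, $M-\nu_{35}+n$ on its right and the points $\nu_4-M-n$, $M-\nu_{235}-n$, $-\nu_5-n$, $-\nu_3-n$, $\nu_2-M-n$ on its left ($n=0,1,2,\dots$). (3) Let $\operatorname{Re}M>\tfrac12$, $0<\operatorname{Re}\nu_j<\operatorname{Re}M$ for $j=2,3,5$, $\operatorname{Re}\nu_{235}>\operatorname{Re}M$, and let $\gamma_3,\gamma_4<\operatorname{Re}M$ satisfy $\gamma_3+\gamma_4>\operatorname{Re}M$, $\gamma_3+\operatorname{Re}\nu_{25}<2\operatorname{Re}M$, $\gamma_4+\operatorname{Re}\nu_{35}<2\operatorname{Re}M$. Let $x,y>0$ be such that * $y\ne1$, or $\gamma_3<\operatorname{Re}M-\frac12$ and $\gamma_3+\operatorname{Re}\nu_{25}<2\operatorname{Re}M-\frac12$;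 and * $(1+\frac1x-\frac1y)^2\ne\frac4x$, or $\operatorname{Re}M>\frac32$. Then the double inverse Mellin transforms $$I^{(1,2)}(M,x,y)=\frac1{(2\pi i)^2}\int_{\gamma_3-i\infty}^{\gamma_3+i\infty}d\nu_1\int_{\gamma_4-i\infty}^{\gamma_4+i\infty}d\nu_4\,x^{-\nu_1}y^{-\nu_4}\hat I^{(1,2)}(M,\nu_1,\nu_4),$$ $$I^{(2,5)}(M,\nu_2,\nu_3,\nu_5;x,y)=\frac1{(2\pi i)^2}\int_{\gamma_3-i\infty}^{\gamma_3+i\infty}d\nu_1\int_{\gamma_4-i\infty}^{\gamma_4+i\infty}d\nu_4\,x^{-\nu_1}y^{-\nu_4}\hat I^{(2,5)}(M,\nu_1,\dots,\nu_5)$$ exist as iterated integrals, improper in the sense $\lim_{T\to\infty}\int_{\gamma-iT}^{\gamma+iT}$ (inner integral over $\nu_4$), the triangle $I^{(1,3)}(M,\nu_2,\nu_3,\nu_5;x,y)$ converges absolutely, and $$I^{(2,5)}(M,\nu_2,\nu_3,\nu_5;x,y)=I^{(1,2)}(M,x,y)\,I^{(1,3)}(M,\nu_2,\nu_3,\nu_5;x,y).$$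 -/

import Mathlib

open Complex MeasureTheory Set Filter Topology

noncomputable section

namespace FeynmanMB

/-! ### Loop integrals in `D = 2 M` dimensions

A Feynman integral with loop momenta `k_l` (`l : L`), propagators `e : E` and external momenta
`p_j` (`j : X`) has propagator momenta `q_e = ∑ l, a e l * k_l + ∑ j, b e j * p_j`. The external
momenta enter through the numbers `g j j' = - p_j · p_j'`. For a complex dimension the integral
`∫ ∏_l d^D k_l / (i π^(D/2)) ∏_e (-q_e^2)^(-ν_e)` means: write every factor as
`(-q^2)^(-ν) = Γ(ν)⁻¹ ∫_0^∞ α^(ν-1) exp(-α (-q^2)) dα` and use the `D`-dimensional (Wick rotated)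
Gaussian integral
`∫ ∏_l d^D k_l / (i π^(D/2)) exp(-∑_e α_e (-q_e^2)) = (det A)^(-D/2) exp(-(C - Bᵀ A⁻¹ B))`,
where `A`, `B`, `C` are the quadratic, linear and constant parts of the quadratic form
`∑_e α_e (-q_e^2)` in the loop momenta. -/

section General

variable {L E X : Type*} [Fintype L] [DecidableEq L] [Fintype E] [Fintype X]

/-- Quadratic part in the loop momenta of `∑_e α_e (-q_e^2)`. -/
def loopMatrix (a : E → L → ℝ) (α : E → ℝ) : Matrix L L ℝ :=
  Matrix.of fun l l' => ∑ e, α e * a e l * a e l'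

/-- Mixed (loop, external) part of `∑_e α_e (-q_e^2)`. -/
def mixedMatrix (a : E → L → ℝ) (b : E → X → ℝ) (α : E → ℝ) : Matrix L X ℝ :=
  Matrix.of fun l j => ∑ e, α e * a e l * b e j

/-- External part of `∑_e α_e (-q_e^2)`. -/
def externalMatrix (b : E → X → ℝ) (α : E → ℝ) : Matrix X X ℝ :=
  Matrix.of fun j j' => ∑ e, α e * b e j * b e j'

/-- The exponent left after completing the square in the loop momenta. -/
def gaussExponent (a : E → L → ℝ) (b : E → X → ℝ) (g : X → X → ℝ) (α : E → ℝ) : ℝ :=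
  ∑ j, ∑ j', (externalMatrix b α -
    (mixedMatrix a b α).transpose * (loopMatrix a α)⁻¹ * mixedMatrix a b α) j j' * g j j'

/-- The integrand over the Schwinger parameters, in dimension `D = 2 M`. -/
def schwingerIntegrand (M : ℂ) (a : E → L → ℝ) (b : E → X → ℝ) (g : X → X → ℝ) (ν : E → ℂ)
    (α : E → ℝ) : ℂ :=
  (∏ e, (α e : ℂ) ^ (ν e - 1)) * (((loopMatrix a α).det : ℝ) : ℂ) ^ (-M) *
    Complex.exp (-((gaussExponent a b g α : ℝ) : ℂ))

/-- Absolute convergence of the loop integral. -/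
def LoopConverges (M : ℂ) (a : E → L → ℝ) (b : E → X → ℝ) (g : X → X → ℝ) (ν : E → ℂ) : Prop :=
  IntegrableOn (schwingerIntegrand M a b g ν) (Set.univ.pi fun _ => Ioi 0)

/-- `∫ ∏_l d^D k_l / (i π^(D/2)) ∏_e (-q_e^2)^(-ν_e)` in dimension `D = 2 M`. -/
def loopIntegral (M : ℂ) (a : E → L → ℝ) (b : E → X → ℝ) (g : X → X → ℝ) (ν : E → ℂ) : ℂ :=
  (∏ e, (Complex.Gamma (ν e))⁻¹) *
    ∫ α in (Set.univ.pi fun _ => Ioi (0 : ℝ)), schwingerIntegrand M a b g ν α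

end General

/-- `c_Γ = Γ(1+ε) Γ(1-ε)² / Γ(1-2ε)`. -/
def cGamma (ε : ℂ) : ℂ :=
  Complex.Gamma (1 + ε) * Complex.Gamma (1 - ε) ^ 2 / Complex.Gamma (1 - 2 * ε)

/-! ### The two-loop integral, the bubble and the triangle; `P = -p^2 > 0` and `D = 2 (m - ε)` -/

/-- Loop part of the routing `k₁, k₂, k₃ = k₂ - p, k₄ = k₁ - p, k₅ = k₂ - k₁`. -/
def twoLoopA : Fin 5 → Fin 2 → ℝ := ![![1, 0], ![0, 1], ![0, 1], ![1, 0], ![-1, 1]]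

/-- External part (coefficient of `p`) of the routing of the two-loop integral. -/
def twoLoopB : Fin 5 → Fin 1 → ℝ := ![![0], ![0], ![-1], ![-1], ![0]]

/-- Convergence of the two-loop integral. -/
def TwoLoopConverges (m : ℤ) (ε : ℂ) (P : ℝ) (ν₁ ν₂ ν₃ ν₄ ν₅ : ℂ) : Prop :=
  LoopConverges ((m : ℂ) - ε) twoLoopA twoLoopB (fun _ _ => P) ![ν₁, ν₂, ν₃, ν₄, ν₅]

/-- The two-loop integral `Î^(2,5)(m-ε, ν₁, …, ν₅)`. -/
def twoLoop (m : ℤ) (ε : ℂ) (P : ℝ) (ν₁ ν₂ ν₃ ν₄ ν₅ : ℂ) : ℂ :=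
  (cGamma ε ^ 2)⁻¹ * (P : ℂ) ^ (ν₁ + ν₂ + ν₃ + ν₄ + ν₅ - 2 * m + 2 * ε) *
    loopIntegral ((m : ℂ) - ε) twoLoopA twoLoopB (fun _ _ => P) ![ν₁, ν₂, ν₃, ν₄, ν₅]

/-- Loop part of the routing `k₁, k₄ = k₁ - p`. -/
def bubbleA : Fin 2 → Fin 1 → ℝ := ![![1], ![1]]

/-- External part of the routing `k₁, k₄ = k₁ - p`. -/
def bubbleB : Fin 2 → Fin 1 → ℝ := ![![0], ![-1]]

/-- Convergence of the bubble integral. -/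
def BubbleConverges (m : ℤ) (ε : ℂ) (P : ℝ) (ν₁ ν₄ : ℂ) : Prop :=
  LoopConverges ((m : ℂ) - ε) bubbleA bubbleB (fun _ _ => P) ![ν₁, ν₄]

/-- The one-loop bubble `Î^(1,2)(m-ε, ν₁, ν₄)`. -/
def bubble (m : ℤ) (ε : ℂ) (P : ℝ) (ν₁ ν₄ : ℂ) : ℂ :=
  (cGamma ε)⁻¹ * (P : ℂ) ^ (ν₁ + ν₄ - m + ε) *
    loopIntegral ((m : ℂ) - ε) bubbleA bubbleB (fun _ _ => P) ![ν₁, ν₄]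

/-- Loop part of the routing `k₂, k₃ = k₂ - p, k₅ = k₂ - k₁`. -/
def triangleA : Fin 3 → Fin 1 → ℝ := ![![1], ![1], ![1]]

/-- External part (coefficients of `p` and `k₁`) of the routing `k₂, k₂ - p, k₂ - k₁`. -/
def triangleB : Fin 3 → Fin 2 → ℝ := ![![0, 0], ![-1, 0], ![0, -1]]

/-- The products `-p·p, -p·k₁, -k₁·k₁` for `-p² = P`, `-k₁² = P / x`, `-(k₁ - p)² = P / y`. -/
def triangleG (P x y : ℝ) : Fin 2 → Fin 2 → ℝ :=
  ![![P, (P + P / x - P / y) / 2], ![(P + P / x - P / y) / 2, P / x]]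

/-- Convergence of the triangle integral. -/
def TriangleConverges (m : ℤ) (ε : ℂ) (P : ℝ) (ν₂ ν₃ ν₅ : ℂ) (x y : ℝ) : Prop :=
  LoopConverges ((m : ℂ) - ε) triangleA triangleB (triangleG P x y) ![ν₂, ν₃, ν₅]

/-- The one-loop triangle `I^(1,3)(m-ε, ν₂, ν₃, ν₅; x, y)`. -/
def triangle (m : ℤ) (ε : ℂ) (P : ℝ) (ν₂ ν₃ ν₅ : ℂ) (x y : ℝ) : ℂ :=
  (cGamma ε)⁻¹ * (P : ℂ) ^ (ν₂ + ν₃ + ν₅ - m + ε) *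
    loopIntegral ((m : ℂ) - ε) triangleA triangleB (triangleG P x y) ![ν₂, ν₃, ν₅]

/-- Absolute convergence of the double Mellin transform of the triangle. -/
def TriangleMellinConverges (m : ℤ) (ε : ℂ) (P : ℝ) (ν₂ ν₃ ν₅ τ σ : ℂ) : Prop :=
  IntegrableOn (fun z : ℝ × ℝ =>
    (z.1 : ℂ) ^ (τ - 1) * (z.2 : ℂ) ^ (σ - 1) * triangle m ε P ν₂ ν₃ ν₅ z.1 z.2)
    (Ioi 0 ×ˢ Ioi 0)

/-- The double Mellin transform `Î^(1,3)(m-ε, ν₂, ν₃, ν₅; τ, σ)` of the triangle. -/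
def triangleMellin (m : ℤ) (ε : ℂ) (P : ℝ) (ν₂ ν₃ ν₅ τ σ : ℂ) : ℂ :=
  ∫ x in Ioi (0 : ℝ), ∫ y in Ioi (0 : ℝ),
    (x : ℂ) ^ (τ - 1) * (y : ℂ) ^ (σ - 1) * triangle m ε P ν₂ ν₃ ν₅ x y

/-- The bubble as a product of Gamma functions. -/
def bubbleGamma (m : ℤ) (ε ν₁ ν₄ : ℂ) : ℂ :=
  (cGamma ε)⁻¹ *
    (Complex.Gamma (-m + ε + ν₁ + ν₄) / (Complex.Gamma ν₁ * Complex.Gamma ν₄)) *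
    (Complex.Gamma (m - ε - ν₁) * Complex.Gamma (m - ε - ν₄) /
      Complex.Gamma (2 * m - 2 * ε - ν₁ - ν₄))

/-- The double Mellin transform of the triangle as a product of Gamma functions. -/
def triangleGamma (m : ℤ) (ε ν₂ ν₃ ν₅ τ σ : ℂ) : ℂ :=
  (cGamma ε)⁻¹ *
    (1 / (Complex.Gamma ν₂ * Complex.Gamma ν₃ * Complex.Gamma ν₅ *
      Complex.Gamma (2 * m - 2 * ε - ν₂ - ν₃ - ν₅))) *
    (Complex.Gamma (-σ) * Complex.Gamma (-σ + m - ε - ν₃ - ν₅)) *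
    (Complex.Gamma (-τ) * Complex.Gamma (-τ + m - ε - ν₂ - ν₅)) *
    (Complex.Gamma (σ + τ - m + ε + ν₂ + ν₃ + ν₅) * Complex.Gamma (σ + τ + ν₅))

/-! ### Contours -/

/-- The vertical line with real part `γ`, from `γ - i∞` to `γ + i∞`. -/
def verticalLine (γ : ℝ) : ℝ → ℂ := fun s => (γ : ℂ) + s * I

/-- A vertical line with (finitely extended) indentations. -/
def IsIndentedLine (c : ℝ → ℂ) : Prop :=
  ContDiff ℝ 1 c ∧ ∃ γ T : ℝ, ∀ s : ℝ, T ≤ |s| → c s = verticalLine γ s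

/-- `∫ f(z) dz` along `c`. -/
def contourIntegral (c : ℝ → ℂ) (f : ℂ → ℂ) : ℂ := ∫ s : ℝ, f (c s) * deriv c s

/-- The integral of `f` along `c` converges absolutely. -/
def ContourIntegrable (c : ℝ → ℂ) (f : ℂ → ℂ) : Prop :=
  Integrable (fun s : ℝ => f (c s) * deriv c s)

/-- `z` is on the left of the upward contour `c`: the argument of `c - z` grows by `π`. -/
def LiesLeft (z : ℂ) (c : ℝ → ℂ) : Prop :=
  z ∉ Set.range c ∧
    Tendsto (fun T : ℝ => ∫ s in (-T)..T, deriv c s / (c s - z)) atTop (𝓝 (Real.pi * I))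

/-- `z` is on the right of the upward contour `c`: the argument of `c - z` decreases by `π`. -/
def LiesRight (z : ℂ) (c : ℝ → ℂ) : Prop :=
  z ∉ Set.range c ∧
    Tendsto (fun T : ℝ => ∫ s in (-T)..T, deriv c s / (c s - z)) atTop (𝓝 (-(Real.pi * I)))

/-- The lines `Re σ = γ₁`, `Re τ = γ₂` separate the poles of the Gamma functions of the
integrand in which `σ`, `τ`, `σ + τ` occur with a minus sign from those in which they occur with
a plus sign: all these Gamma functions have arguments of positive real part on the lines. -/
def SeparatingLines (m : ℤ) (ε ν₁ ν₂ ν₃ ν₄ ν₅ : ℂ) (γ₁ γ₂ : ℝ) : Prop :=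
  0 < -γ₁ ∧ 0 < -γ₁ + ((m : ℂ) - ε - ν₃ - ν₅).re ∧
  0 < -γ₂ ∧ 0 < -γ₂ + ((m : ℂ) - ε - ν₂ - ν₅).re ∧
  0 < γ₁ + γ₂ + (-(m : ℂ) + ε + ν₂ + ν₃ + ν₅).re ∧ 0 < γ₁ + γ₂ + ν₅.re ∧
  0 < γ₁ + ((m : ℂ) - ε - ν₄).re ∧ 0 < γ₂ + ((m : ℂ) - ε - ν₁).re ∧
  0 < -γ₁ - γ₂ + (-(m : ℂ) + ε + ν₁ + ν₄).re

/-- For fixed `σ`, the contour `c` of the inner variable `τ` separates the poles of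
`Γ(-τ) Γ(-τ+m-ε-ν₂₅) Γ(-σ-τ-m+ε+ν₁₄)` from those of
`Γ(τ+m-ε-ν₁) Γ(σ+τ-m+ε+ν₂₃₅) Γ(σ+τ+ν₅)`. -/
def SeparatesInner (m : ℤ) (ε ν₁ ν₂ ν₃ ν₄ ν₅ σ : ℂ) (c : ℝ → ℂ) : Prop :=
  ∀ k : ℕ,
    LiesRight k c ∧
    LiesRight (m - ε - ν₂ - ν₅ + k) c ∧
    LiesRight (-σ - m + ε + ν₁ + ν₄ + k) c ∧
    LiesLeft (-m + ε + ν₁ - k) c ∧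
    LiesLeft (-σ + m - ε - ν₂ - ν₃ - ν₅ - k) c ∧
    LiesLeft (-σ - ν₅ - k) c

/-- The contour `c` of the outer variable `σ` separates the poles in `σ` of
`Γ(-σ) Γ(-σ+m-ε-ν₃₅)` from those of `Γ(σ+m-ε-ν₄)` and from the poles in `σ` which the inner
integral acquires where a pole of `Γ(σ+τ-m+ε+ν₂₃₅)` or `Γ(σ+τ+ν₅)` collides with a pole of
`Γ(-τ)` or `Γ(-τ+m-ε-ν₂₅)`. -/
def SeparatesOuter (m : ℤ) (ε ν₂ ν₃ ν₄ ν₅ : ℂ) (c : ℝ → ℂ) : Prop :=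
  ∀ k : ℕ,
    LiesRight k c ∧
    LiesRight (m - ε - ν₃ - ν₅ + k) c ∧
    LiesLeft (-m + ε + ν₄ - k) c ∧
    LiesLeft (m - ε - ν₂ - ν₃ - ν₅ - k) c ∧
    LiesLeft (-ν₅ - k) c ∧
    LiesLeft (-ν₃ - k) c ∧
    LiesLeft (-m + ε + ν₂ - k) c

/-! ### Parameter regions; a point is `(ε, (ν₁, …, ν₅))` -/

/-- The parameters for which the two-loop integral converges (power counting). -/
def convergenceRegion (m : ℤ) : Set (ℂ × (Fin 5 → ℂ)) :=
  {q | (∀ j, 0 < (q.2 j).re ∧ (q.2 j).re < ((m : ℂ) - q.1).re) ∧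
    (q.2 0 + q.2 1 + q.2 4).re < (2 * ((m : ℂ) - q.1)).re ∧
    (q.2 2 + q.2 3 + q.2 4).re < (2 * ((m : ℂ) - q.1)).re ∧
    ((m : ℂ) - q.1).re < (q.2 0 + q.2 3 + q.2 4).re ∧
    ((m : ℂ) - q.1).re < (q.2 1 + q.2 2 + q.2 4).re ∧
    (2 * ((m : ℂ) - q.1)).re < (q.2 0 + q.2 1 + q.2 2 + q.2 3 + q.2 4).re}

/-- The parameters for which no pole that has to lie to the left of a contour coincides with a
pole that has to lie to its right, and for which `c_Γ⁻¹` is finite. This is the complement of a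
locally finite union of complex hyperplanes. -/
def genericRegion (m : ℤ) : Set (ℂ × (Fin 5 → ℂ)) :=
  {q | ∀ k : ℕ,
    1 - 2 * q.1 ≠ -(k : ℂ) ∧
    (∀ j, (m : ℂ) - q.1 - q.2 j ≠ -(k : ℂ)) ∧
    q.2 1 ≠ -(k : ℂ) ∧ q.2 2 ≠ -(k : ℂ) ∧ q.2 4 ≠ -(k : ℂ) ∧
    2 * ((m : ℂ) - q.1) - (q.2 0 + q.2 1 + q.2 4) ≠ -(k : ℂ) ∧
    2 * ((m : ℂ) - q.1) - (q.2 2 + q.2 3 + q.2 4) ≠ -(k : ℂ) ∧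
    2 * ((m : ℂ) - q.1) - (q.2 1 + q.2 2 + q.2 4) ≠ -(k : ℂ) ∧
    q.2 0 + q.2 3 + q.2 4 - ((m : ℂ) - q.1) ≠ -(k : ℂ) ∧
    q.2 1 + q.2 2 + q.2 4 - ((m : ℂ) - q.1) ≠ -(k : ℂ) ∧
    q.2 0 + q.2 1 + q.2 2 + q.2 3 + q.2 4 - 2 * ((m : ℂ) - q.1) ≠ -(k : ℂ)}

/-! ### Inverse Mellin transforms -/

/-- `∫_{γ-i∞}^{γ+i∞} f(z) dz = v` as a (symmetric) improper integral. -/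
def HasVerticalIntegral (γ : ℝ) (f : ℂ → ℂ) (v : ℂ) : Prop :=
  (∀ T : ℝ, IntervalIntegrable (fun t : ℝ => f (verticalLine γ t) * I) volume (-T) T) ∧
    Tendsto (fun T : ℝ => ∫ t in (-T)..T, f (verticalLine γ t) * I) atTop (𝓝 v)

/-- `(2πi)⁻² ∫_{γ₃-i∞}^{γ₃+i∞} dν₁ ∫_{γ₄-i∞}^{γ₄+i∞} dν₄ x^(-ν₁) y^(-ν₄) f(ν₁, ν₄) = v`,
as an iterated integral. -/
def HasDoubleInverseMellin (γ₃ γ₄ : ℝ) (f : ℂ → ℂ → ℂ) (x y : ℝ) (v : ℂ) : Prop :=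
  ∃ (h : ℂ → ℂ) (w : ℂ),
    (∀ s : ℝ, HasVerticalIntegral γ₄
      (fun ν₄ => (x : ℂ) ^ (-(verticalLine γ₃ s)) * (y : ℂ) ^ (-ν₄) * f (verticalLine γ₃ s) ν₄)
      (h (verticalLine γ₃ s))) ∧
    HasVerticalIntegral γ₃ h w ∧ v = 1 / (2 * Real.pi * I) ^ 2 * w

end FeynmanMB

end

noncomputable section

namespace FeynmanMB

/-! The theorem rests on one property of the diagram: for fixed `k₁` the integral over `k₂` is the
triangle, and it depends on `k₁` only through `k₁²` and `k₄²`. In Schwinger parameters this is an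
identity between Symanzik polynomials (`logIntegrand_twoLoop`). The triangle parameters enter the
`k₁` integral only by shifting `α₁` and `α₄` by `triA` and `triB`, the coefficients of `1/x` and
`1/y` in the exponent of the triangle. Powers of `P` come out by scaling, so `P = 1` may be assumed.

(1) The Mellin transform of the shifted bubble with respect to the two shifts is a product of two
Beta functions and the unshifted bubble with indices `ν₁ - τ`, `ν₄ - σ` (`shift_convolution`).
Fourier inversion in two variables writes the shifted bubble as a superposition of the powers `triA
^ τ * triB ^ σ` (`shiftBubble_eq`). After Fubini the triangle parameters are integrated against
these powers. With the factor `Γ(-τ) Γ(-σ)` this is the Mellin transform of the triangle, and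
Dirichlet's integral evaluates it (`triangle_space`).

(2) Consider an integral of `∏ Γ(a i + z) ∏ Γ(b j - z) E(z)` along a contour separating the two
families of poles. It does not depend on the contour: two contours differ by closed loops around
which every pole has winding number zero (`contourIntegral_eq_of_separates`). Since `(a i + z) + (b
j - z) = a i + b j`, multiplication by `a i + b j` raises parameters by one. Iterating this shows
that the integral times `∏ 1 / Γ(a i + b j)` extends to an entire function of all parameters
(`contourIntegral_mul_barnesNorm`, `differentiable_barnesReg`). This is used first for `τ` and then
for `σ`. The normalized inner integral grows at most like `exp (3 π |Im σ|)`, less than the decay of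
the seven outer Gamma functions, and is therefore an admissible factor `E`. The result is an
explicit product of Gamma functions times an entire function, holomorphic on `G`. Separating
straight lines exist on the part of `R` with `Re ν₂₃₅ < 2 Re M`, and there (1) identifies the
continuation with the integral. The reflection of the diagram that exchanges the loops, together
with the identity theorem along a segment, covers the rest of `R`.

(3) The `k₁` integration is made explicit again. In dimension `2M` the Gaussian bubble is a Laplace
transform of a density in `u = -k₁²/P` and `v = -k₄²/P`, supported where `√u`, `√v` and `1` are the
sides of a Euclidean triangle (`laplace_bubble`). Thus the bubble is a double Mellin transform of
this density, and the two-loop integral is that of the density times the triangle. Inverting both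
transforms at `u = 1/x`, `v = 1/y` gives the same density factor, multiplied by `1` or by the
triangle; this is the product formula. The inversions are pointwise and need Hölder continuity
(`tendsto_integral_lineFourier`). It can fail at the boundary of the support unless `Re M > 3/2`,
and at `v = 1`, where the angular integral reaches `u = 0`. These are the two exceptional conditions
on `x` and `y`. -/

/-! ### Exponential bounds for the Gamma function in vertical strips -/

/-- `‖Γ(x + iy)‖ / Γ(x)` increases in `x > 0`. -/
lemma norm_Gamma_mul_Gamma_le (z : ℂ) (hz : 0 < z.re) (c : ℝ) (hc : 0 ≤ c) :
    ‖Complex.Gamma z‖ * Real.Gamma (z.re + c) ≤ ‖Complex.Gamma (z + c)‖ * Real.Gamma z.re := by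
  rcases hc.eq_or_lt with rfl | hc
  · simp
  -- Both quotients are governed by Beta integrals with the same `Γ(c)`, and the modulus of the Beta
  -- integral is at most its value at the real part.
  have h1 := Complex.Gamma_mul_Gamma_eq_betaIntegral hz (t := (c : ℂ)) (by simpa using hc)
  have h2 := Complex.Gamma_mul_Gamma_eq_betaIntegral (s := (z.re : ℂ)) (by simpa using hz)
    (t := (c : ℂ)) (by simpa using hc)
  have hb : ‖Complex.betaIntegral z c‖ ≤ ‖Complex.betaIntegral z.re c‖ := by
    have e1 : ∀ w : ℂ, w.re = z.re → ∀ x ∈ Ioo (0:ℝ) 1,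
        ‖(x : ℂ) ^ (w - 1) * (1 - (x : ℂ)) ^ ((c : ℂ) - 1)‖ = x ^ (z.re - 1) * (1 - x) ^ (c - 1) := by
      intro w hw x hx
      have hx1 : (1 - (x : ℂ)) = ((1 - x : ℝ) : ℂ) := by push_cast; ring
      rw [norm_mul, hx1, Complex.norm_cpow_eq_rpow_re_of_pos hx.1,
        Complex.norm_cpow_eq_rpow_re_of_pos (by linarith [hx.2])]
      simp [hw]
    have e2 : Complex.betaIntegral z.re c =
        ((∫ x in (0:ℝ)..1, x ^ (z.re - 1) * (1 - x) ^ (c - 1) : ℝ) : ℂ) := by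
      rw [Complex.betaIntegral, ← intervalIntegral.integral_ofReal]
      rw [intervalIntegral.integral_of_le zero_le_one, intervalIntegral.integral_of_le zero_le_one,
        integral_Ioc_eq_integral_Ioo, integral_Ioc_eq_integral_Ioo]
      refine setIntegral_congr_fun measurableSet_Ioo fun x hx => ?_
      have hx1 : (1 - (x : ℂ)) = ((1 - x : ℝ) : ℂ) := by push_cast; ring
      rw [hx1]
      push_cast [Complex.ofReal_cpow hx.1.le, Complex.ofReal_cpow (sub_pos.2 hx.2).le]
      rfl
    have e3 : 0 ≤ ∫ x in (0:ℝ)..1, x ^ (z.re - 1) * (1 - x) ^ (c - 1) := by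
      refine intervalIntegral.integral_nonneg zero_le_one fun x hx => ?_
      exact mul_nonneg (Real.rpow_nonneg hx.1 _) (Real.rpow_nonneg (by linarith [hx.2]) _)
    rw [e2, Complex.norm_real, Real.norm_of_nonneg e3, Complex.betaIntegral]
    rw [intervalIntegral.integral_of_le zero_le_one, intervalIntegral.integral_of_le zero_le_one,
        integral_Ioc_eq_integral_Ioo, integral_Ioc_eq_integral_Ioo]
    refine (norm_integral_le_integral_norm _).trans (le_of_eq ?_)
    exact setIntegral_congr_fun measurableSet_Ioo fun x hx => e1 z rfl x hx
  have hG1 : 0 < Real.Gamma z.re := Real.Gamma_pos_of_pos hz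
  have hG2 : 0 < Real.Gamma c := Real.Gamma_pos_of_pos hc
  have hG3 : 0 < Real.Gamma (z.re + c) := Real.Gamma_pos_of_pos (by linarith)
  have n1 := congrArg norm h1
  have n2 := congrArg norm h2
  rw [norm_mul, norm_mul, Complex.Gamma_ofReal, Complex.norm_real, Real.norm_of_nonneg hG2.le] at n1
  rw [norm_mul, norm_mul, Complex.Gamma_ofReal, Complex.Gamma_ofReal, ← Complex.ofReal_add,
    Complex.Gamma_ofReal, Complex.norm_real, Complex.norm_real, Complex.norm_real,
    Real.norm_of_nonneg hG2.le, Real.norm_of_nonneg hG1.le, Real.norm_of_nonneg hG3.le] at n2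
  have : (‖Complex.Gamma z‖ * Real.Gamma (z.re + c)) * Real.Gamma c ≤
      (‖Complex.Gamma (z + c)‖ * Real.Gamma z.re) * Real.Gamma c := by
    calc _ = ‖Complex.Gamma (z + c)‖ * ‖Complex.betaIntegral z c‖ * Real.Gamma (z.re + c) := by
          rw [← n1]; ring
      _ ≤ ‖Complex.Gamma (z + c)‖ * ‖Complex.betaIntegral z.re c‖ * Real.Gamma (z.re + c) := by
          gcongr
      _ = ‖Complex.Gamma (z + c)‖ * (Real.Gamma (z.re + c) * ‖Complex.betaIntegral z.re c‖) := by
          ring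
      _ = _ := by rw [← n2]; ring
  exact le_of_mul_le_mul_right this hG2

/-- On this line `1 - z` is the conjugate of `z`, so the reflection formula gives the modulus
exactly. All strip estimates are transported from here, and no Stirling asymptotics are needed. -/
lemma norm_Gamma_half_sq (y : ℝ) :
    ‖Complex.Gamma (1 / 2 + y * I)‖ ^ 2 = Real.pi / Real.cosh (Real.pi * y) := by
  have h := Complex.Gamma_mul_Gamma_one_sub (1 / 2 + y * I)
  have e : (1 : ℂ) - (1 / 2 + y * I) = (starRingEnd ℂ) (1 / 2 + y * I) := by
    simp [Complex.ext_iff]; norm_num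
  rw [e, Complex.Gamma_conj, Complex.mul_conj] at h
  have e2 : (Real.pi : ℂ) * (1 / 2 + y * I) = ((Real.pi * y : ℝ) : ℂ) * I + Real.pi / 2 := by
    push_cast; ring
  rw [e2, Complex.sin_add_pi_div_two, Complex.cos_mul_I, ← Complex.ofReal_cosh,
    ← Complex.ofReal_div] at h
  have := Complex.ofReal_injective h
  rw [← this, Complex.normSq_eq_norm_sq]

lemma norm_Gamma_half_le (y : ℝ) :
    ‖Complex.Gamma (1 / 2 + y * I)‖ ≤ 3 * Real.exp (-(Real.pi / 2 * |y|)) := by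
  have h := norm_Gamma_half_sq y
  have hc : Real.exp (Real.pi * |y|) / 2 ≤ Real.cosh (Real.pi * y) := by
    rw [← Real.cosh_abs, abs_mul, abs_of_pos Real.pi_pos, Real.cosh_eq]
    have := Real.exp_pos (-(Real.pi * |y|))
    linarith
  refine abs_le_of_sq_le_sq' ?_ (by positivity) |>.2
  rw [h, mul_pow, ← Real.exp_nat_mul, div_le_iff₀ (Real.cosh_pos _)]
  calc Real.pi ≤ 9 * (1 / 2) := by linarith [Real.pi_lt_four]
    _ = 3 ^ 2 * (Real.exp (((2:ℕ):ℝ) * -(Real.pi / 2 * |y|)) * (Real.exp (Real.pi * |y|) / 2)) := by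
        have : Real.exp (((2:ℕ):ℝ) * -(Real.pi / 2 * |y|)) * Real.exp (Real.pi * |y|) = 1 := by
          rw [← Real.exp_add, Real.exp_eq_one_iff]; push_cast; ring
        linear_combination (-9 / 2) * this
    _ ≤ _ := by rw [mul_assoc]; gcongr

lemma le_norm_Gamma_half (y : ℝ) :
    Real.exp (-(Real.pi / 2 * |y|)) ≤ ‖Complex.Gamma (1 / 2 + y * I)‖ := by
  have h := norm_Gamma_half_sq y
  have hc : Real.cosh (Real.pi * y) ≤ Real.exp (Real.pi * |y|) := by
    rw [← Real.cosh_abs, abs_mul, abs_of_pos Real.pi_pos, Real.cosh_eq]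
    have : Real.exp (-(Real.pi * |y|)) ≤ Real.exp (Real.pi * |y|) :=
      Real.exp_le_exp.2 (by have := mul_nonneg Real.pi_pos.le (abs_nonneg y); linarith)
    linarith
  refine abs_le_of_sq_le_sq' ?_ (by positivity) |>.2
  rw [h, ← Real.exp_nat_mul, le_div_iff₀ (Real.cosh_pos _)]
  calc _ ≤ Real.exp (((2:ℕ):ℝ) * -(Real.pi / 2 * |y|)) * Real.exp (Real.pi * |y|) := by gcongr
    _ = 1 := by
        rw [← Real.exp_add]
        have : ((2:ℕ):ℝ) * -(Real.pi / 2 * |y|) + Real.pi * |y| = 0 := by push_cast; ring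
        rw [this, Real.exp_zero]
    _ ≤ _ := by linarith [Real.pi_gt_three]

/-- A linear factor is absorbed by an exponential. -/
lemma add_abs_le_exp (K η : ℝ) (hη : 0 < η) :
    ∃ C > 0, ∀ y : ℝ, K + |y| ≤ C * Real.exp (η * |y|) := by
  refine ⟨|K| + 1 / η, by positivity, fun y => ?_⟩
  have h1 : 1 ≤ Real.exp (η * |y|) := Real.one_le_exp (by positivity)
  have h2 : η * |y| ≤ Real.exp (η * |y|) := by linarith [Real.add_one_le_exp (η * |y|)]
  have h3 : |y| ≤ 1 / η * Real.exp (η * |y|) := by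
    rw [one_div, inv_mul_eq_div, le_div_iff₀ hη]; linarith
  calc K + |y| ≤ |K| * 1 + |y| := by linarith [le_abs_self K]
    _ ≤ |K| * Real.exp (η * |y|) + 1 / η * Real.exp (η * |y|) := by gcongr
    _ = _ := by ring

lemma norm_le_exp_im (K η : ℝ) (hη : 0 < η) :
    ∃ C > 0, ∀ z : ℂ, |z.re| ≤ K → ‖z‖ ≤ C * Real.exp (η * |z.im|) := by
  obtain ⟨C, hC, h⟩ := add_abs_le_exp K η hη
  exact ⟨C, hC, fun z hz => (Complex.norm_le_abs_re_add_abs_im z).trans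
    ((by linarith : _ ≤ K + |z.im|).trans (h z.im))⟩

/-- Iterated functional equation. -/
lemma Gamma_add_nat (z : ℂ) (n : ℕ) (h : ∀ k < n, z + k ≠ 0) :
    Complex.Gamma (z + n) = (∏ k ∈ Finset.range n, (z + k)) * Complex.Gamma z := by
  induction n with
  | zero => simp
  | succ n ih =>
    have h1 := Complex.Gamma_add_one (z + n) (h n (by omega))
    rw [Finset.prod_range_succ, mul_right_comm, ← ih fun k hk => h k (by omega)]
    push_cast
    rw [← add_assoc, h1]; ring

/-- The polynomial factors in the functional equation are absorbed by an exponential. -/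
lemma norm_prod_add_nat_le (n : ℕ) (K η : ℝ) (hη : 0 < η) :
    ∃ C > 0, ∀ z : ℂ, |z.re| ≤ K →
      ‖∏ k ∈ Finset.range n, (z + (k : ℂ))‖ ≤ C * Real.exp (η * |z.im|) := by
  induction n generalizing η with
  | zero => exact ⟨1, one_pos, fun z _ => by simpa using Real.one_le_exp (by positivity)⟩
  | succ n ih =>
    obtain ⟨C, hC, h⟩ := ih (η / 2) (half_pos hη)
    obtain ⟨C', hC', h'⟩ := norm_le_exp_im (K + n) (η / 2) (half_pos hη)
    refine ⟨C * C', by positivity, fun z hz => ?_⟩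
    rw [Finset.prod_range_succ, norm_mul]
    have h2 := h' (z + n) (by
      simp only [add_re, natCast_re]
      exact (abs_add_le _ _).trans (by simpa using hz))
    simp only [add_im, natCast_im, add_zero] at h2
    calc _ ≤ (C * Real.exp (η / 2 * |z.im|)) * (C' * Real.exp (η / 2 * |z.im|)) := by
          gcongr; exact h z hz
      _ = C * C' * (Real.exp (η / 2 * |z.im|) * Real.exp (η / 2 * |z.im|)) := by ring
      _ = _ := by rw [← Real.exp_add]; ring_nf

lemma exists_Gamma_bounds (δ K : ℝ) (hδ : 0 < δ) :
    ∃ C > 0, ∀ x : ℝ, δ ≤ x → x ≤ K → Real.Gamma x ≤ C ∧ 1 / Real.Gamma x ≤ C := by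
  have hcont : ContinuousOn Real.Gamma (Icc δ K) := fun x hx =>
    (Real.differentiableAt_Gamma fun m hm => by
      have : (0:ℝ) ≤ m := m.cast_nonneg
      linarith [hx.1]).continuousAt.continuousWithinAt
  have hpos : ∀ x ∈ Icc δ K, Real.Gamma x ≠ 0 := fun x hx =>
    (Real.Gamma_pos_of_pos (hδ.trans_le hx.1)).ne'
  obtain ⟨C1, h1⟩ := isCompact_Icc.exists_bound_of_continuousOn hcont
  obtain ⟨C2, h2⟩ := isCompact_Icc.exists_bound_of_continuousOn (hcont.inv₀ hpos)
  refine ⟨max 1 (max C1 C2), by positivity, fun x hx1 hx2 => ⟨?_, ?_⟩⟩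
  · exact (le_abs_self _).trans ((h1 x ⟨hx1, hx2⟩).trans (by simp))
  · rw [one_div]
    exact (le_abs_self _).trans ((h2 x ⟨hx1, hx2⟩).trans (by simp))

/-- Monotonicity bounds `Γ` by its values further to the right, so an upper bound in a strip must
start on a line to the right of it. The functional equation reaches such a line at the cost of
polynomial factors. -/
lemma norm_Gamma_nat_add_half_le (n : ℕ) (η : ℝ) (hη : 0 < η) :
    ∃ C > 0, ∀ y : ℝ, ‖Complex.Gamma (1 / 2 + y * I + n)‖ ≤
      C * Real.exp (-((Real.pi / 2 - η) * |y|)) := by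
  obtain ⟨C, hC, h⟩ := norm_prod_add_nat_le n 1 η hη
  refine ⟨C * 3, by positivity, fun y => ?_⟩
  rw [Gamma_add_nat _ n fun k _ hk => by
    have h3 := congrArg Complex.re hk
    simp at h3
    have : (0:ℝ) ≤ k := k.cast_nonneg
    linarith, norm_mul]
  have h1 := h (1 / 2 + y * I) (by simp; norm_num [abs_le])
  have him : (1 / 2 + (y : ℂ) * I).im = y := by simp
  rw [him] at h1
  calc _ ≤ (C * Real.exp (η * |y|)) * (3 * Real.exp (-(Real.pi / 2 * |y|))) := by
        gcongr; exact norm_Gamma_half_le y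
    _ = C * 3 * (Real.exp (η * |y|) * Real.exp (-(Real.pi / 2 * |y|))) := by ring
    _ = _ := by rw [← Real.exp_add]; ring_nf

/-- Decay of the Gamma function in vertical strips in the right half plane. -/
lemma norm_Gamma_le_of_re_pos (δ K η : ℝ) (hδ : 0 < δ) (hη : 0 < η) :
    ∃ C > 0, ∀ z : ℂ, δ ≤ z.re → z.re ≤ K →
      ‖Complex.Gamma z‖ ≤ C * Real.exp (-((Real.pi / 2 - η) * |z.im|)) := by
  obtain ⟨n, hn⟩ := exists_nat_ge (max K 1)
  obtain ⟨C, hC, h⟩ := norm_Gamma_nat_add_half_le n η hη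
  obtain ⟨C', hC', h'⟩ := exists_Gamma_bounds δ K hδ
  have hG : 0 < Real.Gamma (1 / 2 + n) := Real.Gamma_pos_of_pos (by positivity)
  refine ⟨C * C' / Real.Gamma (1 / 2 + n), by positivity, fun z h1 h2 => ?_⟩
  have hKn : z.re ≤ 1 / 2 + n := h2.trans (((le_max_left _ _).trans hn).trans (by linarith))
  -- Comparison with the point at the same height on the line `Re = n + 1/2`, which lies to the
  -- right of the strip.
  have key := norm_Gamma_mul_Gamma_le z (by linarith) (1 / 2 + n - z.re) (by linarith)
  have e1 : z + ((1 / 2 + n - z.re : ℝ) : ℂ) = 1 / 2 + z.im * I + n := by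
    simp [Complex.ext_iff]
  rw [e1, add_sub_cancel] at key
  rw [div_mul_eq_mul_div, le_div_iff₀ hG]
  calc _ ≤ _ := key
    _ ≤ (C * Real.exp (-((Real.pi / 2 - η) * |z.im|))) * C' := by
        exact mul_le_mul (h z.im) (h' z.re h1 h2).1 (Real.Gamma_pos_of_pos (by linarith)).le
          (by positivity)
    _ = _ := by ring

/-- Decay of the Gamma function in vertical strips away from the real axis. -/
lemma norm_Gamma_le_of_one_le_im (K η : ℝ) (hη : 0 < η) :
    ∃ C > 0, ∀ z : ℂ, |z.re| ≤ K → 1 ≤ |z.im| →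
      ‖Complex.Gamma z‖ ≤ C * Real.exp (-((Real.pi / 2 - η) * |z.im|)) := by
  obtain ⟨n, hn⟩ := exists_nat_ge (K + 1)
  obtain ⟨C, hC, h⟩ := norm_Gamma_le_of_re_pos 1 (K + n) η one_pos hη
  refine ⟨C, hC, fun z hz him => ?_⟩
  have hz' := abs_le.1 hz
  -- At height at least one all factors of the functional equation have modulus at least one, so
  -- shifting to the right half plane does not decrease `‖Γ‖`.
  have hne : ∀ k : ℕ, 1 ≤ ‖z + k‖ := fun k => by
    have := Complex.abs_im_le_norm (z + k)
    simp at this; linarith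
  have key := Gamma_add_nat z n fun k _ hk => by
    have := hne k; rw [hk, norm_zero] at this; linarith
  have h1 := h (z + n) (by simp; linarith) (by simp; linarith)
  rw [key, norm_mul, norm_prod] at h1
  simp only [add_im, natCast_im, add_zero] at h1
  refine le_trans ?_ h1
  have : 1 ≤ ∏ k ∈ Finset.range n, ‖z + (k : ℂ)‖ :=
    (Finset.prod_const_one (s := Finset.range n)).symm.le.trans
      (Finset.prod_le_prod (fun _ _ => zero_le_one) fun k _ => hne k)
  nlinarith [norm_nonneg (Complex.Gamma z)]

lemma inv_Gamma_eq_prod_mul (z : ℂ) (n : ℕ) : (Complex.Gamma z)⁻¹ =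
    (∏ k ∈ Finset.range n, (z + (k : ℂ))) * (Complex.Gamma (z + n))⁻¹ := by
  induction n with
  | zero => simp
  | succ n ih =>
    rw [ih, Finset.prod_range_succ, mul_assoc]
    have := Complex.one_div_Gamma_eq_self_mul_one_div_Gamma_add_one (z + n)
    push_cast
    rw [← add_assoc, this]

/-- Growth of the reciprocal Gamma function in vertical strips. -/
lemma norm_inv_Gamma_le (K η : ℝ) (hη : 0 < η) :
    ∃ C > 0, ∀ z : ℂ, |z.re| ≤ K →
      ‖(Complex.Gamma z)⁻¹‖ ≤ C * Real.exp ((Real.pi / 2 + η) * |z.im|) := by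
  obtain ⟨n, hn⟩ := exists_nat_ge (K + 1)
  obtain ⟨C, hC, h⟩ := norm_prod_add_nat_le n K η hη
  obtain ⟨C', hC', h'⟩ := exists_Gamma_bounds (1 / 2) (K + n) (by norm_num)
  have hG : 0 < Real.Gamma (1 / 2) := Real.Gamma_pos_of_pos (by norm_num)
  refine ⟨C * (C' * Real.Gamma (1 / 2)), by positivity, fun z hz => ?_⟩
  have hz' := abs_le.1 hz
  have hre : (z + n).re = z.re + n := by simp
  have hge : 1 / 2 ≤ z.re + n := by linarith
  -- The same monotonicity in the other direction: a lower bound on the line `Re = 1/2` passes to `z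
  -- + n`, which lies to the right of it.
  have key := norm_Gamma_mul_Gamma_le (1 / 2 + z.im * I) (by simp) (z.re + n - 1 / 2) (by linarith)
  have e1 : (1 / 2 + z.im * I) + ((z.re + n - 1 / 2 : ℝ) : ℂ) = z + n := by
    simp [Complex.ext_iff]
  have e2 : (1 / 2 + (z.im : ℂ) * I).re = 1 / 2 := by simp
  rw [e1, e2, add_sub_cancel] at key
  have hlow := le_norm_Gamma_half z.im
  have hGp : 0 < Real.Gamma (z.re + n) := Real.Gamma_pos_of_pos (by linarith)
  have hb := (h' (z.re + n) hge (by linarith)).2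
  rw [one_div, inv_le_comm₀ hGp hC'] at hb
  have hlow2 : C'⁻¹ * Real.exp (-(Real.pi / 2 * |z.im|)) / Real.Gamma (1 / 2) ≤
      ‖Complex.Gamma (z + n)‖ := by
    rw [div_le_iff₀ hG]
    refine le_trans ?_ key
    rw [mul_comm]
    gcongr
  have hinv : ‖(Complex.Gamma (z + n))⁻¹‖ ≤
      C' * Real.Gamma (1 / 2) * Real.exp (Real.pi / 2 * |z.im|) := by
    rw [norm_inv]
    refine (inv_anti₀ (by positivity) hlow2).trans (le_of_eq ?_)
    rw [Real.exp_neg]; field_simp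
  rw [inv_Gamma_eq_prod_mul z n, norm_mul]
  calc _ ≤ (C * Real.exp (η * |z.im|)) *
        (C' * Real.Gamma (1 / 2) * Real.exp (Real.pi / 2 * |z.im|)) := by
        gcongr; exact h z hz
    _ = C * (C' * Real.Gamma (1 / 2)) * (Real.exp (η * |z.im|) * Real.exp (Real.pi / 2 * |z.im|)) := by
        ring
    _ = _ := by rw [← Real.exp_add]; ring_nf

/-! ### Deformation of indented contours -/

/-- The poles `-a i - k` lie to the left and the poles `b j + k` to the right of `c`. -/
def Separates {ι κ : Type*} (a : ι → ℂ) (b : κ → ℂ) (c : ℝ → ℂ) : Prop :=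
  ∀ k : ℕ, (∀ i, LiesLeft (-a i - k) c) ∧ ∀ j, LiesRight (b j + k) c

lemma IsIndentedLine.continuous {c : ℝ → ℂ} (h : IsIndentedLine c) : Continuous c :=
  h.1.continuous

lemma IsIndentedLine.continuous_deriv {c : ℝ → ℂ} (h : IsIndentedLine c) :
    Continuous (deriv c) :=
  h.1.continuous_deriv le_rfl

lemma IsIndentedLine.hasDerivAt {c : ℝ → ℂ} (h : IsIndentedLine c) (s : ℝ) :
    HasDerivAt c (deriv c s) s :=
  (h.1.differentiable one_ne_zero s).hasDerivAt

lemma hasDerivAt_verticalLine (γ s : ℝ) : HasDerivAt (verticalLine γ) I s := by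
  have := ((Complex.ofRealCLM.hasDerivAt (x := s)).mul_const I).const_add (γ : ℂ)
  exact this.congr_deriv (by simp)

lemma deriv_verticalLine (γ s : ℝ) : deriv (verticalLine γ) s = I :=
  (hasDerivAt_verticalLine γ s).deriv

@[simp] lemma verticalLine_re (γ s : ℝ) : (verticalLine γ s).re = γ := by simp [verticalLine]

@[simp] lemma verticalLine_im (γ s : ℝ) : (verticalLine γ s).im = s := by simp [verticalLine]

/-- The contour integral around the region between two indented lines, cut off at height `N`. -/
def truncatedLoop (c₁ c₂ : ℝ → ℂ) (γ₁ γ₂ N : ℝ) (f : ℂ → ℂ) : ℂ :=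
  (∫ s in (-N)..N, f (c₁ s) * deriv c₁ s) - (∫ s in (-N)..N, f (c₂ s) * deriv c₂ s) +
    ((∫ x in γ₁..γ₂, f (verticalLine x N)) - ∫ x in γ₁..γ₂, f (verticalLine x (-N)))

/-- The trace of the contour in `truncatedLoop`. -/
def loopTrace (c₁ c₂ : ℝ → ℂ) (γ₁ γ₂ N : ℝ) : Set ℂ :=
  c₁ '' uIcc (-N) N ∪ c₂ '' uIcc (-N) N ∪
    ((fun x => verticalLine x N) '' uIcc γ₁ γ₂ ∪ (fun x => verticalLine x (-N)) '' uIcc γ₁ γ₂)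

lemma continuous_verticalLine_left (N : ℝ) : Continuous fun x : ℝ => verticalLine x N := by
  unfold verticalLine; fun_prop

lemma hasDerivAt_verticalLine_left (N x : ℝ) :
    HasDerivAt (fun x : ℝ => verticalLine x N) 1 x := by
  have := (Complex.ofRealCLM.hasDerivAt (x := x)).add_const ((N : ℂ) * I)
  simpa [verticalLine] using this

section

variable {c₁ c₂ : ℝ → ℂ} {γ₁ γ₂ N : ℝ}

lemma intervalIntegrable_mul_deriv {c : ℝ → ℂ} (hc : IsIndentedLine c) {f : ℂ → ℂ} {p q : ℝ}
    (hf : ∀ z ∈ c '' uIcc p q, ContinuousAt f z) :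
    IntervalIntegrable (fun s => f (c s) * deriv c s) volume p q := by
  refine ContinuousOn.intervalIntegrable fun s hs => ?_
  exact (((hf _ ⟨s, hs, rfl⟩).comp hc.continuous.continuousAt).mul
    hc.continuous_deriv.continuousAt).continuousWithinAt

lemma intervalIntegrable_horizontal {f : ℂ → ℂ} {p q : ℝ}
    (hf : ∀ z ∈ (fun x => verticalLine x N) '' uIcc p q, ContinuousAt f z) :
    IntervalIntegrable (fun x => f (verticalLine x N)) volume p q := by
  refine ContinuousOn.intervalIntegrable fun s hs => ?_
  exact ((hf _ ⟨s, hs, rfl⟩).comp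
    (f := fun x => verticalLine x N) (continuous_verticalLine_left N).continuousAt).continuousWithinAt

lemma integral_mul_deriv_eq_sub {c : ℝ → ℂ} (hc : IsIndentedLine c) {f F : ℂ → ℂ} {p q : ℝ}
    (hf : ∀ z ∈ c '' uIcc p q, ContinuousAt f z)
    (hF : ∀ z ∈ c '' uIcc p q, HasDerivAt F (f z) z) :
    ∫ s in p..q, f (c s) * deriv c s = F (c q) - F (c p) :=
  intervalIntegral.integral_eq_sub_of_hasDerivAt (f := F ∘ c)
    (fun s hs => (hF _ ⟨s, hs, rfl⟩).comp s (hc.hasDerivAt s)) (intervalIntegrable_mul_deriv hc hf)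

lemma integral_horizontal_eq_sub {f F : ℂ → ℂ} {p q : ℝ}
    (hf : ∀ z ∈ (fun x => verticalLine x N) '' uIcc p q, ContinuousAt f z)
    (hF : ∀ z ∈ (fun x => verticalLine x N) '' uIcc p q, HasDerivAt F (f z) z) :
    ∫ x in p..q, f (verticalLine x N) = F (verticalLine q N) - F (verticalLine p N) := by
  refine intervalIntegral.integral_eq_sub_of_hasDerivAt (f := fun x => F (verticalLine x N))
    (fun s hs => ?_) (intervalIntegrable_horizontal hf)
  have := (hF _ ⟨s, hs, rfl⟩).comp s (hasDerivAt_verticalLine_left N s)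
  simpa [Function.comp_def] using this

lemma truncatedLoop_sub (h₁ : IsIndentedLine c₁) (h₂ : IsIndentedLine c₂) {f g : ℂ → ℂ}
    (hf : ∀ z ∈ loopTrace c₁ c₂ γ₁ γ₂ N, ContinuousAt f z)
    (hg : ∀ z ∈ loopTrace c₁ c₂ γ₁ γ₂ N, ContinuousAt g z) :
    truncatedLoop c₁ c₂ γ₁ γ₂ N (fun z => f z - g z) =
      truncatedLoop c₁ c₂ γ₁ γ₂ N f - truncatedLoop c₁ c₂ γ₁ γ₂ N g := by
  have s1 : c₁ '' uIcc (-N) N ⊆ loopTrace c₁ c₂ γ₁ γ₂ N := fun z hz => .inl (.inl hz)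
  have s2 : c₂ '' uIcc (-N) N ⊆ loopTrace c₁ c₂ γ₁ γ₂ N := fun z hz => .inl (.inr hz)
  have s3 : (fun x => verticalLine x N) '' uIcc γ₁ γ₂ ⊆ loopTrace c₁ c₂ γ₁ γ₂ N :=
    fun z hz => .inr (.inl hz)
  have s4 : (fun x => verticalLine x (-N)) '' uIcc γ₁ γ₂ ⊆ loopTrace c₁ c₂ γ₁ γ₂ N :=
    fun z hz => .inr (.inr hz)
  simp only [truncatedLoop, sub_mul]
  rw [intervalIntegral.integral_sub
      (intervalIntegrable_mul_deriv h₁ fun z hz => hf z (s1 hz))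
      (intervalIntegrable_mul_deriv h₁ fun z hz => hg z (s1 hz)),
    intervalIntegral.integral_sub
      (intervalIntegrable_mul_deriv h₂ fun z hz => hf z (s2 hz))
      (intervalIntegrable_mul_deriv h₂ fun z hz => hg z (s2 hz)),
    intervalIntegral.integral_sub
      (intervalIntegrable_horizontal fun z hz => hf z (s3 hz))
      (intervalIntegrable_horizontal fun z hz => hg z (s3 hz)),
    intervalIntegral.integral_sub
      (intervalIntegrable_horizontal fun z hz => hf z (s4 hz))
      (intervalIntegrable_horizontal fun z hz => hg z (s4 hz))]
  ring

lemma truncatedLoop_const_mul (k : ℂ) (f : ℂ → ℂ) :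
    truncatedLoop c₁ c₂ γ₁ γ₂ N (fun z => k * f z) = k * truncatedLoop c₁ c₂ γ₁ γ₂ N f := by
  simp only [truncatedLoop, mul_assoc, intervalIntegral.integral_const_mul]
  ring

lemma truncatedLoop_congr {f g : ℂ → ℂ} (h : ∀ z ∈ loopTrace c₁ c₂ γ₁ γ₂ N, f z = g z) :
    truncatedLoop c₁ c₂ γ₁ γ₂ N f = truncatedLoop c₁ c₂ γ₁ γ₂ N g := by
  unfold truncatedLoop
  congr 1
  · congr 1 <;> refine intervalIntegral.integral_congr fun s hs => ?_
    · rw [h _ (.inl (.inl ⟨s, hs, rfl⟩))]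
    · rw [h _ (.inl (.inr ⟨s, hs, rfl⟩))]
  · congr 1 <;> refine intervalIntegral.integral_congr fun s hs => ?_
    · exact h _ (.inr (.inl ⟨s, hs, rfl⟩))
    · exact h _ (.inr (.inr ⟨s, hs, rfl⟩))

lemma truncatedLoop_eq_zero_of_primitive (h₁ : IsIndentedLine c₁) (h₂ : IsIndentedLine c₂)
    (e₁ : c₁ N = verticalLine γ₁ N) (e₁' : c₁ (-N) = verticalLine γ₁ (-N))
    (e₂ : c₂ N = verticalLine γ₂ N) (e₂' : c₂ (-N) = verticalLine γ₂ (-N)) {f F : ℂ → ℂ}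
    (hf : ∀ z ∈ loopTrace c₁ c₂ γ₁ γ₂ N, ContinuousAt f z)
    (hF : ∀ z ∈ loopTrace c₁ c₂ γ₁ γ₂ N, HasDerivAt F (f z) z) :
    truncatedLoop c₁ c₂ γ₁ γ₂ N f = 0 := by
  unfold truncatedLoop
  rw [integral_mul_deriv_eq_sub h₁ (F := F) (fun z hz => hf z (.inl (.inl hz)))
      (fun z hz => hF z (.inl (.inl hz))),
    integral_mul_deriv_eq_sub h₂ (F := F) (fun z hz => hf z (.inl (.inr hz)))
      (fun z hz => hF z (.inl (.inr hz))),
    integral_horizontal_eq_sub (F := F) (fun z hz => hf z (.inr (.inl hz)))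
      (fun z hz => hF z (.inr (.inl hz))),
    integral_horizontal_eq_sub (F := F) (fun z hz => hf z (.inr (.inr hz)))
      (fun z hz => hF z (.inr (.inr hz))), e₁, e₁', e₂, e₂']
  ring

lemma isBounded_loopTrace (h₁ : IsIndentedLine c₁) (h₂ : IsIndentedLine c₂) :
    Bornology.IsBounded (loopTrace c₁ c₂ γ₁ γ₂ N) := by
  refine IsCompact.isBounded ?_
  exact ((isCompact_uIcc.image h₁.continuous).union (isCompact_uIcc.image h₂.continuous)).union
    ((isCompact_uIcc.image (continuous_verticalLine_left N)).union
      (isCompact_uIcc.image (continuous_verticalLine_left (-N))))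

lemma prod_sub_ne_zero {ps : List ℂ} {z : ℂ} (h : z ∉ ps) :
    (ps.map fun p => z - p).prod ≠ 0 := by
  rw [Ne, List.prod_eq_zero_iff]
  simp only [List.mem_map, not_exists, not_and]
  rintro p hp h0
  rw [sub_eq_zero] at h0
  exact h (h0 ▸ hp)

lemma differentiableAt_prod_sub (ps : List ℂ) (z : ℂ) :
    DifferentiableAt ℂ (fun z => (ps.map fun p => z - p).prod) z := by
  induction ps with
  | nil => simp
  | cons p ps ih =>
    simp only [List.map_cons, List.prod_cons]
    exact (differentiableAt_id.sub_const p).mul ih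

/-- A closed contour around which every pole has winding number `0`. -/
lemma truncatedLoop_div_prod_eq_zero (h₁ : IsIndentedLine c₁) (h₂ : IsIndentedLine c₂)
    (e₁ : c₁ N = verticalLine γ₁ N) (e₁' : c₁ (-N) = verticalLine γ₁ (-N))
    (e₂ : c₂ N = verticalLine γ₂ N) (e₂' : c₂ (-N) = verticalLine γ₂ (-N)) {ρ : ℝ}
    (hK : loopTrace c₁ c₂ γ₁ γ₂ N ⊆ Metric.ball 0 ρ) (n : ℕ) :
    ∀ (ps : List ℂ), ps.length = n → (∀ p ∈ ps, p ∉ loopTrace c₁ c₂ γ₁ γ₂ N) →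
      (∀ p ∈ ps, truncatedLoop c₁ c₂ γ₁ γ₂ N (fun z => (z - p)⁻¹) = 0) →
      ∀ h : ℂ → ℂ, DifferentiableOn ℂ h (Metric.ball 0 ρ) →
      truncatedLoop c₁ c₂ γ₁ γ₂ N (fun z => h z / (ps.map fun p => z - p).prod) = 0 := by
  have hnhds : ∀ z ∈ loopTrace c₁ c₂ γ₁ γ₂ N, Metric.ball (0:ℂ) ρ ∈ 𝓝 z := fun z hz =>
    Metric.isOpen_ball.mem_nhds (hK hz)
  have hcont : ∀ (ps : List ℂ), (∀ p ∈ ps, p ∉ loopTrace c₁ c₂ γ₁ γ₂ N) → ∀ h : ℂ → ℂ,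
      DifferentiableOn ℂ h (Metric.ball 0 ρ) → ∀ z ∈ loopTrace c₁ c₂ γ₁ γ₂ N,
      ContinuousAt (fun z => h z / (ps.map fun p => z - p).prod) z := by
    intro ps hps h hh z hz
    exact ((hh.differentiableAt (hnhds z hz)).div (differentiableAt_prod_sub ps z)
      (prod_sub_ne_zero fun hz' => hps z hz' hz)).continuousAt
  -- Induction on the number of poles replaces the residue theorem. Without poles there is a
  -- primitive on the ball. Two different poles are separated by partial fractions. For equal poles
  -- `h` is split into `h p` and `(z - p)` times its divided slope; the pure power left over has a
  -- primitive, or is a simple pole with vanishing winding number.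
  induction n with
  | zero =>
    intro ps hl _ _ h hh
    rw [List.length_eq_zero_iff] at hl
    subst hl
    simp only [List.map_nil, List.prod_nil, div_one]
    obtain ⟨F, hF⟩ := hh.isExactOn_ball
    exact truncatedLoop_eq_zero_of_primitive h₁ h₂ e₁ e₁' e₂ e₂'
      (fun z hz => (hh.differentiableAt (hnhds z hz)).continuousAt) (F := F) fun z hz => hF z (hK hz)
  | succ n ih =>
    intro ps hl hps hw h hh
    obtain ⟨p, qs, rfl⟩ : ∃ p qs, ps = p :: qs := by
      cases ps with
      | nil => simp at hl
      | cons p qs => exact ⟨p, qs, rfl⟩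
    have hlq : qs.length = n := by simpa using hl
    have hqs : ∀ q ∈ qs, q ∉ loopTrace c₁ c₂ γ₁ γ₂ N := fun q hq => hps q (by simp [hq])
    have hwq : ∀ q ∈ qs, truncatedLoop c₁ c₂ γ₁ γ₂ N (fun z => (z - q)⁻¹) = 0 :=
      fun q hq => hw q (by simp [hq])
    have hpK : p ∉ loopTrace c₁ c₂ γ₁ γ₂ N := hps p (by simp)
    by_cases hpb : p ∈ Metric.ball (0 : ℂ) ρ
    swap
    -- A pole outside the ball is absorbed into the holomorphic numerator.
    · have := ih qs hlq hqs hwq (fun z => h z / (z - p)) (hh.div (by fun_prop) fun z hz h0 => by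
        rw [sub_eq_zero] at h0
        exact hpb (h0 ▸ hz))
      rw [← this]
      refine truncatedLoop_congr fun z hz => ?_
      simp [div_div]
    by_cases hall : ∀ q ∈ qs, q = p
    · -- a single pole of higher order
      have hrep : qs = List.replicate n p := List.eq_replicate_iff.2 ⟨hlq, hall⟩
      have hd : DifferentiableOn ℂ (dslope h p) (Metric.ball 0 ρ) :=
        (Complex.differentiableOn_dslope (Metric.isOpen_ball.mem_nhds hpb)).2 hh
      have key := ih qs hlq hqs hwq _ hd
      have hpow : truncatedLoop c₁ c₂ γ₁ γ₂ N (fun z => h p * ((z - p)⁻¹ ^ (n + 1))) = 0 := by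
        rw [truncatedLoop_const_mul (h p) fun z => (z - p)⁻¹ ^ (n + 1)]
        rcases Nat.eq_zero_or_pos n with rfl | hn
        · simp only [zero_add, pow_one]
          rw [hw p (by simp), mul_zero]
        · rw [truncatedLoop_eq_zero_of_primitive h₁ h₂ e₁ e₁' e₂ e₂' (f := fun z => (z - p)⁻¹ ^ (n + 1))
            (F := fun z => -(n : ℂ)⁻¹ * (z - p)⁻¹ ^ n) , mul_zero]
          · intro z hz
            have : z - p ≠ 0 := fun h0 => hpK (sub_eq_zero.1 h0 ▸ hz)
            exact ((continuousAt_id.sub continuousAt_const).inv₀ this).pow _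
          · intro z hz
            have h0 : z - p ≠ 0 := fun h0 => hpK (sub_eq_zero.1 h0 ▸ hz)
            have hn0 : (n : ℂ) ≠ 0 := by exact_mod_cast hn.ne'
            have := ((((hasDerivAt_id z).sub_const p).inv h0).pow n).const_mul (-(n : ℂ)⁻¹)
            refine this.congr_deriv ?_
            obtain ⟨k, rfl⟩ : ∃ k, n = k + 1 := ⟨n - 1, by omega⟩
            simp only [Pi.inv_apply, id, Nat.add_sub_cancel, inv_pow, pow_succ]
            field_simp
      have := truncatedLoop_sub h₁ h₂ (γ₁ := γ₁) (γ₂ := γ₂) (N := N)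
        (f := fun z => dslope h p z / (qs.map fun q => z - q).prod)
        (g := fun z => -(h p) * ((z - p)⁻¹ ^ (n + 1))) (hcont qs hqs _ hd) fun z hz => by
          have h0 : z - p ≠ 0 := fun h0 => hpK (sub_eq_zero.1 h0 ▸ hz)
          exact continuousAt_const.mul (((continuousAt_id.sub continuousAt_const).inv₀ h0).pow _)
      rw [key, truncatedLoop_const_mul (-h p) fun z => (z - p)⁻¹ ^ (n + 1)] at this
      rw [truncatedLoop_const_mul (h p) fun z => (z - p)⁻¹ ^ (n + 1)] at hpow
      rw [neg_mul, hpow, neg_zero, sub_zero] at this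
      rw [← this]
      refine truncatedLoop_congr fun z hz => ?_
      have h0 : z - p ≠ 0 := fun h0 => hpK (sub_eq_zero.1 h0 ▸ hz)
      have hne : z ≠ p := fun h => h0 (by rw [h, sub_self])
      rw [dslope_of_ne _ hne, slope_def_field, hrep]
      simp only [List.map_cons, List.prod_cons, List.map_replicate, List.prod_replicate, inv_pow]
      field_simp
      ring
    · -- partial fractions
      push Not at hall
      obtain ⟨q, hq, hqp⟩ := hall
      obtain ⟨rs, hrs⟩ : ∃ rs, qs.Perm (q :: rs) := ⟨qs.erase q, List.perm_cons_erase hq⟩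
      have hprod : ∀ z, (qs.map fun p => z - p).prod = (z - q) * (rs.map fun p => z - p).prod :=
        fun z => by rw [(hrs.map _).prod_eq]; simp
      have hmem : ∀ r ∈ p :: rs, r ∈ p :: qs := by
        intro r hr
        rcases List.mem_cons.1 hr with rfl | hr
        · simp
        · exact List.mem_cons_of_mem _ (hrs.mem_iff.2 (List.mem_cons_of_mem _ hr))
      have hl' : (p :: rs).length = n := by
        have := hrs.length_eq
        simp at this ⊢; omega
      have k1 := ih (p :: rs) hl' (fun r hr => hps r (hmem r hr)) (fun r hr => hw r (hmem r hr)) h hh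
      have k2 := ih qs hlq hqs hwq h hh
      have := truncatedLoop_sub h₁ h₂ (γ₁ := γ₁) (γ₂ := γ₂) (N := N)
        (hcont (p :: rs) (fun r hr => hps r (hmem r hr)) h hh) (hcont qs hqs h hh)
      rw [k1, k2, sub_zero] at this
      have h2 := truncatedLoop_const_mul (c₁ := c₁) (c₂ := c₂) (γ₁ := γ₁) (γ₂ := γ₂) (N := N)
        ((p - q)⁻¹) (fun z => h z / ((p :: rs).map fun p => z - p).prod -
          h z / (qs.map fun p => z - p).prod)
      rw [this, mul_zero] at h2
      rw [← h2]
      refine truncatedLoop_congr fun z hz => ?_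
      have h0 : z - p ≠ 0 := fun h0 => hpK (sub_eq_zero.1 h0 ▸ hz)
      have h0' : z - q ≠ 0 := fun h0 => hqs q hq (sub_eq_zero.1 h0 ▸ hz)
      have hr0 : (rs.map fun p => z - p).prod ≠ 0 := by
        refine prod_sub_ne_zero fun hz' => hps z (hmem z (List.mem_cons_of_mem _ hz')) hz
      have hpq : p - q ≠ 0 := sub_ne_zero.2 (Ne.symm hqp)
      simp only [List.map_cons, List.prod_cons, hprod]
      field_simp
      ring

end

/-- The common term `log T` cancels and what remains tends to `log I - log (-I)`: a vertical line
turns by a half circle as seen from a point off it. -/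
lemma tendsto_log_sub_log {w w' : ℂ} (h : 0 < w.re) (h' : 0 < w'.re) :
    Tendsto (fun T : ℝ => Complex.log (w + T * I) - Complex.log (w' - T * I)) atTop
      (𝓝 (Real.pi * I)) := by
  have e1 : ∀ᶠ T : ℝ in atTop, Complex.log (w / T + I) - Complex.log (w' / T - I) =
      Complex.log (w + T * I) - Complex.log (w' - T * I) := by
    filter_upwards [eventually_gt_atTop (0 : ℝ)] with T hT
    have hT0 : (T : ℂ) ≠ 0 := by exact_mod_cast hT.ne'
    have a1 : w + T * I = T * (w / T + I) := by field_simp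
    have a2 : w' - T * I = T * (w' / T - I) := by field_simp
    have b1 : w / T + I ≠ 0 := fun h0 => by
      rw [h0, mul_zero] at a1
      have := congrArg Complex.re a1
      simp at this; linarith
    have b2 : w' / T - I ≠ 0 := fun h0 => by
      rw [h0, mul_zero] at a2
      have := congrArg Complex.re a2
      simp at this; linarith
    rw [a1, a2, Complex.log_ofReal_mul hT b1, Complex.log_ofReal_mul hT b2]
    ring
  refine Tendsto.congr' e1 ?_
  have l : ∀ u : ℂ, Tendsto (fun T : ℝ => u / T) atTop (𝓝 0) := fun u => by
    have := (tendsto_inv_atTop_zero (𝕜 := ℝ)).ofReal.const_mul u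
    simpa [div_eq_mul_inv] using this
  have t1 : Tendsto (fun T : ℝ => Complex.log (w / T + I)) atTop (𝓝 (Complex.log I)) := by
    refine Tendsto.clog ?_ (by simp [Complex.slitPlane])
    simpa using (l w).add_const I
  have t2 : Tendsto (fun T : ℝ => Complex.log (w' / T - I)) atTop (𝓝 (Complex.log (-I))) := by
    refine Tendsto.clog ?_ (by simp [Complex.slitPlane])
    simpa [sub_eq_add_neg] using (l w').add_const (-I)
  have := t1.sub t2
  rw [Complex.log_I, Complex.log_neg_I] at this
  convert this using 2
  ring

lemma liesLeft_verticalLine {z : ℂ} {γ : ℝ} (h : z.re < γ) : LiesLeft z (verticalLine γ) := by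
  have hre : ∀ s : ℝ, 0 < (verticalLine γ s - z).re := fun s => by simpa using h
  refine ⟨?_, ?_⟩
  · rintro ⟨s, rfl⟩
    simp at h
  · have key : ∀ T : ℝ, ∫ s in (-T)..T, deriv (verticalLine γ) s / (verticalLine γ s - z) =
        Complex.log ((γ - z) + T * I) - Complex.log ((γ - z) - T * I) := by
      intro T
      have hd : ∀ s : ℝ, HasDerivAt (fun s => Complex.log (verticalLine γ s - z))
          (deriv (verticalLine γ) s / (verticalLine γ s - z)) s := fun s => by
        rw [deriv_verticalLine]
        exact ((hasDerivAt_verticalLine γ s).sub_const z).clog_real (.inl (hre s))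
      rw [intervalIntegral.integral_eq_sub_of_hasDerivAt (fun s _ => hd s)]
      · simp only [verticalLine]; push_cast; ring_nf
      · refine ContinuousOn.intervalIntegrable fun s _ => ContinuousAt.continuousWithinAt ?_
        simp only [deriv_verticalLine]
        refine continuousAt_const.div ?_ fun h0 => by have := hre s; rw [h0] at this; simp at this
        exact (hasDerivAt_verticalLine γ s).continuousAt.sub continuousAt_const
    simp only [key]
    exact tendsto_log_sub_log (by simpa using h) (by simpa using h)

lemma liesRight_verticalLine {z : ℂ} {γ : ℝ} (h : γ < z.re) : LiesRight z (verticalLine γ) := by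
  have hre : ∀ s : ℝ, 0 < (z - verticalLine γ s).re := fun s => by simpa using h
  refine ⟨?_, ?_⟩
  · rintro ⟨s, rfl⟩
    simp at h
  · have key : ∀ T : ℝ, ∫ s in (-T)..T, deriv (verticalLine γ) s / (verticalLine γ s - z) =
        -(Complex.log ((z - γ) + T * I) - Complex.log ((z - γ) - T * I)) := by
      intro T
      have hd : ∀ s : ℝ, HasDerivAt (fun s => Complex.log (z - verticalLine γ s))
          (deriv (verticalLine γ) s / (verticalLine γ s - z)) s := fun s => by
        rw [deriv_verticalLine]
        have := ((hasDerivAt_verticalLine γ s).const_sub z).clog_real (.inl (hre s))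
        rwa [← neg_sub (verticalLine γ s) z, neg_div_neg_eq] at this
      rw [intervalIntegral.integral_eq_sub_of_hasDerivAt (fun s _ => hd s)]
      · simp only [verticalLine]; push_cast; ring_nf
      · refine ContinuousOn.intervalIntegrable fun s _ => ContinuousAt.continuousWithinAt ?_
        simp only [deriv_verticalLine]
        refine continuousAt_const.div ?_ fun h0 => by
          have := hre s; rw [← neg_sub, h0] at this; simp at this
        exact (hasDerivAt_verticalLine γ s).continuousAt.sub continuousAt_const
    simp only [key]
    exact (tendsto_log_sub_log (by simpa using h) (by simpa using h)).neg

lemma isIndentedLine_verticalLine (γ : ℝ) : IsIndentedLine (verticalLine γ) := by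
  refine ⟨?_, γ, 0, fun _ _ => rfl⟩
  unfold verticalLine
  exact contDiff_const.add (Complex.ofRealCLM.contDiff.mul contDiff_const)

lemma separates_verticalLine {ι κ : Type*} {a : ι → ℂ} {b : κ → ℂ} {γ : ℝ}
    (ha : ∀ i, 0 < (a i).re + γ) (hb : ∀ j, 0 < (b j).re - γ) :
    Separates a b (verticalLine γ) := fun k => by
  have hk : (0:ℝ) ≤ k := k.cast_nonneg
  refine ⟨fun i => liesLeft_verticalLine ?_, fun j => liesRight_verticalLine ?_⟩
  · have := ha i; simp; linarith
  · have := hb j; simp; linarith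

/-! ### Winding numbers of the closed contours between two indented lines -/

section

variable {c₁ c₂ : ℝ → ℂ} {γ₁ γ₂ T : ℝ}

/-- Above and below the pole suitably rotated logarithms are primitives, so the pieces added between
the two heights telescope. -/
lemma truncatedLoop_inv_eq_of_le (h₁ : IsIndentedLine c₁) (h₂ : IsIndentedLine c₂)
    (e₁ : ∀ s : ℝ, T ≤ |s| → c₁ s = verticalLine γ₁ s)
    (e₂ : ∀ s : ℝ, T ≤ |s| → c₂ s = verticalLine γ₂ s) {p : ℂ} (hp1 : p ∉ range c₁)
    (hp2 : p ∉ range c₂) {N N' : ℝ} (hN : |p.im| < N) (hT : T ≤ N) (hNN' : N ≤ N') :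
    truncatedLoop c₁ c₂ γ₁ γ₂ N' (fun z => (z - p)⁻¹) =
      truncatedLoop c₁ c₂ γ₁ γ₂ N (fun z => (z - p)⁻¹) := by
  have hN0 : 0 < N := (abs_nonneg _).trans_lt hN
  have him := abs_lt.1 hN
  -- primitives above and below the pole
  have up : ∀ z : ℂ, N ≤ z.im → HasDerivAt (fun z => Complex.log (-I * (z - p))) (z - p)⁻¹ z := by
    intro z hz
    have hre : 0 < (-I * (z - p)).re := by simp; linarith
    have := (((hasDerivAt_id z).sub_const p).const_mul (-I)).clog (.inl hre)
    refine this.congr_deriv ?_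
    have h0 : z - p ≠ 0 := fun h0 => by rw [h0] at hre; simp at hre
    simp only [id]
    field_simp
  have lo : ∀ z : ℂ, z.im ≤ -N → HasDerivAt (fun z => Complex.log (I * (z - p))) (z - p)⁻¹ z := by
    intro z hz
    have hre : 0 < (I * (z - p)).re := by simp; linarith
    have := (((hasDerivAt_id z).sub_const p).const_mul I).clog (.inl hre)
    refine this.congr_deriv ?_
    have h0 : z - p ≠ 0 := fun h0 => by rw [h0] at hre; simp at hre
    simp only [id]
    field_simp
  have cont : ∀ z, z ≠ p → ContinuousAt (fun z : ℂ => (z - p)⁻¹) z := fun z hz =>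
    (continuousAt_id.sub continuousAt_const).inv₀ (sub_ne_zero.2 hz)
  have vert : ∀ (c : ℝ → ℂ) (γ : ℝ), IsIndentedLine c → (∀ s : ℝ, T ≤ |s| → c s = verticalLine γ s) →
      p ∉ range c →
      ∫ s in (-N')..N', (c s - p)⁻¹ * deriv c s =
        (Complex.log (I * (verticalLine γ (-N) - p)) - Complex.log (I * (verticalLine γ (-N') - p))) +
        (∫ s in (-N)..N, (c s - p)⁻¹ * deriv c s) +
        (Complex.log (-I * (verticalLine γ N' - p)) - Complex.log (-I * (verticalLine γ N - p))) := by
    intro c γ hc ec hpc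
    have hcc : ∀ q q' : ℝ, ∀ z ∈ c '' uIcc q q', ContinuousAt (fun z : ℂ => (z - p)⁻¹) z := by
      rintro q q' _ ⟨s, -, rfl⟩
      exact cont _ fun h => hpc ⟨s, h⟩
    have ii : ∀ q q', IntervalIntegrable (fun s => (c s - p)⁻¹ * deriv c s) volume q q' :=
      fun q q' => intervalIntegrable_mul_deriv (f := fun z => (z - p)⁻¹) hc (hcc q q')
    rw [← intervalIntegral.integral_add_adjacent_intervals (ii (-N') N) (ii N N'),
      ← intervalIntegral.integral_add_adjacent_intervals (ii (-N') (-N)) (ii (-N) N),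
      integral_mul_deriv_eq_sub (f := fun z => (z - p)⁻¹) hc (p := -N') (q := -N)
        (F := fun z => Complex.log (I * (z - p))) (hcc _ _),
      integral_mul_deriv_eq_sub (f := fun z => (z - p)⁻¹) hc (p := N) (q := N')
        (F := fun z => Complex.log (-I * (z - p))) (hcc _ _)]
    · rw [ec (-N) (by rw [abs_neg, abs_of_pos hN0]; exact hT),
        ec N (by rw [abs_of_pos hN0]; exact hT),
        ec N' (by rw [abs_of_pos (by linarith)]; linarith),
        ec (-N') (by rw [abs_neg, abs_of_pos (by linarith)]; linarith)]
    · rintro _ ⟨s, hs, rfl⟩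
      rw [uIcc_of_le hNN'] at hs
      refine up _ ?_
      rw [ec s (by rw [abs_of_pos (by linarith [hs.1])]; linarith [hs.1])]
      simpa using hs.1
    · rintro _ ⟨s, hs, rfl⟩
      rw [uIcc_of_le (by linarith)] at hs
      refine lo _ ?_
      rw [ec s (by rw [abs_of_neg (by linarith [hs.2])]; linarith [hs.2])]
      simpa using hs.2
  have horU : ∀ L : ℝ, N ≤ L → ∫ x in γ₁..γ₂, (verticalLine x L - p)⁻¹ =
      Complex.log (-I * (verticalLine γ₂ L - p)) - Complex.log (-I * (verticalLine γ₁ L - p)) := by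
    intro L hL
    refine integral_horizontal_eq_sub (f := fun z => (z - p)⁻¹)
      (F := fun z => Complex.log (-I * (z - p))) ?_ ?_ <;> rintro _ ⟨s, -, rfl⟩
    · exact cont _ fun h => by
        have := congrArg Complex.im h; simp at this; linarith
    · exact up _ (by simpa using hL)
  have horL : ∀ L : ℝ, N ≤ L → ∫ x in γ₁..γ₂, (verticalLine x (-L) - p)⁻¹ =
      Complex.log (I * (verticalLine γ₂ (-L) - p)) - Complex.log (I * (verticalLine γ₁ (-L) - p)) := by
    intro L hL
    refine integral_horizontal_eq_sub (f := fun z => (z - p)⁻¹)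
      (F := fun z => Complex.log (I * (z - p))) ?_ ?_ <;> rintro _ ⟨s, -, rfl⟩
    · exact cont _ fun h => by
        have := congrArg Complex.im h; simp at this; linarith
    · exact lo _ (by simpa using hL)
  unfold truncatedLoop
  rw [vert c₁ γ₁ h₁ e₁ hp1, vert c₂ γ₂ h₂ e₂ hp2, horU N le_rfl, horU N' hNN', horL N le_rfl,
    horL N' hNN']
  ring

lemma tendsto_horizontal_zero {f : ℝ → ℝ → ℂ} {B : ℝ → ℝ} {Y : ℝ}
    (hf : ∀ N, Y ≤ N → ∀ x ∈ uIcc γ₁ γ₂, ‖f N x‖ ≤ B N) (hB : Tendsto B atTop (𝓝 0)) :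
    Tendsto (fun N => ∫ x in γ₁..γ₂, f N x) atTop (𝓝 0) := by
  have h2 : Tendsto (fun N => B N * |γ₂ - γ₁|) atTop (𝓝 0) := by simpa using hB.mul_const _
  refine squeeze_zero_norm' ?_ h2
  filter_upwards [eventually_ge_atTop Y] with N hN
  exact intervalIntegral.norm_integral_le_of_norm_le_const fun x hx => hf N hN x (uIoc_subset_uIcc hx)

/-- The loop integral is independent of the height. As the height grows the horizontal sides vanish
and the two vertical sides have the same limit, since the pole lies on the same side of both
contours. No planar topology is involved. -/
lemma truncatedLoop_inv_eq_zero (h₁ : IsIndentedLine c₁) (h₂ : IsIndentedLine c₂)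
    (e₁ : ∀ s : ℝ, T ≤ |s| → c₁ s = verticalLine γ₁ s)
    (e₂ : ∀ s : ℝ, T ≤ |s| → c₂ s = verticalLine γ₂ s) {p : ℂ} (hp1 : p ∉ range c₁)
    (hp2 : p ∉ range c₂) {w : ℂ}
    (t₁ : Tendsto (fun T : ℝ => ∫ s in (-T)..T, deriv c₁ s / (c₁ s - p)) atTop (𝓝 w))
    (t₂ : Tendsto (fun T : ℝ => ∫ s in (-T)..T, deriv c₂ s / (c₂ s - p)) atTop (𝓝 w))
    {N : ℝ} (hN : |p.im| < N) (hT : T ≤ N) :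
    truncatedLoop c₁ c₂ γ₁ γ₂ N (fun z => (z - p)⁻¹) = 0 := by
  have hconst : ∀ᶠ N' in atTop, truncatedLoop c₁ c₂ γ₁ γ₂ N (fun z => (z - p)⁻¹) =
      truncatedLoop c₁ c₂ γ₁ γ₂ N' (fun z => (z - p)⁻¹) := by
    filter_upwards [eventually_ge_atTop N] with N' hN'
    exact (truncatedLoop_inv_eq_of_le h₁ h₂ e₁ e₂ hp1 hp2 hN hT hN').symm
  have hB : Tendsto (fun N : ℝ => (N - |p.im|)⁻¹) atTop (𝓝 0) :=
    tendsto_inv_atTop_zero.comp (tendsto_atTop_add_const_right _ _ tendsto_id)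
  have bound : ∀ z : ℂ, N ≤ |z.im| → ‖(z - p)⁻¹‖ ≤ (|z.im| - |p.im|)⁻¹ := by
    intro z hz
    rw [norm_inv]
    refine inv_anti₀ (by linarith) ?_
    have := Complex.abs_im_le_norm (z - p)
    rw [sub_im] at this
    linarith [abs_sub_abs_le_abs_sub z.im p.im]
  have hN0 : 0 < N := (abs_nonneg _).trans_lt hN
  have l1 := tendsto_horizontal_zero (γ₁ := γ₁) (γ₂ := γ₂) (Y := N)
    (f := fun N' x => (verticalLine x N' - p)⁻¹) (fun N' hN' x _ => by
      have := bound (verticalLine x N') (by simpa using hN'.trans (le_abs_self _))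
      rwa [verticalLine_im, abs_of_pos (hN0.trans_le hN')] at this) hB
  have l2 := tendsto_horizontal_zero (γ₁ := γ₁) (γ₂ := γ₂) (Y := N)
    (f := fun N' x => (verticalLine x (-N') - p)⁻¹) (fun N' hN' x _ => by
      have := bound (verticalLine x (-N')) (by
        rw [verticalLine_im, abs_neg]; exact hN'.trans (le_abs_self _))
      rwa [verticalLine_im, abs_neg, abs_of_pos (hN0.trans_le hN')] at this) hB
  have hlim := (t₁.sub t₂).add (l1.sub l2)
  simp only [sub_self, add_zero] at hlim
  refine tendsto_nhds_unique (tendsto_const_nhds.congr' hconst) ?_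
  refine hlim.congr fun N' => ?_
  simp only [truncatedLoop, div_eq_inv_mul]

end

/-! ### Products of Gamma functions and independence of the contour -/

section

variable {ι κ : Type*}

/-- A product of Gamma functions of Barnes type. -/
def barnesKernel [Fintype ι] [Fintype κ] (a : ι → ℂ) (b : κ → ℂ) (z : ℂ) : ℂ :=
  (∏ i, Complex.Gamma (a i + z)) * ∏ j, Complex.Gamma (b j - z)

lemma Separates.left_ne {a : ι → ℂ} {b : κ → ℂ} {c : ℝ → ℂ} (h : Separates a b c) (s : ℝ) (i : ι)
    (k : ℕ) : a i + c s ≠ -(k : ℂ) := fun h0 =>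
  ((h k).1 i).1 ⟨s, by linear_combination h0⟩

lemma Separates.right_ne {a : ι → ℂ} {b : κ → ℂ} {c : ℝ → ℂ} (h : Separates a b c) (s : ℝ) (j : κ)
    (k : ℕ) : b j - c s ≠ -(k : ℂ) := fun h0 =>
  ((h k).2 j).1 ⟨s, by linear_combination -h0⟩

variable [Fintype ι] [Fintype κ]

lemma differentiableAt_barnesKernel {a : ι → ℂ} {b : κ → ℂ} {z : ℂ}
    (ha : ∀ i, ∀ k : ℕ, a i + z ≠ -(k : ℂ)) (hb : ∀ j, ∀ k : ℕ, b j - z ≠ -(k : ℂ)) :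
    DifferentiableAt ℂ (barnesKernel a b) z := by
  unfold barnesKernel
  refine DifferentiableAt.mul (DifferentiableAt.fun_finsetProd fun i _ => ?_)
    (DifferentiableAt.fun_finsetProd fun j _ => ?_)
  · exact (Complex.differentiableAt_Gamma _ (ha i)).comp z (by fun_prop)
  · exact (Complex.differentiableAt_Gamma _ (hb j)).comp z (by fun_prop)

/-- Exponential decay in vertical strips. -/
def StripDecay (g : ℂ → ℂ) : Prop :=
  ∀ R : ℝ, ∃ C δ Y : ℝ, 0 < δ ∧ ∀ z : ℂ, |z.re| ≤ R → Y ≤ |z.im| → ‖g z‖ ≤ C * Real.exp (-(δ * |z.im|))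

lemma integrable_exp_neg_mul_abs {δ : ℝ} (hδ : 0 < δ) :
    Integrable fun t : ℝ => Real.exp (-(δ * |t|)) := by
  have h1 : IntegrableOn (fun t : ℝ => Real.exp (-(δ * |t|))) (Ioi 0) := by
    refine (integrableOn_exp_mul_Ioi (neg_lt_zero.2 hδ) 0).congr_fun (fun t ht => ?_)
      measurableSet_Ioi
    simp only [abs_of_pos (mem_Ioi.1 ht), neg_mul]
  have h2 : IntegrableOn (fun t : ℝ => Real.exp (-(δ * |t|))) (Iic 0) := by
    refine (integrableOn_exp_mul_Iic hδ 0).congr_fun (fun t ht => ?_) measurableSet_Iic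
    simp only [abs_of_nonpos (mem_Iic.1 ht)]
    ring_nf
  rw [← integrableOn_univ, ← Iic_union_Ioi (a := (0:ℝ))]
  exact h2.union h1

lemma contourIntegrable_of_stripDecay {g : ℂ → ℂ} {c : ℝ → ℂ} (hg : StripDecay g)
    (hc : IsIndentedLine c) (hcont : Continuous fun s => g (c s)) : ContourIntegrable c g := by
  obtain ⟨γ, T, hT⟩ := hc.2
  obtain ⟨C, δ, Y, hδ, h⟩ := hg |γ|
  set N := max (max T Y) 0 + 1
  have hcont' : Continuous fun s => g (c s) * deriv c s := hcont.mul hc.continuous_deriv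
  have hN : T < N ∧ Y < N ∧ 0 < N := by
    have h1 := le_max_left (max T Y) 0
    have h2 := le_max_left T Y
    have h3 := le_max_right T Y
    have h4 := le_max_right (max T Y) 0
    refine ⟨?_, ?_, ?_⟩ <;> simp only [N] <;> linarith
  have hbd : ∀ s : ℝ, N ≤ |s| → ‖g (c s) * deriv c s‖ ≤ C * Real.exp (-(δ * |s|)) := by
    intro s hs
    have e : c =ᶠ[𝓝 s] verticalLine γ := by
      have : ∀ᶠ r in 𝓝 s, T < |r| := continuous_abs.continuousAt.eventually (lt_mem_nhds (by linarith))
      filter_upwards [this] with r hr using hT r hr.le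
    rw [e.deriv_eq, deriv_verticalLine, norm_mul, Complex.norm_I, mul_one, hT s (by linarith)]
    have := h (verticalLine γ s) (by simp) (by simp; linarith)
    simpa using this
  have hC : 0 ≤ C := by
    have := (norm_nonneg _).trans (hbd N (le_abs_self N))
    exact nonneg_of_mul_nonneg_left this (Real.exp_pos _)
  obtain ⟨B, hB⟩ := (isCompact_Icc (a := -N) (b := N)).exists_bound_of_continuousOn hcont'.continuousOn
  have i1 := (integrable_exp_neg_mul_abs hδ).const_mul C
  have i2 : Integrable ((Icc (-N) N).indicator fun _ : ℝ => B) :=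
    (integrable_indicator_iff measurableSet_Icc).2 (by simp [integrableOn_const_iff])
  refine (i1.add i2).mono' hcont'.aestronglyMeasurable (Eventually.of_forall fun s => ?_)
  by_cases hs : s ∈ Icc (-N) N
  · simp only [Pi.add_apply, indicator_of_mem hs]
    have := hB s hs
    have : 0 ≤ C * Real.exp (-(δ * |s|)) := by positivity
    linarith
  · simp only [Pi.add_apply, indicator_of_notMem hs, add_zero]
    refine hbd s ?_
    by_contra! hlt
    exact hs (abs_le.1 hlt.le)

/-- Removing finitely many poles from a product of Gamma functions. -/
lemma barnesKernel_eq_div {a : ι → ℂ} {b : κ → ℂ} {z : ℂ} (n : ℕ)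
    (ha : ∀ i, ∀ k : ℕ, a i + z ≠ -(k : ℂ)) (hb : ∀ j, ∀ k : ℕ, b j - z ≠ -(k : ℂ)) :
    barnesKernel a b z = barnesKernel (fun i => a i + n) (fun j => b j + n) z /
      ((∏ i, ∏ k ∈ Finset.range n, (a i + z + k)) * ∏ j, ∏ k ∈ Finset.range n, (b j - z + k)) := by
  have h1 : ∀ i, Complex.Gamma (a i + n + z) =
      (∏ k ∈ Finset.range n, (a i + z + k)) * Complex.Gamma (a i + z) := fun i => by
    rw [← Gamma_add_nat _ n fun k _ h0 => ha i k (eq_neg_of_add_eq_zero_left h0)]; ring_nf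
  have h2 : ∀ j, Complex.Gamma (b j + n - z) =
      (∏ k ∈ Finset.range n, (b j - z + k)) * Complex.Gamma (b j - z) := fun j => by
    rw [← Gamma_add_nat _ n fun k _ h0 => hb j k (eq_neg_of_add_eq_zero_left h0)]; ring_nf
  have n1 : (∏ i, ∏ k ∈ Finset.range n, (a i + z + k)) ≠ 0 :=
    Finset.prod_ne_zero_iff.2 fun i _ => Finset.prod_ne_zero_iff.2 fun k _ h0 =>
      ha i k (eq_neg_of_add_eq_zero_left h0)
  have n2 : (∏ j, ∏ k ∈ Finset.range n, (b j - z + k)) ≠ 0 :=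
    Finset.prod_ne_zero_iff.2 fun i _ => Finset.prod_ne_zero_iff.2 fun k _ h0 =>
      hb i k (eq_neg_of_add_eq_zero_left h0)
  simp only [barnesKernel, h1, h2, Finset.prod_mul_distrib]
  field_simp

/-- Integrals of Barnes type do not depend on the contour. -/
theorem contourIntegral_eq_of_separates {a : ι → ℂ} {b : κ → ℂ} {E : ℂ → ℂ}
    (hE : Differentiable ℂ E) (hg : StripDecay fun z => barnesKernel a b z * E z) {c₁ c₂ : ℝ → ℂ}
    (h₁ : IsIndentedLine c₁) (h₂ : IsIndentedLine c₂) (s₁ : Separates a b c₁)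
    (s₂ : Separates a b c₂) :
    ContourIntegrable c₁ (fun z => barnesKernel a b z * E z) ∧
    contourIntegral c₁ (fun z => barnesKernel a b z * E z) =
      contourIntegral c₂ (fun z => barnesKernel a b z * E z) := by
  set g : ℂ → ℂ := fun z => barnesKernel a b z * E z with hgdef
  have gcont : ∀ {c : ℝ → ℂ}, IsIndentedLine c → Separates a b c → Continuous fun s => g (c s) := by
    intro c hc hs
    refine continuous_iff_continuousAt.2 fun s => ?_
    have : DifferentiableAt ℂ g (c s) :=
      (differentiableAt_barnesKernel (hs.left_ne s) (hs.right_ne s)).mul (hE _)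
    exact this.continuousAt.comp hc.continuous.continuousAt
  have int₁ := contourIntegrable_of_stripDecay hg h₁ (gcont h₁ s₁)
  have int₂ := contourIntegrable_of_stripDecay hg h₂ (gcont h₂ s₂)
  refine ⟨int₁, ?_⟩
  obtain ⟨γ₁, T₁, e₁⟩ := h₁.2
  obtain ⟨γ₂, T₂, e₂⟩ := h₂.2
  obtain ⟨C, δ, Y, hδ, hdec⟩ := hg (max |γ₁| |γ₂|)
  -- the horizontal parts tend to zero
  have hB : Tendsto (fun N : ℝ => C * Real.exp (-(δ * N))) atTop (𝓝 0) := by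
    have : Tendsto (fun N : ℝ => Real.exp (-(δ * N))) atTop (𝓝 0) :=
      Real.tendsto_exp_neg_atTop_nhds_zero.comp (tendsto_id.const_mul_atTop hδ)
    simpa using this.const_mul C
  have hre : ∀ x ∈ uIcc γ₁ γ₂, |x| ≤ max |γ₁| |γ₂| := fun x hx => by
    rcases mem_uIcc.1 hx with h | h
    · exact abs_le_max_abs_abs h.1 h.2
    · rw [max_comm]; exact abs_le_max_abs_abs h.1 h.2
  have l1 := tendsto_horizontal_zero (γ₁ := γ₁) (γ₂ := γ₂) (Y := max Y 0)
    (f := fun N x => g (verticalLine x N)) (fun N hN x hx => by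
      have hN0 : |N| = N := abs_of_nonneg ((le_max_right _ _).trans hN)
      have := hdec (verticalLine x N) (by simpa using hre x hx)
        (by rw [verticalLine_im, hN0]; exact (le_max_left _ _).trans hN)
      rwa [verticalLine_im, hN0] at this) hB
  have l2 := tendsto_horizontal_zero (γ₁ := γ₁) (γ₂ := γ₂) (Y := max Y 0)
    (f := fun N x => g (verticalLine x (-N))) (fun N hN x hx => by
      have hN0 : |-N| = N := by rw [abs_neg]; exact abs_of_nonneg ((le_max_right _ _).trans hN)
      have := hdec (verticalLine x (-N)) (by simpa using hre x hx)
        (by rw [verticalLine_im, hN0]; exact (le_max_left _ _).trans hN)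
      rwa [verticalLine_im, hN0] at this) hB
  have v1 := intervalIntegral_tendsto_integral int₁ tendsto_neg_atTop_atBot tendsto_id
  have v2 := intervalIntegral_tendsto_integral int₂ tendsto_neg_atTop_atBot tendsto_id
  have hlim := (v1.sub v2).add (l1.sub l2)
  rw [sub_zero, add_zero] at hlim
  -- the closed contours contribute zero
  obtain ⟨Y₀, hY₀⟩ : ∃ Y₀ : ℝ, T₁ ≤ Y₀ ∧ T₂ ≤ Y₀ ∧ (∀ i, |(a i).im| < Y₀) ∧ ∀ j, |(b j).im| < Y₀ := by
    refine ⟨|T₁| + |T₂| + ∑ i, |(a i).im| + ∑ j, |(b j).im| + 1, ?_, ?_, fun i => ?_, fun j => ?_⟩ <;>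
    have p1 : 0 ≤ ∑ i, |(a i).im| := Finset.sum_nonneg fun _ _ => abs_nonneg _ <;>
    have p2 : 0 ≤ ∑ j, |(b j).im| := Finset.sum_nonneg fun _ _ => abs_nonneg _
    · linarith [le_abs_self T₁, abs_nonneg T₂]
    · linarith [le_abs_self T₂, abs_nonneg T₁]
    · have := Finset.single_le_sum (f := fun i => |(a i).im|) (fun _ _ => abs_nonneg _) (Finset.mem_univ i)
      linarith [abs_nonneg T₁, abs_nonneg T₂]
    · have := Finset.single_le_sum (f := fun i => |(b i).im|) (fun _ _ => abs_nonneg _) (Finset.mem_univ j)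
      linarith [abs_nonneg T₁, abs_nonneg T₂]
  have hzero : ∀ N : ℝ, Y₀ ≤ N → 0 < N → truncatedLoop c₁ c₂ γ₁ γ₂ N g = 0 := by
    intro N hN hN0
    have hNabs : |N| = N := abs_of_pos hN0
    have hT1 : T₁ ≤ N := hY₀.1.trans hN
    have hT2 : T₂ ≤ N := hY₀.2.1.trans hN
    set K := loopTrace c₁ c₂ γ₁ γ₂ N with hK
    have hnot : ∀ p : ℂ, p ∉ range c₁ → p ∉ range c₂ → |p.im| < N → p ∉ K := by
      rintro p hp1 hp2 hp ((⟨s, -, rfl⟩ | ⟨s, -, rfl⟩) | (⟨s, -, rfl⟩ | ⟨s, -, rfl⟩))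
      · exact hp1 ⟨s, rfl⟩
      · exact hp2 ⟨s, rfl⟩
      · simp [hNabs] at hp
      · simp [hNabs] at hp
    have haK : ∀ i (k : ℕ), -a i - k ∉ K := fun i k =>
      hnot _ ((s₁ k).1 i).1 ((s₂ k).1 i).1 (by simpa using (hY₀.2.2.1 i).trans_le hN)
    have hbK : ∀ j (k : ℕ), b j + k ∉ K := fun j k =>
      hnot _ ((s₁ k).2 j).1 ((s₂ k).2 j).1 (by simpa using (hY₀.2.2.2 j).trans_le hN)
    obtain ⟨ρ, hρ⟩ := (isBounded_loopTrace (γ₁ := γ₁) (γ₂ := γ₂) (N := N) h₁ h₂).subset_ball 0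
    -- With all parameters raised by this `n` the kernel has no pole in the ball of radius `ρ`.
    -- There the original kernel is a holomorphic function divided by the finitely many linear
    -- factors whose zeros are collected in `ps`.
    obtain ⟨n, hn⟩ := exists_nat_ge (ρ + ∑ i, ‖a i‖ + ∑ j, ‖b j‖)
    let ps : List ℂ :=
      ((Finset.univ ×ˢ Finset.range n : Finset (ι × ℕ)).toList.map fun q => -a q.1 - q.2) ++
      ((Finset.univ ×ˢ Finset.range n : Finset (κ × ℕ)).toList.map fun q => b q.1 + q.2)
    have hps : ∀ p ∈ ps, (∃ i, ∃ k : ℕ, p = -a i - k) ∨ ∃ j, ∃ k : ℕ, p = b j + k := by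
      intro p hp
      rcases List.mem_append.1 hp with hp | hp <;> obtain ⟨q, -, rfl⟩ := List.mem_map.1 hp
      · exact .inl ⟨_, _, rfl⟩
      · exact .inr ⟨_, _, rfl⟩
    have hprod : ∀ z, (ps.map fun p => z - p).prod =
        (∏ i, ∏ k ∈ Finset.range n, (a i + z + k)) * ∏ j, ∏ k ∈ Finset.range n, (z - (b j + k)) := by
      intro z
      simp only [ps, List.map_append, List.prod_append, List.map_map, Finset.prod_map_toList,
        Finset.prod_product, Function.comp_def]
      congr 1
      exact Finset.prod_congr rfl fun i _ => Finset.prod_congr rfl fun k _ => by ring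
    have hsign : ∀ z, (∏ j, ∏ k ∈ Finset.range n, (b j - z + k)) =
        (∏ _j : κ, ∏ _k ∈ Finset.range n, (-1 : ℂ)) * ∏ j, ∏ k ∈ Finset.range n, (z - (b j + k)) := by
      intro z
      simp only [← Finset.prod_mul_distrib]
      exact Finset.prod_congr rfl fun i _ => Finset.prod_congr rfl fun k _ => by ring
    set sgn : ℂ := ∏ _j : κ, ∏ _k ∈ Finset.range n, (-1 : ℂ) with hsgn
    have hh : DifferentiableOn ℂ (fun z => barnesKernel (fun i => a i + n) (fun j => b j + n) z *
        E z / sgn) (Metric.ball 0 ρ) := by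
      intro z hz
      have hz' : ‖z‖ < ρ := by simpa using hz
      have hzre := (abs_le.1 (Complex.abs_re_le_norm z))
      have pos1 : ∀ i, 0 < (a i + n + z).re := fun i => by
        have := Finset.single_le_sum (f := fun i => ‖a i‖) (fun _ _ => norm_nonneg _) (Finset.mem_univ i)
        have p2 : 0 ≤ ∑ j, ‖b j‖ := Finset.sum_nonneg fun _ _ => norm_nonneg _
        have := (abs_le.1 (Complex.abs_re_le_norm (a i)))
        simp only [add_re, natCast_re]; linarith
      have pos2 : ∀ j, 0 < (b j + n - z).re := fun j => by
        have := Finset.single_le_sum (f := fun i => ‖b i‖) (fun _ _ => norm_nonneg _) (Finset.mem_univ j)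
        have p2 : 0 ≤ ∑ j, ‖a j‖ := Finset.sum_nonneg fun _ _ => norm_nonneg _
        have := (abs_le.1 (Complex.abs_re_le_norm (b j)))
        simp only [add_re, sub_re, natCast_re]; linarith
      have ne : ∀ w : ℂ, 0 < w.re → ∀ k : ℕ, w ≠ -(k : ℂ) := fun w hw k h0 => by
        rw [h0] at hw
        have : (0:ℝ) ≤ k := k.cast_nonneg
        simp at hw; linarith
      exact (((differentiableAt_barnesKernel (fun i => ne _ (pos1 i)) fun j => ne _ (pos2 j)).mul
        (hE z)).div_const _).differentiableWithinAt
    have key := truncatedLoop_div_prod_eq_zero h₁ h₂ (e₁ N (by rwa [hNabs]))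
      (e₁ (-N) (by rwa [abs_neg, hNabs])) (e₂ N (by rwa [hNabs])) (e₂ (-N) (by rwa [abs_neg, hNabs]))
      hρ _ ps rfl (fun p hp => by
        rcases hps p hp with ⟨i, k, rfl⟩ | ⟨j, k, rfl⟩
        · exact haK i k
        · exact hbK j k)
      (fun p hp => by
        have u1 : ∀ s : ℝ, max T₁ T₂ ≤ |s| → c₁ s = verticalLine γ₁ s :=
          fun s hs => e₁ s ((le_max_left _ _).trans hs)
        have u2 : ∀ s : ℝ, max T₁ T₂ ≤ |s| → c₂ s = verticalLine γ₂ s :=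
          fun s hs => e₂ s ((le_max_right _ _).trans hs)
        rcases hps p hp with ⟨i, k, rfl⟩ | ⟨j, k, rfl⟩
        · exact truncatedLoop_inv_eq_zero h₁ h₂ u1 u2 ((s₁ k).1 i).1 ((s₂ k).1 i).1
            ((s₁ k).1 i).2 ((s₂ k).1 i).2 (by simpa using (hY₀.2.2.1 i).trans_le hN) (max_le hT1 hT2)
        · exact truncatedLoop_inv_eq_zero h₁ h₂ u1 u2 ((s₁ k).2 j).1 ((s₂ k).2 j).1
            ((s₁ k).2 j).2 ((s₂ k).2 j).2 (by simpa using (hY₀.2.2.2 j).trans_le hN) (max_le hT1 hT2))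
      _ hh
    rw [← key]
    refine truncatedLoop_congr fun z hz => ?_
    rw [hgdef]
    simp only
    rw [barnesKernel_eq_div n (fun i k h0 => haK i k (by rwa [← (by linear_combination h0 : z = -a i - k)]))
      (fun j k h0 => hbK j k (by rwa [← (by linear_combination -h0 : z = b j + k)])), hprod, hsign,
      div_mul_eq_mul_div, div_div]
    congr 1
    ring
  have hz : ∀ᶠ N in atTop, truncatedLoop c₁ c₂ γ₁ γ₂ N g = 0 := by
    filter_upwards [eventually_ge_atTop Y₀, eventually_gt_atTop 0] with N h1 h2 using hzero N h1 h2
  have := tendsto_nhds_unique (tendsto_const_nhds.congr' (hz.mono fun N h => h.symm)) hlim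
  exact (sub_eq_zero.1 this.symm)

end

/-! ### Holomorphic dependence of integrals on parameters -/

section

variable {V : Type*} [NormedAddCommGroup V] [NormedSpace ℂ V]

/-- Cauchy's estimate on the complex line through `v` in the given direction; half the radius keeps
the closed disc inside the open ball. -/
lemma norm_fderiv_le_of_bound {f : V → ℂ} {v : V} {r B : ℝ} (hr : 0 < r) (hB : 0 ≤ B)
    (hd : DifferentiableOn ℂ f (Metric.ball v r)) (hb : ∀ w ∈ Metric.ball v r, ‖f w‖ ≤ B) :
    ‖fderiv ℂ f v‖ ≤ B / (r / 2) := by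
  refine ContinuousLinearMap.opNorm_le_bound _ (by positivity) fun h => ?_
  rcases eq_or_ne h 0 with rfl | hh
  · simp
  have hh' : 0 < ‖h‖ := norm_pos_iff.2 hh
  set R : ℝ := r / 2 / ‖h‖ with hR
  have hR0 : 0 < R := by positivity
  have hmem : ∀ ζ : ℂ, ‖ζ‖ ≤ R → v + ζ • h ∈ Metric.ball v r := fun ζ hζ => by
    rw [mem_ball_iff_norm, add_sub_cancel_left, norm_smul]
    calc _ ≤ R * ‖h‖ := by gcongr
      _ = r / 2 := by rw [hR]; field_simp
      _ < r := by linarith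
  have hdv : DifferentiableAt ℂ f v := hd.differentiableAt (Metric.ball_mem_nhds v hr)
  have hline : ∀ ζ : ℂ, HasDerivAt (fun ζ : ℂ => v + ζ • h) h ζ := fun ζ => by
    simpa using ((hasDerivAt_id ζ).smul_const h).const_add v
  have hder : deriv (fun ζ : ℂ => f (v + ζ • h)) 0 = fderiv ℂ f v h := by
    have h1 : HasFDerivAt f (fderiv ℂ f v) (v + (0:ℂ) • h) := by simpa using hdv.hasFDerivAt
    exact (h1.comp_hasDerivAt (0:ℂ) (hline 0)).deriv
  rw [← hder]
  have hdiff : DifferentiableOn ℂ (fun ζ : ℂ => f (v + ζ • h)) (Metric.closedBall 0 R) := by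
    intro ζ hζ
    have h1 := hmem ζ (by simpa using hζ)
    have h2 := hd.differentiableAt (Metric.isOpen_ball.mem_nhds h1)
    exact (h2.comp ζ (hline ζ).differentiableAt).differentiableWithinAt
  have := Complex.norm_deriv_le_of_forall_mem_sphere_norm_le (c := 0) (C := B) hR0
    (hdiff.diffContOnCl_ball subset_rfl) fun ζ hζ => hb _ (hmem ζ (by simpa using (by simpa using hζ : ‖ζ‖ = R).le))
  calc _ ≤ B / R := this
    _ = _ := by rw [hR]; field_simp

/-- Each directional derivative along a basis vector is a limit of measurable difference quotients,
and in finite dimension these determine the derivative. The offset `N` keeps the increments inside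
the ball on which measurability is known. -/
lemma aestronglyMeasurable_fderiv [FiniteDimensional ℂ V] {α : Type*} [MeasurableSpace α]
    {μ : Measure α} {F : V → α → ℂ} {v : V} {r : ℝ} (hr : 0 < r)
    (hm : ∀ w ∈ Metric.ball v r, AEStronglyMeasurable (F w) μ)
    (hd : ∀ᵐ t ∂μ, DifferentiableAt ℂ (fun w => F w t) v) :
    AEStronglyMeasurable (fun t => fderiv ℂ (fun w => F w t) v) μ := by
  let b := Module.finBasis ℂ V
  have hcoord : ∀ i, AEStronglyMeasurable (fun t => fderiv ℂ (fun w => F w t) v (b i)) μ := by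
    intro i
    obtain ⟨N, hN⟩ := exists_nat_gt (‖b i‖ / r)
    have hsmall : ∀ n : ℕ, v + ((n + N + 1 : ℕ) : ℂ)⁻¹ • b i ∈ Metric.ball v r := fun n => by
      rw [mem_ball_iff_norm, add_sub_cancel_left, norm_smul, norm_inv, Complex.norm_natCast,
        inv_mul_lt_iff₀ (by positivity), ← div_lt_iff₀ hr]
      refine hN.trans ?_
      push_cast
      linarith [(n.cast_nonneg : (0:ℝ) ≤ n)]
    refine aestronglyMeasurable_of_tendsto_ae atTop
      (f := fun (n : ℕ) t => ((n + N + 1 : ℕ) : ℂ) *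
        (F (v + ((n + N + 1 : ℕ) : ℂ)⁻¹ • b i) t - F v t)) (fun n => ?_) ?_
    · exact ((hm _ (hsmall n)).sub (hm v (Metric.mem_ball_self hr))).const_mul _
    · filter_upwards [hd] with t ht
      have hline : HasDerivAt (fun ζ : ℂ => v + ζ • b i) (b i) 0 := by
        simpa using ((hasDerivAt_id (0:ℂ)).smul_const (b i)).const_add v
      have h1 : HasFDerivAt (fun w => F w t) (fderiv ℂ (fun w => F w t) v) (v + (0:ℂ) • b i) := by
        simpa using ht.hasFDerivAt
      have h2 := (h1.comp_hasDerivAt (0:ℂ) hline).tendsto_slope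
      have h3 : Tendsto (fun n : ℕ => ((n + N + 1 : ℕ) : ℂ)⁻¹) atTop (𝓝[≠] 0) := by
        refine tendsto_nhdsWithin_iff.2 ⟨?_, Eventually.of_forall fun n => ?_⟩
        · have := ((tendsto_inv_atTop_nhds_zero_nat (𝕜 := ℝ)).comp
            (tendsto_add_atTop_nat (N + 1))).ofReal
          simpa [Function.comp_def, add_assoc] using this
        · have : ((n + N + 1 : ℕ) : ℂ) ≠ 0 := Nat.cast_ne_zero.2 (Nat.succ_ne_zero (n + N))
          simpa using this
      refine (h2.comp h3).congr fun n => ?_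
      simp [slope_def_field, div_eq_mul_inv, mul_comm]
  have hrep : (fun t => fderiv ℂ (fun w => F w t) v) = fun t =>
      ∑ i, (fderiv ℂ (fun w => F w t) v (b i)) • LinearMap.toContinuousLinearMap (b.coord i) := by
    funext t
    refine ContinuousLinearMap.ext fun w => ?_
    have := congrArg (fderiv ℂ (fun w => F w t) v) (b.sum_repr w)
    simp only [map_sum, map_smul, smul_eq_mul] at this
    rw [← this]
    simp [mul_comm]
  rw [hrep]
  exact Finset.aestronglyMeasurable_fun_sum _ fun i _ => (hcoord i).smul_const _

/-- For holomorphic integrands a bound on the functions alone suffices: Cauchy's estimate on balls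
of half the radius supplies the domination of the derivatives. -/
theorem differentiableAt_integral_of_bound [FiniteDimensional ℂ V] {α : Type*}
    [MeasurableSpace α] {μ : Measure α} {F : V → α → ℂ} {v : V} {r : ℝ} (hr : 0 < r) {B : α → ℝ}
    (hB : Integrable B μ) (hm : ∀ w ∈ Metric.ball v r, AEStronglyMeasurable (F w) μ)
    (hd : ∀ᵐ t ∂μ, DifferentiableOn ℂ (fun w => F w t) (Metric.ball v r))
    (hb : ∀ᵐ t ∂μ, ∀ w ∈ Metric.ball v r, ‖F w t‖ ≤ B t) :
    DifferentiableAt ℂ (fun w => ∫ t, F w t ∂μ) v := by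
  have hsub : ∀ w ∈ Metric.ball v (r / 2), Metric.ball w (r / 2) ⊆ Metric.ball v r := fun w hw =>
    Metric.ball_subset_ball' (by have := Metric.mem_ball.1 hw; linarith)
  have hvr : v ∈ Metric.ball v r := Metric.mem_ball_self hr
  refine (hasFDerivAt_integral_of_dominated_of_fderiv_le (μ := μ) (𝕜 := ℂ)
    (F' := fun w t => fderiv ℂ (fun w => F w t) w)
    (bound := fun t => B t / (r / 2 / 2)) (s := Metric.ball v (r / 2))
    (Metric.ball_mem_nhds v (half_pos hr)) ?_ ?_ ?_ ?_ ?_ ?_).differentiableAt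
  · filter_upwards [Metric.ball_mem_nhds v hr] with w hw using hm w hw
  · refine hB.mono' (hm v hvr) ?_
    filter_upwards [hb] with t ht using ht v hvr
  · refine aestronglyMeasurable_fderiv hr hm ?_
    filter_upwards [hd] with t ht using ht.differentiableAt (Metric.ball_mem_nhds v hr)
  · filter_upwards [hd, hb] with t ht hbt w hw
    exact norm_fderiv_le_of_bound (half_pos hr) ((norm_nonneg _).trans (hbt v hvr))
      (ht.mono (hsub w hw)) fun u hu => hbt u (hsub w hw hu)
  · exact hB.div_const _
  · filter_upwards [hd] with t ht w hw
    exact (ht.differentiableAt (Metric.isOpen_ball.mem_nhds (hsub w hw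
      (Metric.mem_ball_self (half_pos hr))))).hasFDerivAt

end

/-! ### Regularized integrals of Barnes type -/

section

variable {Λ : Type*} [NormedAddCommGroup Λ] [NormedSpace ℂ Λ] {ι κ : Type*} [Fintype ι] [Fintype κ]
  [DecidableEq ι] [DecidableEq κ]

/-- The reciprocal of the singular factor of a Barnes integral. -/
def barnesNorm (a : ι → ℂ) (b : κ → ℂ) : ℂ := ∏ i, ∏ j, (Complex.Gamma (a i + b j))⁻¹

/-- The half space on which the sums of a left and a right parameter have real part `> -t`. -/
def sumsAbove (t : ι × κ → ℕ) : Set (Λ × (ι → ℂ) × (κ → ℂ)) :=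
  {x | ∀ i j, 0 < (x.2.1 i + x.2.2 j).re + t (i, j)}

/-- The operator which raises one of the parameters `a i`, `b j`, where `p = (i, j)`. -/
def raise (p : ι × κ) (f : Λ × (ι → ℂ) × (κ → ℂ) → ℂ) (x : Λ × (ι → ℂ) × (κ → ℂ)) : ℂ :=
  (∏ l ∈ Finset.univ.erase p.2, (x.2.1 p.1 + x.2.2 l)) * f (x.1, x.2.1 + Pi.single p.1 1, x.2.2) +
  (∏ k ∈ Finset.univ.erase p.1, (x.2.1 k + x.2.2 p.2)) * f (x.1, x.2.1, x.2.2 + Pi.single p.2 1)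

/-- One round of raising operators. -/
def raiseAll (f : Λ × (ι → ℂ) × (κ → ℂ) → ℂ) : Λ × (ι → ℂ) × (κ → ℂ) → ℂ :=
  (Finset.univ : Finset (ι × κ)).toList.foldr raise f

-- One raising step for the pair `p` enlarges the admissible half space of that pair by one, and a
-- round over all pairs enlarges all of them. The representation of the integral, holomorphy and
-- growth all propagate in this way. A second function is carried along so that equality of two
-- continuations is covered too.
omit [NormedAddCommGroup Λ] [NormedSpace ℂ Λ] in
theorem raise_induction
    (Pr : (ι × κ → ℕ) → (Λ × (ι → ℂ) × (κ → ℂ) → ℂ) → (Λ × (ι → ℂ) × (κ → ℂ) → ℂ) → Prop)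
    (step : ∀ t p f h, Pr t f h → Pr (t + Pi.single p 1) (raise p f) (raise p h))
    {f h : Λ × (ι → ℂ) × (κ → ℂ) → ℂ} (t : ι × κ → ℕ) (h0 : Pr t f h) (n : ℕ) :
    Pr (t + fun _ => n) (raiseAll^[n] f) (raiseAll^[n] h) := by
  have hl : ∀ (l : List (ι × κ)) (t : ι × κ → ℕ) f h, Pr t f h →
      Pr (t + (l.map fun p => Pi.single p 1).sum) (l.foldr raise f) (l.foldr raise h) := by
    intro l
    induction l with
    | nil => intro t f h H; simpa using H
    | cons p l ih =>
      intro t f h H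
      have := step _ p _ _ (ih t f h H)
      simp only [List.map_cons, List.sum_cons, List.foldr_cons]
      rwa [add_comm (Pi.single p 1), ← add_assoc]
  induction n with
  | zero =>
    have e : (t + fun _ => 0) = t := by ext; simp
    rw [e]; exact h0
  | succ n ih =>
    have := hl (Finset.univ : Finset (ι × κ)).toList _ _ _ ih
    rw [Function.iterate_succ_apply', Function.iterate_succ_apply']
    rw [Finset.sum_map_toList] at this
    have e : ∑ p : ι × κ, (Pi.single p 1 : ι × κ → ℕ) = fun _ => 1 :=
      Finset.univ_sum_single (fun _ : ι × κ => 1)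
    rw [e, add_assoc] at this
    exact this

/-- The integrand of a Barnes integral with additional factor `E`. -/
def barnesIntegrand (E : Λ → ℂ → ℂ) (x : Λ × (ι → ℂ) × (κ → ℂ)) (z : ℂ) : ℂ :=
  barnesKernel x.2.1 x.2.2 z * E x.1 z

/-- Admissible additional factors. -/
structure IsBarnesFactor (n : ℕ) (E : Λ → ℂ → ℂ) : Prop where
  differentiable : Differentiable ℂ fun p : Λ × ℂ => E p.1 p.2
  growth : ∃ κ₀ < n * (Real.pi / 2), ∀ l₀ : Λ, ∃ U ∈ 𝓝 l₀, ∀ R : ℝ, ∃ C, ∀ l ∈ U, ∀ z : ℂ,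
    |z.re| ≤ R → ‖E l z‖ ≤ C * Real.exp (κ₀ * |z.im|)

lemma exp_neg_mul_abs_add_le {θ K v t : ℝ} (hθ : 0 ≤ θ) (hv : |v| ≤ K) :
    Real.exp (-(θ * |v + t|)) ≤ Real.exp (θ * K) * Real.exp (-(θ * |t|)) := by
  rw [← Real.exp_add, Real.exp_le_exp]
  have h1 : |t| ≤ |v + t| + |v| := by
    have := abs_sub (v + t) v
    rwa [add_sub_cancel_left] at this
  nlinarith

omit [DecidableEq ι] [DecidableEq κ] in
/-- Locally uniform exponential decay of Barnes integrands on vertical strips. -/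
lemma barnesIntegrand_bound {E : Λ → ℂ → ℂ}
    (hE : IsBarnesFactor (Fintype.card ι + Fintype.card κ) E) (l₀ : Λ) :
    ∃ U ∈ 𝓝 l₀, ∃ δ > 0, ∀ K δ₀ : ℝ, 0 < δ₀ → ∃ C, ∀ l ∈ U, ∀ (a : ι → ℂ) (b : κ → ℂ) (z : ℂ),
      |z.re| ≤ K → (∀ i, |(a i).re| ≤ K ∧ |(a i).im| ≤ K) → (∀ j, |(b j).re| ≤ K ∧ |(b j).im| ≤ K) →
      ((∀ i, δ₀ ≤ (a i + z).re) ∧ (∀ j, δ₀ ≤ (b j - z).re) ∨ K + 1 ≤ |z.im|) →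
      ‖barnesIntegrand E (l, a, b) z‖ ≤ C * Real.exp (-(δ * |z.im|)) := by
  obtain ⟨κ₀, hκ₀, hgr⟩ := hE.growth
  obtain ⟨U, hU, hgr⟩ := hgr l₀
  set n := Fintype.card ι + Fintype.card κ with hn
  -- distribute the gap over the Gamma functions
  obtain ⟨η, hη, hηlt, δ, hδ, hδeq⟩ : ∃ η > 0, η < Real.pi / 2 ∧ ∃ δ > 0,
      κ₀ - n * (Real.pi / 2 - η) = -δ := by
    set gap := n * (Real.pi / 2) - κ₀ with hgap
    have hgap0 : 0 < gap := by linarith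
    refine ⟨min (Real.pi / 4) (gap / (2 * (n + 1))), by positivity, ?_, gap -
      n * min (Real.pi / 4) (gap / (2 * (n + 1))), ?_, by rw [hgap]; ring⟩
    · exact (min_le_left _ _).trans_lt (by linarith [Real.pi_pos])
    · have h1 : (n:ℝ) * min (Real.pi / 4) (gap / (2 * (n + 1))) ≤ n * (gap / (2 * (n + 1))) := by
        gcongr; exact min_le_right _ _
      have h2 : n * (gap / (2 * (n + 1))) < gap := by
        rw [mul_div_assoc', div_lt_iff₀ (by positivity)]
        nlinarith [(n.cast_nonneg : (0:ℝ) ≤ n)]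
      linarith
  set θ := Real.pi / 2 - η with hθ
  have hθ0 : 0 ≤ θ := by linarith
  refine ⟨U, hU, δ, hδ, fun K δ₀ hδ₀ => ?_⟩
  obtain ⟨C0, hC0⟩ := hgr K
  obtain ⟨C1, hC1, h1⟩ := norm_Gamma_le_of_re_pos δ₀ (2 * K) η hδ₀ hη
  obtain ⟨C2, hC2, h2⟩ := norm_Gamma_le_of_one_le_im (2 * K) η hη
  set D := max C1 C2 * Real.exp (θ * K) with hD
  have hD0 : 0 < D := by positivity
  refine ⟨D ^ n * C0, fun l hl a b z hz ha hb hcase => ?_⟩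
  have gam : ∀ w : ℂ, |w.re| ≤ 2 * K → (δ₀ ≤ w.re ∨ 1 ≤ |w.im|) → (∃ v, |v| ≤ K ∧ |w.im| = |v + z.im|) →
      ‖Complex.Gamma w‖ ≤ D * Real.exp (-(θ * |z.im|)) := by
    rintro w hw hor ⟨v, hv, him⟩
    have h3 : ‖Complex.Gamma w‖ ≤ max C1 C2 * Real.exp (-(θ * |w.im|)) := by
      rcases hor with h | h
      · exact (h1 w h (abs_le.1 hw).2).trans (by gcongr; exact le_max_left _ _)
      · exact (h2 w hw h).trans (by gcongr; exact le_max_right _ _)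
    refine h3.trans ?_
    rw [him, hD, mul_assoc]
    gcongr
    exact exp_neg_mul_abs_add_le hθ0 hv
  have e1 : ∀ i, ‖Complex.Gamma (a i + z)‖ ≤ D * Real.exp (-(θ * |z.im|)) := fun i => by
    have := ha i
    refine gam _ ?_ ?_ ⟨(a i).im, (ha i).2, by simp⟩
    · simp only [add_re]; exact (abs_add_le _ _).trans (by linarith)
    · rcases hcase with h | h
      · exact .inl (h.1 i)
      · right
        have := abs_sub_abs_le_abs_sub z.im (-(a i).im)
        rw [abs_neg] at this
        simp only [add_im]
        rw [add_comm, ← sub_neg_eq_add]; linarith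
  have e2 : ∀ j, ‖Complex.Gamma (b j - z)‖ ≤ D * Real.exp (-(θ * |z.im|)) := fun j => by
    have := hb j
    refine gam _ ?_ ?_ ⟨-(b j).im, by rw [abs_neg]; exact (hb j).2, by
      rw [sub_im, ← abs_neg]; ring_nf⟩
    · simp only [sub_re]; exact (abs_sub _ _).trans (by linarith)
    · rcases hcase with h | h
      · exact .inl (h.2 j)
      · right
        have := abs_sub_abs_le_abs_sub z.im (b j).im
        rw [sub_im, ← abs_neg, neg_sub]; linarith
  have p1 : ∏ i, ‖Complex.Gamma (a i + z)‖ ≤ (D * Real.exp (-(θ * |z.im|))) ^ Fintype.card ι := by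
    have := Finset.prod_le_prod (s := Finset.univ) (fun i _ => norm_nonneg _) fun i _ => e1 i
    simpa using this
  have p2 : ∏ j, ‖Complex.Gamma (b j - z)‖ ≤ (D * Real.exp (-(θ * |z.im|))) ^ Fintype.card κ := by
    have := Finset.prod_le_prod (s := Finset.univ) (fun i _ => norm_nonneg _) fun i _ => e2 i
    simpa using this
  have e3 := hC0 l hl z hz
  unfold barnesIntegrand barnesKernel
  rw [norm_mul, norm_mul, norm_prod, norm_prod]
  calc _ ≤ (D * Real.exp (-(θ * |z.im|))) ^ Fintype.card ι *
        (D * Real.exp (-(θ * |z.im|))) ^ Fintype.card κ * (C0 * Real.exp (κ₀ * |z.im|)) := by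
        gcongr
    _ = D ^ n * C0 * (Real.exp (-(θ * |z.im|)) ^ n * Real.exp (κ₀ * |z.im|)) := by
        rw [← pow_add, mul_pow]; ring
    _ = _ := by
        rw [← Real.exp_nat_mul, ← Real.exp_add]
        congr 2
        linear_combination |z.im| * hδeq

omit [DecidableEq ι] [DecidableEq κ] in
lemma exists_norm_le (a : ι → ℂ) (b : κ → ℂ) : ∃ K : ℝ, 0 ≤ K ∧ (∀ i, ‖a i‖ ≤ K) ∧ ∀ j, ‖b j‖ ≤ K :=
  ⟨‖a‖ + ‖b‖, by positivity, fun i => (norm_le_pi_norm a i).trans (by linarith [norm_nonneg b]),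
    fun j => (norm_le_pi_norm b j).trans (by linarith [norm_nonneg a])⟩

omit [DecidableEq ι] [DecidableEq κ] in
lemma stripDecay_barnesIntegrand {E : Λ → ℂ → ℂ}
    (hE : IsBarnesFactor (Fintype.card ι + Fintype.card κ) E) (x : Λ × (ι → ℂ) × (κ → ℂ)) :
    StripDecay (barnesIntegrand E x) := by
  intro R
  obtain ⟨U, hU, δ, hδ, h⟩ := barnesIntegrand_bound hE x.1
  obtain ⟨K, hK0, hK1, hK2⟩ := exists_norm_le x.2.1 x.2.2
  obtain ⟨C, hC⟩ := h (max R K) 1 one_pos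
  refine ⟨C, δ, max R K + 1, hδ, fun z hz him => ?_⟩
  have bd : ∀ w : ℂ, ‖w‖ ≤ K → |w.re| ≤ max R K ∧ |w.im| ≤ max R K := fun w hw =>
    ⟨(Complex.abs_re_le_norm w).trans (hw.trans (le_max_right _ _)),
      (Complex.abs_im_le_norm w).trans (hw.trans (le_max_right _ _))⟩
  exact hC x.1 (mem_of_mem_nhds hU) x.2.1 x.2.2 z (hz.trans (le_max_left _ _))
    (fun i => bd _ (hK1 i)) (fun j => bd _ (hK2 j)) (.inr him)

lemma IsBarnesFactor.differentiable_right {n : ℕ} {E : Λ → ℂ → ℂ} (hE : IsBarnesFactor n E) (l : Λ) :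
    Differentiable ℂ (E l) :=
  hE.differentiable.comp (f := fun z : ℂ => (l, z)) (by fun_prop)

omit [DecidableEq ι] [DecidableEq κ] in
theorem barnes_contourIntegral_eq {E : Λ → ℂ → ℂ}
    (hE : IsBarnesFactor (Fintype.card ι + Fintype.card κ) E) {x : Λ × (ι → ℂ) × (κ → ℂ)}
    {c₁ c₂ : ℝ → ℂ} (h₁ : IsIndentedLine c₁) (h₂ : IsIndentedLine c₂)
    (s₁ : Separates x.2.1 x.2.2 c₁) (s₂ : Separates x.2.1 x.2.2 c₂) :
    ContourIntegrable c₁ (barnesIntegrand E x) ∧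
    contourIntegral c₁ (barnesIntegrand E x) = contourIntegral c₂ (barnesIntegrand E x) :=
  contourIntegral_eq_of_separates (hE.differentiable_right x.1) (stripDecay_barnesIntegrand hE x)
    h₁ h₂ s₁ s₂

/-- `γ` separates the poles on the straight line. -/
def LineSeparates (x : Λ × (ι → ℂ) × (κ → ℂ)) (γ : ℝ) : Prop :=
  (∀ i, 0 < (x.2.1 i).re + γ) ∧ ∀ j, 0 < (x.2.2 j).re - γ

open Classical in
/-- The Barnes integral along a straight line that separates the poles. -/
def barnesStraight (E : Λ → ℂ → ℂ) (x : Λ × (ι → ℂ) × (κ → ℂ)) : ℂ :=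
  if h : ∃ γ, LineSeparates x γ then
    contourIntegral (verticalLine h.choose) (barnesIntegrand E x) * barnesNorm x.2.1 x.2.2
  else 0

-- Independence of the contour makes the line chosen in the definition of `barnesStraight`
-- irrelevant, so that one fixed line may be used for all parameters near a given point.
omit [DecidableEq ι] [DecidableEq κ] in
lemma barnesStraight_eq {E : Λ → ℂ → ℂ}
    (hE : IsBarnesFactor (Fintype.card ι + Fintype.card κ) E) {x : Λ × (ι → ℂ) × (κ → ℂ)} {γ : ℝ}
    (hγ : LineSeparates x γ) {c : ℝ → ℂ} (hc : IsIndentedLine c) (hs : Separates x.2.1 x.2.2 c) :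
    contourIntegral c (barnesIntegrand E x) * barnesNorm x.2.1 x.2.2 = barnesStraight E x := by
  have h : ∃ γ, LineSeparates x γ := ⟨γ, hγ⟩
  rw [barnesStraight, dif_pos h, (barnes_contourIntegral_eq hE hc
    (isIndentedLine_verticalLine h.choose) hs
    (separates_verticalLine h.choose_spec.1 h.choose_spec.2)).2]

omit [DecidableEq ι] [DecidableEq κ] [NormedAddCommGroup Λ] [NormedSpace ℂ Λ] in
lemma exists_lineSeparates [Nonempty ι] [Nonempty κ] {x : Λ × (ι → ℂ) × (κ → ℂ)}
    (hx : x ∈ sumsAbove (0 : ι × κ → ℕ)) : ∃ γ, LineSeparates x γ := by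
  obtain ⟨i, hi⟩ := Finite.exists_min fun i => (x.2.1 i).re
  obtain ⟨j, hj⟩ := Finite.exists_min fun j => (x.2.2 j).re
  have := hx i j
  simp only [add_re, Pi.zero_apply, Nat.cast_zero, add_zero] at this
  refine ⟨((x.2.2 j).re - (x.2.1 i).re) / 2, fun k => ?_, fun k => ?_⟩
  · linarith [hi k]
  · linarith [hj k]

omit [NormedAddCommGroup Λ] [NormedSpace ℂ Λ] [Fintype ι] [Fintype κ] in
lemma raise_fst_mem {t : ι × κ → ℕ} {p : ι × κ} {x : Λ × (ι → ℂ) × (κ → ℂ)}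
    (hx : x ∈ sumsAbove (t + Pi.single p 1)) :
    (x.1, x.2.1 + Pi.single p.1 1, x.2.2) ∈ sumsAbove t := by
  intro i j
  have := hx i j
  rcases eq_or_ne i p.1 with rfl | hi
  · rcases eq_or_ne (p.1, j) p with h | h
    · rw [h] at this ⊢; simp at this ⊢; linarith
    · rw [Pi.add_apply, Pi.single_eq_of_ne h] at this
      simp at this ⊢; linarith
  · have h : (i, j) ≠ p := fun h => hi (by rw [← h])
    rw [Pi.add_apply, Pi.single_eq_of_ne h] at this
    simp [hi] at this ⊢; linarith

omit [NormedAddCommGroup Λ] [NormedSpace ℂ Λ] [Fintype ι] [Fintype κ] in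
lemma raise_snd_mem {t : ι × κ → ℕ} {p : ι × κ} {x : Λ × (ι → ℂ) × (κ → ℂ)}
    (hx : x ∈ sumsAbove (t + Pi.single p 1)) :
    (x.1, x.2.1, x.2.2 + Pi.single p.2 1) ∈ sumsAbove t := by
  intro i j
  have := hx i j
  rcases eq_or_ne j p.2 with rfl | hi
  · rcases eq_or_ne (i, p.2) p with h | h
    · rw [h] at this ⊢; simp at this ⊢; linarith
    · rw [Pi.add_apply, Pi.single_eq_of_ne h] at this
      simp at this ⊢; linarith
  · have h : (i, j) ≠ p := fun h => hi (by rw [← h])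
    rw [Pi.add_apply, Pi.single_eq_of_ne h] at this
    simp [hi] at this ⊢; linarith

omit [Fintype ι] [Fintype κ] [DecidableEq κ] in
lemma Separates.raise_fst {a : ι → ℂ} {b : κ → ℂ} {c : ℝ → ℂ} (h : Separates a b c) (i : ι) :
    Separates (a + Pi.single i 1) b c := fun k => by
  refine ⟨fun l => ?_, (h k).2⟩
  rcases eq_or_ne l i with rfl | hl
  · have := (h (k + 1)).1 l
    push_cast at this
    rw [Pi.add_apply, Pi.single_eq_same]
    convert this using 1; ring
  · rw [Pi.add_apply, Pi.single_eq_of_ne hl, add_zero]; exact (h k).1 l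

omit [Fintype ι] [Fintype κ] [DecidableEq ι] in
lemma Separates.raise_snd {a : ι → ℂ} {b : κ → ℂ} {c : ℝ → ℂ} (h : Separates a b c) (j : κ) :
    Separates a (b + Pi.single j 1) c := fun k => by
  refine ⟨(h k).1, fun l => ?_⟩
  rcases eq_or_ne l j with rfl | hl
  · have := (h (k + 1)).2 l
    push_cast at this
    rw [Pi.add_apply, Pi.single_eq_same]
    convert this using 1; ring
  · rw [Pi.add_apply, Pi.single_eq_of_ne hl, add_zero]; exact (h k).2 l

-- Otherwise a single point would lie on both sides of the contour.
omit [Fintype ι] [Fintype κ] [DecidableEq ι] [DecidableEq κ] in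
lemma Separates.add_ne_zero {a : ι → ℂ} {b : κ → ℂ} {c : ℝ → ℂ} (h : Separates a b c) (i : ι) (j : κ) :
    a i + b j ≠ 0 := fun h0 => by
  have h1 := ((h 0).1 i).2
  have h2 := ((h 0).2 j).2
  have e : -a i - ((0:ℕ):ℂ) = b j + ((0:ℕ):ℂ) := by simp; linear_combination -h0
  rw [e] at h1
  have := tendsto_nhds_unique h1 h2
  have h3 : (Real.pi : ℂ) * I = 0 := by linear_combination this / 2
  simp [Real.pi_ne_zero] at h3

lemma inv_Gamma_eq (z : ℂ) : (Complex.Gamma z)⁻¹ = z * (Complex.Gamma (z + 1))⁻¹ := by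
  have := Complex.one_div_Gamma_eq_self_mul_one_div_Gamma_add_one z
  simpa [one_div] using this

omit [DecidableEq κ] in
lemma barnesNorm_raise_fst (a : ι → ℂ) (b : κ → ℂ) (i : ι) :
    barnesNorm a b = (∏ l, (a i + b l)) * barnesNorm (a + Pi.single i 1) b := by
  unfold barnesNorm
  conv_lhs => rw [← Finset.mul_prod_erase Finset.univ _ (Finset.mem_univ i)]
  conv_rhs => rw [← Finset.mul_prod_erase Finset.univ _ (Finset.mem_univ i)]
  rw [← mul_assoc, ← Finset.prod_mul_distrib]
  congr 1
  · refine Finset.prod_congr rfl fun j _ => ?_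
    rw [inv_Gamma_eq, Pi.add_apply, Pi.single_eq_same]
    ring_nf
  · refine Finset.prod_congr rfl fun k hk => ?_
    rw [Pi.add_apply, Pi.single_eq_of_ne (Finset.ne_of_mem_erase hk), add_zero]

omit [DecidableEq ι] in
lemma barnesNorm_raise_snd (a : ι → ℂ) (b : κ → ℂ) (j : κ) :
    barnesNorm a b = (∏ k, (a k + b j)) * barnesNorm a (b + Pi.single j 1) := by
  unfold barnesNorm
  rw [← Finset.prod_mul_distrib]
  refine Finset.prod_congr rfl fun i _ => ?_
  conv_lhs => rw [← Finset.mul_prod_erase Finset.univ _ (Finset.mem_univ j)]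
  conv_rhs => rw [← Finset.mul_prod_erase Finset.univ _ (Finset.mem_univ j)]
  rw [← mul_assoc]
  congr 1
  · rw [inv_Gamma_eq, Pi.add_apply, Pi.single_eq_same]
    ring_nf
  · refine Finset.prod_congr rfl fun k hk => ?_
    rw [Pi.add_apply, Pi.single_eq_of_ne (Finset.ne_of_mem_erase hk), add_zero]

omit [DecidableEq κ] in
lemma barnesKernel_raise_fst (a : ι → ℂ) (b : κ → ℂ) (i : ι) {z : ℂ} (h : a i + z ≠ 0) :
    barnesKernel (a + Pi.single i 1) b z = (a i + z) * barnesKernel a b z := by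
  unfold barnesKernel
  rw [← Finset.mul_prod_erase Finset.univ _ (Finset.mem_univ i),
    ← Finset.mul_prod_erase Finset.univ (fun k => Complex.Gamma (a k + z)) (Finset.mem_univ i),
    Pi.add_apply, Pi.single_eq_same, add_right_comm, Complex.Gamma_add_one _ h]
  rw [Finset.prod_congr rfl fun k hk => by
    rw [Pi.add_apply, Pi.single_eq_of_ne (Finset.ne_of_mem_erase hk), add_zero]]
  ring

omit [DecidableEq ι] in
lemma barnesKernel_raise_snd (a : ι → ℂ) (b : κ → ℂ) (j : κ) {z : ℂ} (h : b j - z ≠ 0) :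
    barnesKernel a (b + Pi.single j 1) z = (b j - z) * barnesKernel a b z := by
  unfold barnesKernel
  rw [← Finset.mul_prod_erase Finset.univ _ (Finset.mem_univ j),
    ← Finset.mul_prod_erase Finset.univ (fun k => Complex.Gamma (b k - z)) (Finset.mem_univ j),
    Pi.add_apply, Pi.single_eq_same, add_sub_right_comm, Complex.Gamma_add_one _ h]
  rw [Finset.prod_congr (s₁ := Finset.univ.erase j) rfl fun k hk => by
    rw [Pi.add_apply, Pi.single_eq_of_ne (Finset.ne_of_mem_erase hk), add_zero]]
  ring

/-- The function `f` represents the normalized Barnes integral on `sumsAbove t`. -/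
def Represents (E : Λ → ℂ → ℂ) (t : ι × κ → ℕ) (f : Λ × (ι → ℂ) × (κ → ℂ) → ℂ) : Prop :=
  ∀ x ∈ sumsAbove t, ∀ c : ℝ → ℂ, IsIndentedLine c → Separates x.2.1 x.2.2 c →
    contourIntegral c (barnesIntegrand E x) * barnesNorm x.2.1 x.2.2 = f x

/-- Because `(a i + z) + (b j - z) = a i + b j`, the integral times `a i + b j` is the sum of the
integrals with `a i` or with `b j` raised by one. The normalization contains the same factor, which
cancels because separation makes it nonzero; its remaining linear factors are the coefficients in
`raise`. -/
lemma Represents.raise {E : Λ → ℂ → ℂ}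
    (hE : IsBarnesFactor (Fintype.card ι + Fintype.card κ) E) {t : ι × κ → ℕ}
    {f : Λ × (ι → ℂ) × (κ → ℂ) → ℂ} (hf : Represents E t f) (p : ι × κ) :
    Represents E (t + Pi.single p 1) (raise p f) := by
  intro x hx c hc hs
  have hs1 : Separates (x.2.1 + Pi.single p.1 1) x.2.2 c := hs.raise_fst p.1
  have hs2 : Separates x.2.1 (x.2.2 + Pi.single p.2 1) c := hs.raise_snd p.2
  have k1 := hf _ (raise_fst_mem hx) c hc hs1
  have k2 := hf _ (raise_snd_mem hx) c hc hs2
  have i1 := (barnes_contourIntegral_eq (x := (x.1, x.2.1 + Pi.single p.1 1, x.2.2)) hE hc hc hs1 hs1).1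
  have i2 := (barnes_contourIntegral_eq (x := (x.1, x.2.1, x.2.2 + Pi.single p.2 1)) hE hc hc hs2 hs2).1
  have hne := hs.add_ne_zero p.1 p.2
  have hsum : (x.2.1 p.1 + x.2.2 p.2) * contourIntegral c (barnesIntegrand E x) =
      contourIntegral c (barnesIntegrand E (x.1, x.2.1 + Pi.single p.1 1, x.2.2)) +
      contourIntegral c (barnesIntegrand E (x.1, x.2.1, x.2.2 + Pi.single p.2 1)) := by
    unfold contourIntegral
    rw [← integral_add i1 i2, ← integral_const_mul]
    refine integral_congr_ae (Eventually.of_forall fun s => ?_)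
    have n1 : x.2.1 p.1 + c s ≠ 0 := by simpa using hs.left_ne s p.1 0
    have n2 : x.2.2 p.2 - c s ≠ 0 := by simpa using hs.right_ne s p.2 0
    simp only [barnesIntegrand, barnesKernel_raise_fst _ _ _ n1, barnesKernel_raise_snd _ _ _ n2]
    ring
  have q1 : barnesNorm x.2.1 x.2.2 = (x.2.1 p.1 + x.2.2 p.2) *
      ((∏ l ∈ Finset.univ.erase p.2, (x.2.1 p.1 + x.2.2 l)) *
        barnesNorm (x.2.1 + Pi.single p.1 1) x.2.2) := by
    rw [barnesNorm_raise_fst _ _ p.1, ← Finset.mul_prod_erase Finset.univ _ (Finset.mem_univ p.2)]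
    ring
  have q2 : barnesNorm x.2.1 x.2.2 = (x.2.1 p.1 + x.2.2 p.2) *
      ((∏ k ∈ Finset.univ.erase p.1, (x.2.1 k + x.2.2 p.2)) *
        barnesNorm x.2.1 (x.2.2 + Pi.single p.2 1)) := by
    rw [barnesNorm_raise_snd _ _ p.2, ← Finset.mul_prod_erase Finset.univ _ (Finset.mem_univ p.1)]
    ring
  rw [FeynmanMB.raise, ← k1, ← k2]
  refine mul_left_cancel₀ hne ?_
  rw [← mul_assoc, hsum, add_mul, mul_add]
  congr 1
  · rw [q1]; ring
  · rw [q2]; ring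

end

/-! ### Holomorphy of the normalized Barnes integral in all parameters -/

section

variable {Λ : Type*} [NormedAddCommGroup Λ] [NormedSpace ℂ Λ] {ι κ : Type*} [Fintype ι] [Fintype κ]

lemma differentiable_inv_Gamma : Differentiable ℂ fun z => (Complex.Gamma z)⁻¹ := by
  simpa [one_div] using Complex.differentiable_one_div_Gamma

lemma differentiableAt_prod {V α : Type*} [NormedAddCommGroup V] [NormedSpace ℂ V] {s : Finset α}
    {f : α → V → ℂ} {x : V} (h : ∀ i ∈ s, DifferentiableAt ℂ (f i) x) :
    DifferentiableAt ℂ (fun y => ∏ i ∈ s, f i y) x := by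
  classical
  induction s using Finset.induction_on with
  | empty => simp
  | insert i s hi ih =>
    simp only [Finset.prod_insert hi]
    exact (h i (Finset.mem_insert_self i s)).mul (ih fun j hj => h j (Finset.mem_insert_of_mem hj))

lemma differentiable_barnesNorm :
    Differentiable ℂ fun x : Λ × (ι → ℂ) × (κ → ℂ) => barnesNorm x.2.1 x.2.2 := by
  intro x
  unfold barnesNorm
  refine differentiableAt_prod fun i _ => differentiableAt_prod fun j _ => ?_
  exact (differentiable_inv_Gamma _).comp x (by fun_prop)

omit [NormedSpace ℂ Λ] in
lemma lineSeparates_nhds {x : Λ × (ι → ℂ) × (κ → ℂ)} {γ : ℝ} (h : LineSeparates x γ) :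
    ∃ δ > 0, ∃ r > 0, ∀ y ∈ Metric.ball x r,
      (∀ i, δ ≤ (y.2.1 i).re + γ) ∧ ∀ j, δ ≤ (y.2.2 j).re - γ := by
  have hopen : ∀ᶠ y : Λ × (ι → ℂ) × (κ → ℂ) in 𝓝 x, (∀ i, ∀ _ : True, (x.2.1 i).re - (y.2.1 i).re < ((x.2.1 i).re + γ) / 2) ∧
      ∀ j, ∀ _ : True, (x.2.2 j).re - (y.2.2 j).re < ((x.2.2 j).re - γ) / 2 := by
    refine (eventually_all.2 fun i => ?_).and (eventually_all.2 fun j => ?_)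
    · have : ContinuousAt (fun y : Λ × (ι → ℂ) × (κ → ℂ) => (x.2.1 i).re - (y.2.1 i).re) x := by fun_prop
      have hlt : (x.2.1 i).re - (x.2.1 i).re < ((x.2.1 i).re + γ) / 2 := by linarith [h.1 i]
      filter_upwards [this.eventually_lt_const hlt] with y hy _ using hy
    · have : ContinuousAt (fun y : Λ × (ι → ℂ) × (κ → ℂ) => (x.2.2 j).re - (y.2.2 j).re) x := by fun_prop
      have hlt : (x.2.2 j).re - (x.2.2 j).re < ((x.2.2 j).re - γ) / 2 := by linarith [h.2 j]
      filter_upwards [this.eventually_lt_const hlt] with y hy _ using hy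
  obtain ⟨r, hr, hball⟩ := Metric.mem_nhds_iff.1 hopen
  obtain ⟨δ₁, hδ₁, h1⟩ : ∃ δ > 0, ∀ i, δ ≤ ((x.2.1 i).re + γ) / 2 := by
    have := (Set.finite_range fun i => ((x.2.1 i).re + γ) / 2)
    rcases isEmpty_or_nonempty ι with hι | hι
    · exact ⟨1, one_pos, fun i => (hι.false i).elim⟩
    · obtain ⟨i, hi⟩ := Finite.exists_min fun i => ((x.2.1 i).re + γ) / 2
      exact ⟨_, by linarith [h.1 i], hi⟩
  obtain ⟨δ₂, hδ₂, h2⟩ : ∃ δ > 0, ∀ j, δ ≤ ((x.2.2 j).re - γ) / 2 := by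
    rcases isEmpty_or_nonempty κ with hι | hι
    · exact ⟨1, one_pos, fun i => (hι.false i).elim⟩
    · obtain ⟨i, hi⟩ := Finite.exists_min fun j => ((x.2.2 j).re - γ) / 2
      exact ⟨_, by linarith [h.2 i], hi⟩
  refine ⟨min δ₁ δ₂, by positivity, r, hr, fun y hy => ⟨fun i => ?_, fun j => ?_⟩⟩
  · have := (hball hy).1 i trivial
    linarith [min_le_left δ₁ δ₂, h1 i]
  · have := (hball hy).2 j trivial
    linarith [min_le_right δ₁ δ₂, h2 j]

lemma ne_neg_nat_of_re_pos {w : ℂ} (hw : 0 < w.re) (k : ℕ) : w ≠ -(k : ℂ) := fun h0 => by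
  rw [h0] at hw
  have : (0:ℝ) ≤ k := k.cast_nonneg
  simp at hw; linarith

/-- The Barnes integral along a fixed line is holomorphic in the parameters. -/
lemma differentiableAt_barnesLine [FiniteDimensional ℂ Λ] {E : Λ → ℂ → ℂ}
    (hE : IsBarnesFactor (Fintype.card ι + Fintype.card κ) E) {x : Λ × (ι → ℂ) × (κ → ℂ)} {γ : ℝ}
    (h : LineSeparates x γ) :
    DifferentiableAt ℂ (fun y => contourIntegral (verticalLine γ) (barnesIntegrand E y)) x := by
  obtain ⟨δ₀, hδ₀, r₁, hr₁, hsep⟩ := lineSeparates_nhds h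
  obtain ⟨U, hU, δ, hδ, hbd⟩ := barnesIntegrand_bound (ι := ι) (κ := κ) hE x.1
  obtain ⟨r₂, hr₂, hball⟩ := Metric.mem_nhds_iff.1 hU
  set K : ℝ := ‖x‖ + 1 + |γ| with hK
  obtain ⟨C, hC⟩ := hbd K δ₀ hδ₀
  set r := min 1 (min r₁ r₂) with hr
  have hr0 : 0 < r := by positivity
  have hline : ∀ y ∈ Metric.ball x r, LineSeparates y γ := fun y hy => by
    have := hsep y (Metric.ball_subset_ball ((min_le_right _ _).trans (min_le_left _ _)) hy)
    exact ⟨fun i => hδ₀.trans_le (this.1 i), fun j => hδ₀.trans_le (this.2 j)⟩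
  have hdiff : ∀ y ∈ Metric.ball x r, ∀ t : ℝ, DifferentiableAt ℂ
      (fun p : (Λ × (ι → ℂ) × (κ → ℂ)) × ℂ => barnesIntegrand E p.1 p.2) (y, verticalLine γ t) := by
    intro y hy t
    have hl := hline y hy
    unfold barnesIntegrand barnesKernel
    refine DifferentiableAt.mul (DifferentiableAt.mul (differentiableAt_prod fun i _ => ?_)
      (differentiableAt_prod fun j _ => ?_)) ?_
    · have h1 := Complex.differentiableAt_Gamma (y.2.1 i + verticalLine γ t) fun k =>
        ne_neg_nat_of_re_pos (by simpa using hl.1 i) k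
      exact h1.comp ((y, verticalLine γ t) : (Λ × (ι → ℂ) × (κ → ℂ)) × ℂ)
        (f := fun p : (Λ × (ι → ℂ) × (κ → ℂ)) × ℂ => p.1.2.1 i + p.2) (by fun_prop)
    · have h1 := Complex.differentiableAt_Gamma (y.2.2 j - verticalLine γ t) fun k =>
        ne_neg_nat_of_re_pos (by simpa using hl.2 j) k
      exact h1.comp ((y, verticalLine γ t) : (Λ × (ι → ℂ) × (κ → ℂ)) × ℂ)
        (f := fun p : (Λ × (ι → ℂ) × (κ → ℂ)) × ℂ => p.1.2.2 j - p.2) (by fun_prop)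
    · exact (hE.differentiable (y.1, verticalLine γ t)).comp
        ((y, verticalLine γ t) : (Λ × (ι → ℂ) × (κ → ℂ)) × ℂ)
        (f := fun p : (Λ × (ι → ℂ) × (κ → ℂ)) × ℂ => (p.1.1, p.2)) (by fun_prop)
  unfold contourIntegral
  simp only [deriv_verticalLine]
  refine differentiableAt_integral_of_bound (r := r) hr0
    (B := fun t => C * Real.exp (-(δ * |t|))) ((integrable_exp_neg_mul_abs hδ).const_mul C) ?_ ?_ ?_
  · intro y hy
    refine Continuous.aestronglyMeasurable ?_
    refine Continuous.mul (continuous_iff_continuousAt.2 fun t => ?_) continuous_const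
    have := (hdiff y hy t).continuousAt.comp (f := fun t : ℝ => (y, verticalLine γ t))
      (continuousAt_const.prodMk (hasDerivAt_verticalLine γ t).continuousAt)
    exact this
  · refine Eventually.of_forall fun t y hy => ?_
    refine DifferentiableAt.differentiableWithinAt (DifferentiableAt.mul_const ?_ _)
    exact (hdiff y hy t).comp y (f := fun y => (y, verticalLine γ t)) (by fun_prop)
  · refine Eventually.of_forall fun t y hy => ?_
    rw [norm_mul, Complex.norm_I, mul_one]
    have hy1 : ‖y‖ ≤ ‖x‖ + 1 := by
      have h1 : ‖y - x‖ < 1 := (mem_ball_iff_norm.1 hy).trans_le (min_le_left _ _)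
      have := norm_le_norm_add_norm_sub' y x
      linarith
    have hs := hsep y (Metric.ball_subset_ball ((min_le_right _ _).trans (min_le_left _ _)) hy)
    have hyU : y.1 ∈ U := by
      refine hball ?_
      have : dist y.1 x.1 ≤ dist y x := le_max_left _ _
      rw [Metric.mem_ball] at hy ⊢
      exact this.trans_lt (hy.trans_le ((min_le_right _ _).trans (min_le_right _ _)))
    have hb : ∀ w : ℂ, ‖w‖ ≤ ‖y‖ → |w.re| ≤ K ∧ |w.im| ≤ K := fun w hw =>
      ⟨(Complex.abs_re_le_norm w).trans (by linarith [abs_nonneg γ]),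
        (Complex.abs_im_le_norm w).trans (by linarith [abs_nonneg γ])⟩
    have := hC y.1 hyU y.2.1 y.2.2 (verticalLine γ t)
      (by rw [verticalLine_re]; linarith [norm_nonneg x])
      (fun i => hb _ ((norm_le_pi_norm _ i).trans ((norm_fst_le y.2).trans (norm_snd_le y))))
      (fun j => hb _ ((norm_le_pi_norm _ j).trans ((norm_snd_le y.2).trans (norm_snd_le y))))
      (.inl ⟨fun i => by simpa using hs.1 i, fun j => by simpa using hs.2 j⟩)
    simpa using this

lemma differentiableAt_barnesStraight [FiniteDimensional ℂ Λ] [Nonempty ι] [Nonempty κ]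
    {E : Λ → ℂ → ℂ} (hE : IsBarnesFactor (Fintype.card ι + Fintype.card κ) E)
    {x : Λ × (ι → ℂ) × (κ → ℂ)} (hx : x ∈ sumsAbove (0 : ι × κ → ℕ)) :
    DifferentiableAt ℂ (barnesStraight E) x := by
  obtain ⟨γ, hγ⟩ := exists_lineSeparates hx
  have h1 := (differentiableAt_barnesLine hE hγ).mul (differentiable_barnesNorm x)
  refine h1.congr_of_eventuallyEq ?_
  obtain ⟨δ₀, hδ₀, r, hr, hsep⟩ := lineSeparates_nhds hγ
  filter_upwards [Metric.ball_mem_nhds x hr] with y hy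
  have hl : LineSeparates y γ := ⟨fun i => hδ₀.trans_le ((hsep y hy).1 i),
    fun j => hδ₀.trans_le ((hsep y hy).2 j)⟩
  exact (barnesStraight_eq hE hl (isIndentedLine_verticalLine γ)
    (separates_verticalLine hl.1 hl.2)).symm

variable [DecidableEq ι] [DecidableEq κ]

/-- The entire function which continues the normalized Barnes integral. -/
def barnesReg (E : Λ → ℂ → ℂ) (x : Λ × (ι → ℂ) × (κ → ℂ)) : ℂ :=
  raiseAll^[⌈2 * ‖x.2‖⌉₊ + 1] (barnesStraight E) x

-- The number of rounds in `barnesReg` depends on the point: `2 * ‖x.2‖` bounds the real parts of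
-- all sums of a left and a right parameter.
omit [NormedAddCommGroup Λ] [NormedSpace ℂ Λ] [DecidableEq ι] [DecidableEq κ] in
lemma mem_sumsAbove {x : Λ × (ι → ℂ) × (κ → ℂ)} {n : ℕ} (h : 2 * ‖x.2‖ < n) :
    x ∈ sumsAbove (0 + fun _ : ι × κ => n) := by
  intro i j
  have h1 := (Complex.abs_re_le_norm (x.2.1 i)).trans ((norm_le_pi_norm _ i).trans (norm_fst_le x.2))
  have h2 := (Complex.abs_re_le_norm (x.2.2 j)).trans ((norm_le_pi_norm _ j).trans (norm_snd_le x.2))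
  simp only [Pi.add_apply, Pi.zero_apply, zero_add, add_re]
  linarith [(abs_le.1 h1).1, (abs_le.1 h2).1]

/-- Where a straight separating line exists, both functions represent the integral along it. Hence
further rounds change nothing, and near a point a fixed number of rounds can be used. -/
lemma raiseAll_barnesStraight [Nonempty ι] [Nonempty κ] {E : Λ → ℂ → ℂ}
    (hE : IsBarnesFactor (Fintype.card ι + Fintype.card κ) E) :
    EqOn (raiseAll (barnesStraight E)) (barnesStraight E)
      (sumsAbove (0 : ι × κ → ℕ) : Set (Λ × (ι → ℂ) × (κ → ℂ))) := by
  have h0 : Represents E (0 : ι × κ → ℕ) (barnesStraight E) := fun x hx c hc hs => by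
    obtain ⟨γ, hγ⟩ := exists_lineSeparates hx
    exact barnesStraight_eq hE hγ hc hs
  have h1 := raise_induction (fun t f _ => Represents E t f) (fun t p f _ hf => hf.raise hE p) 0
    (f := barnesStraight E) (h := barnesStraight E) h0 1
  intro x hx
  obtain ⟨γ, hγ⟩ := exists_lineSeparates hx
  have hv := isIndentedLine_verticalLine γ
  have hs := separates_verticalLine hγ.1 hγ.2
  have hx1 : x ∈ sumsAbove (0 + fun _ : ι × κ => 1) := fun i j => by
    have := hx i j
    simp at this ⊢; linarith
  exact (h1 x hx1 _ hv hs).symm.trans (h0 x hx _ hv hs)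

lemma barnesReg_eq [Nonempty ι] [Nonempty κ] {E : Λ → ℂ → ℂ}
    (hE : IsBarnesFactor (Fintype.card ι + Fintype.card κ) E) {x : Λ × (ι → ℂ) × (κ → ℂ)} {n : ℕ}
    (hn : x ∈ sumsAbove (0 + fun _ : ι × κ => n)) :
    barnesReg E x = raiseAll^[n] (barnesStraight E) x := by
  have hmono : ∀ n m : ℕ, n ≤ m → x ∈ sumsAbove (0 + fun _ : ι × κ => n) →
      raiseAll^[m] (barnesStraight E) x = raiseAll^[n] (barnesStraight E) x := by
    intro n m hnm hx
    induction m, hnm using Nat.le_induction with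
    | base => rfl
    | succ m hm ih =>
      rw [← ih, Function.iterate_succ_apply]
      have := raise_induction (fun t f h => EqOn f h (sumsAbove t : Set (Λ × (ι → ℂ) × (κ → ℂ))))
        (fun t p f h hfh y hy => by
          simp only [raise, hfh (raise_fst_mem hy), hfh (raise_snd_mem hy)]) 0
        (raiseAll_barnesStraight hE) m
      refine this fun i j => (hx i j).trans_le ?_
      simpa using hm
  have h1 := mem_sumsAbove (x := x) (n := ⌈2 * ‖x.2‖⌉₊ + 1) (by
    push_cast; linarith [Nat.le_ceil (2 * ‖x.2‖)])
  rw [barnesReg]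
  rcases le_total n (⌈2 * ‖x.2‖⌉₊ + 1) with h | h
  · exact hmono _ _ h hn
  · exact (hmono _ _ h h1).symm

/-- The raising identities keep the contour fixed, so the continuation is the integral along every
separating contour, also for parameters that no straight line separates. -/
theorem contourIntegral_mul_barnesNorm [Nonempty ι] [Nonempty κ] {E : Λ → ℂ → ℂ}
    (hE : IsBarnesFactor (Fintype.card ι + Fintype.card κ) E) (x : Λ × (ι → ℂ) × (κ → ℂ))
    {c : ℝ → ℂ} (hc : IsIndentedLine c) (hs : Separates x.2.1 x.2.2 c) :
    contourIntegral c (barnesIntegrand E x) * barnesNorm x.2.1 x.2.2 = barnesReg E x := by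
  have h0 : Represents E (0 : ι × κ → ℕ) (barnesStraight E) := fun x hx c hc hs => by
    obtain ⟨γ, hγ⟩ := exists_lineSeparates hx
    exact barnesStraight_eq hE hγ hc hs
  obtain ⟨n, hn⟩ := exists_nat_gt (2 * ‖x.2‖)
  have h1 := raise_induction (fun t f _ => Represents E t f) (fun t p f _ hf => hf.raise hE p) 0
    (f := barnesStraight E) (h := barnesStraight E) h0 n
  rw [barnesReg_eq hE (mem_sumsAbove hn), h1 x (mem_sumsAbove hn) c hc hs]

theorem differentiable_barnesReg [FiniteDimensional ℂ Λ] [Nonempty ι] [Nonempty κ] {E : Λ → ℂ → ℂ}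
    (hE : IsBarnesFactor (Fintype.card ι + Fintype.card κ) E) :
    Differentiable ℂ (barnesReg E : Λ × (ι → ℂ) × (κ → ℂ) → ℂ) := by
  intro x
  obtain ⟨n, hn⟩ := exists_nat_gt (2 * ‖x.2‖)
  have h1 := raise_induction (fun t f _ => ∀ x ∈ (sumsAbove t : Set (Λ × (ι → ℂ) × (κ → ℂ))),
    DifferentiableAt ℂ f x) (fun t p f _ hf x hx => by
      have d1 := (hf _ (raise_fst_mem hx)).comp x
        (f := fun x : Λ × (ι → ℂ) × (κ → ℂ) => (x.1, x.2.1 + Pi.single p.1 1, x.2.2)) (by fun_prop)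
      have d2 := (hf _ (raise_snd_mem hx)).comp x
        (f := fun x : Λ × (ι → ℂ) × (κ → ℂ) => (x.1, x.2.1, x.2.2 + Pi.single p.2 1)) (by fun_prop)
      have e1 : DifferentiableAt ℂ (fun x : Λ × (ι → ℂ) × (κ → ℂ) =>
          ∏ l ∈ Finset.univ.erase p.2, (x.2.1 p.1 + x.2.2 l)) x :=
        differentiableAt_prod fun i _ => by fun_prop
      have e2 : DifferentiableAt ℂ (fun x : Λ × (ι → ℂ) × (κ → ℂ) =>
          ∏ k ∈ Finset.univ.erase p.1, (x.2.1 k + x.2.2 p.2)) x :=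
        differentiableAt_prod fun i _ => by fun_prop
      exact (e1.mul d1).add (e2.mul d2)) 0
    (f := barnesStraight E) (h := barnesStraight E) (fun x hx => differentiableAt_barnesStraight hE hx) n
  refine (h1 x (mem_sumsAbove hn)).congr_of_eventuallyEq ?_
  have hcont : ContinuousAt (fun y : Λ × (ι → ℂ) × (κ → ℂ) => 2 * ‖y.2‖) x := by fun_prop
  filter_upwards [hcont.eventually_lt_const hn] with y hy
  exact barnesReg_eq hE (mem_sumsAbove hy)

end

/-! ### The two nested Barnes integrals -/

/-- The reciprocal Gamma functions of the inner integrand. -/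
def innerFactor (l : ℂ × ℂ) (z : ℂ) : ℂ := (Complex.Gamma (l.1 - z))⁻¹ * (Complex.Gamma (l.2 + z))⁻¹

lemma differentiable_innerFactor : Differentiable ℂ fun p : (ℂ × ℂ) × ℂ => innerFactor p.1 p.2 := by
  intro p
  unfold innerFactor
  exact ((differentiable_inv_Gamma _).comp p
      (f := fun p : (ℂ × ℂ) × ℂ => p.1.1 - p.2) (by fun_prop)).mul
    ((differentiable_inv_Gamma _).comp p (f := fun p : (ℂ × ℂ) × ℂ => p.1.2 + p.2) (by fun_prop))

lemma norm_inv_Gamma_le_shift (K η : ℝ) (hη : 0 < η) :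
    ∃ C > 0, ∀ (z : ℂ) (s : ℝ), |z.re| ≤ K → |z.im - s| ≤ K →
      ‖(Complex.Gamma z)⁻¹‖ ≤ C * Real.exp ((Real.pi / 2 + η) * |s|) := by
  obtain ⟨C, hC, h⟩ := norm_inv_Gamma_le K η hη
  have hθ : 0 ≤ Real.pi / 2 + η := by positivity
  refine ⟨C * Real.exp ((Real.pi / 2 + η) * K), by positivity, fun z s hz him => (h z hz).trans ?_⟩
  rw [mul_assoc, ← Real.exp_add]
  gcongr
  have h1 : |z.im| ≤ |z.im - s| + |s| := by
    have := abs_add_le (z.im - s) s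
    rwa [sub_add_cancel] at this
  nlinarith

lemma norm_Gamma_le_shift (δ K η : ℝ) (hδ : 0 < δ) (hη : 0 < η) (hη2 : η < Real.pi / 2) :
    ∃ C > 0, ∀ (z : ℂ) (s : ℝ), δ ≤ z.re → z.re ≤ K → |z.im - s| ≤ K →
      ‖Complex.Gamma z‖ ≤ C * Real.exp (-((Real.pi / 2 - η) * |s|)) := by
  obtain ⟨C, hC, h⟩ := norm_Gamma_le_of_re_pos δ K η hδ hη
  have hθ : 0 ≤ Real.pi / 2 - η := by linarith
  refine ⟨C * Real.exp ((Real.pi / 2 - η) * K), by positivity,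
    fun z s h1 h2 him => (h z h1 h2).trans ?_⟩
  rw [mul_assoc]
  gcongr
  have := exp_neg_mul_abs_add_le (t := s) hθ him
  rwa [sub_add_cancel] at this

/-- Six Gamma functions decay at total rate `3π`, while the two reciprocal ones grow at rate `π` up
to an arbitrarily small loss. The rate `3π/2` is one choice strictly in between. -/
lemma isBarnesFactor_innerFactor : IsBarnesFactor (Fintype.card (Fin 3) + Fintype.card (Fin 3)) innerFactor := by
  refine ⟨differentiable_innerFactor, 3 / 2 * Real.pi, ?_, fun l₀ => ⟨Metric.ball l₀ 1,
    Metric.ball_mem_nhds _ one_pos, fun R => ?_⟩⟩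
  · simp only [Fintype.card_fin]; push_cast; linarith [Real.pi_pos]
  obtain ⟨C, hC, h⟩ := norm_inv_Gamma_le_shift (R + ‖l₀‖ + 1) (Real.pi / 4) (by positivity)
  refine ⟨C * C, fun l hl z hz => ?_⟩
  have hl1 : ‖l‖ ≤ ‖l₀‖ + 1 := by
    have h1 : ‖l - l₀‖ < 1 := mem_ball_iff_norm.1 hl
    linarith [norm_le_norm_add_norm_sub' l l₀]
  have b1 := (norm_fst_le l).trans hl1
  have b2 := (norm_snd_le l).trans hl1
  have r1 := (Complex.abs_re_le_norm l.1).trans b1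
  have r2 := (Complex.abs_re_le_norm l.2).trans b2
  have i1 := (Complex.abs_im_le_norm l.1).trans b1
  have i2 := (Complex.abs_im_le_norm l.2).trans b2
  have hR : 0 ≤ R := (abs_nonneg _).trans hz
  have g1 := h (l.1 - z) (-z.im) (by rw [sub_re]; exact (abs_sub _ _).trans (by linarith))
    (by rw [sub_im, sub_neg_eq_add, sub_add_cancel]; linarith)
  have g2 := h (l.2 + z) z.im (by rw [add_re]; exact (abs_add_le _ _).trans (by linarith))
    (by rw [add_im, add_sub_cancel_right]; linarith)
  rw [abs_neg] at g1
  rw [innerFactor, norm_mul]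
  calc _ ≤ (C * Real.exp ((Real.pi / 2 + Real.pi / 4) * |z.im|)) *
        (C * Real.exp ((Real.pi / 2 + Real.pi / 4) * |z.im|)) := by gcongr
    _ = C * C * (Real.exp ((Real.pi / 2 + Real.pi / 4) * |z.im|) *
        Real.exp ((Real.pi / 2 + Real.pi / 4) * |z.im|)) := by ring
    _ = _ := by rw [← Real.exp_add]; ring_nf

/-! ### Growth of the normalized inner integral in the outer variable -/

/-- Parameters of the inner integral whose imaginary parts follow an outer variable with
imaginary part `s`. -/
def InnerShift (K s : ℝ) (x : (ℂ × ℂ) × (Fin 3 → ℂ) × (Fin 3 → ℂ)) : Prop :=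
  (|x.1.1.re| ≤ K ∧ |x.1.1.im| ≤ K ∧ |x.1.2.re| ≤ K ∧ |x.1.2.im - s| ≤ K) ∧
  (∀ i, |(x.2.1 i).re| ≤ K ∧ |(x.2.1 i).im - (![0, s, s] : Fin 3 → ℝ) i| ≤ K) ∧
  ∀ j, |(x.2.2 j).re| ≤ K ∧ |(x.2.2 j).im - (![0, 0, -s] : Fin 3 → ℝ) j| ≤ K

lemma InnerShift.nonneg {K s : ℝ} {x : (ℂ × ℂ) × (Fin 3 → ℂ) × (Fin 3 → ℂ)}
    (h : InnerShift K s x) : 0 ≤ K := (abs_nonneg _).trans h.1.1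

lemma abs_shift_le (s : ℝ) (i : Fin 3) : |(![0, s, s] : Fin 3 → ℝ) i| ≤ |s| := by
  fin_cases i <;> simp

lemma abs_shift_le' (s : ℝ) (i : Fin 3) : |(![0, 0, -s] : Fin 3 → ℝ) i| ≤ |s| := by
  fin_cases i <;> simp

/-- Exponential growth of a function of the inner parameters in the outer variable. -/
def InnerGrowth (t : Fin 3 × Fin 3 → ℕ) (f : (ℂ × ℂ) × (Fin 3 → ℂ) × (Fin 3 → ℂ) → ℂ) : Prop :=
  ∀ η > 0, ∀ K δ : ℝ, 0 < δ → ∃ C, 0 ≤ C ∧ ∀ x s, InnerShift K s x →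
    (∀ i j, δ ≤ (x.2.1 i + x.2.2 j).re + t (i, j)) →
    ‖f x‖ ≤ C * Real.exp ((5 / 2 * Real.pi + η) * |s|)

lemma InnerShift.raise_fst {K s : ℝ} {x : (ℂ × ℂ) × (Fin 3 → ℂ) × (Fin 3 → ℂ)}
    (h : InnerShift K s x) (i : Fin 3) :
    InnerShift (K + 1) s (x.1, x.2.1 + Pi.single i 1, x.2.2) := by
  obtain ⟨⟨h1, h2, h3, h4⟩, h5, h6⟩ := h
  refine ⟨⟨by linarith, by linarith, by linarith, by linarith⟩, fun k => ?_, fun k => ?_⟩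
  · have := h5 k
    rcases eq_or_ne k i with rfl | hk
    · simp only [Pi.add_apply, Pi.single_eq_same, add_re, one_re, add_im, one_im, add_zero]
      exact ⟨(abs_add_le _ _).trans (by rw [abs_one]; linarith), by linarith⟩
    · simp only [Pi.add_apply, Pi.single_eq_of_ne hk, add_zero]
      exact ⟨by linarith, by linarith⟩
  · have := h6 k
    exact ⟨by linarith, by linarith⟩

lemma InnerShift.raise_snd {K s : ℝ} {x : (ℂ × ℂ) × (Fin 3 → ℂ) × (Fin 3 → ℂ)}
    (h : InnerShift K s x) (i : Fin 3) :
    InnerShift (K + 1) s (x.1, x.2.1, x.2.2 + Pi.single i 1) := by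
  obtain ⟨⟨h1, h2, h3, h4⟩, h5, h6⟩ := h
  refine ⟨⟨by linarith, by linarith, by linarith, by linarith⟩, fun k => ?_, fun k => ?_⟩
  · have := h5 k
    exact ⟨by linarith, by linarith⟩
  · have := h6 k
    rcases eq_or_ne k i with rfl | hk
    · simp only [Pi.add_apply, Pi.single_eq_same, add_re, one_re, add_im, one_im, add_zero]
      exact ⟨(abs_add_le _ _).trans (by rw [abs_one]; linarith), by linarith⟩
    · simp only [Pi.add_apply, Pi.single_eq_of_ne hk, add_zero]
      exact ⟨by linarith, by linarith⟩

lemma raise_fst_ge {δ : ℝ} {t : Fin 3 × Fin 3 → ℕ} {p : Fin 3 × Fin 3} {a b : Fin 3 → ℂ}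
    (hx : ∀ i j, δ ≤ (a i + b j).re + ((t + Pi.single p 1 : Fin 3 × Fin 3 → ℕ) (i, j) : ℝ))
    (i j : Fin 3) : δ ≤ ((a + Pi.single p.1 1 : Fin 3 → ℂ) i + b j).re + t (i, j) := by
  have h2 := hx i j
  rcases eq_or_ne i p.1 with rfl | hi
  · rcases eq_or_ne (p.1, j) p with h | h
    · rw [h] at h2 ⊢; simp at h2 ⊢; linarith
    · rw [Pi.add_apply, Pi.single_eq_of_ne h] at h2
      simp at h2 ⊢; linarith
  · have h : (i, j) ≠ p := fun h => hi (by rw [← h])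
    rw [Pi.add_apply, Pi.single_eq_of_ne h] at h2
    simp [hi] at h2 ⊢; linarith

lemma raise_snd_ge {δ : ℝ} {t : Fin 3 × Fin 3 → ℕ} {p : Fin 3 × Fin 3} {a b : Fin 3 → ℂ}
    (hx : ∀ i j, δ ≤ (a i + b j).re + ((t + Pi.single p 1 : Fin 3 × Fin 3 → ℕ) (i, j) : ℝ))
    (i j : Fin 3) : δ ≤ (a i + (b + Pi.single p.2 1 : Fin 3 → ℂ) j).re + t (i, j) := by
  have h2 := hx i j
  rcases eq_or_ne j p.2 with rfl | hi
  · rcases eq_or_ne (i, p.2) p with h | h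
    · rw [h] at h2 ⊢; simp at h2 ⊢; linarith
    · rw [Pi.add_apply, Pi.single_eq_of_ne h] at h2
      simp at h2 ⊢; linarith
  · have h : (i, j) ≠ p := fun h => hi (by rw [← h])
    rw [Pi.add_apply, Pi.single_eq_of_ne h] at h2
    simp [hi] at h2 ⊢; linarith

lemma InnerShift.norm_add_le {K s : ℝ} {x : (ℂ × ℂ) × (Fin 3 → ℂ) × (Fin 3 → ℂ)}
    (h : InnerShift K s x) (i j : Fin 3) : ‖x.2.1 i + x.2.2 j‖ ≤ 2 * (2 * K + |s|) := by
  have h1 := h.2.1 i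
  have h2 := h.2.2 j
  have e1 : |(x.2.1 i).im| ≤ K + |s| := by
    have := abs_add_le ((x.2.1 i).im - (![0, s, s] : Fin 3 → ℝ) i) ((![0, s, s] : Fin 3 → ℝ) i)
    rw [sub_add_cancel] at this
    linarith [abs_shift_le s i]
  have e2 : |(x.2.2 j).im| ≤ K + |s| := by
    have := abs_add_le ((x.2.2 j).im - (![0, 0, -s] : Fin 3 → ℝ) j) ((![0, 0, -s] : Fin 3 → ℝ) j)
    rw [sub_add_cancel] at this
    linarith [abs_shift_le' s j]
  have n1 := Complex.norm_le_abs_re_add_abs_im (x.2.1 i)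
  have n2 := Complex.norm_le_abs_re_add_abs_im (x.2.2 j)
  linarith [_root_.norm_add_le (x.2.1 i) (x.2.2 j)]

/-- The coefficients in `raise` are products of two linear factors, so they grow quadratically in
`s`; half of `η` pays for them and the other half is left to `f`. -/
lemma InnerGrowth.raise {t : Fin 3 × Fin 3 → ℕ} {f : (ℂ × ℂ) × (Fin 3 → ℂ) × (Fin 3 → ℂ) → ℂ}
    (hf : InnerGrowth t f) (p : Fin 3 × Fin 3) : InnerGrowth (t + Pi.single p 1) (raise p f) := by
  intro η hη K δ hδ
  obtain ⟨C, hC, h⟩ := hf (η / 2) (half_pos hη) (K + 1) δ hδ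
  obtain ⟨C', hC', h'⟩ := add_abs_le_exp (2 * K) (η / 4) (by positivity)
  refine ⟨8 * C' ^ 2 * C, by positivity, fun x s hx hre => ?_⟩
  have k1 := h _ s (hx.raise_fst p.1) (raise_fst_ge hre)
  have k2 := h _ s (hx.raise_snd p.2) (raise_snd_ge hre)
  have hfac : ∀ i j, ‖x.2.1 i + x.2.2 j‖ ≤ 2 * (C' * Real.exp (η / 4 * |s|)) := fun i j =>
    (hx.norm_add_le i j).trans (by gcongr; exact h' s)
  have q1 : ‖∏ l ∈ Finset.univ.erase p.2, (x.2.1 p.1 + x.2.2 l)‖ ≤ (2 * (C' * Real.exp (η / 4 * |s|))) ^ 2 := by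
    rw [norm_prod]
    refine (Finset.prod_le_prod (fun _ _ => norm_nonneg _) fun l _ => hfac p.1 l).trans (le_of_eq ?_)
    simp
  have q2 : ‖∏ k ∈ Finset.univ.erase p.1, (x.2.1 k + x.2.2 p.2)‖ ≤ (2 * (C' * Real.exp (η / 4 * |s|))) ^ 2 := by
    rw [norm_prod]
    refine (Finset.prod_le_prod (fun _ _ => norm_nonneg _) fun l _ => hfac l p.2).trans (le_of_eq ?_)
    simp
  rw [FeynmanMB.raise]
  refine (norm_add_le _ _).trans ?_
  rw [norm_mul, norm_mul]
  calc _ ≤ (2 * (C' * Real.exp (η / 4 * |s|))) ^ 2 * (C * Real.exp ((5 / 2 * Real.pi + η / 2) * |s|)) +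
        (2 * (C' * Real.exp (η / 4 * |s|))) ^ 2 * (C * Real.exp ((5 / 2 * Real.pi + η / 2) * |s|)) := by
        gcongr
    _ = 8 * C' ^ 2 * C * (Real.exp (η / 4 * |s|) * Real.exp (η / 4 * |s|) *
        Real.exp ((5 / 2 * Real.pi + η / 2) * |s|)) := by ring
    _ = _ := by
        rw [← Real.exp_add, ← Real.exp_add]
        ring_nf

/-- Five of the nine sums `a i + b j` have an imaginary part that follows `s` or `-s`, and their
reciprocal Gamma functions produce the rate `5π/2`. The integral itself is bounded uniformly in `s`:
three of its Gamma functions decay in `|t|` and three in `|s + t|`, against one growing reciprocal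
in each. -/
lemma innerGrowth_barnesStraight : InnerGrowth 0 (barnesStraight innerFactor) := by
  intro η hη K δ hδ
  -- bounds for the individual factors
  obtain ⟨CG, hCG, hG⟩ := norm_Gamma_le_shift (δ / 2) (2 * K) (Real.pi / 16) (half_pos hδ)
    (by positivity) (by linarith [Real.pi_pos])
  obtain ⟨CE, hCE, hE⟩ := norm_inv_Gamma_le_shift (2 * K) (Real.pi / 16) (by positivity)
  obtain ⟨CN, hCN, hN⟩ := norm_inv_Gamma_le_shift (2 * K) (η / 5) (by positivity)
  set I₀ := ∫ t : ℝ, Real.exp (-(Real.pi / 2 * |t|)) with hI₀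
  have hI₀0 : 0 ≤ I₀ := integral_nonneg fun _ => (Real.exp_pos _).le
  refine ⟨CG ^ 6 * CE ^ 2 * I₀ * CN ^ 9, by positivity, fun x s hx hre => ?_⟩
  have hK := hx.nonneg
  obtain ⟨⟨hl1, hl2, hl3, hl4⟩, ha, hb⟩ := hx
  obtain ⟨i, hi⟩ := Finite.exists_min fun i => (x.2.1 i).re
  obtain ⟨j, hj⟩ := Finite.exists_min fun j => (x.2.2 j).re
  have hij := hre i j
  simp only [add_re, Pi.zero_apply, Nat.cast_zero, add_zero] at hij
  set γ := ((x.2.2 j).re - (x.2.1 i).re) / 2 with hγ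
  have hγK : |γ| ≤ K := by
    rw [hγ, abs_div, abs_two, div_le_iff₀ two_pos]
    exact (abs_sub _ _).trans (by linarith [(ha i).1, (hb j).1])
  have g1 : ∀ k, δ / 2 ≤ (x.2.1 k).re + γ := fun k => by linarith [hi k]
  have g2 : ∀ k, δ / 2 ≤ (x.2.2 k).re - γ := fun k => by linarith [hj k]
  have hsep : LineSeparates x γ := ⟨fun k => by linarith [g1 k], fun k => by linarith [g2 k]⟩
  have hval := barnesStraight_eq isBarnesFactor_innerFactor hsep (isIndentedLine_verticalLine γ)
    (separates_verticalLine hsep.1 hsep.2)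
  rw [← hval, norm_mul]
  have bN : ‖barnesNorm x.2.1 x.2.2‖ ≤ CN ^ 9 * Real.exp ((5 / 2 * Real.pi + η) * |s|) := by
    have key : ∀ k l, ‖(Complex.Gamma (x.2.1 k + x.2.2 l))⁻¹‖ ≤ CN * Real.exp ((Real.pi / 2 + η / 5) *
        |(![0, s, s] : Fin 3 → ℝ) k + (![0, 0, -s] : Fin 3 → ℝ) l|) := by
      intro k l
      refine hN _ _ ?_ ?_
      · rw [add_re]; exact (abs_add_le _ _).trans (by linarith [(ha k).1, (hb l).1])
      · rw [add_im, add_sub_add_comm]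
        exact (abs_add_le _ _).trans (by linarith [(ha k).2, (hb l).2])
    unfold barnesNorm
    rw [norm_prod]
    simp only [norm_prod]
    refine (Finset.prod_le_prod (fun _ _ => Finset.prod_nonneg fun _ _ => norm_nonneg _) fun k _ =>
      Finset.prod_le_prod (fun _ _ => norm_nonneg _) fun l _ => key k l).trans (le_of_eq ?_)
    simp only [Fin.prod_univ_three, Matrix.cons_val_zero, Matrix.cons_val_one, Matrix.cons_val,
      add_zero, zero_add, abs_zero, mul_zero, Real.exp_zero, mul_one, abs_neg, add_neg_cancel]
    have : Real.exp ((5 / 2 * Real.pi + η) * |s|) = Real.exp ((Real.pi / 2 + η / 5) * |s|) ^ 5 := by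
      rw [← Real.exp_nat_mul]; congr 1; push_cast; ring
    rw [this]; ring
  have bI : ‖contourIntegral (verticalLine γ) (barnesIntegrand innerFactor x)‖ ≤
      CG ^ 6 * CE ^ 2 * I₀ := by
    unfold contourIntegral
    rw [hI₀, ← integral_const_mul]
    refine norm_integral_le_of_norm_le ((integrable_exp_neg_mul_abs (by positivity)).const_mul _)
      (Eventually.of_forall fun t => ?_)
    rw [deriv_verticalLine, norm_mul, Complex.norm_I, mul_one]
    have kA : ∀ k, ‖Complex.Gamma (x.2.1 k + verticalLine γ t)‖ ≤ CG * Real.exp (-((Real.pi / 2 - Real.pi / 16) *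
        |(![0, s, s] : Fin 3 → ℝ) k + t|)) := by
      intro k
      refine hG _ _ (by simpa using g1 k) ?_ ?_
      · rw [add_re, verticalLine_re]
        linarith [(abs_le.1 (ha k).1).2, (abs_le.1 hγK).2]
      · rw [add_im, verticalLine_im, add_sub_add_right_eq_sub]
        linarith [(ha k).2]
    have kB : ∀ k, ‖Complex.Gamma (x.2.2 k - verticalLine γ t)‖ ≤ CG * Real.exp (-((Real.pi / 2 - Real.pi / 16) *
        |(![0, 0, -s] : Fin 3 → ℝ) k - t|)) := by
      intro k
      refine hG _ _ (by simpa using g2 k) ?_ ?_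
      · rw [sub_re, verticalLine_re]
        linarith [(abs_le.1 (hb k).1).2, (abs_le.1 hγK).1]
      · rw [sub_im, verticalLine_im, sub_sub_sub_cancel_right]
        linarith [(hb k).2]
    have kE1 : ‖(Complex.Gamma (x.1.1 - verticalLine γ t))⁻¹‖ ≤ CE * Real.exp ((Real.pi / 2 + Real.pi / 16) * |t|) := by
      rw [← abs_neg t]
      refine hE _ _ ?_ ?_
      · rw [sub_re, verticalLine_re]; exact (abs_sub _ _).trans (by linarith)
      · rw [sub_im, verticalLine_im, sub_neg_eq_add, sub_add_cancel]; linarith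
    have kE2 : ‖(Complex.Gamma (x.1.2 + verticalLine γ t))⁻¹‖ ≤
        CE * Real.exp ((Real.pi / 2 + Real.pi / 16) * |s + t|) := by
      refine hE _ _ ?_ ?_
      · rw [add_re, verticalLine_re]; exact (abs_add_le _ _).trans (by linarith)
      · rw [add_im, verticalLine_im, add_sub_add_right_eq_sub]; linarith
    unfold barnesIntegrand barnesKernel innerFactor
    rw [norm_mul, norm_mul, norm_mul, norm_prod, norm_prod]
    have pA := Finset.prod_le_prod (s := Finset.univ) (fun i _ => norm_nonneg _) fun i _ => kA i
    have pB := Finset.prod_le_prod (s := Finset.univ) (fun i _ => norm_nonneg _) fun i _ => kB i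
    refine (mul_le_mul (mul_le_mul pA pB (by positivity) (by positivity))
      (mul_le_mul kE1 kE2 (by positivity) (by positivity)) (by positivity) (by positivity)).trans ?_
    simp only [Fin.prod_univ_three, Matrix.cons_val_zero, Matrix.cons_val_one, Matrix.cons_val,
      zero_add, zero_sub, abs_neg]
    have hst : |-s - t| = |s + t| := by rw [← abs_neg]; ring_nf
    rw [hst]
    set u := |t|
    set v := |s + t| with hv
    have hv0 : 0 ≤ v := abs_nonneg _
    set X := Real.exp (-((Real.pi / 2 - Real.pi / 16) * u))
    set Z := Real.exp (-((Real.pi / 2 - Real.pi / 16) * v))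
    calc _ = CG ^ 6 * CE ^ 2 * (X ^ 3 * Z ^ 3 * Real.exp ((Real.pi / 2 + Real.pi / 16) * u) *
          Real.exp ((Real.pi / 2 + Real.pi / 16) * v)) := by ring
      _ ≤ _ := by
          -- Both rates are `-3 (π/2 - π/16) + (π/2 + π/16) = -3π/4`. For `|t|` the weaker rate
          -- `-π/2` is kept to integrate; the decay in `|s + t|` is dropped.
          gcongr
          rw [← Real.exp_nat_mul, ← Real.exp_nat_mul, ← Real.exp_add, ← Real.exp_add, ← Real.exp_add,
            Real.exp_le_exp]
          push_cast
          have hu0 : 0 ≤ u := abs_nonneg _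
          nlinarith [mul_nonneg Real.pi_pos.le hu0, mul_nonneg Real.pi_pos.le hv0]
  calc _ ≤ (CG ^ 6 * CE ^ 2 * I₀) * (CN ^ 9 * Real.exp ((5 / 2 * Real.pi + η) * |s|)) := by gcongr
    _ = _ := by ring

/-- Growth of the continued inner integral in the outer variable. -/
lemma norm_barnesReg_innerFactor_le (K : ℝ) :
    ∃ C, ∀ x s, InnerShift K s x → ‖barnesReg innerFactor x‖ ≤ C * Real.exp (3 * Real.pi * |s|) := by
  obtain ⟨n, hn⟩ := exists_nat_ge (2 * K + 1)
  have h := raise_induction (fun t f _ => InnerGrowth t f) (fun t p f _ hf => hf.raise p) 0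
    (f := barnesStraight innerFactor) (h := barnesStraight innerFactor) innerGrowth_barnesStraight n
  -- The choice `η = π/2` gives the rate `3π`, below the decay rate `7π/2` of the seven Gamma
  -- functions of the outer integral.
  obtain ⟨C, -, hC⟩ := h (Real.pi / 2) (by positivity) K 1 one_pos
  refine ⟨C, fun x s hx => ?_⟩
  have hge : ∀ i j, 1 ≤ (x.2.1 i + x.2.2 j).re + ((0 + fun _ => n : Fin 3 × Fin 3 → ℕ) (i, j) : ℝ) := by
    intro i j
    simp only [Pi.add_apply, Pi.zero_apply, zero_add, add_re]
    linarith [(abs_le.1 (hx.2.1 i).1).1, (abs_le.1 (hx.2.2 j).1).1]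
  rw [barnesReg_eq isBarnesFactor_innerFactor (n := n) fun i j => by linarith [hge i j]]
  refine (hC x s hx hge).trans (le_of_eq ?_)
  ring_nf

/-! ### The dimensionally continued two-loop integral -/

lemma Separates.add_ne_neg_nat {ι κ : Type*} {a : ι → ℂ} {b : κ → ℂ} {c : ℝ → ℂ}
    (h : Separates a b c) (i : ι) (j : κ) (k : ℕ) : a i + b j ≠ -(k : ℂ) := fun h0 => by
  have h1 := ((h 0).1 i).2
  have h2 := ((h k).2 j).2
  have e : -a i - ((0:ℕ):ℂ) = b j + (k:ℂ) := by simp; linear_combination -h0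
  rw [e] at h1
  have := tendsto_nhds_unique h1 h2
  have h3 : (Real.pi : ℂ) * I = 0 := by linear_combination this / 2
  simp [Real.pi_ne_zero] at h3

lemma Separates.Gamma_add_ne_zero {ι κ : Type*} {a : ι → ℂ} {b : κ → ℂ} {c : ℝ → ℂ}
    (h : Separates a b c) (i : ι) (j : κ) : Complex.Gamma (a i + b j) ≠ 0 :=
  Complex.Gamma_ne_zero fun k => h.add_ne_neg_nat i j k

/-- All singularities in the parameters are isolated in the Gamma functions; the other factor is
entire. -/
lemma contourIntegral_barnesIntegrand_eq {Λ ι κ : Type*} [NormedAddCommGroup Λ] [NormedSpace ℂ Λ]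
    [Fintype ι] [Fintype κ] [DecidableEq ι] [DecidableEq κ] [Nonempty ι] [Nonempty κ]
    {E : Λ → ℂ → ℂ} (hE : IsBarnesFactor (Fintype.card ι + Fintype.card κ) E)
    (x : Λ × (ι → ℂ) × (κ → ℂ)) {c : ℝ → ℂ} (hc : IsIndentedLine c) (hs : Separates x.2.1 x.2.2 c) :
    contourIntegral c (barnesIntegrand E x) =
      (∏ i, ∏ j, Complex.Gamma (x.2.1 i + x.2.2 j)) * barnesReg E x := by
  rw [← contourIntegral_mul_barnesNorm hE x hc hs, barnesNorm]
  simp only [Finset.prod_inv_distrib]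
  have : ∏ i, ∏ j, Complex.Gamma (x.2.1 i + x.2.2 j) ≠ 0 :=
    Finset.prod_ne_zero_iff.2 fun i _ => Finset.prod_ne_zero_iff.2 fun j _ => hs.Gamma_add_ne_zero i j
  field_simp

/-- Parameters of the inner Barnes integral, at the value `s` of the outer variable. -/
def innerParam (m : ℤ) (q : ℂ × (Fin 5 → ℂ)) (s : ℂ) : (ℂ × ℂ) × (Fin 3 → ℂ) × (Fin 3 → ℂ) :=
  ((q.2 0, 2 * (m - q.1) - q.2 0 - q.2 3 + s),
    ![m - q.1 - q.2 0, q.2 1 + q.2 2 + q.2 4 - (m - q.1) + s, q.2 4 + s],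
    ![0, m - q.1 - q.2 1 - q.2 4, q.2 0 + q.2 3 - (m - q.1) - s])

/-- The continued inner integral as a function of the outer variable. -/
def outerFactor (m : ℤ) (q : ℂ × (Fin 5 → ℂ)) (s : ℂ) : ℂ :=
  barnesReg innerFactor (innerParam m q s)

/-- Parameters of the outer Barnes integral. -/
def outerParam (m : ℤ) (q : ℂ × (Fin 5 → ℂ)) :
    (ℂ × (Fin 5 → ℂ)) × (Fin 5 → ℂ) × (Fin 2 → ℂ) :=
  (q, ![m - q.1 - q.2 3, q.2 1 + q.2 2 + q.2 4 - (m - q.1), q.2 4, q.2 2, m - q.1 - q.2 1],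
    ![0, m - q.1 - q.2 2 - q.2 4])

lemma differentiable_innerParam (m : ℤ) :
    Differentiable ℂ fun p : (ℂ × (Fin 5 → ℂ)) × ℂ => innerParam m p.1 p.2 := by
  unfold innerParam
  refine Differentiable.prodMk (by fun_prop) (Differentiable.prodMk ?_ ?_) <;>
  · rw [differentiable_pi]
    intro i
    fin_cases i <;> simp <;> fun_prop

lemma differentiable_outerParam (m : ℤ) : Differentiable ℂ (outerParam m) := by
  unfold outerParam
  refine Differentiable.prodMk (by fun_prop) (Differentiable.prodMk ?_ ?_) <;>
  · rw [differentiable_pi]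
    intro i
    fin_cases i <;> simp <;> fun_prop

lemma innerShift_innerParam (m : ℤ) {q : ℂ × (Fin 5 → ℂ)} {s : ℂ} {N R : ℝ} (hq : ‖q‖ ≤ N)
    (hs : |s.re| ≤ R) : InnerShift (2 * |(m : ℝ)| + 4 * N + R) s.im (innerParam m q s) := by
  have h1 := (norm_fst_le q).trans hq
  have h2 : ∀ j, ‖q.2 j‖ ≤ N := fun j => (norm_le_pi_norm _ j).trans ((norm_snd_le q).trans hq)
  have hR : 0 ≤ R := (abs_nonneg _).trans hs
  have hs' := abs_le.1 hs
  have r1 := abs_le.1 ((Complex.abs_re_le_norm q.1).trans h1)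
  have i1 := abs_le.1 ((Complex.abs_im_le_norm q.1).trans h1)
  have r2 := fun j => abs_le.1 ((Complex.abs_re_le_norm (q.2 j)).trans (h2 j))
  have i2 := fun j => abs_le.1 ((Complex.abs_im_le_norm (q.2 j)).trans (h2 j))
  have hm := abs_le.1 (le_refl |(m : ℝ)|)
  have hm0 := abs_nonneg (m : ℝ)
  have hN : 0 ≤ N := (norm_nonneg _).trans hq
  have a0 := r2 0; have a1 := r2 1; have a2 := r2 2; have a3 := r2 3; have a4 := r2 4
  have b0 := i2 0; have b1 := i2 1; have b2 := i2 2; have b3 := i2 3; have b4 := i2 4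
  generalize |(m : ℝ)| = A at hm hm0 ⊢
  refine ⟨⟨?_, ?_, ?_, ?_⟩, fun i => ⟨?_, ?_⟩, fun j => ⟨?_, ?_⟩⟩
  iterate 4 rw [abs_le]; simp [innerParam]; constructor <;> linarith
  iterate 2 rw [abs_le]; fin_cases i <;> simp [innerParam] <;> constructor <;> linarith
  iterate 2 rw [abs_le]; fin_cases j <;> simp [innerParam] <;> (try constructor) <;> linarith

lemma isBarnesFactor_outerFactor (m : ℤ) :
    IsBarnesFactor (Fintype.card (Fin 5) + Fintype.card (Fin 2)) (outerFactor m) := by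
  refine ⟨fun p => ?_, 3 * Real.pi, ?_, fun l₀ => ⟨Metric.ball l₀ 1,
    Metric.ball_mem_nhds _ one_pos, fun R => ?_⟩⟩
  · exact ((differentiable_barnesReg isBarnesFactor_innerFactor) _).comp p
      (differentiable_innerParam m p)
  · simp only [Fintype.card_fin]; push_cast; linarith [Real.pi_pos]
  · obtain ⟨C, hC⟩ := norm_barnesReg_innerFactor_le (2 * |(m : ℝ)| + 4 * (‖l₀‖ + 1) + R)
    refine ⟨C, fun l hl z hz => hC _ _ (innerShift_innerParam m ?_ hz)⟩
    have h1 : ‖l - l₀‖ < 1 := mem_ball_iff_norm.1 hl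
    linarith [norm_le_norm_add_norm_sub' l l₀]

/-- The continuation of the two-loop integral to generic parameters. -/
def twoLoopContinued (m : ℤ) (q : ℂ × (Fin 5 → ℂ)) : ℂ :=
  1 / (2 * Real.pi * I) ^ 2 * (Complex.Gamma (1 - 2 * q.1) * (Complex.Gamma (1 + q.1))⁻¹ *
      (Complex.Gamma (1 - q.1))⁻¹ ^ 2) ^ 2 *
    ((∏ j, Complex.Gamma (m - q.1 - q.2 j)) *
      (Complex.Gamma (2 * (m - q.1) - (q.2 0 + q.2 1 + q.2 4)) *
        Complex.Gamma (2 * (m - q.1) - (q.2 2 + q.2 3 + q.2 4)) *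
        Complex.Gamma (q.2 0 + q.2 3 + q.2 4 - (m - q.1)) *
        Complex.Gamma (q.2 1 + q.2 2 + q.2 4 - (m - q.1)) *
        Complex.Gamma (q.2 0 + q.2 1 + q.2 2 + q.2 3 + q.2 4 - 2 * (m - q.1)))) *
    barnesReg (outerFactor m) (outerParam m q)

lemma differentiableOn_twoLoopContinued (m : ℤ) :
    DifferentiableOn ℂ (twoLoopContinued m) (genericRegion m) := by
  intro q hq
  refine DifferentiableAt.differentiableWithinAt ?_
  have hG : ∀ {f : ℂ × (Fin 5 → ℂ) → ℂ}, DifferentiableAt ℂ f q → (∀ k : ℕ, f q ≠ -(k : ℂ)) →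
      DifferentiableAt ℂ (fun q => Complex.Gamma (f q)) q := fun hf h =>
    (Complex.differentiableAt_Gamma _ h).comp q hf
  have hI : ∀ {f : ℂ × (Fin 5 → ℂ) → ℂ}, DifferentiableAt ℂ f q →
      DifferentiableAt ℂ (fun q => (Complex.Gamma (f q))⁻¹) q := fun hf =>
    (differentiable_inv_Gamma _).comp q hf
  unfold twoLoopContinued
  refine DifferentiableAt.mul (DifferentiableAt.mul (DifferentiableAt.const_mul
    (DifferentiableAt.fun_pow (((hG (by fun_prop) fun k => (hq k).1).mul (hI (by fun_prop))).mul
      ((hI (by fun_prop)).fun_pow _)) _) _) (DifferentiableAt.mul ?_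
        ((((DifferentiableAt.mul ?_ ?_).mul ?_).mul ?_).mul ?_)))
    (((differentiable_barnesReg (isBarnesFactor_outerFactor m)) _).comp q
      (differentiable_outerParam m q))
  · exact differentiableAt_prod fun j _ => hG (by fun_prop) fun k => (hq k).2.1 j
  · exact hG (by fun_prop) fun k => (hq k).2.2.2.2.2.1
  · exact hG (by fun_prop) fun k => (hq k).2.2.2.2.2.2.1
  · exact hG (by fun_prop) fun k => (hq k).2.2.2.2.2.2.2.2.1
  · exact hG (by fun_prop) fun k => (hq k).2.2.2.2.2.2.2.2.2.1
  · exact hG (by fun_prop) fun k => (hq k).2.2.2.2.2.2.2.2.2.2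

/-! ### The iterated integral along arbitrary separating contours -/

section Contours

variable (m : ℤ) (ε ν₁ ν₂ ν₃ ν₄ ν₅ : ℂ)

/-- The part of the integrand that does not depend on the inner variable. -/
def innerPrefactor (σ : ℂ) : ℂ :=
  (cGamma ε)⁻¹ ^ 2 * ((Complex.Gamma ν₂)⁻¹ * (Complex.Gamma ν₃)⁻¹ * (Complex.Gamma ν₅)⁻¹ *
    (Complex.Gamma (2 * (m - ε) - (ν₂ + ν₃ + ν₅)))⁻¹) *
  ((Complex.Gamma (ν₄ - σ))⁻¹ * Complex.Gamma (m - ε - ν₄ + σ) *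
    (Complex.Gamma (0 - σ) * Complex.Gamma (m - ε - ν₃ - ν₅ - σ)))

lemma bubbleGamma_mul_triangleGamma (σ τ : ℂ) :
    bubbleGamma m ε (ν₁ - τ) (ν₄ - σ) * triangleGamma m ε ν₂ ν₃ ν₅ τ σ =
      innerPrefactor m ε ν₂ ν₃ ν₄ ν₅ σ *
        barnesIntegrand innerFactor (innerParam m (ε, ![ν₁, ν₂, ν₃, ν₄, ν₅]) σ) τ := by
  unfold bubbleGamma triangleGamma innerPrefactor barnesIntegrand barnesKernel innerFactor innerParam
  simp only [Fin.prod_univ_three, Matrix.cons_val_zero, Matrix.cons_val_one, Matrix.cons_val]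
  rw [show -(m : ℂ) + ε + (ν₁ - τ) + (ν₄ - σ) = ν₁ + ν₄ - (m - ε) - σ - τ by ring,
    show (m : ℂ) - ε - (ν₁ - τ) = m - ε - ν₁ + τ by ring,
    show (m : ℂ) - ε - (ν₄ - σ) = m - ε - ν₄ + σ by ring,
    show 2 * (m : ℂ) - 2 * ε - (ν₁ - τ) - (ν₄ - σ) = 2 * (m - ε) - ν₁ - ν₄ + σ + τ by ring,
    show 2 * (m : ℂ) - 2 * ε - ν₂ - ν₃ - ν₅ = 2 * (m - ε) - (ν₂ + ν₃ + ν₅) by ring,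
    show -σ + (m : ℂ) - ε - ν₃ - ν₅ = m - ε - ν₃ - ν₅ - σ by ring,
    show -τ + (m : ℂ) - ε - ν₂ - ν₅ = m - ε - ν₂ - ν₅ - τ by ring,
    show σ + τ - (m : ℂ) + ε + ν₂ + ν₃ + ν₅ = ν₂ + ν₃ + ν₅ - (m - ε) + σ + τ by ring,
    show σ + τ + ν₅ = ν₅ + σ + τ by ring, zero_sub, zero_sub]
  simp only [div_eq_mul_inv, mul_inv, one_mul]
  ring

variable {m ε ν₁ ν₂ ν₃ ν₄ ν₅}

lemma SeparatesInner.separates {σ : ℂ} {c : ℝ → ℂ}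
    (h : SeparatesInner m ε ν₁ ν₂ ν₃ ν₄ ν₅ σ c) :
    Separates (innerParam m (ε, ![ν₁, ν₂, ν₃, ν₄, ν₅]) σ).2.1
      (innerParam m (ε, ![ν₁, ν₂, ν₃, ν₄, ν₅]) σ).2.2 c := by
  intro k
  obtain ⟨h1, h2, h3, h4, h5, h6⟩ := h k
  refine ⟨fun i => ?_, fun j => ?_⟩
  · fin_cases i <;> simp only [innerParam] <;> simp
    · convert h4 using 1; ring
    · convert h5 using 1; ring
    · convert h6 using 1; ring
  · fin_cases j <;> simp only [innerParam] <;> simp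
    · exact h1
    · exact h2
    · convert h3 using 1; ring

lemma SeparatesOuter.separates {c : ℝ → ℂ} (h : SeparatesOuter m ε ν₂ ν₃ ν₄ ν₅ c) :
    Separates (outerParam m (ε, ![ν₁, ν₂, ν₃, ν₄, ν₅])).2.1
      (outerParam m (ε, ![ν₁, ν₂, ν₃, ν₄, ν₅])).2.2 c := by
  intro k
  obtain ⟨h1, h2, h3, h4, h5, h6, h7⟩ := h k
  refine ⟨fun i => ?_, fun j => ?_⟩
  · fin_cases i <;> simp only [outerParam] <;> simp
    · convert h3 using 1; ring
    · convert h4 using 1; ring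
    · exact h5
    · exact h6
    · convert h7 using 1; ring
  · fin_cases j <;> simp only [outerParam] <;> simp
    · exact h1
    · exact h2

lemma contourIntegrable_inner {σ : ℂ} {c : ℝ → ℂ} (hc : IsIndentedLine c)
    (h : SeparatesInner m ε ν₁ ν₂ ν₃ ν₄ ν₅ σ c) :
    ContourIntegrable c (fun τ =>
      bubbleGamma m ε (ν₁ - τ) (ν₄ - σ) * triangleGamma m ε ν₂ ν₃ ν₅ τ σ) := by
  simp only [bubbleGamma_mul_triangleGamma]
  have := (barnes_contourIntegral_eq isBarnesFactor_innerFactor hc hc h.separates h.separates).1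
  unfold ContourIntegrable at this ⊢
  simp only [mul_assoc] at this ⊢
  exact this.const_mul _

/-- The prefactor of the outer Barnes integral. -/
def outerPrefactor (m : ℤ) (ε ν₁ ν₂ ν₃ ν₄ ν₅ : ℂ) : ℂ :=
  (cGamma ε)⁻¹ ^ 2 * ((Complex.Gamma ν₂)⁻¹ * (Complex.Gamma ν₃)⁻¹ * (Complex.Gamma ν₅)⁻¹ *
    (Complex.Gamma (2 * (m - ε) - (ν₂ + ν₃ + ν₅)))⁻¹) *
  (Complex.Gamma (m - ε - ν₁) * Complex.Gamma (2 * (m - ε) - (ν₁ + ν₂ + ν₅)) *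
    Complex.Gamma (ν₁ + ν₂ + ν₃ + ν₄ + ν₅ - 2 * (m - ε)) * Complex.Gamma (ν₁ + ν₄ + ν₅ - (m - ε)))

/-- The inner integral produces nine Gamma functions. Four are independent of `σ` and go into the
prefactor, four become left Gamma functions of the outer kernel. The last one, `Γ(ν₄ - σ)`, cancels
the reciprocal factor from the bubble, which is why the points `ν₄ + n` impose no condition on the
outer contour. -/
lemma contourIntegral_inner {σ : ℂ} {c : ℝ → ℂ} (hc : IsIndentedLine c)
    (h : SeparatesInner m ε ν₁ ν₂ ν₃ ν₄ ν₅ σ c) :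
    contourIntegral c (fun τ =>
      bubbleGamma m ε (ν₁ - τ) (ν₄ - σ) * triangleGamma m ε ν₂ ν₃ ν₅ τ σ) =
    outerPrefactor m ε ν₁ ν₂ ν₃ ν₄ ν₅ *
      barnesIntegrand (outerFactor m) (outerParam m (ε, ![ν₁, ν₂, ν₃, ν₄, ν₅])) σ := by
  have e := contourIntegral_barnesIntegrand_eq isBarnesFactor_innerFactor _ hc h.separates
  have h02 := h.separates.Gamma_add_ne_zero 0 2
  simp only [bubbleGamma_mul_triangleGamma]
  unfold contourIntegral at e ⊢
  simp only [mul_assoc (innerPrefactor _ _ _ _ _ _ _)]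
  rw [integral_const_mul, e]
  unfold barnesIntegrand barnesKernel innerPrefactor outerPrefactor outerFactor outerParam
  simp only [innerParam] at h02 ⊢
  simp only [Fin.prod_univ_three, Fin.prod_univ_five, Fin.prod_univ_two, Matrix.cons_val_zero,
    Matrix.cons_val_one, Matrix.cons_val] at h02 ⊢
  simp only [add_zero]
  rw [show (m : ℂ) - ε - ν₁ + (ν₁ + ν₄ - (m - ε) - σ) = ν₄ - σ by ring] at h02 ⊢
  rw [show (m : ℂ) - ε - ν₁ + (m - ε - ν₂ - ν₅) = 2 * (m - ε) - (ν₁ + ν₂ + ν₅) by ring,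
    show ν₂ + ν₃ + ν₅ - ((m : ℂ) - ε) + σ + (m - ε - ν₂ - ν₅) = ν₃ + σ by ring,
    show ν₂ + ν₃ + ν₅ - ((m : ℂ) - ε) + σ + (ν₁ + ν₄ - (m - ε) - σ) =
      ν₁ + ν₂ + ν₃ + ν₄ + ν₅ - 2 * (m - ε) by ring,
    show ν₅ + σ + ((m : ℂ) - ε - ν₂ - ν₅) = m - ε - ν₂ + σ by ring,
    show ν₅ + σ + (ν₁ + ν₄ - ((m : ℂ) - ε) - σ) = ν₁ + ν₄ + ν₅ - (m - ε) by ring]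
  generalize Complex.Gamma (ν₄ - σ) = g at h02 ⊢
  -- At a pole `Γ` has the default value `0` and this cancellation would fail; the separating inner
  -- contour excludes that case through `h02`.
  refine Eq.trans ?_ (mul_one _)
  rw [← inv_mul_cancel₀ h02]
  ring

/-- The iterated contour integral along arbitrary admissible contours. -/
theorem twoLoopContinued_eq (hq : (ε, ![ν₁, ν₂, ν₃, ν₄, ν₅]) ∈ genericRegion m)
    {cσ : ℝ → ℂ} {cτ : ℝ → ℝ → ℂ} (hc : IsIndentedLine cσ)
    (hs : SeparatesOuter m ε ν₂ ν₃ ν₄ ν₅ cσ)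
    (h : ∀ s, IsIndentedLine (cτ s) ∧ SeparatesInner m ε ν₁ ν₂ ν₃ ν₄ ν₅ (cσ s) (cτ s)) :
    (∀ s, ContourIntegrable (cτ s) (fun τ =>
      bubbleGamma m ε (ν₁ - τ) (ν₄ - cσ s) * triangleGamma m ε ν₂ ν₃ ν₅ τ (cσ s))) ∧
    Integrable (fun s : ℝ => contourIntegral (cτ s) (fun τ =>
      bubbleGamma m ε (ν₁ - τ) (ν₄ - cσ s) * triangleGamma m ε ν₂ ν₃ ν₅ τ (cσ s)) * deriv cσ s) ∧
    twoLoopContinued m (ε, ![ν₁, ν₂, ν₃, ν₄, ν₅]) = 1 / (2 * Real.pi * I) ^ 2 *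
      ∫ s : ℝ, contourIntegral (cτ s) (fun τ =>
        bubbleGamma m ε (ν₁ - τ) (ν₄ - cσ s) * triangleGamma m ε ν₂ ν₃ ν₅ τ (cσ s)) *
          deriv cσ s := by
  have hsep := hs.separates (ν₁ := ν₁)
  have hin : ∀ s, contourIntegral (cτ s) (fun τ =>
      bubbleGamma m ε (ν₁ - τ) (ν₄ - cσ s) * triangleGamma m ε ν₂ ν₃ ν₅ τ (cσ s)) * deriv cσ s =
      outerPrefactor m ε ν₁ ν₂ ν₃ ν₄ ν₅ * (barnesIntegrand (outerFactor m)
        (outerParam m (ε, ![ν₁, ν₂, ν₃, ν₄, ν₅])) (cσ s) * deriv cσ s) := fun s => by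
    rw [contourIntegral_inner (h s).1 (h s).2, mul_assoc]
  refine ⟨fun s => contourIntegrable_inner (h s).1 (h s).2, ?_, ?_⟩
  · simp only [hin]
    exact (barnes_contourIntegral_eq (isBarnesFactor_outerFactor m) hc hc hsep hsep).1.const_mul _
  · simp only [hin]
    rw [integral_const_mul]
    have e := contourIntegral_barnesIntegrand_eq (isBarnesFactor_outerFactor m) _ hc hsep
    unfold contourIntegral at e
    rw [e]
    -- Four of the ten Gamma functions produced by the outer integral cancel the denominator of the
    -- triangle. Genericity keeps their arguments off the poles, where the default value `0` would
    -- break the cancellation.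
    have n2 : Complex.Gamma ν₂ ≠ 0 := Complex.Gamma_ne_zero fun k => (hq k).2.2.1
    have n3 : Complex.Gamma ν₃ ≠ 0 := Complex.Gamma_ne_zero fun k => (hq k).2.2.2.1
    have n5 : Complex.Gamma ν₅ ≠ 0 := Complex.Gamma_ne_zero fun k => (hq k).2.2.2.2.1
    have nM : Complex.Gamma (2 * (m - ε) - (ν₂ + ν₃ + ν₅)) ≠ 0 :=
      Complex.Gamma_ne_zero fun k => (hq k).2.2.2.2.2.2.2.1
    unfold twoLoopContinued outerPrefactor cGamma
    simp only [outerParam, Fin.prod_univ_five, Fin.prod_univ_two, Matrix.cons_val_zero,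
      Matrix.cons_val_one, Matrix.cons_val, add_zero]
    rw [show (m : ℂ) - ε - ν₄ + (m - ε - ν₃ - ν₅) = 2 * (m - ε) - (ν₃ + ν₄ + ν₅) by ring,
      show ν₂ + ν₃ + ν₅ - ((m : ℂ) - ε) + (m - ε - ν₃ - ν₅) = ν₂ by ring,
      show ν₅ + ((m : ℂ) - ε - ν₃ - ν₅) = m - ε - ν₃ by ring,
      show ν₃ + ((m : ℂ) - ε - ν₃ - ν₅) = m - ε - ν₅ by ring,
      show (m : ℂ) - ε - ν₂ + (m - ε - ν₃ - ν₅) = 2 * (m - ε) - (ν₂ + ν₃ + ν₅) by ring]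
    have hcg : (Complex.Gamma (1 + ε) * Complex.Gamma (1 - ε) ^ 2 / Complex.Gamma (1 - 2 * ε))⁻¹ =
        Complex.Gamma (1 - 2 * ε) * (Complex.Gamma (1 + ε))⁻¹ * (Complex.Gamma (1 - ε))⁻¹ ^ 2 := by
      rw [inv_div, div_eq_mul_inv, mul_inv, inv_pow, mul_assoc]
    rw [hcg]
    generalize Complex.Gamma ν₂ = g2 at n2 ⊢
    generalize Complex.Gamma ν₃ = g3 at n3 ⊢
    generalize Complex.Gamma ν₅ = g5 at n5 ⊢
    generalize Complex.Gamma (2 * (m - ε) - (ν₂ + ν₃ + ν₅)) = gM at nM ⊢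
    have e1 : g2⁻¹ * g3⁻¹ * g5⁻¹ * gM⁻¹ * (g2 * g3 * g5 * gM) = 1 := by field_simp
    rw [← mul_one (1 / _ * _ * _ * _), ← e1]
    ring

end Contours

/-! ### Schwinger parameters in logarithmic coordinates -/

lemma ofReal_exp_cpow (x : ℝ) (s : ℂ) : ((Real.exp x : ℝ) : ℂ) ^ s = cexp (s * x) := by
  rw [Complex.cpow_def_of_ne_zero (by exact_mod_cast (Real.exp_pos x).ne'),
    ← Complex.ofReal_log (Real.exp_pos x).le, Real.log_exp, mul_comm]

lemma ofReal_cpow_eq_exp {x : ℝ} (hx : 0 < x) (s : ℂ) : (x : ℂ) ^ s = cexp (s * Real.log x) := by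
  rw [← ofReal_exp_cpow, Real.exp_log hx]

lemma norm_ofReal_cpow {x : ℝ} (hx : 0 < x) (s : ℂ) : ‖(x : ℂ) ^ s‖ = x ^ s.re :=
  Complex.norm_cpow_eq_rpow_re_of_pos hx s

lemma ofReal_mul_cpow {x : ℝ} (hx : 0 < x) (y : ℝ) (s : ℂ) :
    ((x * y : ℝ) : ℂ) ^ s = (x : ℂ) ^ s * (y : ℂ) ^ s := by
  rcases eq_or_ne y 0 with rfl | hy
  · rcases eq_or_ne s 0 with rfl | hs
    · simp
    · simp [Complex.zero_cpow hs]
  · have hy' : (y : ℂ) ≠ 0 := by exact_mod_cast hy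
    have hx' : (x : ℂ) ≠ 0 := by exact_mod_cast hx.ne'
    rw [Complex.ofReal_mul, Complex.cpow_def_of_ne_zero (mul_ne_zero hx' hy'),
      Complex.cpow_def_of_ne_zero hx', Complex.cpow_def_of_ne_zero hy',
      Complex.log_ofReal_mul hx hy', ← Complex.exp_add, Complex.ofReal_log hx.le]
    ring_nf

section Chart

variable {E : Type*} [Fintype E]

lemma image_exp_pi :
    (fun x : E → ℝ => fun e => Real.exp (x e)) '' univ = univ.pi fun _ => Ioi 0 := by
  ext y
  rw [image_univ, mem_range, Set.mem_univ_pi]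
  refine ⟨?_, fun h => ⟨fun e => Real.log (y e), funext fun e => Real.exp_log (h e)⟩⟩
  rintro ⟨x, rfl⟩ e
  exact Real.exp_pos _

lemma hasFDerivAt_exp_pi (x : E → ℝ) :
    HasFDerivAt (fun x : E → ℝ => fun e => Real.exp (x e))
      (ContinuousLinearMap.pi fun e => (Real.exp (x e) • ContinuousLinearMap.id ℝ ℝ) ∘SL
        ContinuousLinearMap.proj e) x := by
  rw [hasFDerivAt_pi]
  intro e
  refine ((hasFDerivAt_apply e x).exp).congr_fderiv ?_
  ext; simp

lemma abs_det_exp_pi (x : E → ℝ) :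
    |(ContinuousLinearMap.pi fun e => (Real.exp (x e) • ContinuousLinearMap.id ℝ ℝ) ∘SL
        (ContinuousLinearMap.proj e : (E → ℝ) →L[ℝ] ℝ)).det| = ∏ e, Real.exp (x e) := by
  rw [ContinuousLinearMap.det_pi]
  simp only [ContinuousLinearMap.det, ContinuousLinearMap.toLinearMap_smul,
    ContinuousLinearMap.coe_id, LinearMap.det_smul, LinearMap.det_id, Module.finrank_self, pow_one,
    mul_one]
  exact abs_of_pos (Finset.prod_pos fun e _ => Real.exp_pos _)

lemma injOn_exp_pi : InjOn (fun x : E → ℝ => fun e => Real.exp (x e)) univ := fun x _ y _ h =>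
  funext fun e => Real.exp_injective (congrFun h e)

lemma integrableOn_pi_Ioi_iff (f : (E → ℝ) → ℂ) :
    IntegrableOn f (univ.pi fun _ => Ioi 0) ↔
      Integrable fun x : E → ℝ => ((∏ e, Real.exp (x e) : ℝ) : ℂ) * f fun e => Real.exp (x e) := by
  rw [← image_exp_pi, integrableOn_image_iff_integrableOn_abs_det_fderiv_smul _ MeasurableSet.univ
    (fun x _ => (hasFDerivAt_exp_pi x).hasFDerivWithinAt) injOn_exp_pi, integrableOn_univ]
  simp only [abs_det_exp_pi, Complex.real_smul]

lemma integral_pi_Ioi (f : (E → ℝ) → ℂ) :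
    ∫ α in univ.pi fun _ => Ioi 0, f α =
      ∫ x : E → ℝ, ((∏ e, Real.exp (x e) : ℝ) : ℂ) * f fun e => Real.exp (x e) := by
  rw [← image_exp_pi, integral_image_eq_integral_abs_det_fderiv_smul _ MeasurableSet.univ
    (fun x _ => (hasFDerivAt_exp_pi x).hasFDerivWithinAt) injOn_exp_pi, setIntegral_univ]
  simp only [abs_det_exp_pi, Complex.real_smul]

variable {L X : Type*} [Fintype L] [DecidableEq L] [Fintype X]

/-- The Schwinger integrand in logarithmic coordinates, with the Jacobian. -/
def logIntegrand (M : ℂ) (a : E → L → ℝ) (b : E → X → ℝ) (g : X → X → ℝ) (ν : E → ℂ)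
    (x : E → ℝ) : ℂ :=
  cexp (∑ e, ν e * x e) * (((loopMatrix a fun e => Real.exp (x e)).det : ℝ) : ℂ) ^ (-M) *
    cexp (-((gaussExponent a b g fun e => Real.exp (x e) : ℝ) : ℂ))

lemma prod_exp_mul_schwingerIntegrand (M : ℂ) (a : E → L → ℝ) (b : E → X → ℝ) (g : X → X → ℝ)
    (ν : E → ℂ) (x : E → ℝ) :
    ((∏ e, Real.exp (x e) : ℝ) : ℂ) * schwingerIntegrand M a b g ν (fun e => Real.exp (x e)) =
      logIntegrand M a b g ν x := by
  unfold schwingerIntegrand logIntegrand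
  rw [← mul_assoc, ← mul_assoc, Complex.ofReal_prod, ← Finset.prod_mul_distrib, Complex.exp_sum]
  congr 2
  refine Finset.prod_congr rfl fun e _ => ?_
  rw [ofReal_exp_cpow, Complex.ofReal_exp, ← Complex.exp_add]
  ring_nf

lemma loopConverges_iff (M : ℂ) (a : E → L → ℝ) (b : E → X → ℝ) (g : X → X → ℝ) (ν : E → ℂ) :
    LoopConverges M a b g ν ↔ Integrable (logIntegrand M a b g ν) := by
  unfold LoopConverges
  rw [integrableOn_pi_Ioi_iff]
  simp only [prod_exp_mul_schwingerIntegrand]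

lemma loopIntegral_eq (M : ℂ) (a : E → L → ℝ) (b : E → X → ℝ) (g : X → X → ℝ) (ν : E → ℂ) :
    loopIntegral M a b g ν = (∏ e, (Complex.Gamma (ν e))⁻¹) * ∫ x, logIntegrand M a b g ν x := by
  unfold loopIntegral
  rw [integral_pi_Ioi]
  simp only [prod_exp_mul_schwingerIntegrand]

lemma loopMatrix_mul (a : E → L → ℝ) (α : E → ℝ) (c : ℝ) :
    loopMatrix a (fun e => c * α e) = c • loopMatrix a α := by
  ext l l'
  simp [loopMatrix, Finset.mul_sum, mul_assoc]

lemma gaussExponent_mul (a : E → L → ℝ) (b : E → X → ℝ) (g : X → X → ℝ) (α : E → ℝ) {c : ℝ}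
    (hc : c ≠ 0) : gaussExponent a b g (fun e => c * α e) = c * gaussExponent a b g α := by
  have h1 : mixedMatrix a b (fun e => c * α e) = c • mixedMatrix a b α := by
    ext l l'; simp [mixedMatrix, Finset.mul_sum, mul_assoc]
  have h2 : externalMatrix b (fun e => c * α e) = c • externalMatrix b α := by
    ext l l'; simp [externalMatrix, Finset.mul_sum, mul_assoc]
  have h3 : (c • loopMatrix a α)⁻¹ = c⁻¹ • (loopMatrix a α)⁻¹ := by
    -- The inverse of a singular matrix is `0` by convention, so homogeneity holds without
    -- invertibility.
    by_cases h : IsUnit (loopMatrix a α).det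
    · have := Matrix.inv_smul' (loopMatrix a α) (Units.mk0 c hc) h
      simpa [Units.smul_def] using this
    · rw [Matrix.nonsing_inv_apply_not_isUnit _ h, Matrix.nonsing_inv_apply_not_isUnit, smul_zero]
      rw [Matrix.det_smul]
      simpa [hc] using h
  have h4 : externalMatrix b (fun e => c * α e) - (mixedMatrix a b (fun e => c * α e)).transpose *
      (loopMatrix a (fun e => c * α e))⁻¹ * mixedMatrix a b (fun e => c * α e) =
      c • (externalMatrix b α - (mixedMatrix a b α).transpose * (loopMatrix a α)⁻¹ *
        mixedMatrix a b α) := by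
    rw [h1, h2, loopMatrix_mul, h3]
    simp only [Matrix.transpose_smul, Matrix.smul_mul, Matrix.mul_smul, smul_smul, smul_sub]
    rw [inv_mul_cancel₀ hc, mul_one]
  unfold gaussExponent
  rw [h4]
  simp only [Matrix.smul_apply, smul_eq_mul, Finset.mul_sum, mul_assoc]

/-- Scaling all Schwinger parameters is a translation in logarithmic coordinates. The determinant is
homogeneous of degree equal to the number of loops and the exponent of degree one, so the scale `P`
comes out as a power. -/
lemma logIntegrand_sub_log (M : ℂ) (a : E → L → ℝ) (b : E → X → ℝ) (g : X → X → ℝ) (ν : E → ℂ)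
    {P : ℝ} (hP : 0 < P) (x : E → ℝ) :
    logIntegrand M a b (fun i j => P * g i j) ν (x - fun _ => Real.log P) =
      (P : ℂ) ^ (Fintype.card L * M - ∑ e, ν e) * logIntegrand M a b g ν x := by
  have h1 : (fun e => Real.exp ((x - fun _ => Real.log P : E → ℝ) e)) = fun e => P⁻¹ * Real.exp (x e) := by
    ext e
    rw [Pi.sub_apply, Real.exp_sub, Real.exp_log hP, div_eq_inv_mul]
  have h2 : ∀ α, gaussExponent a b (fun i j => P * g i j) α = P * gaussExponent a b g α := fun α => by
    unfold gaussExponent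
    simp only [Finset.mul_sum]
    exact Finset.sum_congr rfl fun _ _ => Finset.sum_congr rfl fun _ _ => by ring
  unfold logIntegrand
  rw [h1, h2, loopMatrix_mul, gaussExponent_mul _ _ _ _ (inv_ne_zero hP.ne'), Matrix.det_smul,
    mul_inv_cancel_left₀ hP.ne']
  have h3 : ∑ e, ν e * (((x - fun _ => Real.log P : E → ℝ) e : ℝ) : ℂ) =
      ∑ e, ν e * x e - (∑ e, ν e) * Real.log P := by
    rw [Finset.sum_mul, ← Finset.sum_sub_distrib]
    exact Finset.sum_congr rfl fun _ _ => by push_cast [Pi.sub_apply]; ring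
  have h4 : (((P⁻¹ ^ Fintype.card L * (loopMatrix a fun e => Real.exp (x e)).det : ℝ)) : ℂ) ^ (-M) =
      cexp (Fintype.card L * M * Real.log P) *
        (((loopMatrix a fun e => Real.exp (x e)).det : ℝ) : ℂ) ^ (-M) := by
    have hp : 0 < P⁻¹ ^ Fintype.card L := by positivity
    rw [ofReal_mul_cpow hp, ofReal_cpow_eq_exp hp]
    congr 2
    rw [Real.log_pow, Real.log_inv]
    push_cast; ring
  rw [h3, h4, ofReal_cpow_eq_exp hP, sub_mul, Complex.exp_sub, Complex.exp_sub]
  ring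

lemma loopConverges_mul_iff (M : ℂ) (a : E → L → ℝ) (b : E → X → ℝ) (g : X → X → ℝ) (ν : E → ℂ)
    {P : ℝ} (hP : 0 < P) :
    LoopConverges M a b (fun i j => P * g i j) ν ↔ LoopConverges M a b g ν := by
  rw [loopConverges_iff, loopConverges_iff, ← (measurePreserving_sub_right volume
    (fun _ : E => Real.log P)).integrable_comp_emb (measurableEmbedding_subRight _)]
  simp only [Function.comp_def, logIntegrand_sub_log _ _ _ _ _ hP]
  exact integrable_const_mul_iff (isUnit_iff_ne_zero.2
    (Complex.cpow_ne_zero_iff.2 (Or.inl (by exact_mod_cast hP.ne')))) _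

lemma loopIntegral_mul (M : ℂ) (a : E → L → ℝ) (b : E → X → ℝ) (g : X → X → ℝ) (ν : E → ℂ)
    {P : ℝ} (hP : 0 < P) :
    loopIntegral M a b (fun i j => P * g i j) ν =
      (P : ℂ) ^ (Fintype.card L * M - ∑ e, ν e) * loopIntegral M a b g ν := by
  rw [loopIntegral_eq, loopIntegral_eq, ← integral_sub_right_eq_self _ (fun _ : E => Real.log P)]
  simp only [logIntegrand_sub_log _ _ _ _ _ hP]
  rw [integral_const_mul]
  ring

end Chart

/-! ### Changes of variables -/

/-- The equivalence of `ℝ³` as a product with the function space. -/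
def finThree : ℝ × ℝ × ℝ ≃ᵐ (Fin 3 → ℝ) :=
  ((MeasurableEquiv.refl ℝ).prodCongr MeasurableEquiv.finTwoArrow.symm).trans
    (MeasurableEquiv.piFinSuccAbove (fun _ => ℝ) 0).symm

lemma measurePreserving_finThree : MeasurePreserving finThree :=
  ((volume_preserving_piFinSuccAbove (fun _ : Fin 3 => ℝ) 0).symm _).comp
    ((MeasurePreserving.id volume).prod ((volume_preserving_finTwoArrow ℝ).symm _))

lemma finThree_apply (w : ℝ × ℝ × ℝ) : finThree w = ![w.1, w.2.1, w.2.2] := by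
  ext i
  fin_cases i <;> rfl

/-- The lines `2, 3, 5` and `1, 4` of the two-loop diagram. -/
def lineEquiv : Fin 3 ⊕ Fin 2 ≃ Fin 5 where
  toFun := Sum.elim ![1, 2, 4] ![0, 3]
  invFun := ![Sum.inr 0, Sum.inl 0, Sum.inl 1, Sum.inr 1, Sum.inl 2]
  left_inv x := by rcases x with i | i <;> fin_cases i <;> rfl
  right_inv i := by fin_cases i <;> rfl

/-- The Schwinger parameters of the lines `2, 3, 5` and `1, 4` of the two-loop diagram. -/
def finFive : (ℝ × ℝ × ℝ) × (ℝ × ℝ) ≃ᵐ (Fin 5 → ℝ) :=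
  ((finThree.prodCongr MeasurableEquiv.finTwoArrow.symm).trans
    (MeasurableEquiv.sumPiEquivProdPi (fun _ : Fin 3 ⊕ Fin 2 => ℝ)).symm).trans
    (MeasurableEquiv.piCongrLeft (fun _ => ℝ) lineEquiv)

lemma measurePreserving_finFive : MeasurePreserving finFive :=
  ((volume_measurePreserving_piCongrLeft (fun _ : Fin 5 => ℝ) lineEquiv).comp
    (volume_measurePreserving_sumPiEquivProdPi_symm (fun _ : Fin 3 ⊕ Fin 2 => ℝ))).comp
    (measurePreserving_finThree.prod ((volume_preserving_finTwoArrow ℝ).symm _))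

lemma finFive_apply (p : (ℝ × ℝ × ℝ) × (ℝ × ℝ)) :
    finFive p = ![p.2.1, p.1.1, p.1.2.1, p.2.2, p.1.2.2] := by
  ext i
  fin_cases i <;> rfl

section Shear

variable {Y G : Type*} [MeasurableSpace Y] [AddCommGroup G] [MeasureSpace G] [MeasurableAdd₂ G]
  [MeasurableSub₂ G] [SFinite (volume : Measure G)] [(volume : Measure G).IsAddRightInvariant]

/-- The shear `(y, x) ↦ (y, x + φ y)`. -/
def shear (φ : Y → G) (hφ : Measurable φ) : Y × G ≃ᵐ Y × G where
  toFun p := (p.1, p.2 + φ p.1)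
  invFun p := (p.1, p.2 - φ p.1)
  left_inv p := by simp
  right_inv p := by simp
  measurable_toFun := by simp only [Equiv.coe_fn_mk]; fun_prop
  measurable_invFun := by simp only [Equiv.coe_fn_symm_mk]; fun_prop

lemma measurePreserving_shear {φ : Y → G} (hφ : Measurable φ) (μ : Measure Y) [SFinite μ] :
    MeasurePreserving (shear φ hφ) (μ.prod volume) (μ.prod volume) :=
  (MeasurePreserving.id μ).skew_product (g := fun y x => x + φ y)
    (by simp only [Function.uncurry_def]; fun_prop)
    (Eventually.of_forall fun y => map_add_right_eq_self volume (φ y))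

lemma integrable_shear_iff {φ : Y → G} (hφ : Measurable φ) (μ : Measure Y) [SFinite μ]
    (f : Y × G → ℂ) :
    Integrable (fun p => f (p.1, p.2 + φ p.1)) (μ.prod volume) ↔ Integrable f (μ.prod volume) :=
  (measurePreserving_shear hφ μ).integrable_comp_emb (shear φ hφ).measurableEmbedding

lemma integral_shear {φ : Y → G} (hφ : Measurable φ) (μ : Measure Y) [SFinite μ]
    (f : Y × G → ℂ) :
    ∫ p, f (p.1, p.2 + φ p.1) ∂(μ.prod volume) = ∫ p, f p ∂(μ.prod volume) :=
  (measurePreserving_shear hφ μ).integral_comp' f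

lemma integrable_swap_shear_iff {φ : Y → G} (hφ : Measurable φ) (μ : Measure Y) [SFinite μ]
    (f : Y × G → ℂ) : Integrable (fun p : G × Y => f (p.2, p.1 + φ p.2)) (volume.prod μ) ↔
      Integrable f (μ.prod volume) := by
  rw [← integrable_shear_iff hφ μ f]
  exact integrable_swap_iff (f := fun p : Y × G => f (p.1, p.2 + φ p.1))

lemma integral_swap_shear {φ : Y → G} (hφ : Measurable φ) (μ : Measure Y) [SFinite μ]
    (f : Y × G → ℂ) : ∫ p : G × Y, f (p.2, p.1 + φ p.2) ∂(volume.prod μ) =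
      ∫ p, f p ∂(μ.prod volume) := by
  rw [← integral_shear hφ μ f]
  exact integral_prod_swap (fun p : Y × G => f (p.1, p.2 + φ p.1))

end Shear

/-! ### The Schwinger integral -/

lemma integrable_and_integral_exp_mul_exp_neg {s : ℂ} (hs : 0 < s.re) {k : ℝ} (hk : 0 < k) :
    Integrable (fun x : ℝ => cexp (s * x) * cexp (-((k * Real.exp x : ℝ) : ℂ))) ∧
    ∫ x : ℝ, cexp (s * x) * cexp (-((k * Real.exp x : ℝ) : ℂ)) =
      Complex.Gamma s * (k : ℂ) ^ (-s) := by
  have key : Integrable (fun x : ℝ => cexp (s * x) * cexp (-((Real.exp x : ℝ) : ℂ))) ∧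
      ∫ x : ℝ, cexp (s * x) * cexp (-((Real.exp x : ℝ) : ℂ)) = Complex.Gamma s := by
    have hd : ∀ x ∈ (univ : Set ℝ), HasDerivWithinAt Real.exp (Real.exp x) univ x := fun x _ =>
      (Real.hasDerivAt_exp x).hasDerivWithinAt
    have hi : (Real.exp '' univ : Set ℝ) = Ioi 0 := by rw [image_univ, Real.range_exp]
    have hf : ∀ x : ℝ, |Real.exp x| • (((-Real.exp x).exp : ℝ) * ((Real.exp x : ℝ) : ℂ) ^ (s - 1)) =
        cexp (s * x) * cexp (-((Real.exp x : ℝ) : ℂ)) := fun x => by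
      rw [abs_of_pos (Real.exp_pos x), ofReal_exp_cpow, Complex.real_smul, Complex.ofReal_exp,
        Complex.ofReal_exp, Complex.ofReal_neg, Complex.ofReal_exp, mul_left_comm, ← Complex.exp_add,
        mul_comm]
      ring_nf
    have h1 := Complex.GammaIntegral_convergent hs
    have h2 := Complex.Gamma_eq_integral hs
    unfold Complex.GammaIntegral at h2
    rw [← hi, integrableOn_image_iff_integrableOn_abs_deriv_smul MeasurableSet.univ hd
      Real.exp_injective.injOn, integrableOn_univ] at h1
    rw [← hi, integral_image_eq_integral_abs_deriv_smul MeasurableSet.univ hd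
      Real.exp_injective.injOn, setIntegral_univ] at h2
    push_cast at h1 h2 hf
    simp only [hf] at h1 h2
    push_cast
    exact ⟨h1, h2.symm⟩
  have hx : ∀ x : ℝ, cexp (s * x) * cexp (-((k * Real.exp x : ℝ) : ℂ)) =
      (k : ℂ) ^ (-s) * (cexp (s * ((x + Real.log k : ℝ) : ℂ)) *
        cexp (-((Real.exp (x + Real.log k) : ℝ) : ℂ))) := fun x => by
    rw [Real.exp_add, Real.exp_log hk, mul_comm (Real.exp x) k, ofReal_cpow_eq_exp hk, ← mul_assoc]
    congr 1
    rw [← Complex.exp_add, Complex.ofReal_add]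
    ring_nf
  simp only [hx]
  constructor
  · exact (key.1.comp_add_right (Real.log k)).const_mul _
  · rw [integral_const_mul, integral_add_right_eq_self
      (fun x : ℝ => cexp (s * x) * cexp (-((Real.exp x : ℝ) : ℂ))), key.2, mul_comm]

section Schwinger

variable {Y : Type*} [MeasurableSpace Y] {μ : Measure Y} [SFinite μ]

lemma integral_norm_exp_mul_exp_neg {s : ℂ} (hs : 0 < s.re) {k : ℝ} (hk : 0 < k) :
    ∫ x : ℝ, ‖cexp (s * x) * cexp (-((k * Real.exp x : ℝ) : ℂ))‖ = Real.Gamma s.re * k ^ (-s.re) := by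
  apply Complex.ofReal_injective
  rw [← integral_complex_ofReal, Complex.ofReal_mul, Complex.ofReal_cpow hk.le, ← Complex.Gamma_ofReal,
    Complex.ofReal_neg, ← (integrable_and_integral_exp_mul_exp_neg (s := (s.re : ℂ))
      (by simpa using hs) hk).2]
  refine integral_congr_ae (Eventually.of_forall fun x => ?_)
  simp only [norm_mul, Complex.norm_exp]
  push_cast
  simp

/-- The Schwinger parametrization in a parameter integral. -/
lemma integrable_schwinger_iff {s : ℂ} (hs : 0 < s.re) {k : Y → ℝ} (hk : Measurable k)
    (hk0 : ∀ y, 0 < k y) {g : Y → ℂ} (hg : AEStronglyMeasurable g μ) :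
    Integrable (fun p : Y × ℝ => g p.1 * (cexp (s * p.2) * cexp (-((k p.1 * Real.exp p.2 : ℝ) : ℂ))))
      (μ.prod volume) ↔ Integrable (fun y => (k y : ℂ) ^ (-s) * g y) μ := by
  have hm : AEStronglyMeasurable (fun p : Y × ℝ => g p.1 * (cexp (s * p.2) *
      cexp (-((k p.1 * Real.exp p.2 : ℝ) : ℂ)))) (μ.prod volume) := by
    refine hg.comp_fst.mul (Measurable.aestronglyMeasurable ?_)
    fun_prop
  rw [integrable_prod_iff hm]
  have h1 : ∀ᵐ y ∂μ, Integrable (fun x : ℝ => g y * (cexp (s * x) *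
      cexp (-((k y * Real.exp x : ℝ) : ℂ)))) := Eventually.of_forall fun y =>
    ((integrable_and_integral_exp_mul_exp_neg hs (hk0 y)).1).const_mul _
  have h2 : ∀ y, ∫ x : ℝ, ‖g y * (cexp (s * x) * cexp (-((k y * Real.exp x : ℝ) : ℂ)))‖ =
      Real.Gamma s.re * ‖(k y : ℂ) ^ (-s) * g y‖ := fun y => by
    simp only [norm_mul (g y)]
    rw [integral_const_mul, integral_norm_exp_mul_exp_neg hs (hk0 y), norm_mul,
      norm_ofReal_cpow (hk0 y), Complex.neg_re]
    ring
  simp only [h1, h2, true_and]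
  rw [integrable_const_mul_iff (isUnit_iff_ne_zero.2 (Real.Gamma_pos_of_pos hs).ne')]
  refine integrable_norm_iff (AEStronglyMeasurable.mul (Measurable.aestronglyMeasurable ?_) hg)
  exact (Complex.measurable_ofReal.comp hk).pow_const _

lemma integral_schwinger {s : ℂ} (hs : 0 < s.re) {k : Y → ℝ} (hk : Measurable k)
    (hk0 : ∀ y, 0 < k y) {g : Y → ℂ} (hg : AEStronglyMeasurable g μ) :
    ∫ p : Y × ℝ, g p.1 * (cexp (s * p.2) * cexp (-((k p.1 * Real.exp p.2 : ℝ) : ℂ)))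
      ∂(μ.prod volume) = Complex.Gamma s * ∫ y, (k y : ℂ) ^ (-s) * g y ∂μ := by
  -- If one side diverges so does the other, and both integrals have the default value `0`; hence
  -- the identity holds unconditionally.
  by_cases h : Integrable (fun y => (k y : ℂ) ^ (-s) * g y) μ
  · rw [integral_prod _ ((integrable_schwinger_iff hs hk hk0 hg).2 h), ← integral_const_mul]
    refine integral_congr_ae (Eventually.of_forall fun y => ?_)
    simp only []
    rw [integral_const_mul, (integrable_and_integral_exp_mul_exp_neg hs (hk0 y)).2]
    ring
  · rw [integral_undef h, integral_undef (mt (integrable_schwinger_iff hs hk hk0 hg).1 h), mul_zero]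

end Schwinger

/-! ### Beta, bubble and triangle integrals -/

/-- Euler's Beta integral. -/
lemma beta_line {p q : ℂ} (hp : 0 < p.re) (hq : 0 < q.re) :
    Integrable (fun x : ℝ => ((1 + Real.exp x : ℝ) : ℂ) ^ (-(p + q)) * cexp (p * x)) ∧
    Complex.Gamma (p + q) * ∫ x : ℝ, ((1 + Real.exp x : ℝ) : ℂ) ^ (-(p + q)) * cexp (p * x) =
      Complex.Gamma p * Complex.Gamma q := by
  have hpq : 0 < (p + q).re := by rw [add_re]; positivity
  have hk : Measurable fun x : ℝ => 1 + Real.exp x := by fun_prop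
  have hk0 : ∀ x : ℝ, 0 < 1 + Real.exp x := fun x => by positivity
  have hg : AEStronglyMeasurable (fun x : ℝ => cexp (p * x)) volume :=
    Continuous.aestronglyMeasurable (by fun_prop)
  -- The power of `1 + exp x` is replaced by its Schwinger integral; a shear then factorizes the
  -- double integral into two Gamma integrals.
  rw [← integrable_schwinger_iff hpq hk hk0 hg, ← integral_schwinger hpq hk hk0 hg]
  have gp := integrable_and_integral_exp_mul_exp_neg hp one_pos
  have gq := integrable_and_integral_exp_mul_exp_neg hq one_pos
  set f : ℝ × ℝ → ℂ := fun u => (cexp (q * u.1) * cexp (-((1 * Real.exp u.1 : ℝ) : ℂ))) *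
    (cexp (p * u.2) * cexp (-((1 * Real.exp u.2 : ℝ) : ℂ))) with hf
  have hF : ∀ z : ℝ × ℝ, cexp (p * z.1) * (cexp ((p + q) * z.2) *
      cexp (-(((1 + Real.exp z.1) * Real.exp z.2 : ℝ) : ℂ))) = f (z.2, z.1 + z.2) := fun ⟨x, y⟩ => by
    simp only [hf, ← Complex.exp_add, one_mul, Real.exp_add]
    congr 1
    push_cast; ring
  simp only [hF]
  refine ⟨(integrable_swap_shear_iff measurable_id volume f).2 (gq.1.mul_prod gp.1), ?_⟩
  refine (integral_swap_shear measurable_id volume f).trans ((integral_prod_mul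
    (fun u : ℝ => cexp (q * u) * cexp (-((1 * Real.exp u : ℝ) : ℂ)))
    (fun u : ℝ => cexp (p * u) * cexp (-((1 * Real.exp u : ℝ) : ℂ)))).trans ?_)
  rw [gp.2, gq.2]
  simp [mul_comm]

/-- Dirichlet's integral. -/
lemma dirichlet_plane {p q r : ℂ} (hp : 0 < p.re) (hq : 0 < q.re) (hr : 0 < r.re) :
    Integrable (fun u : ℝ × ℝ => ((1 + Real.exp u.1 + Real.exp u.2 : ℝ) : ℂ) ^ (-(p + q + r)) *
      cexp (p * u.1 + q * u.2)) ∧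
    Complex.Gamma (p + q + r) * ∫ u : ℝ × ℝ,
      ((1 + Real.exp u.1 + Real.exp u.2 : ℝ) : ℂ) ^ (-(p + q + r)) * cexp (p * u.1 + q * u.2) =
      Complex.Gamma p * Complex.Gamma q * Complex.Gamma r := by
  have hpr : 0 < (p + r).re := by rw [add_re]; positivity
  have b1 := beta_line hp hr
  have b2 := beta_line hq hpr
  have hφ : Measurable fun t : ℝ => Real.log (1 + Real.exp t) := by fun_prop
  set f : ℝ × ℝ → ℂ := fun u => ((1 + Real.exp u.1 + Real.exp u.2 : ℝ) : ℂ) ^ (-(p + q + r)) *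
    cexp (p * u.1 + q * u.2) with hf
  -- The translation of the second variable by `log (1 + exp u.1)` factorizes the sum of three
  -- exponentials, so Dirichlet's integral is a product of two Beta integrals.
  have hF : ∀ u : ℝ × ℝ, (((1 + Real.exp u.1 : ℝ) : ℂ) ^ (-(p + r)) * cexp (p * u.1)) *
      (((1 + Real.exp u.2 : ℝ) : ℂ) ^ (-(q + (p + r))) * cexp (q * u.2)) =
      f (u.1, u.2 + Real.log (1 + Real.exp u.1)) := fun u => by
    have h1 : 0 < 1 + Real.exp u.1 := by positivity
    have h2 : 0 < 1 + Real.exp u.2 := by positivity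
    have h3 : 1 + Real.exp u.1 + Real.exp (u.2 + Real.log (1 + Real.exp u.1)) =
        (1 + Real.exp u.1) * (1 + Real.exp u.2) := by
      rw [Real.exp_add, Real.exp_log h1]; ring
    simp only [hf, h3]
    rw [ofReal_cpow_eq_exp h1, ofReal_cpow_eq_exp h2, ofReal_cpow_eq_exp (mul_pos h1 h2),
      Real.log_mul h1.ne' h2.ne']
    simp only [← Complex.exp_add]
    congr 1
    push_cast; ring
  have hi := b1.1.mul_prod b2.1
  have he := integral_prod_mul (μ := (volume : Measure ℝ)) (ν := (volume : Measure ℝ))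
    (fun x : ℝ => ((1 + Real.exp x : ℝ) : ℂ) ^ (-(p + r)) * cexp (p * x))
    (fun x : ℝ => ((1 + Real.exp x : ℝ) : ℂ) ^ (-(q + (p + r))) * cexp (q * x))
  simp only [hF] at hi he
  rw [integrable_shear_iff hφ volume] at hi
  rw [integral_shear hφ volume f] at he
  refine ⟨hi, ?_⟩
  rw [show (volume : Measure (ℝ × ℝ)) = volume.prod volume from rfl, he,
    show p + q + r = q + (p + r) by ring, mul_left_comm, b2.2]
  linear_combination Complex.Gamma q * b1.2

/-- The bubble in Schwinger parameters. -/
def Phi (M : ℂ) (a b : ℝ) : ℂ := ((a + b : ℝ) : ℂ) ^ (-M) * cexp (-((a * b / (a + b) : ℝ) : ℂ))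

/-- The bubble integral. -/
lemma bubble_plane {M ν₁ ν₄ : ℂ} (h : M.re < (ν₁ + ν₄).re) (h₁ : ν₁.re < M.re) (h₄ : ν₄.re < M.re) :
    Integrable (fun x : ℝ × ℝ => cexp (ν₁ * x.1 + ν₄ * x.2) * Phi M (Real.exp x.1) (Real.exp x.2)) ∧
    Complex.Gamma (2 * M - ν₁ - ν₄) * ∫ x : ℝ × ℝ,
      cexp (ν₁ * x.1 + ν₄ * x.2) * Phi M (Real.exp x.1) (Real.exp x.2) =
      Complex.Gamma (ν₁ + ν₄ - M) * Complex.Gamma (M - ν₁) * Complex.Gamma (M - ν₄) := by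
  set f : ℝ × ℝ → ℂ := fun x => cexp (ν₁ * x.1 + ν₄ * x.2) * Phi M (Real.exp x.1) (Real.exp x.2)
  have hs : 0 < (ν₁ + ν₄ - M).re := by rw [sub_re]; linarith
  have hk : Measurable fun t : ℝ => Real.exp t / (1 + Real.exp t) := by fun_prop
  have hk0 : ∀ t : ℝ, 0 < Real.exp t / (1 + Real.exp t) := fun t => by positivity
  set g : ℝ → ℂ := fun t => cexp (ν₄ * t) * ((1 + Real.exp t : ℝ) : ℂ) ^ (-M) with hgdef
  have hg : AEStronglyMeasurable g volume := by
    refine (Measurable.mul (by fun_prop) (Measurable.pow_const (by fun_prop) _)).aestronglyMeasurable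
  -- In terms of the overall scale `p.2` and the logarithmic ratio `p.1`, the scale is a Schwinger
  -- variable and the ratio is left with a Beta integral.
  have hF : ∀ p : ℝ × ℝ, g p.1 * (cexp ((ν₁ + ν₄ - M) * p.2) *
      cexp (-((Real.exp p.1 / (1 + Real.exp p.1) * Real.exp p.2 : ℝ) : ℂ))) =
      f (p.2, p.1 + p.2) := fun ⟨t, x⟩ => by
    have h1 : 0 < 1 + Real.exp t := by positivity
    have h2 : Real.exp x + Real.exp (t + x) = Real.exp x * (1 + Real.exp t) := by
      rw [Real.exp_add]; ring
    have h3 : Real.exp x * Real.exp (t + x) / (Real.exp x * (1 + Real.exp t)) =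
        Real.exp t / (1 + Real.exp t) * Real.exp x := by
      rw [Real.exp_add]
      field_simp
    simp only [f, g, Phi, h2, h3]
    rw [ofReal_mul_cpow (Real.exp_pos x), ofReal_exp_cpow,
      show (ν₁ + ν₄ - M) * (x : ℂ) = ν₁ * x + ν₄ * x + -M * x by ring,
      show ν₁ * (x : ℂ) + ν₄ * ((t + x : ℝ) : ℂ) = ν₁ * x + ν₄ * x + ν₄ * t by push_cast; ring,
      Complex.exp_add (_ + _), Complex.exp_add (_ + _)]
    ring
  have b := beta_line (p := M - ν₁) (q := M - ν₄) (by rw [sub_re]; linarith)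
    (by rw [sub_re]; linarith)
  have hB : ∀ t : ℝ, ((Real.exp t / (1 + Real.exp t) : ℝ) : ℂ) ^ (-(ν₁ + ν₄ - M)) * g t =
      ((1 + Real.exp t : ℝ) : ℂ) ^ (-(M - ν₁ + (M - ν₄))) * cexp ((M - ν₁) * t) := fun t => by
    have h1 : 0 < 1 + Real.exp t := by positivity
    rw [hgdef, ofReal_cpow_eq_exp (hk0 t)]
    simp only [ofReal_cpow_eq_exp h1]
    rw [Real.log_div (Real.exp_pos t).ne' h1.ne', Real.log_exp]
    simp only [← Complex.exp_add]
    congr 1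
    push_cast; ring
  have i1 := integrable_schwinger_iff (μ := volume) hs hk hk0 hg
  have i2 := integral_schwinger (μ := volume) hs hk hk0 hg
  simp only [hB, hF] at i1 i2
  have i3 := integral_swap_shear measurable_id volume f
  have i4 := integrable_swap_shear_iff measurable_id volume f
  simp only [id] at i3 i4
  refine ⟨i4.1 (i1.2 b.1), ?_⟩
  rw [show (volume : Measure (ℝ × ℝ)) = volume.prod volume from rfl, ← i3, i2,
    show 2 * M - ν₁ - ν₄ = M - ν₁ + (M - ν₄) by ring, mul_left_comm, b.2, mul_assoc]

/-- The sum of the Schwinger parameters of the triangle. -/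
def triS (w : ℝ × ℝ × ℝ) : ℝ := Real.exp w.1 + Real.exp w.2.1 + Real.exp w.2.2

/-- The coefficient of `1 / x` in the exponent of the triangle. -/
def triA (w : ℝ × ℝ × ℝ) : ℝ := Real.exp (w.1 + w.2.2) / triS w

/-- The coefficient of `1 / y` in the exponent of the triangle. -/
def triB (w : ℝ × ℝ × ℝ) : ℝ := Real.exp (w.2.1 + w.2.2) / triS w

/-- The part of the integrand of the triangle that is independent of `x` and `y`. -/
def triWeight (M ν₂ ν₃ ν₅ : ℂ) (w : ℝ × ℝ × ℝ) : ℂ :=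
  cexp (ν₂ * w.1 + ν₃ * w.2.1 + ν₅ * w.2.2) * (triS w : ℂ) ^ (-M) *
    cexp (-((Real.exp (w.1 + w.2.1) / triS w : ℝ) : ℂ))

lemma triS_pos (w : ℝ × ℝ × ℝ) : 0 < triS w := by unfold triS; positivity

lemma triA_pos (w : ℝ × ℝ × ℝ) : 0 < triA w := div_pos (Real.exp_pos _) (triS_pos w)

lemma triB_pos (w : ℝ × ℝ × ℝ) : 0 < triB w := div_pos (Real.exp_pos _) (triS_pos w)

lemma measurable_triS : Measurable triS := by unfold triS; fun_prop

lemma measurable_triA : Measurable triA := by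
  unfold triA; exact Measurable.div (by fun_prop) measurable_triS

lemma measurable_triB : Measurable triB := by
  unfold triB; exact Measurable.div (by fun_prop) measurable_triS

lemma measurable_triWeight (M ν₂ ν₃ ν₅ : ℂ) : Measurable (triWeight M ν₂ ν₃ ν₅) := by
  have h1 := measurable_triS
  unfold triWeight
  exact ((by fun_prop : Measurable _).mul ((Complex.measurable_ofReal.comp h1).pow_const _)).mul
    (by fun_prop)

/-- The Mellin transform of the triangle, up to the Gamma functions of the two variables. -/
lemma triangle_space {M ν₂ ν₃ ν₅ τ σ : ℂ} (h1 : M.re < (ν₂ + ν₃ + ν₅ + τ + σ).re)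
    (h2 : (ν₂ + ν₅ + τ).re < M.re) (h3 : 0 < (ν₅ + τ + σ).re) (h4 : (ν₃ + ν₅ + σ).re < M.re) :
    Integrable (fun w => triWeight M ν₂ ν₃ ν₅ w * ((triA w : ℂ) ^ τ * (triB w : ℂ) ^ σ)) ∧
    Complex.Gamma (2 * M - ν₂ - ν₃ - ν₅) *
        ∫ w, triWeight M ν₂ ν₃ ν₅ w * ((triA w : ℂ) ^ τ * (triB w : ℂ) ^ σ) =
      Complex.Gamma (ν₂ + ν₃ + ν₅ + τ + σ - M) * (Complex.Gamma (M - ν₂ - ν₅ - τ) *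
        Complex.Gamma (ν₅ + τ + σ) * Complex.Gamma (M - ν₃ - ν₅ - σ)) := by
  set f : ℝ × ℝ × ℝ → ℂ := fun w =>
    triWeight M ν₂ ν₃ ν₅ w * ((triA w : ℂ) ^ τ * (triB w : ℂ) ^ σ) with hf
  have hs : 0 < (ν₂ + ν₃ + ν₅ + τ + σ - M).re := by rw [sub_re]; linarith
  have hk : Measurable fun u : ℝ × ℝ => Real.exp u.1 / (1 + Real.exp u.1 + Real.exp u.2) := by
    fun_prop
  have hk0 : ∀ u : ℝ × ℝ, 0 < Real.exp u.1 / (1 + Real.exp u.1 + Real.exp u.2) := fun u => by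
    positivity
  set g : ℝ × ℝ → ℂ := fun u => cexp ((ν₃ + σ) * u.1 + (ν₅ + τ + σ) * u.2) *
    ((1 + Real.exp u.1 + Real.exp u.2 : ℝ) : ℂ) ^ (-M - τ - σ) with hgdef
  have hg : AEStronglyMeasurable g volume :=
    (Measurable.mul (by fun_prop) (Measurable.pow_const (by fun_prop) _)).aestronglyMeasurable
  -- Since `triS`, `triA` and `triB` are homogeneous of degree one, the overall scale `p.2`
  -- separates as a Schwinger variable. The two logarithmic ratios are left with Dirichlet's
  -- integral.
  have hF : ∀ p : (ℝ × ℝ) × ℝ, g p.1 * (cexp ((ν₂ + ν₃ + ν₅ + τ + σ - M) * p.2) *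
      cexp (-((Real.exp p.1.1 / (1 + Real.exp p.1.1 + Real.exp p.1.2) * Real.exp p.2 : ℝ) : ℂ))) =
      f (p.2, p.1 + (p.2, p.2)) := fun ⟨⟨t, z⟩, x⟩ => by
    have h1 : 0 < 1 + Real.exp t + Real.exp z := by positivity
    have h2 : triS (x, t + x, z + x) = Real.exp x * (1 + Real.exp t + Real.exp z) := by
      simp only [triS, Real.exp_add]; ring
    have h3 : Real.exp (x + (t + x)) / (Real.exp x * (1 + Real.exp t + Real.exp z)) =
        Real.exp t / (1 + Real.exp t + Real.exp z) * Real.exp x := by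
      simp only [Real.exp_add]
      field_simp
    have h4 : 0 < Real.exp x * (1 + Real.exp t + Real.exp z) := by positivity
    simp only [hf, hgdef, triWeight, Prod.mk_add_mk]
    rw [ofReal_cpow_eq_exp (triA_pos _), ofReal_cpow_eq_exp (triB_pos _)]
    simp only [triA, triB, h2, h3]
    rw [Real.log_div (Real.exp_pos _).ne' (by positivity), Real.log_div (Real.exp_pos _).ne'
      (by positivity), ofReal_cpow_eq_exp h4, ofReal_cpow_eq_exp h1,
      Real.log_mul (Real.exp_pos x).ne' h1.ne', Real.log_exp, Real.log_exp, Real.log_exp]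
    simp only [← Complex.exp_add]
    congr 1
    push_cast; ring
  have b := dirichlet_plane (p := M - ν₂ - ν₅ - τ) (q := ν₅ + τ + σ) (r := M - ν₃ - ν₅ - σ)
    (by simp only [sub_re, add_re] at *; linarith) h3 (by simp only [sub_re, add_re] at *; linarith)
  have hB : ∀ u : ℝ × ℝ, ((Real.exp u.1 / (1 + Real.exp u.1 + Real.exp u.2) : ℝ) : ℂ) ^
      (-(ν₂ + ν₃ + ν₅ + τ + σ - M)) * g u = ((1 + Real.exp u.1 + Real.exp u.2 : ℝ) : ℂ) ^
      (-(M - ν₂ - ν₅ - τ + (ν₅ + τ + σ) + (M - ν₃ - ν₅ - σ))) *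
        cexp ((M - ν₂ - ν₅ - τ) * u.1 + (ν₅ + τ + σ) * u.2) := fun u => by
    have h1 : 0 < 1 + Real.exp u.1 + Real.exp u.2 := by positivity
    rw [hgdef, ofReal_cpow_eq_exp (hk0 u)]
    simp only [ofReal_cpow_eq_exp h1]
    rw [Real.log_div (Real.exp_pos _).ne' h1.ne', Real.log_exp]
    simp only [← Complex.exp_add]
    congr 1
    push_cast; ring
  have i1 := integrable_schwinger_iff (μ := volume) hs hk hk0 hg
  have i2 := integral_schwinger (μ := volume) hs hk hk0 hg
  simp only [hB, hF] at i1 i2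
  have hφ : Measurable fun x : ℝ => (x, x) := by fun_prop
  refine ⟨(integrable_swap_shear_iff hφ volume f).1 (i1.2 b.1), ?_⟩
  rw [show (volume : Measure (ℝ × ℝ × ℝ)) = volume.prod volume from rfl,
    ← integral_swap_shear hφ volume f]
  refine (congrArg _ i2).trans ?_
  rw [mul_left_comm, ← b.2]
  ring_nf

/-! ### Explicit Schwinger representations -/

lemma det_bubble (α : Fin 2 → ℝ) : (loopMatrix bubbleA α).det = α 0 + α 1 := by
  simp [loopMatrix, bubbleA, Fin.sum_univ_two]

lemma gaussExponent_bubble (α : Fin 2 → ℝ) (h : α 0 + α 1 ≠ 0) :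
    gaussExponent bubbleA bubbleB (fun _ _ => 1) α = α 0 * α 1 / (α 0 + α 1) := by
  simp only [gaussExponent, Matrix.inv_def, det_bubble, Ring.inverse_eq_inv', Matrix.adjugate_fin_one]
  simp [externalMatrix, mixedMatrix, bubbleA, bubbleB, Fin.sum_univ_two, Matrix.mul_apply]
  field_simp
  ring

lemma det_triangle (α : Fin 3 → ℝ) : (loopMatrix triangleA α).det = α 0 + α 1 + α 2 := by
  simp [loopMatrix, triangleA, Fin.sum_univ_three]

lemma gaussExponent_triangle (x y : ℝ) (α : Fin 3 → ℝ) (h : α 0 + α 1 + α 2 ≠ 0) :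
    gaussExponent triangleA triangleB (triangleG 1 x y) α =
      α 0 * α 1 / (α 0 + α 1 + α 2) + (α 0 * α 2 / (α 0 + α 1 + α 2) / x +
        α 1 * α 2 / (α 0 + α 1 + α 2) / y) := by
  simp only [gaussExponent, Matrix.inv_def, det_triangle, Ring.inverse_eq_inv',
    Matrix.adjugate_fin_one]
  simp [externalMatrix, mixedMatrix, triangleA, triangleB, triangleG, Fin.sum_univ_two,
    Fin.sum_univ_three, Matrix.mul_apply]
  simp only [div_eq_mul_inv]
  generalize x⁻¹ = u
  generalize y⁻¹ = v
  field_simp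
  ring

/-- The Symanzik polynomials of the two-loop diagram. -/
lemma det_twoLoop (α : Fin 5 → ℝ) : (loopMatrix twoLoopA α).det =
    (α 0 + α 3) * (α 1 + α 2 + α 4) + α 4 * (α 1 + α 2) := by
  simp [loopMatrix, twoLoopA, Fin.sum_univ_five, Matrix.det_fin_two]
  ring

lemma gaussExponent_twoLoop (α : Fin 5 → ℝ)
    (h : (α 0 + α 3) * (α 1 + α 2 + α 4) + α 4 * (α 1 + α 2) ≠ 0) :
    gaussExponent twoLoopA twoLoopB (fun _ _ => 1) α =
      (α 0 * α 3 * (α 1 + α 2 + α 4) + α 1 * α 2 * (α 0 + α 3 + α 4) +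
        α 4 * (α 0 * α 2 + α 1 * α 3)) /
          ((α 0 + α 3) * (α 1 + α 2 + α 4) + α 4 * (α 1 + α 2)) := by
  simp only [gaussExponent, Matrix.inv_def, det_twoLoop, Ring.inverse_eq_inv',
    Matrix.adjugate_fin_two]
  generalize hD : (α 0 + α 3) * (α 1 + α 2 + α 4) + α 4 * (α 1 + α 2) = D at *
  simp [externalMatrix, mixedMatrix, loopMatrix, twoLoopA, twoLoopB, Fin.sum_univ_two,
    Fin.sum_univ_five, Matrix.mul_apply, Matrix.vecMul, dotProduct]
  field_simp
  rw [← hD]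
  ring

section Bubble

variable {m : ℤ} {ε ν₁ ν₄ : ℂ} {P : ℝ}

/-- The integrand of the bubble in logarithmic coordinates. -/
def bubbleLog (M ν₁ ν₄ : ℂ) (x : ℝ × ℝ) : ℂ :=
  cexp (ν₁ * x.1 + ν₄ * x.2) * Phi M (Real.exp x.1) (Real.exp x.2)

lemma logIntegrand_bubble (M : ℂ) (x : ℝ × ℝ) :
    logIntegrand M bubbleA bubbleB (fun _ _ => 1) ![ν₁, ν₄] (MeasurableEquiv.finTwoArrow.symm x) =
      bubbleLog M ν₁ ν₄ x := by
  have hx : (MeasurableEquiv.finTwoArrow.symm x : Fin 2 → ℝ) = ![x.1, x.2] := by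
    ext i; fin_cases i <;> rfl
  rw [hx, logIntegrand, det_bubble, gaussExponent_bubble _ (by positivity)]
  simp [bubbleLog, Phi, Fin.sum_univ_two, mul_assoc]

lemma bubbleConverges_iff (hP : 0 < P) :
    BubbleConverges m ε P ν₁ ν₄ ↔ Integrable (bubbleLog (m - ε) ν₁ ν₄) := by
  have h := loopConverges_mul_iff (m - ε) bubbleA bubbleB (fun _ _ => 1) ![ν₁, ν₄] hP
  simp only [mul_one] at h
  rw [BubbleConverges, h, loopConverges_iff, ← ((volume_preserving_finTwoArrow ℝ).symm
    _).integrable_comp_emb (MeasurableEquiv.measurableEmbedding _)]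
  simp only [Function.comp_def, logIntegrand_bubble]

lemma bubble_eq (hP : 0 < P) : bubble m ε P ν₁ ν₄ = (cGamma ε)⁻¹ *
    ((Complex.Gamma ν₁)⁻¹ * (Complex.Gamma ν₄)⁻¹ * ∫ x, bubbleLog (m - ε) ν₁ ν₄ x) := by
  have h := loopIntegral_mul (m - ε) bubbleA bubbleB (fun _ _ => 1) ![ν₁, ν₄] hP
  simp only [mul_one] at h
  rw [bubble, h, loopIntegral_eq, ← ((volume_preserving_finTwoArrow ℝ).symm _).integral_comp'
    (g := logIntegrand _ _ _ _ _)]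
  simp only [logIntegrand_bubble]
  have hP' : (P : ℂ) ≠ 0 := by exact_mod_cast hP.ne'
  have h2 : (P : ℂ) ^ (ν₁ + ν₄ - m + ε) * (P : ℂ) ^ (Fintype.card (Fin 1) * ((m : ℂ) - ε) -
      ∑ e, (![ν₁, ν₄] : Fin 2 → ℂ) e) = 1 := by
    rw [← Complex.cpow_add _ _ hP', ← Complex.cpow_zero (P : ℂ)]
    congr 1
    simp [Fin.sum_univ_two]
    ring
  rw [mul_assoc, ← mul_assoc ((P : ℂ) ^ _), h2, one_mul, Fin.prod_univ_two]
  simp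

lemma bubble_converges_and_eq (hP : 0 < P) (h : ((m : ℂ) - ε).re < (ν₁ + ν₄).re)
    (h₁ : ν₁.re < ((m : ℂ) - ε).re) (h₄ : ν₄.re < ((m : ℂ) - ε).re) :
    BubbleConverges m ε P ν₁ ν₄ ∧ bubble m ε P ν₁ ν₄ = bubbleGamma m ε ν₁ ν₄ := by
  have b := bubble_plane h h₁ h₄
  refine ⟨(bubbleConverges_iff hP).2 b.1, ?_⟩
  have hG : Complex.Gamma (2 * (m - ε) - ν₁ - ν₄) ≠ 0 := Complex.Gamma_ne_zero_of_re_pos (by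
    have : 2 * ((m : ℂ) - ε) - ν₁ - ν₄ = (m - ε - ν₁) + (m - ε - ν₄) := by ring
    rw [this, add_re, sub_re _ ν₁, sub_re _ ν₄]; linarith)
  have h2 := eq_div_of_mul_eq hG ((mul_comm _ _).trans b.2)
  rw [bubble_eq hP]
  unfold bubbleLog
  rw [h2, bubbleGamma,
    show -(m : ℂ) + ε + ν₁ + ν₄ = ν₁ + ν₄ - (m - ε) by ring,
    show 2 * (m : ℂ) - 2 * ε - ν₁ - ν₄ = 2 * (m - ε) - ν₁ - ν₄ by ring]
  simp only [div_eq_mul_inv, mul_inv]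
  ring

end Bubble

section Triangle

variable {m : ℤ} {ε ν₂ ν₃ ν₅ : ℂ} {P x y : ℝ}

/-- The integrand of the triangle in logarithmic coordinates. -/
def triangleLog (M ν₂ ν₃ ν₅ : ℂ) (u v : ℝ) (w : ℝ × ℝ × ℝ) : ℂ :=
  triWeight M ν₂ ν₃ ν₅ w * cexp (-((triA w * u + triB w * v : ℝ) : ℂ))

lemma logIntegrand_triangle (M : ℂ) (w : ℝ × ℝ × ℝ) :
    logIntegrand M triangleA triangleB (triangleG 1 x y) ![ν₂, ν₃, ν₅] (finThree w) =
      triangleLog M ν₂ ν₃ ν₅ x⁻¹ y⁻¹ w := by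
  rw [finThree_apply, logIntegrand, det_triangle, gaussExponent_triangle _ _ _ (by positivity)]
  simp only [Fin.sum_univ_three, Matrix.cons_val_zero, Matrix.cons_val_one, Matrix.cons_val,
    triangleLog, triWeight, triA, triB, triS, Real.exp_add, ← div_eq_mul_inv]
  rw [mul_assoc (_ * _) (cexp _) (cexp _), ← Complex.exp_add]
  congr 2
  push_cast
  ring

lemma triangleG_eq (P x y : ℝ) : triangleG P x y = fun i j => P * triangleG 1 x y i j := by
  ext i j
  fin_cases i <;> fin_cases j <;> simp [triangleG] <;> ring

lemma triangleConverges_iff (hP : 0 < P) : TriangleConverges m ε P ν₂ ν₃ ν₅ x y ↔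
    Integrable (triangleLog (m - ε) ν₂ ν₃ ν₅ x⁻¹ y⁻¹) := by
  rw [TriangleConverges, triangleG_eq, loopConverges_mul_iff _ _ _ _ _ hP, loopConverges_iff,
    ← measurePreserving_finThree.integrable_comp_emb finThree.measurableEmbedding]
  simp only [Function.comp_def, logIntegrand_triangle]

lemma triangle_eq (hP : 0 < P) : triangle m ε P ν₂ ν₃ ν₅ x y = (cGamma ε)⁻¹ *
    ((Complex.Gamma ν₂)⁻¹ * (Complex.Gamma ν₃)⁻¹ * (Complex.Gamma ν₅)⁻¹ *
      ∫ w, triangleLog (m - ε) ν₂ ν₃ ν₅ x⁻¹ y⁻¹ w) := by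
  rw [triangle, triangleG_eq, loopIntegral_mul _ _ _ _ _ hP, loopIntegral_eq,
    ← measurePreserving_finThree.integral_comp' (g := logIntegrand _ _ _ _ _)]
  simp only [logIntegrand_triangle]
  have hP' : (P : ℂ) ≠ 0 := by exact_mod_cast hP.ne'
  have h2 : (P : ℂ) ^ (ν₂ + ν₃ + ν₅ - m + ε) * (P : ℂ) ^ (Fintype.card (Fin 1) * ((m : ℂ) - ε) -
      ∑ e, (![ν₂, ν₃, ν₅] : Fin 3 → ℂ) e) = 1 := by
    rw [← Complex.cpow_add _ _ hP', ← Complex.cpow_zero (P : ℂ)]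
    congr 1
    simp [Fin.sum_univ_three]
    ring
  rw [mul_assoc, ← mul_assoc ((P : ℂ) ^ _), h2, one_mul, Fin.prod_univ_three]
  simp

end Triangle

section TwoLoop

variable {m : ℤ} {ε ν₁ ν₂ ν₃ ν₄ ν₅ : ℂ} {P : ℝ}

/-- The integrand of the two-loop integral in logarithmic coordinates. -/
def twoLoopLog (M ν₁ ν₂ ν₃ ν₄ ν₅ : ℂ) (p : (ℝ × ℝ × ℝ) × ℝ × ℝ) : ℂ :=
  triWeight M ν₂ ν₃ ν₅ p.1 * (cexp (ν₁ * p.2.1 + ν₄ * p.2.2) *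
    Phi M (Real.exp p.2.1 + triA p.1) (Real.exp p.2.2 + triB p.1))

/-- The factorization of the diagram. Completing the square in `k₂` first leaves a Gaussian in `k₁`
in which `triA` and `triB` multiply `-k₁²` and `-k₄²`, so they are simply added to the Schwinger
parameters of these two lines. The remaining term, independent of `k₁`, belongs to the weight of the
triangle. -/
lemma logIntegrand_twoLoop (M : ℂ) (p : (ℝ × ℝ × ℝ) × ℝ × ℝ) :
    logIntegrand M twoLoopA twoLoopB (fun _ _ => 1) ![ν₁, ν₂, ν₃, ν₄, ν₅] (finFive p) =
      twoLoopLog M ν₁ ν₂ ν₃ ν₄ ν₅ p := by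
  obtain ⟨⟨x₂, x₃, x₅⟩, x₁, x₄⟩ := p
  have hS : 0 < triS (x₂, x₃, x₅) := triS_pos _
  have hA := triA_pos (x₂, x₃, x₅)
  have hB := triB_pos (x₂, x₃, x₅)
  have h1 := Real.exp_pos x₁
  have h4 := Real.exp_pos x₄
  have hd : (Real.exp x₁ + Real.exp x₄) * (Real.exp x₂ + Real.exp x₃ + Real.exp x₅) +
      Real.exp x₅ * (Real.exp x₂ + Real.exp x₃) = triS (x₂, x₃, x₅) * (Real.exp x₁ +
        triA (x₂, x₃, x₅) + (Real.exp x₄ + triB (x₂, x₃, x₅))) := by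
    simp only [triA, triB, mul_add, mul_div_cancel₀ _ hS.ne', Real.exp_add]
    simp only [triS]
    ring
  have hF : (Real.exp x₁ * Real.exp x₄ * (Real.exp x₂ + Real.exp x₃ + Real.exp x₅) +
      Real.exp x₂ * Real.exp x₃ * (Real.exp x₁ + Real.exp x₄ + Real.exp x₅) +
        Real.exp x₅ * (Real.exp x₁ * Real.exp x₃ + Real.exp x₂ * Real.exp x₄)) /
          ((Real.exp x₁ + Real.exp x₄) * (Real.exp x₂ + Real.exp x₃ + Real.exp x₅) +
      Real.exp x₅ * (Real.exp x₂ + Real.exp x₃)) = Real.exp (x₂ + x₃) / triS (x₂, x₃, x₅) +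
      (Real.exp x₁ + triA (x₂, x₃, x₅)) * (Real.exp x₄ + triB (x₂, x₃, x₅)) / (Real.exp x₁ +
        triA (x₂, x₃, x₅) + (Real.exp x₄ + triB (x₂, x₃, x₅))) := by
    rw [hd, div_add_div _ _ hS.ne' (by positivity), div_left_inj' (by positivity)]
    have eA : triS (x₂, x₃, x₅) * triA (x₂, x₃, x₅) = Real.exp x₂ * Real.exp x₅ := by
      rw [triA, mul_div_cancel₀ _ hS.ne', Real.exp_add]
    have eB : triS (x₂, x₃, x₅) * triB (x₂, x₃, x₅) = Real.exp x₃ * Real.exp x₅ := by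
      rw [triB, mul_div_cancel₀ _ hS.ne', Real.exp_add]
    rw [Real.exp_add]
    have e1 : triS (x₂, x₃, x₅) * ((Real.exp x₁ + triA (x₂, x₃, x₅)) *
        (Real.exp x₄ + triB (x₂, x₃, x₅))) = triS (x₂, x₃, x₅) * (Real.exp x₁ * Real.exp x₄) +
        Real.exp x₁ * (Real.exp x₃ * Real.exp x₅) + Real.exp x₄ * (Real.exp x₂ * Real.exp x₅) +
          triA (x₂, x₃, x₅) * (Real.exp x₃ * Real.exp x₅) := by
      rw [← eA, ← eB]; ring
    rw [e1]
    have e2 : triA (x₂, x₃, x₅) * (Real.exp x₃ * Real.exp x₅) +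
        Real.exp x₂ * Real.exp x₃ * (triA (x₂, x₃, x₅) + triB (x₂, x₃, x₅)) =
        Real.exp x₂ * Real.exp x₃ * Real.exp x₅ := by
      simp only [triA, triB, Real.exp_add]
      field_simp
      simp only [triS]
      ring
    have e3 : triS (x₂, x₃, x₅) * (Real.exp x₁ * Real.exp x₄) = Real.exp x₁ * Real.exp x₄ *
        (Real.exp x₂ + Real.exp x₃ + Real.exp x₅) := by simp only [triS]; ring
    rw [e3]
    linear_combination -e2
  rw [finFive_apply, logIntegrand, det_twoLoop, gaussExponent_twoLoop _ (by positivity)]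
  simp only [Fin.sum_univ_five, Matrix.cons_val_zero, Matrix.cons_val_one, Matrix.cons_val,
    twoLoopLog, triWeight, Phi]
  rw [hF, hd, ofReal_mul_cpow hS, Complex.ofReal_add (_ / _), neg_add, Complex.exp_add (-_),
    show ν₁ * (x₁ : ℂ) + ν₂ * x₂ + ν₃ * x₃ + ν₄ * x₄ + ν₅ * x₅ =
      (ν₂ * x₂ + ν₃ * x₃ + ν₅ * x₅) + (ν₁ * x₁ + ν₄ * x₄) by ring,
    Complex.exp_add (_ + _ + _) (_ + _)]
  ring

lemma twoLoopConverges_iff (hP : 0 < P) : TwoLoopConverges m ε P ν₁ ν₂ ν₃ ν₄ ν₅ ↔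
    Integrable (twoLoopLog (m - ε) ν₁ ν₂ ν₃ ν₄ ν₅) := by
  have h := loopConverges_mul_iff (m - ε) twoLoopA twoLoopB (fun _ _ => 1) ![ν₁, ν₂, ν₃, ν₄, ν₅] hP
  simp only [mul_one] at h
  rw [TwoLoopConverges, h, loopConverges_iff,
    ← measurePreserving_finFive.integrable_comp_emb finFive.measurableEmbedding]
  simp only [Function.comp_def, logIntegrand_twoLoop]

lemma twoLoop_eq (hP : 0 < P) : twoLoop m ε P ν₁ ν₂ ν₃ ν₄ ν₅ = (cGamma ε ^ 2)⁻¹ *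
    ((Complex.Gamma ν₁)⁻¹ * (Complex.Gamma ν₂)⁻¹ * (Complex.Gamma ν₃)⁻¹ * (Complex.Gamma ν₄)⁻¹ *
      (Complex.Gamma ν₅)⁻¹ * ∫ p, twoLoopLog (m - ε) ν₁ ν₂ ν₃ ν₄ ν₅ p) := by
  have h := loopIntegral_mul (m - ε) twoLoopA twoLoopB (fun _ _ => 1) ![ν₁, ν₂, ν₃, ν₄, ν₅] hP
  simp only [mul_one] at h
  rw [twoLoop, h, loopIntegral_eq, ← measurePreserving_finFive.integral_comp'
    (g := logIntegrand _ _ _ _ _)]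
  simp only [logIntegrand_twoLoop]
  have hP' : (P : ℂ) ≠ 0 := by exact_mod_cast hP.ne'
  have h2 : (P : ℂ) ^ (ν₁ + ν₂ + ν₃ + ν₄ + ν₅ - 2 * m + 2 * ε) *
      (P : ℂ) ^ (Fintype.card (Fin 2) * ((m : ℂ) - ε) -
      ∑ e, (![ν₁, ν₂, ν₃, ν₄, ν₅] : Fin 5 → ℂ) e) = 1 := by
    rw [← Complex.cpow_add _ _ hP', ← Complex.cpow_zero (P : ℂ)]
    congr 1
    simp [Fin.sum_univ_five]
    ring
  rw [mul_assoc, ← mul_assoc ((P : ℂ) ^ _), h2, one_mul, Fin.prod_univ_five]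
  simp

/-- Exchanging the two loop momenta permutes the lines as `1 ↔ 2`, `3 ↔ 4` and leaves both Symanzik
polynomials invariant. -/
lemma logIntegrand_twoLoop_swap (M : ℂ) (α : Fin 5 → ℝ) :
    logIntegrand M twoLoopA twoLoopB (fun _ _ => 1) ![ν₂, ν₁, ν₄, ν₃, ν₅]
      ![α 1, α 0, α 3, α 2, α 4] =
    logIntegrand M twoLoopA twoLoopB (fun _ _ => 1) ![ν₁, ν₂, ν₃, ν₄, ν₅] α := by
  have h : 0 < (Real.exp (α 0) + Real.exp (α 3)) * (Real.exp (α 1) + Real.exp (α 2) +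
    Real.exp (α 4)) + Real.exp (α 4) * (Real.exp (α 1) + Real.exp (α 2)) := by positivity
  rw [logIntegrand, logIntegrand, det_twoLoop, det_twoLoop, gaussExponent_twoLoop _ (by positivity),
    gaussExponent_twoLoop _ h.ne']
  simp only [Fin.sum_univ_five, Matrix.cons_val_zero, Matrix.cons_val_one, Matrix.cons_val]
  have hd : (Real.exp (α 1) + Real.exp (α 2)) * (Real.exp (α 0) + Real.exp (α 3) +
      Real.exp (α 4)) + Real.exp (α 4) * (Real.exp (α 0) + Real.exp (α 3)) =
      (Real.exp (α 0) + Real.exp (α 3)) * (Real.exp (α 1) + Real.exp (α 2) + Real.exp (α 4)) +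
        Real.exp (α 4) * (Real.exp (α 1) + Real.exp (α 2)) := by ring
  rw [hd]
  congr 2
  · congr 2
    ring
  · congr 3
    ring

end TwoLoop

/-! ### The bubble with massive shifts as an inverse Mellin transform -/

lemma norm_Phi {M : ℂ} {a b : ℝ} (h : 0 < a + b) :
    ‖Phi M a b‖ = (a + b) ^ (-M.re) * Real.exp (-(a * b / (a + b))) := by
  rw [Phi, norm_mul, norm_ofReal_cpow h, Complex.norm_exp]
  simp [-ofReal_div, -ofReal_mul, -ofReal_add]

/-- Both `a + b` and `a b / (a + b)` increase in each argument, so shifts only improve convergence.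
-/
lemma norm_Phi_le {M : ℂ} (hM : 0 ≤ M.re) {a b a' b' : ℝ} (ha : 0 < a) (hb : 0 < b) (h1 : a ≤ a')
    (h2 : b ≤ b') : ‖Phi M a' b'‖ ≤ ‖Phi M a b‖ := by
  rw [norm_Phi (by linarith), norm_Phi (by linarith)]
  refine mul_le_mul (Real.rpow_le_rpow_of_nonpos (by linarith) (by linarith) (by linarith))
    (Real.exp_le_exp.2 (neg_le_neg ?_)) (Real.exp_pos _).le (by positivity)
  rw [div_le_div_iff₀ (by linarith) (by linarith)]
  have e : a' * b' * (a + b) - a * b * (a' + b') = a * a' * (b' - b) + b * b' * (a' - a) := by ring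
  have e1 : 0 ≤ a * a' * (b' - b) := mul_nonneg (mul_nonneg ha.le (by linarith)) (by linarith)
  have e2 : 0 ≤ b * b' * (a' - a) := mul_nonneg (mul_nonneg hb.le (by linarith)) (by linarith)
  linarith

/-- The integrand of the bubble with massive shifts `e^{s}`. -/
def shiftKernel (M ν₁ ν₄ : ℂ) (s x : ℝ × ℝ) : ℂ :=
  cexp (ν₁ * x.1 + ν₄ * x.2) *
    Phi M (Real.exp x.1 + Real.exp s.1) (Real.exp x.2 + Real.exp s.2)

/-- The bubble with massive shifts `e^{s}`. -/
def shiftBubble (M ν₁ ν₄ : ℂ) (s : ℝ × ℝ) : ℂ := ∫ x, shiftKernel M ν₁ ν₄ s x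

/-- The double Mellin transform of the bubble with massive shifts. -/
def shiftMellin (M ν₁ ν₄ τ σ : ℂ) : ℂ :=
  (Complex.Gamma (-τ) * Complex.Gamma ν₁ / Complex.Gamma (ν₁ - τ)) *
    (Complex.Gamma (-σ) * Complex.Gamma ν₄ / Complex.Gamma (ν₄ - σ)) *
    ∫ x, bubbleLog M (ν₁ - τ) (ν₄ - σ) x

variable {M ν₁ ν₄ τ σ : ℂ}

lemma measurable_shiftKernel : Measurable fun p : (ℝ × ℝ) × ℝ × ℝ => shiftKernel M ν₁ ν₄ p.1 p.2 := by
  unfold shiftKernel Phi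
  exact Measurable.mul (by fun_prop) (Measurable.mul (Measurable.pow_const (by fun_prop) _)
    (by fun_prop))

/-- The parameters for which the bubble with massive shifts has a Mellin transform. -/
structure ShiftRegion (M ν₁ ν₄ τ σ : ℂ) : Prop where
  hτ : τ.re < 0
  hσ : σ.re < 0
  h₁ : 0 < ν₁.re
  h₄ : 0 < ν₄.re
  hM₁ : (ν₁ - τ).re < M.re
  hM₄ : (ν₄ - σ).re < M.re
  hM : M.re < (ν₁ - τ + (ν₄ - σ)).re

/-- With `s = t + x` and `x = a - log (1 + exp t)` in each component, `exp x + exp s = exp a`. The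
shifted bubble thus becomes the unshifted one in `a`, and the variables `t` separate into two Beta
integrals. -/
lemma shift_convolution (h : ShiftRegion M ν₁ ν₄ τ σ) :
    Integrable (fun p : (ℝ × ℝ) × ℝ × ℝ =>
      cexp (-τ * p.2.1 - σ * p.2.2) * shiftKernel M ν₁ ν₄ p.2 p.1) ∧
    ∫ p : (ℝ × ℝ) × ℝ × ℝ, cexp (-τ * p.2.1 - σ * p.2.2) * shiftKernel M ν₁ ν₄ p.2 p.1 =
      shiftMellin M ν₁ ν₄ τ σ := by
  have hτ := h.hτ
  have hσ := h.hσ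
  have b := bubble_plane h.hM h.hM₁ h.hM₄
  have g1 := beta_line (p := -τ) (q := ν₁) (by simpa using hτ) h.h₁
  have g4 := beta_line (p := -σ) (q := ν₄) (by simpa using hσ) h.h₄
  have hφ : Measurable fun t : ℝ × ℝ =>
      (-Real.log (1 + Real.exp t.1), -Real.log (1 + Real.exp t.2)) := by fun_prop
  set φ : ℝ × ℝ → ℝ × ℝ := fun t =>
    (-Real.log (1 + Real.exp t.1), -Real.log (1 + Real.exp t.2)) with hφd
  set f : (ℝ × ℝ) × ℝ × ℝ → ℂ := fun p =>
    cexp (-τ * p.2.1 - σ * p.2.2) * shiftKernel M ν₁ ν₄ p.2 p.1 with hf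
  set B : ℝ × ℝ → ℂ := fun t =>
    (((1 + Real.exp t.1 : ℝ) : ℂ) ^ (-(-τ + ν₁)) * cexp (-τ * t.1)) *
    (((1 + Real.exp t.2 : ℝ) : ℂ) ^ (-(-σ + ν₄)) * cexp (-σ * t.2)) with hB
  have hF : ∀ p : (ℝ × ℝ) × ℝ × ℝ, B p.1 * bubbleLog M (ν₁ - τ) (ν₄ - σ) p.2 =
      f (p.2 + φ p.1, p.1 + (p.2 + φ p.1)) := fun ⟨⟨t₁, t₄⟩, a₁, a₄⟩ => by
    have key : ∀ t a : ℝ, Real.exp (a + -Real.log (1 + Real.exp t)) +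
        Real.exp (t + (a + -Real.log (1 + Real.exp t))) = Real.exp a := fun t a => by
      have h1 : 0 < 1 + Real.exp t := by positivity
      rw [Real.exp_add t, Real.exp_add a, Real.exp_neg, Real.exp_log h1]
      field_simp
    have h1 : 0 < 1 + Real.exp t₁ := by positivity
    have h4 : 0 < 1 + Real.exp t₄ := by positivity
    simp only [hf, hB, hφd, shiftKernel, bubbleLog, Prod.mk_add_mk, key]
    rw [ofReal_cpow_eq_exp h1, ofReal_cpow_eq_exp h4, ← mul_assoc (cexp _), ← mul_assoc (_ * _)]
    congr 1
    simp only [← Complex.exp_add]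
    congr 1
    push_cast; ring
  have hb1 : Integrable (bubbleLog M (ν₁ - τ) (ν₄ - σ)) := b.1
  have hi : Integrable (fun p : (ℝ × ℝ) × ℝ × ℝ => B p.1 * bubbleLog M (ν₁ - τ) (ν₄ - σ) p.2)
    (volume.prod volume) := (g1.1.mul_prod g4.1).mul_prod hb1
  have he := integral_prod_mul (μ := (volume : Measure (ℝ × ℝ))) (ν := (volume : Measure (ℝ × ℝ))) B
    (bubbleLog M (ν₁ - τ) (ν₄ - σ))
  have hBi : ∫ t, B t = (Complex.Gamma (-τ) * Complex.Gamma ν₁ / Complex.Gamma (ν₁ - τ)) *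
      (Complex.Gamma (-σ) * Complex.Gamma ν₄ / Complex.Gamma (ν₄ - σ)) := by
    have k1 : Complex.Gamma (-τ + ν₁) ≠ 0 := Complex.Gamma_ne_zero_of_re_pos
      (by rw [add_re, neg_re]; linarith [h.h₁])
    have k4 : Complex.Gamma (-σ + ν₄) ≠ 0 := Complex.Gamma_ne_zero_of_re_pos
      (by rw [add_re, neg_re]; linarith [h.h₄])
    refine (integral_prod_mul (μ := (volume : Measure ℝ)) (ν := (volume : Measure ℝ))
      (fun t : ℝ => ((1 + Real.exp t : ℝ) : ℂ) ^ (-(-τ + ν₁)) * cexp (-τ * t))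
      (fun t : ℝ => ((1 + Real.exp t : ℝ) : ℂ) ^ (-(-σ + ν₄)) * cexp (-σ * t))).trans ?_
    rw [← g1.2, ← g4.2, sub_eq_neg_add, sub_eq_neg_add, mul_div_cancel_left₀ _ k1,
      mul_div_cancel_left₀ _ k4]
  have a1 := integrable_shear_iff hφ volume
    (fun p : (ℝ × ℝ) × ℝ × ℝ => f (p.2, p.1 + p.2))
  have a2 := integral_shear hφ volume (fun p : (ℝ × ℝ) × ℝ × ℝ => f (p.2, p.1 + p.2))
  have a3 := integrable_swap_shear_iff (Y := ℝ × ℝ) (G := ℝ × ℝ) measurable_id volume f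
  have a4 := integral_swap_shear (Y := ℝ × ℝ) (G := ℝ × ℝ) measurable_id volume f
  simp only [id] at a1 a2 a3 a4
  simp only [← hF] at a1 a2
  refine ⟨a3.1 (a1.1 hi), ?_⟩
  rw [show (volume : Measure ((ℝ × ℝ) × ℝ × ℝ)) = volume.prod volume from rfl, ← a4, ← a2, he, hBi,
    shiftMellin]

lemma ShiftRegion.re_pos (h : ShiftRegion M ν₁ ν₄ τ σ) : 0 < M.re := by
  have := h.hM₁
  rw [sub_re] at this
  linarith [h.h₁, h.hτ]

lemma norm_shiftKernel_le (hM : 0 ≤ M.re) {s s' : ℝ × ℝ} (h1 : s.1 ≤ s'.1) (h2 : s.2 ≤ s'.2)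
    (x : ℝ × ℝ) : ‖shiftKernel M ν₁ ν₄ s' x‖ ≤ ‖shiftKernel M ν₁ ν₄ s x‖ := by
  rw [shiftKernel, shiftKernel, norm_mul, norm_mul]
  refine mul_le_mul_of_nonneg_left (norm_Phi_le hM (by positivity) (by positivity) ?_ ?_)
    (norm_nonneg _)
  · linarith [Real.exp_le_exp.2 h1]
  · linarith [Real.exp_le_exp.2 h2]

/-- Fubini yields integrability for almost every shift only. Such shifts are dense, so one of them
is smaller than `s` in both components, and monotonicity in the shift does the rest. -/
lemma integrable_shiftKernel (h : ShiftRegion M ν₁ ν₄ τ σ) (s : ℝ × ℝ) :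
    Integrable (shiftKernel M ν₁ ν₄ s) := by
  have h1 := (shift_convolution h).1
  rw [show (volume : Measure ((ℝ × ℝ) × ℝ × ℝ)) = volume.prod volume from rfl] at h1
  have h2 := Measure.dense_of_ae h1.prod_left_ae
  obtain ⟨s', hs', hs⟩ := h2.exists_mem_open (isOpen_Iio.prod isOpen_Iio :
    IsOpen (Iio s.1 ×ˢ Iio s.2)) ⟨(s.1 - 1, s.2 - 1), by simp⟩
  simp only [mem_setOf_eq] at hs'
  have h3 : Integrable (shiftKernel M ν₁ ν₄ s') :=
    (integrable_const_mul_iff (isUnit_iff_ne_zero.2 (Complex.exp_ne_zero _)) _).1 hs'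
  exact h3.mono (measurable_shiftKernel.comp measurable_prodMk_left).aestronglyMeasurable
    (Eventually.of_forall fun x => norm_shiftKernel_le h.re_pos.le hs.1.le hs.2.le x)

lemma continuous_shiftBubble (h : ShiftRegion M ν₁ ν₄ τ σ) : Continuous (shiftBubble M ν₁ ν₄) := by
  rw [continuous_iff_continuousAt]
  intro s
  refine continuousAt_of_dominated (bound := fun x => ‖shiftKernel M ν₁ ν₄ (s.1 - 1, s.2 - 1) x‖)
    (Eventually.of_forall fun s' =>
      (measurable_shiftKernel.comp measurable_prodMk_left).aestronglyMeasurable) ?_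
    (integrable_shiftKernel h _).norm (Eventually.of_forall fun x => ?_)
  · filter_upwards [(isOpen_Ioi.prod isOpen_Ioi : IsOpen (Ioi (s.1 - 1) ×ˢ Ioi (s.2 - 1))).mem_nhds
      (by simp : s ∈ Ioi (s.1 - 1) ×ˢ Ioi (s.2 - 1))] with s' hs'
    exact Eventually.of_forall fun x => norm_shiftKernel_le h.re_pos.le
      (mem_Ioi.1 hs'.1).le (mem_Ioi.1 hs'.2).le x
  · have hp : ∀ s : ℝ × ℝ, 0 < Real.exp x.1 + Real.exp s.1 + (Real.exp x.2 + Real.exp s.2) :=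
      fun s => by positivity
    have h1 : Continuous fun s : ℝ × ℝ => shiftKernel M ν₁ ν₄ s x := by
      unfold shiftKernel Phi
      refine continuous_const.mul (Continuous.mul ?_ ?_)
      · refine Continuous.cpow (by fun_prop) continuous_const fun s => ?_
        exact Complex.ofReal_mem_slitPlane.2 (hp s)
      · refine Complex.continuous_exp.comp (Continuous.neg (Complex.continuous_ofReal.comp ?_))
        exact Continuous.div (by fun_prop) (by fun_prop) fun s => (hp s).ne'
    exact h1.continuousAt

lemma integrable_shiftBubble (h : ShiftRegion M ν₁ ν₄ τ σ) :
    Integrable (fun s : ℝ × ℝ => cexp (-τ * s.1 - σ * s.2) * shiftBubble M ν₁ ν₄ s) ∧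
    ∫ s : ℝ × ℝ, cexp (-τ * s.1 - σ * s.2) * shiftBubble M ν₁ ν₄ s = shiftMellin M ν₁ ν₄ τ σ := by
  obtain ⟨h1, h2⟩ := shift_convolution h
  rw [show (volume : Measure ((ℝ × ℝ) × ℝ × ℝ)) = volume.prod volume from rfl] at h1 h2
  have h3 := h1.integral_prod_right
  rw [integral_prod_symm _ h1] at h2
  simp only [integral_const_mul] at h2 h3
  exact ⟨h3, h2⟩

lemma norm_Gamma_add_mul_I_le {a : ℂ} (ha : 0 < a.re) {η : ℝ} (hη : 0 < η)
    (hη2 : η < Real.pi / 2) : ∃ C > 0, ∀ t : ℝ,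
      ‖Complex.Gamma (a + t * I)‖ ≤ C * Real.exp (-((Real.pi / 2 - η) * |t|)) := by
  obtain ⟨C, hC, h⟩ := norm_Gamma_le_shift a.re (max a.re |a.im|) η ha hη hη2
  exact ⟨C, hC, fun t => h _ t (by simp) (by simp) (by simp)⟩

lemma norm_inv_Gamma_add_mul_I_le (a : ℂ) {η : ℝ} (hη : 0 < η) : ∃ C > 0, ∀ t : ℝ,
    ‖(Complex.Gamma (a + t * I))⁻¹‖ ≤ C * Real.exp ((Real.pi / 2 + η) * |t|) := by
  obtain ⟨C, hC, h⟩ := norm_inv_Gamma_le_shift (max |a.re| |a.im|) η hη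
  exact ⟨C, hC, fun t => h _ t (by simp) (by simp)⟩

lemma continuous_Gamma_add_mul_I {a : ℂ} (ha : 0 < a.re) :
    Continuous fun t : ℝ => Complex.Gamma (a + t * I) := by
  rw [continuous_iff_continuousAt]
  intro t
  have h1 : ContinuousAt Complex.Gamma (a + t * I) := (Complex.differentiableAt_Gamma _ fun n hn => by
    have := congrArg Complex.re hn
    simp at this
    linarith [(Nat.cast_nonneg n : (0 : ℝ) ≤ n)]).continuousAt
  exact ContinuousAt.comp (f := fun t : ℝ => a + t * I) h1
    (by fun_prop : Continuous fun t : ℝ => a + t * I).continuousAt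

lemma continuous_inv_Gamma_add_mul_I (a : ℂ) :
    Continuous fun t : ℝ => (Complex.Gamma (a + t * I))⁻¹ := by
  have h1 : Continuous fun z : ℂ => (Complex.Gamma z)⁻¹ := Complex.differentiable_one_div_Gamma.continuous
  exact h1.comp (by fun_prop)

lemma ShiftRegion.vertical {γ₂ γ₁ : ℝ} (h : ShiftRegion M ν₁ ν₄ γ₂ γ₁) (t s : ℝ) :
    ShiftRegion M ν₁ ν₄ (verticalLine γ₂ t) (verticalLine γ₁ s) := by
  obtain ⟨a1, a2, a3, a4, a5, a6, a7⟩ := h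
  constructor <;> simp [verticalLine] at * <;> assumption

lemma shiftMellin_eq (h : ShiftRegion M ν₁ ν₄ τ σ) : shiftMellin M ν₁ ν₄ τ σ =
    Complex.Gamma ν₁ * Complex.Gamma ν₄ *
      ((Complex.Gamma (-τ) * Complex.Gamma (M - (ν₁ - τ)) * (Complex.Gamma (ν₁ - τ))⁻¹) *
      (Complex.Gamma (-σ) * Complex.Gamma (M - (ν₄ - σ)) * (Complex.Gamma (ν₄ - σ))⁻¹) *
      (Complex.Gamma (ν₁ - τ + (ν₄ - σ) - M) *
        (Complex.Gamma (2 * M - (ν₁ - τ) - (ν₄ - σ)))⁻¹)) := by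
  have b := bubble_plane h.hM h.hM₁ h.hM₄
  have hG : Complex.Gamma (2 * M - (ν₁ - τ) - (ν₄ - σ)) ≠ 0 := Complex.Gamma_ne_zero_of_re_pos (by
    have h1 := h.hM₁
    have h4 := h.hM₄
    have : 2 * M - (ν₁ - τ) - (ν₄ - σ) = (M - (ν₁ - τ)) + (M - (ν₄ - σ)) := by ring
    rw [this, add_re, sub_re, sub_re M (ν₄ - σ)]
    linarith)
  have h2 := eq_div_of_mul_eq hG ((mul_comm _ _).trans b.2)
  rw [shiftMellin]
  unfold bubbleLog
  rw [h2]
  simp only [div_eq_mul_inv]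
  ring

/-- In each of the two imaginary parts, two Gamma functions against one reciprocal leave the decay
rate `π/2 - 3η`. The two factors in the sum of the variables compensate up to the growth rate `2η`.
With `η = π/20` the rate `π/2 - 5η = π/4` remains. -/
lemma integrable_shiftMellin {γ₂ γ₁ : ℝ} (h : ShiftRegion M ν₁ ν₄ γ₂ γ₁) :
    Integrable fun z : ℝ × ℝ =>
      shiftMellin M ν₁ ν₄ (verticalLine γ₂ z.1) (verticalLine γ₁ z.2) := by
  have hpi := Real.pi_pos
  set η := Real.pi / 20 with hη
  have hη0 : 0 < η := by positivity
  have hη2 : η < Real.pi / 2 := by rw [hη]; linarith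
  obtain ⟨a1, a2, a3, a4, a5, a6, a7⟩ := h
  have p1 : 0 < (-(γ₂ : ℂ)).re := by simpa using a1
  have p2 : 0 < (-(γ₁ : ℂ)).re := by simpa using a2
  have p3 : 0 < (M - (ν₁ - γ₂)).re := by rw [sub_re]; linarith
  have p4 : 0 < (M - (ν₄ - γ₁)).re := by rw [sub_re]; linarith
  have p5 : 0 < (ν₁ - γ₂ + (ν₄ - γ₁) - M).re := by rw [sub_re]; linarith
  obtain ⟨C1, hC1, h1⟩ := norm_Gamma_add_mul_I_le p1 hη0 hη2
  obtain ⟨C2, hC2, h2⟩ := norm_Gamma_add_mul_I_le p2 hη0 hη2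
  obtain ⟨C3, hC3, h3⟩ := norm_Gamma_add_mul_I_le p3 hη0 hη2
  obtain ⟨C4, hC4, h4⟩ := norm_Gamma_add_mul_I_le p4 hη0 hη2
  obtain ⟨C5, hC5, h5⟩ := norm_Gamma_add_mul_I_le p5 hη0 hη2
  obtain ⟨D1, hD1, g1⟩ := norm_inv_Gamma_add_mul_I_le (ν₁ - γ₂) hη0
  obtain ⟨D4, hD4, g4⟩ := norm_inv_Gamma_add_mul_I_le (ν₄ - γ₁) hη0
  obtain ⟨D5, hD5, g5⟩ := norm_inv_Gamma_add_mul_I_le (2 * M - (ν₁ - γ₂) - (ν₄ - γ₁)) hη0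
  have hv := ShiftRegion.vertical ⟨a1, a2, a3, a4, a5, a6, a7⟩
  have hF : ∀ z : ℝ × ℝ, shiftMellin M ν₁ ν₄ (verticalLine γ₂ z.1) (verticalLine γ₁ z.2) =
      Complex.Gamma ν₁ * Complex.Gamma ν₄ *
      ((Complex.Gamma (-(γ₂ : ℂ) + (-z.1 : ℝ) * I) * Complex.Gamma (M - (ν₁ - γ₂) + z.1 * I) *
        (Complex.Gamma (ν₁ - γ₂ + (-z.1 : ℝ) * I))⁻¹) *
      (Complex.Gamma (-(γ₁ : ℂ) + (-z.2 : ℝ) * I) * Complex.Gamma (M - (ν₄ - γ₁) + z.2 * I) *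
        (Complex.Gamma (ν₄ - γ₁ + (-z.2 : ℝ) * I))⁻¹) *
      (Complex.Gamma (ν₁ - γ₂ + (ν₄ - γ₁) - M + (-(z.1 + z.2) : ℝ) * I) *
        (Complex.Gamma (2 * M - (ν₁ - γ₂) - (ν₄ - γ₁) + (z.1 + z.2 : ℝ) * I))⁻¹)) := fun z => by
    rw [shiftMellin_eq (hv z.1 z.2)]
    unfold verticalLine
    push_cast
    ring_nf
  simp only [hF]
  refine Integrable.const_mul ?_ _
  have hi := (integrable_exp_neg_mul_abs (δ := Real.pi / 4) (by positivity)).mul_prod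
    (integrable_exp_neg_mul_abs (δ := Real.pi / 4) (by positivity))
  refine Integrable.mono' (hi.const_mul (C1 * C3 * D1 * (C2 * C4 * D4) * (C5 * D5))) ?_
    (Eventually.of_forall fun z => ?_)
  · refine Continuous.aestronglyMeasurable (Continuous.mul (Continuous.mul (Continuous.mul
      (Continuous.mul ?_ ?_) ?_) (Continuous.mul (Continuous.mul ?_ ?_) ?_)) (Continuous.mul ?_ ?_))
    · exact (continuous_Gamma_add_mul_I p1).comp continuous_fst.neg
    · exact (continuous_Gamma_add_mul_I p3).comp continuous_fst
    · exact (continuous_inv_Gamma_add_mul_I _).comp continuous_fst.neg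
    · exact (continuous_Gamma_add_mul_I p2).comp continuous_snd.neg
    · exact (continuous_Gamma_add_mul_I p4).comp continuous_snd
    · exact (continuous_inv_Gamma_add_mul_I _).comp continuous_snd.neg
    · exact (continuous_Gamma_add_mul_I p5).comp (continuous_fst.add continuous_snd).neg
    · exact (continuous_inv_Gamma_add_mul_I _).comp (continuous_fst.add continuous_snd)
  · simp only [norm_mul]
    have e1 := h1 (-z.1)
    have e2 := h2 (-z.2)
    have e3 := h3 z.1
    have e4 := h4 z.2
    have e5 := h5 (-(z.1 + z.2))
    have f1 := g1 (-z.1)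
    have f4 := g4 (-z.2)
    have f5 := g5 (z.1 + z.2)
    rw [abs_neg] at e1 e2 e5 f1 f4
    calc _ ≤ C1 * Real.exp (-((Real.pi / 2 - η) * |z.1|)) * (C3 * Real.exp (-((Real.pi / 2 - η) * |z.1|)))
          * (D1 * Real.exp ((Real.pi / 2 + η) * |z.1|)) *
          (C2 * Real.exp (-((Real.pi / 2 - η) * |z.2|)) * (C4 * Real.exp (-((Real.pi / 2 - η) * |z.2|)))
          * (D4 * Real.exp ((Real.pi / 2 + η) * |z.2|))) *
          (C5 * Real.exp (-((Real.pi / 2 - η) * |z.1 + z.2|)) *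
            (D5 * Real.exp ((Real.pi / 2 + η) * |z.1 + z.2|))) := by gcongr
      _ = C1 * C3 * D1 * (C2 * C4 * D4) * (C5 * D5) * Real.exp (-((Real.pi / 2 - 3 * η) * |z.1|) +
            -((Real.pi / 2 - 3 * η) * |z.2|) + 2 * η * |z.1 + z.2|) := by
          have k : ∀ a b c d e f g i : ℝ, C1 * Real.exp a * (C3 * Real.exp b) * (D1 * Real.exp c) *
              (C2 * Real.exp d * (C4 * Real.exp e) * (D4 * Real.exp f)) * (C5 * Real.exp g *
                (D5 * Real.exp i)) = C1 * C3 * D1 * (C2 * C4 * D4) * (C5 * D5) *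
                  Real.exp (a + b + c + (d + e + f) + (g + i)) := fun a b c d e f g i => by
            simp only [Real.exp_add]; ring
          rw [k]
          congr 2
          ring
      _ ≤ C1 * C3 * D1 * (C2 * C4 * D4) * (C5 * D5) * Real.exp (-(Real.pi / 4 * |z.1|) +
            -(Real.pi / 4 * |z.2|)) := by
          have := abs_add_le z.1 z.2
          have h6 : 2 * η * |z.1 + z.2| ≤ 2 * η * (|z.1| + |z.2|) := by gcongr
          refine mul_le_mul_of_nonneg_left (Real.exp_le_exp.2 ?_) (by positivity)
          rw [hη] at h6 ⊢
          linarith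
      _ = _ := by rw [Real.exp_add]

open scoped FourierTransform in
/-- The bubble with massive shifts is the inverse Mellin transform of `shiftMellin`. -/
lemma shiftBubble_eq {γ₂ γ₁ : ℝ} (h : ShiftRegion M ν₁ ν₄ γ₂ γ₁) (s : ℝ × ℝ) :
    shiftBubble M ν₁ ν₄ s = ((2 * Real.pi) ^ 2 : ℂ)⁻¹ * ∫ z : ℝ × ℝ,
      cexp (verticalLine γ₂ z.1 * s.1 + verticalLine γ₁ z.2 * s.2) *
        shiftMellin M ν₁ ν₄ (verticalLine γ₂ z.1) (verticalLine γ₁ z.2) := by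
  set J : ℝ × ℝ → ℂ := fun z => shiftMellin M ν₁ ν₄ (verticalLine γ₂ z.1) (verticalLine γ₁ z.2)
    with hJ
  set f₀ : ℝ × ℝ → ℂ := fun s => cexp (-(γ₂ : ℂ) * s.1 - γ₁ * s.2) * shiftBubble M ν₁ ν₄ s with hf₀
  -- The Fourier transform needs a real inner product space, so the plane is modelled by `ℂ`; the
  -- product `ℝ × ℝ` carries the maximum norm.
  set f : ℂ → ℂ := fun v => f₀ (Complex.measurableEquivRealProd v) with hf
  have hvp := Complex.volume_preserving_equiv_real_prod
  have hpi := Real.pi_pos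
  have hfc : Continuous f := by
    have h1 : Continuous fun v : ℂ => f₀ (v.re, v.im) :=
      Continuous.mul (by fun_prop) ((continuous_shiftBubble h).comp (by fun_prop))
    exact h1
  have hfi : Integrable f := (hvp.integrable_comp_emb (MeasurableEquiv.measurableEmbedding _)).2
    (integrable_shiftBubble h).1
  have hFf : 𝓕 f = fun w => J ((2 * Real.pi) • Complex.measurableEquivRealProd w) := by
    ext w
    rw [Real.fourier_eq']
    have h1 := (integrable_shiftBubble (h.vertical (2 * Real.pi * w.re) (2 * Real.pi * w.im))).2
    have h2 : J ((2 * Real.pi) • Complex.measurableEquivRealProd w) = shiftMellin M ν₁ ν₄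
      (verticalLine γ₂ (2 * Real.pi * w.re)) (verticalLine γ₁ (2 * Real.pi * w.im)) := rfl
    rw [h2, ← h1, ← hvp.integral_comp']
    refine integral_congr_ae (Eventually.of_forall fun v => ?_)
    simp only [hf, hf₀, Complex.measurableEquivRealProd_apply, smul_eq_mul, verticalLine]
    rw [← mul_assoc, ← Complex.exp_add, Complex.inner]
    congr 2
    simp
    ring
  have hFi : Integrable (𝓕 f) := by
    rw [hFf]
    exact (hvp.integrable_comp_emb (MeasurableEquiv.measurableEmbedding _)).2
      ((integrable_shiftMellin h).comp_smul (by positivity : 2 * Real.pi ≠ 0))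
  have key := hfi.fourierInv_fourier_eq hFi (v := ⟨s.1, s.2⟩) hfc.continuousAt
  rw [Real.fourierInv_eq', hFf] at key
  have e1 : f ⟨s.1, s.2⟩ = f₀ s := rfl
  set K : ℝ × ℝ → ℂ := fun z => cexp ((z.1 * s.1 + z.2 * s.2) * I) * J z with hK
  have e2 : ∀ w : ℂ, cexp ((2 * Real.pi * inner ℝ w (⟨s.1, s.2⟩ : ℂ) : ℝ) * I) •
      J ((2 * Real.pi) • Complex.measurableEquivRealProd w) =
      K ((2 * Real.pi) • Complex.measurableEquivRealProd w) := fun w => by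
    simp only [hK, smul_eq_mul, Complex.inner, Complex.measurableEquivRealProd_apply, Prod.smul_mk]
    congr 2
    simp
    ring
  simp only [e2] at key
  rw [hvp.integral_comp' (g := fun z => K ((2 * Real.pi) • z)), Measure.integral_comp_smul, e1] at key
  have h3 : shiftBubble M ν₁ ν₄ s = cexp (γ₂ * s.1 + γ₁ * s.2) * f₀ s := by
    simp only [hf₀]
    rw [← mul_assoc, ← Complex.exp_add]
    ring_nf
    simp
  rw [h3, ← key, Module.finrank_prod, Module.finrank_self, abs_of_pos (by positivity),
    Complex.real_smul, mul_left_comm]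
  congr 1
  · push_cast; norm_num
  rw [← integral_const_mul]
  refine integral_congr_ae (Eventually.of_forall fun z => ?_)
  simp only [hK, hJ, verticalLine]
  rw [← mul_assoc, ← Complex.exp_add]
  ring_nf

/-! ### Convergence and Mellin transform of the triangle -/

/-- The function `X ^ κ * exp (-X)` is largest at `X = κ`. With `log 0 = 0` the constant also covers
`κ = 0`. -/
lemma exp_neg_le_rpow {κ X : ℝ} (hκ : 0 ≤ κ) (hX : 0 < X) :
    Real.exp (-X) ≤ Real.exp (κ * Real.log κ) * X ^ (-κ) := by
  rcases hκ.eq_or_lt with rfl | hκ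
  · simpa using hX.le
  rw [Real.rpow_def_of_pos hX, ← Real.exp_add, Real.exp_le_exp]
  have h1 := Real.log_le_sub_one_of_pos (div_pos hX hκ)
  rw [Real.log_div hX.ne' hκ.ne'] at h1
  have h2 := mul_le_mul_of_nonneg_left h1 hκ.le
  have h3 : κ * (X / κ - 1) = X - κ := by field_simp
  nlinarith

/-- The parameters for which the triangle has a Mellin transform. -/
structure TriRegion (M ν₂ ν₃ ν₅ τ σ : ℂ) : Prop where
  hM : M.re < (ν₂ + ν₃ + ν₅ + τ + σ).re
  hτ : (ν₂ + ν₅ + τ).re < M.re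
  h₅ : 0 < (ν₅ + τ + σ).re
  hσ : (ν₃ + ν₅ + σ).re < M.re

variable {M ν₂ ν₃ ν₅ τ σ : ℂ}

lemma TriRegion.integrable (h : TriRegion M ν₂ ν₃ ν₅ τ σ) :
    Integrable (fun w => triWeight M ν₂ ν₃ ν₅ w * ((triA w : ℂ) ^ τ * (triB w : ℂ) ^ σ)) :=
  (triangle_space h.hM h.hτ h.h₅ h.hσ).1

lemma TriRegion.integrable_norm (h : TriRegion M ν₂ ν₃ ν₅ τ σ) :
    Integrable (fun w => ‖triWeight M ν₂ ν₃ ν₅ w‖ * (triA w ^ τ.re * triB w ^ σ.re)) := by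
  refine h.integrable.norm.congr (Eventually.of_forall fun w => ?_)
  simp only [norm_mul, norm_ofReal_cpow (triA_pos w), norm_ofReal_cpow (triB_pos w)]

lemma norm_triangleLog (u v : ℝ) (w : ℝ × ℝ × ℝ) : ‖triangleLog M ν₂ ν₃ ν₅ u v w‖ =
    ‖triWeight M ν₂ ν₃ ν₅ w‖ * Real.exp (-(triA w * u + triB w * v)) := by
  rw [triangleLog, norm_mul, Complex.norm_exp, ← Complex.ofReal_neg, Complex.ofReal_re]

lemma norm_triangleLog_le {u v κ lam : ℝ} (hu : 0 < u) (hv : 0 < v) (hκ : 0 ≤ κ) (hl : 0 ≤ lam)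
    (w : ℝ × ℝ × ℝ) : ‖triangleLog M ν₂ ν₃ ν₅ u v w‖ ≤
      Real.exp (κ * Real.log κ) * Real.exp (lam * Real.log lam) * u ^ (-κ) * v ^ (-lam) *
        (‖triWeight M ν₂ ν₃ ν₅ w‖ * (triA w ^ (-κ) * triB w ^ (-lam))) := by
  have hA := triA_pos w
  have hB := triB_pos w
  have h1 := exp_neg_le_rpow hκ (mul_pos hA hu)
  have h2 := exp_neg_le_rpow hl (mul_pos hB hv)
  rw [Real.mul_rpow hA.le hu.le] at h1
  rw [Real.mul_rpow hB.le hv.le] at h2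
  rw [norm_triangleLog, neg_add, Real.exp_add]
  calc _ ≤ ‖triWeight M ν₂ ν₃ ν₅ w‖ * (Real.exp (κ * Real.log κ) * (triA w ^ (-κ) * u ^ (-κ)) *
        (Real.exp (lam * Real.log lam) * (triB w ^ (-lam) * v ^ (-lam)))) := by gcongr
    _ = _ := by ring

lemma measurable_triangleLog (u v : ℝ) : Measurable (triangleLog M ν₂ ν₃ ν₅ u v) := by
  have h1 := measurable_triA
  have h2 := measurable_triB
  have h3 := measurable_triWeight M ν₂ ν₃ ν₅
  unfold triangleLog
  fun_prop

lemma integrable_triangleLog {κ lam : ℝ} (hκ : 0 ≤ κ) (hl : 0 ≤ lam)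
    (h : TriRegion M ν₂ ν₃ ν₅ (-κ : ℝ) (-lam : ℝ)) {u v : ℝ} (hu : 0 < u) (hv : 0 < v) :
    Integrable (triangleLog M ν₂ ν₃ ν₅ u v) := by
  refine Integrable.mono' (h.integrable_norm.const_mul (Real.exp (κ * Real.log κ) *
    Real.exp (lam * Real.log lam) * u ^ (-κ) * v ^ (-lam)))
    (measurable_triangleLog u v).aestronglyMeasurable (Eventually.of_forall fun w => ?_)
  simpa using norm_triangleLog_le hu hv hκ hl w

/-- The double Mellin transform in logarithmic coordinates. -/
lemma integrableOn_quadrant_iff (f : ℝ × ℝ → ℂ) : IntegrableOn f (Ioi 0 ×ˢ Ioi 0) ↔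
    Integrable fun p : ℝ × ℝ => ((Real.exp (-p.1) * Real.exp (-p.2) : ℝ) : ℂ) *
      f (Real.exp (-p.1), Real.exp (-p.2)) := by
  have hvp := volume_preserving_finTwoArrow ℝ
  have h1 : (MeasurableEquiv.finTwoArrow : (Fin 2 → ℝ) ≃ᵐ ℝ × ℝ) ⁻¹' (Ioi 0 ×ˢ Ioi 0) =
      univ.pi fun _ => Ioi 0 := by
    ext x
    simp [MeasurableEquiv.finTwoArrow, Set.mem_univ_pi, Fin.forall_fin_two]
  rw [← hvp.integrableOn_comp_preimage (MeasurableEquiv.measurableEmbedding _), h1,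
    integrableOn_pi_Ioi_iff, ← (hvp.symm _).integrable_comp_emb
      (MeasurableEquiv.measurableEmbedding _),
    ← (Measure.measurePreserving_neg (volume : Measure (ℝ × ℝ))).integrable_comp_emb
      (MeasurableEquiv.neg (ℝ × ℝ)).measurableEmbedding]
  simp [Function.comp_def, MeasurableEquiv.finTwoArrow, Fin.prod_univ_two]

lemma integral_quadrant (f : ℝ × ℝ → ℂ) : ∫ z in Ioi 0 ×ˢ Ioi 0, f z =
    ∫ p : ℝ × ℝ, ((Real.exp (-p.1) * Real.exp (-p.2) : ℝ) : ℂ) *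
      f (Real.exp (-p.1), Real.exp (-p.2)) := by
  have hvp := volume_preserving_finTwoArrow ℝ
  have h1 : (MeasurableEquiv.finTwoArrow : (Fin 2 → ℝ) ≃ᵐ ℝ × ℝ) ⁻¹' (Ioi 0 ×ˢ Ioi 0) =
      univ.pi fun _ => Ioi 0 := by
    ext x
    simp [MeasurableEquiv.finTwoArrow, Set.mem_univ_pi, Fin.forall_fin_two]
  rw [← hvp.setIntegral_preimage_emb (MeasurableEquiv.measurableEmbedding _), h1,
    integral_pi_Ioi, ← (hvp.symm _).integral_comp (MeasurableEquiv.measurableEmbedding _),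
    ← (Measure.measurePreserving_neg (volume : Measure (ℝ × ℝ))).integral_comp
      (MeasurableEquiv.neg (ℝ × ℝ)).measurableEmbedding]
  simp [MeasurableEquiv.finTwoArrow, Fin.prod_univ_two]

/-- In the variables `-log x` and `-log y` each Mellin integration is a Schwinger integral, turning
an exponential in `triA` or `triB` into a power with a Gamma function in front. -/
lemma triangle_mellin_space (h : TriRegion M ν₂ ν₃ ν₅ τ σ) (hτ : τ.re < 0) (hσ : σ.re < 0) :
    Integrable (fun p : ((ℝ × ℝ × ℝ) × ℝ) × ℝ => cexp (-τ * p.1.2 + -σ * p.2) *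
      triangleLog M ν₂ ν₃ ν₅ (Real.exp p.1.2) (Real.exp p.2) p.1.1) ∧
    ∫ p : ((ℝ × ℝ × ℝ) × ℝ) × ℝ, cexp (-τ * p.1.2 + -σ * p.2) *
      triangleLog M ν₂ ν₃ ν₅ (Real.exp p.1.2) (Real.exp p.2) p.1.1 =
      Complex.Gamma (-τ) * Complex.Gamma (-σ) *
        ∫ w, triWeight M ν₂ ν₃ ν₅ w * ((triA w : ℂ) ^ τ * (triB w : ℂ) ^ σ) := by
  have hτ' : 0 < (-τ).re := by simpa using hτ
  have hσ' : 0 < (-σ).re := by simpa using hσ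
  have mA := measurable_triA
  have mB := measurable_triB
  have mW := measurable_triWeight M ν₂ ν₃ ν₅
  set g₁ : ℝ × ℝ × ℝ → ℂ := fun w => triWeight M ν₂ ν₃ ν₅ w * (triB w : ℂ) ^ σ with hg₁
  have mg₁ : Measurable g₁ := mW.mul ((Complex.measurable_ofReal.comp mB).pow_const _)
  set g₂ : (ℝ × ℝ × ℝ) × ℝ → ℂ := fun y => triWeight M ν₂ ν₃ ν₅ y.1 *
    (cexp (-τ * y.2) * cexp (-((triA y.1 * Real.exp y.2 : ℝ) : ℂ))) with hg₂
  have mg₂ : Measurable g₂ := by fun_prop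
  have i1 := integrable_schwinger_iff (μ := volume) hτ' mA triA_pos mg₁.aestronglyMeasurable
  have e1 := integral_schwinger (μ := volume) hτ' mA triA_pos mg₁.aestronglyMeasurable
  have i2 := integrable_schwinger_iff (μ := volume.prod volume) hσ' (mB.comp measurable_fst)
    (fun y => triB_pos y.1) mg₂.aestronglyMeasurable
  have e2 := integral_schwinger (μ := volume.prod volume) hσ' (mB.comp measurable_fst)
    (fun y => triB_pos y.1) mg₂.aestronglyMeasurable
  simp only [neg_neg] at i1 e1 i2 e2
  have c1 : ∀ w, (triA w : ℂ) ^ τ * g₁ w =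
      triWeight M ν₂ ν₃ ν₅ w * ((triA w : ℂ) ^ τ * (triB w : ℂ) ^ σ) := fun w => by
    simp only [hg₁]; ring
  have c2 : ∀ y : (ℝ × ℝ × ℝ) × ℝ, ((triB ∘ Prod.fst) y : ℂ) ^ σ * g₂ y =
      g₁ y.1 * (cexp (-τ * y.2) * cexp (-((triA y.1 * Real.exp y.2 : ℝ) : ℂ))) := fun y => by
    simp only [hg₁, hg₂, Function.comp_apply]; ring
  have c3 : ∀ p : ((ℝ × ℝ × ℝ) × ℝ) × ℝ, g₂ p.1 * (cexp (-σ * p.2) *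
      cexp (-(((triB ∘ Prod.fst) p.1 * Real.exp p.2 : ℝ) : ℂ))) =
      cexp (-τ * p.1.2 + -σ * p.2) *
        triangleLog M ν₂ ν₃ ν₅ (Real.exp p.1.2) (Real.exp p.2) p.1.1 := fun p => by
    simp only [hg₂, triangleLog, Function.comp_apply]
    rw [Complex.ofReal_add, neg_add, Complex.exp_add, Complex.exp_add]
    ring
  simp only [c1] at i1 e1
  simp only [c2, c3] at i2 e2
  refine ⟨i2.2 (i1.2 h.integrable), ?_⟩
  rw [show (volume : Measure (((ℝ × ℝ × ℝ) × ℝ) × ℝ)) =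
    ((volume : Measure (ℝ × ℝ × ℝ)).prod volume).prod volume from rfl, e2, e1]
  ring

lemma triangleMellin_converges_and_eq {m : ℤ} {ε : ℂ} {P : ℝ} (hP : 0 < P)
    (h : TriRegion (m - ε) ν₂ ν₃ ν₅ τ σ) (hτ : τ.re < 0) (hσ : σ.re < 0) :
    TriangleMellinConverges m ε P ν₂ ν₃ ν₅ τ σ ∧
    triangleMellin m ε P ν₂ ν₃ ν₅ τ σ = (cGamma ε)⁻¹ *
      ((Complex.Gamma ν₂)⁻¹ * (Complex.Gamma ν₃)⁻¹ * (Complex.Gamma ν₅)⁻¹ *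
        (Complex.Gamma (-τ) * Complex.Gamma (-σ) *
          ∫ w, triWeight (m - ε) ν₂ ν₃ ν₅ w * ((triA w : ℂ) ^ τ * (triB w : ℂ) ^ σ))) := by
  obtain ⟨hi, he⟩ := triangle_mellin_space h hτ hσ
  have hF : ∀ p : ℝ × ℝ, ((Real.exp (-p.1) * Real.exp (-p.2) : ℝ) : ℂ) *
      (((Real.exp (-p.1) : ℝ) : ℂ) ^ (τ - 1) * ((Real.exp (-p.2) : ℝ) : ℂ) ^ (σ - 1) *
        triangle m ε P ν₂ ν₃ ν₅ (Real.exp (-p.1)) (Real.exp (-p.2))) =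
      (cGamma ε)⁻¹ * ((Complex.Gamma ν₂)⁻¹ * (Complex.Gamma ν₃)⁻¹ * (Complex.Gamma ν₅)⁻¹) *
        ∫ w, cexp (-τ * p.1 + -σ * p.2) *
          triangleLog (m - ε) ν₂ ν₃ ν₅ (Real.exp p.1) (Real.exp p.2) w := fun p => by
    rw [triangle_eq hP, integral_const_mul, ← Real.exp_neg, ← Real.exp_neg, neg_neg, neg_neg,
      ofReal_exp_cpow, ofReal_exp_cpow]
    have e1 : ((Real.exp (-p.1) * Real.exp (-p.2) : ℝ) : ℂ) * (cexp ((τ - 1) * (-p.1 : ℝ)) *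
        cexp ((σ - 1) * (-p.2 : ℝ))) = cexp (-τ * p.1 + -σ * p.2) := by
      push_cast
      simp only [← Complex.exp_add]
      ring_nf
    rw [← e1]
    ring
  have k1 := measurePreserving_prodAssoc (volume : Measure (ℝ × ℝ × ℝ)) (volume : Measure ℝ)
    (volume : Measure ℝ)
  have k2 : Integrable (fun p : (ℝ × ℝ × ℝ) × ℝ × ℝ => cexp (-τ * p.2.1 + -σ * p.2.2) *
      triangleLog (m - ε) ν₂ ν₃ ν₅ (Real.exp p.2.1) (Real.exp p.2.2) p.1)
      (volume.prod (volume.prod volume)) :=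
    (k1.integrable_comp_emb (MeasurableEquiv.measurableEmbedding _)).1 hi
  have k3 : ∫ p : (ℝ × ℝ × ℝ) × ℝ × ℝ, cexp (-τ * p.2.1 + -σ * p.2.2) *
      triangleLog (m - ε) ν₂ ν₃ ν₅ (Real.exp p.2.1) (Real.exp p.2.2) p.1
      ∂(volume.prod (volume.prod volume)) = _ :=
    (k1.integral_comp' _).symm.trans he
  have hconv : TriangleMellinConverges m ε P ν₂ ν₃ ν₅ τ σ := by
    rw [TriangleMellinConverges, integrableOn_quadrant_iff]
    simp only [hF]
    exact k2.integral_prod_right.const_mul _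
  refine ⟨hconv, ?_⟩
  rw [triangleMellin, ← setIntegral_prod _ hconv]
  refine (integral_quadrant _).trans ?_
  simp only [hF]
  rw [integral_const_mul, ← k3, integral_prod_symm _ k2, mul_assoc]
  rfl

/-! ### The two-loop integral with straight contours -/

variable {M ν₁ ν₂ ν₃ ν₄ ν₅ : ℂ} {γ₁ γ₂ : ℝ}

lemma twoLoopLog_eq (p : (ℝ × ℝ × ℝ) × ℝ × ℝ) : twoLoopLog M ν₁ ν₂ ν₃ ν₄ ν₅ p =
    triWeight M ν₂ ν₃ ν₅ p.1 *
      shiftKernel M ν₁ ν₄ (Real.log (triA p.1), Real.log (triB p.1)) p.2 := by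
  rw [twoLoopLog, shiftKernel, Real.exp_log (triA_pos _), Real.exp_log (triB_pos _)]

lemma measurable_twoLoopLog : Measurable (twoLoopLog M ν₁ ν₂ ν₃ ν₄ ν₅) := by
  have mA := measurable_triA
  have mB := measurable_triB
  have h : twoLoopLog M ν₁ ν₂ ν₃ ν₄ ν₅ = _ := funext twoLoopLog_eq
  rw [h]
  refine ((measurable_triWeight M ν₂ ν₃ ν₅).comp measurable_fst).mul ?_
  exact measurable_shiftKernel.comp (f := fun p : (ℝ × ℝ × ℝ) × ℝ × ℝ =>
    ((Real.log (triA p.1), Real.log (triB p.1)), p.2)) (by fun_prop)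

lemma ShiftRegion.ofReal (h : ShiftRegion M ν₁ ν₄ γ₂ γ₁) :
    ShiftRegion (M.re : ℂ) (ν₁.re : ℂ) (ν₄.re : ℂ) γ₂ γ₁ := by
  obtain ⟨a1, a2, a3, a4, a5, a6, a7⟩ := h
  constructor <;> simp at * <;> assumption

lemma ofReal_norm_shiftKernel (s x : ℝ × ℝ) : ((‖shiftKernel M ν₁ ν₄ s x‖ : ℝ) : ℂ) =
    shiftKernel (M.re : ℂ) (ν₁.re : ℂ) (ν₄.re : ℂ) s x := by
  have h : 0 < Real.exp x.1 + Real.exp s.1 + (Real.exp x.2 + Real.exp s.2) := by positivity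
  rw [shiftKernel, norm_mul, norm_Phi h, Complex.norm_exp, shiftKernel, Phi,
    Complex.ofReal_mul, Complex.ofReal_mul, Complex.ofReal_cpow h.le, Complex.ofReal_exp,
    Complex.ofReal_exp]
  simp

/-- The modulus of the kernel is the kernel with the real parts as parameters. The inversion formula
at these parameters therefore bounds the absolute integral, by a power of the shifts that the
triangle integral tolerates. -/
lemma integral_norm_shiftKernel_le (h : ShiftRegion M ν₁ ν₄ γ₂ γ₁) : ∃ C : ℝ, ∀ s : ℝ × ℝ,
    ∫ x, ‖shiftKernel M ν₁ ν₄ s x‖ ≤ C * Real.exp (γ₂ * s.1 + γ₁ * s.2) := by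
  have hr := h.ofReal
  refine ⟨((2 * Real.pi) ^ 2)⁻¹ * ∫ z : ℝ × ℝ, ‖shiftMellin (M.re : ℂ) (ν₁.re : ℂ) (ν₄.re : ℂ)
    (verticalLine γ₂ z.1) (verticalLine γ₁ z.2)‖, fun s => ?_⟩
  have h1 : ((∫ x, ‖shiftKernel M ν₁ ν₄ s x‖ : ℝ) : ℂ) =
      shiftBubble (M.re : ℂ) (ν₁.re : ℂ) (ν₄.re : ℂ) s := by
    rw [← integral_complex_ofReal, shiftBubble]
    simp only [ofReal_norm_shiftKernel]
  have h2 : ∫ x, ‖shiftKernel M ν₁ ν₄ s x‖ = ‖shiftBubble (M.re : ℂ) (ν₁.re : ℂ) (ν₄.re : ℂ) s‖ := by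
    rw [← h1, Complex.norm_real, Real.norm_of_nonneg (integral_nonneg fun _ => norm_nonneg _)]
  rw [h2, shiftBubble_eq hr, norm_mul, mul_assoc]
  refine mul_le_mul (by simp [abs_of_pos Real.pi_pos]) ?_ (norm_nonneg _) (by positivity)
  refine (norm_integral_le_integral_norm _).trans_eq ?_
  rw [← integral_mul_const]
  refine integral_congr_ae (Eventually.of_forall fun z => ?_)
  simp only [norm_mul, Complex.norm_exp]
  rw [mul_comm]
  simp

/-- Absolute convergence of the two-loop integral. -/
lemma integrable_twoLoopLog (h : ShiftRegion M ν₁ ν₄ γ₂ γ₁) (ht : TriRegion M ν₂ ν₃ ν₅ γ₂ γ₁) :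
    Integrable (twoLoopLog M ν₁ ν₂ ν₃ ν₄ ν₅) := by
  obtain ⟨C, hC⟩ := integral_norm_shiftKernel_le h
  rw [show (volume : Measure ((ℝ × ℝ × ℝ) × ℝ × ℝ)) = volume.prod volume from rfl,
    integrable_prod_iff measurable_twoLoopLog.aestronglyMeasurable]
  simp only [twoLoopLog_eq, norm_mul]
  refine ⟨Eventually.of_forall fun w => (integrable_shiftKernel h _).const_mul _, ?_⟩
  simp only [integral_const_mul]
  refine Integrable.mono' (ht.integrable_norm.const_mul C) ?_ (Eventually.of_forall fun w => ?_)
  · refine (measurable_triWeight M ν₂ ν₃ ν₅).norm.aestronglyMeasurable.mul ?_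
    have mA := measurable_triA
    have mB := measurable_triB
    have h1 : Measurable fun p : (ℝ × ℝ × ℝ) × ℝ × ℝ =>
        ‖shiftKernel M ν₁ ν₄ (Real.log (triA p.1), Real.log (triB p.1)) p.2‖ :=
      (measurable_shiftKernel.comp (f := fun p : (ℝ × ℝ × ℝ) × ℝ × ℝ =>
        ((Real.log (triA p.1), Real.log (triB p.1)), p.2)) (by fun_prop)).norm
    exact h1.stronglyMeasurable.integral_prod_right.aestronglyMeasurable
  · have h1 := hC (Real.log (triA w), Real.log (triB w))
    have h2 : 0 ≤ ∫ x, ‖shiftKernel M ν₁ ν₄ (Real.log (triA w), Real.log (triB w)) x‖ :=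
      integral_nonneg fun _ => norm_nonneg _
    rw [Real.norm_of_nonneg (mul_nonneg (norm_nonneg _) h2), Complex.ofReal_re, Complex.ofReal_re,
      Real.rpow_def_of_pos (triA_pos w), Real.rpow_def_of_pos (triB_pos w), ← Real.exp_add]
    calc _ ≤ ‖triWeight M ν₂ ν₃ ν₅ w‖ * (C * Real.exp (γ₂ * Real.log (triA w) +
          γ₁ * Real.log (triB w))) := by gcongr
      _ = _ := by ring_nf

/-- The inversion formula is inserted at the shifts `log triA`, `log triB`. On the contours the
moduli of the powers depend on `γ₁`, `γ₂` only, so the joint integrand is dominated by a product and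
Fubini applies. -/
lemma integral_twoLoopLog (h : ShiftRegion M ν₁ ν₄ γ₂ γ₁) (ht : TriRegion M ν₂ ν₃ ν₅ γ₂ γ₁) :
    Integrable (fun z : ℝ × ℝ =>
      shiftMellin M ν₁ ν₄ (verticalLine γ₂ z.1) (verticalLine γ₁ z.2) *
      ∫ w, triWeight M ν₂ ν₃ ν₅ w *
        ((triA w : ℂ) ^ verticalLine γ₂ z.1 * (triB w : ℂ) ^ verticalLine γ₁ z.2)) ∧
    ∫ p, twoLoopLog M ν₁ ν₂ ν₃ ν₄ ν₅ p = ((2 * Real.pi) ^ 2 : ℂ)⁻¹ * ∫ z : ℝ × ℝ,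
      shiftMellin M ν₁ ν₄ (verticalLine γ₂ z.1) (verticalLine γ₁ z.2) *
      ∫ w, triWeight M ν₂ ν₃ ν₅ w *
        ((triA w : ℂ) ^ verticalLine γ₂ z.1 * (triB w : ℂ) ^ verticalLine γ₁ z.2) := by
  set J : ℝ × ℝ → ℂ := fun z => shiftMellin M ν₁ ν₄ (verticalLine γ₂ z.1) (verticalLine γ₁ z.2)
    with hJ
  have hJi : Integrable J := integrable_shiftMellin h
  have mA := measurable_triA
  have mB := measurable_triB
  set K : (ℝ × ℝ × ℝ) × ℝ × ℝ → ℂ := fun p => triWeight M ν₂ ν₃ ν₅ p.1 *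
    ((triA p.1 : ℂ) ^ verticalLine γ₂ p.2.1 * (triB p.1 : ℂ) ^ verticalLine γ₁ p.2.2) with hK
  have hK' : ∀ p, K p = triWeight M ν₂ ν₃ ν₅ p.1 * cexp (verticalLine γ₂ p.2.1 * Real.log (triA p.1) +
      verticalLine γ₁ p.2.2 * Real.log (triB p.1)) := fun p => by
    simp only [hK]
    rw [ofReal_cpow_eq_exp (triA_pos _), ofReal_cpow_eq_exp (triB_pos _), ← Complex.exp_add]
  have hKm : Measurable K := by
    rw [funext hK']
    have := measurable_triWeight M ν₂ ν₃ ν₅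
    unfold verticalLine
    fun_prop
  have hKn : ∀ p, ‖K p‖ = ‖triWeight M ν₂ ν₃ ν₅ p.1‖ * (triA p.1 ^ γ₂ * triB p.1 ^ γ₁) := fun p => by
    simp only [hK, norm_mul, norm_ofReal_cpow (triA_pos _), norm_ofReal_cpow (triB_pos _),
      verticalLine_re]
  have hi : Integrable (fun p : (ℝ × ℝ × ℝ) × ℝ × ℝ => J p.2 * K p) (volume.prod volume) := by
    have h1 := ht.integrable_norm.mul_prod hJi.norm
    refine Integrable.mono' h1 (hJi.aestronglyMeasurable.comp_snd.mul hKm.aestronglyMeasurable)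
      (Eventually.of_forall fun p => ?_)
    rw [norm_mul, hKn, mul_comm]
    rfl
  refine ⟨?_, ?_⟩
  · have h1 := hi.integral_prod_right
    simp only [integral_const_mul] at h1
    exact h1
  · have h2 := integral_integral_swap (f := fun w z => J z * K (w, z)) hi
    have h3 := integrable_twoLoopLog h ht
    rw [show (volume : Measure ((ℝ × ℝ × ℝ) × ℝ × ℝ)) = volume.prod volume from rfl] at h3 ⊢
    rw [integral_prod _ h3]
    simp only [twoLoopLog_eq, integral_const_mul]
    have h4 : ∀ w, ∫ x, shiftKernel M ν₁ ν₄ (Real.log (triA w), Real.log (triB w)) x =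
        ((2 * Real.pi) ^ 2 : ℂ)⁻¹ * ∫ z : ℝ × ℝ, cexp (verticalLine γ₂ z.1 * Real.log (triA w) +
          verticalLine γ₁ z.2 * Real.log (triB w)) * J z := fun w => shiftBubble_eq h _
    simp only [h4]
    simp only [integral_const_mul] at h2
    rw [← h2, ← integral_const_mul]
    refine integral_congr_ae (Eventually.of_forall fun w => ?_)
    simp only []
    rw [mul_left_comm, ← integral_const_mul]
    congr 1
    refine integral_congr_ae (Eventually.of_forall fun z => ?_)
    simp only [hK']
    ring

variable {m : ℤ} {ε : ℂ} {P : ℝ}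

lemma SeparatingLines.triRegion (h : SeparatingLines m ε ν₁ ν₂ ν₃ ν₄ ν₅ γ₁ γ₂) :
    TriRegion (m - ε) ν₂ ν₃ ν₅ γ₂ γ₁ := by
  obtain ⟨a1, a2, a3, a4, a5, a6, a7, a8, a9⟩ := h
  constructor <;> simp at * <;> linarith

lemma SeparatingLines.shiftRegion (h : SeparatingLines m ε ν₁ ν₂ ν₃ ν₄ ν₅ γ₁ γ₂) (h₁ : 0 < ν₁.re)
    (h₄ : 0 < ν₄.re) : ShiftRegion (m - ε) ν₁ ν₄ γ₂ γ₁ := by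
  obtain ⟨a1, a2, a3, a4, a5, a6, a7, a8, a9⟩ := h
  constructor <;> simp at * <;> linarith

lemma TriRegion.congr {M ν₂ ν₃ ν₅ τ σ τ' σ' : ℂ} (h : TriRegion M ν₂ ν₃ ν₅ τ σ)
    (hτ : τ'.re = τ.re) (hσ : σ'.re = σ.re) : TriRegion M ν₂ ν₃ ν₅ τ' σ' := by
  obtain ⟨a1, a2, a3, a4⟩ := h
  constructor <;> simp only [add_re, hτ, hσ] at * <;> assumption

lemma ShiftRegion.congr {M ν₁ ν₄ τ σ τ' σ' : ℂ} (h : ShiftRegion M ν₁ ν₄ τ σ)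
    (hτ : τ'.re = τ.re) (hσ : σ'.re = σ.re) : ShiftRegion M ν₁ ν₄ τ' σ' := by
  obtain ⟨a1, a2, a3, a4, a5, a6, a7⟩ := h
  constructor <;> simp only [add_re, sub_re, hτ, hσ] at * <;> assumption

lemma triangleMellin_eq_triangleGamma (hP : 0 < P) {τ σ : ℂ} (h : TriRegion (m - ε) ν₂ ν₃ ν₅ τ σ)
    (hτ : τ.re < 0) (hσ : σ.re < 0) (hν : (ν₂ + ν₃ + ν₅).re < 2 * ((m : ℂ) - ε).re) :
    triangleMellin m ε P ν₂ ν₃ ν₅ τ σ = triangleGamma m ε ν₂ ν₃ ν₅ τ σ := by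
  rw [(triangleMellin_converges_and_eq hP h hτ hσ).2]
  have t := (triangle_space h.hM h.hτ h.h₅ h.hσ).2
  have hG : Complex.Gamma (2 * (m - ε) - ν₂ - ν₃ - ν₅) ≠ 0 := Complex.Gamma_ne_zero_of_re_pos (by
    simp at *; linarith)
  have t2 := eq_div_of_mul_eq hG ((mul_comm _ _).trans t)
  rw [t2, triangleGamma,
    show -σ + (m : ℂ) - ε - ν₃ - ν₅ = m - ε - ν₃ - ν₅ - σ by ring,
    show -τ + (m : ℂ) - ε - ν₂ - ν₅ = m - ε - ν₂ - ν₅ - τ by ring,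
    show σ + τ - (m : ℂ) + ε + ν₂ + ν₃ + ν₅ = ν₂ + ν₃ + ν₅ + τ + σ - (m - ε) by ring,
    show σ + τ + ν₅ = ν₅ + τ + σ by ring,
    show 2 * (m : ℂ) - 2 * ε - ν₂ - ν₃ - ν₅ = 2 * (m - ε) - ν₂ - ν₃ - ν₅ by ring]
  simp only [div_eq_mul_inv, mul_inv, one_mul]
  ring

/-- The convolution formula with straight contours. -/
theorem convolution_straight (hP : 0 < P) (h₁ : 0 < ν₁.re) (h₄ : 0 < ν₄.re)
    (h : SeparatingLines m ε ν₁ ν₂ ν₃ ν₄ ν₅ γ₁ γ₂) :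
    TwoLoopConverges m ε P ν₁ ν₂ ν₃ ν₄ ν₅ ∧
      (∀ x y : ℝ, 0 < x → 0 < y → TriangleConverges m ε P ν₂ ν₃ ν₅ x y) ∧
      (∀ σ τ : ℂ, σ.re = γ₁ → τ.re = γ₂ →
        BubbleConverges m ε P (ν₁ - τ) (ν₄ - σ) ∧
        bubble m ε P (ν₁ - τ) (ν₄ - σ) = bubbleGamma m ε (ν₁ - τ) (ν₄ - σ) ∧
        TriangleMellinConverges m ε P ν₂ ν₃ ν₅ τ σ ∧
        triangleMellin m ε P ν₂ ν₃ ν₅ τ σ = triangleGamma m ε ν₂ ν₃ ν₅ τ σ) ∧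
      Integrable (fun z : ℝ × ℝ =>
        bubble m ε P (ν₁ - verticalLine γ₂ z.2) (ν₄ - verticalLine γ₁ z.1) *
          triangleMellin m ε P ν₂ ν₃ ν₅ (verticalLine γ₂ z.2) (verticalLine γ₁ z.1)) ∧
      twoLoop m ε P ν₁ ν₂ ν₃ ν₄ ν₅ =
        1 / (2 * Real.pi * Complex.I) ^ 2 *
          contourIntegral (verticalLine γ₁) (fun σ =>
            contourIntegral (verticalLine γ₂) (fun τ =>
              bubble m ε P (ν₁ - τ) (ν₄ - σ) * triangleMellin m ε P ν₂ ν₃ ν₅ τ σ)) := by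
  have ht := h.triRegion
  have hs := h.shiftRegion h₁ h₄
  obtain ⟨hint, heq⟩ := integral_twoLoopLog hs ht
  have hγ₂ : γ₂ < 0 := by have := h.2.2.1; linarith
  have hγ₁ : γ₁ < 0 := by have := h.1; linarith
  set c : ℂ := (cGamma ε ^ 2)⁻¹ * ((Complex.Gamma ν₁)⁻¹ * (Complex.Gamma ν₂)⁻¹ *
    (Complex.Gamma ν₃)⁻¹ * (Complex.Gamma ν₄)⁻¹ * (Complex.Gamma ν₅)⁻¹) with hc
  have hprod : ∀ z : ℝ × ℝ, bubble m ε P (ν₁ - verticalLine γ₂ z.1) (ν₄ - verticalLine γ₁ z.2) *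
      triangleMellin m ε P ν₂ ν₃ ν₅ (verticalLine γ₂ z.1) (verticalLine γ₁ z.2) =
      c * (shiftMellin (m - ε) ν₁ ν₄ (verticalLine γ₂ z.1) (verticalLine γ₁ z.2) *
      ∫ w, triWeight (m - ε) ν₂ ν₃ ν₅ w *
        ((triA w : ℂ) ^ verticalLine γ₂ z.1 * (triB w : ℂ) ^ verticalLine γ₁ z.2)) := fun z => by
    rw [(triangleMellin_converges_and_eq hP (ht.congr (by simp) (by simp)) (by simpa using hγ₂)
      (by simpa using hγ₁)).2, bubble_eq hP, shiftMellin, hc]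
    have g1 := Complex.Gamma_ne_zero_of_re_pos h₁
    have g4 := Complex.Gamma_ne_zero_of_re_pos h₄
    generalize Complex.Gamma ν₁ = G1 at *
    generalize Complex.Gamma ν₄ = G4 at *
    simp only [div_eq_mul_inv, pow_two, mul_inv]
    generalize (∫ w, triWeight (m - ε) ν₂ ν₃ ν₅ w *
        ((triA w : ℂ) ^ verticalLine γ₂ z.1 * (triB w : ℂ) ^ verticalLine γ₁ z.2)) = V
    generalize (∫ x, bubbleLog (m - ε) (ν₁ - verticalLine γ₂ z.1) (ν₄ - verticalLine γ₁ z.2) x) = W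
    generalize (Complex.Gamma (ν₁ - verticalLine γ₂ z.1))⁻¹ = X1
    generalize (Complex.Gamma (ν₄ - verticalLine γ₁ z.2))⁻¹ = X4
    field_simp
  have hsw : Integrable (fun z : ℝ × ℝ =>
        bubble m ε P (ν₁ - verticalLine γ₂ z.2) (ν₄ - verticalLine γ₁ z.1) *
          triangleMellin m ε P ν₂ ν₃ ν₅ (verticalLine γ₂ z.2) (verticalLine γ₁ z.1)) := by
    have h1 := hint.const_mul c
    simp only [← hprod] at h1
    exact h1.swap
  refine ⟨(twoLoopConverges_iff hP).2 (integrable_twoLoopLog hs ht), fun x y hx hy => ?_,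
    fun σ τ hσ hτ => ?_, hsw, ?_⟩
  · refine (triangleConverges_iff hP).2 (integrable_triangleLog (κ := -γ₂) (lam := -γ₁) (by linarith)
      (by linarith) (ht.congr (by simp) (by simp)) (inv_pos.2 hx) (inv_pos.2 hy))
  · have ht' := ht.congr (τ' := τ) (σ' := σ) (by simpa using hτ) (by simpa using hσ)
    have hs' := hs.congr (τ' := τ) (σ' := σ) (by simpa using hτ) (by simpa using hσ)
    have b := bubble_converges_and_eq (m := m) (ε := ε) hP hs'.hM hs'.hM₁ hs'.hM₄
    refine ⟨b.1, b.2, (triangleMellin_converges_and_eq hP ht' hs'.hτ hs'.hσ).1,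
      triangleMellin_eq_triangleGamma hP ht' hs'.hτ hs'.hσ ?_⟩
    have e1 := ht'.hτ
    have e2 := ht'.hσ
    have e3 := ht'.h₅
    simp only [add_re] at *
    linarith
  · simp only [contourIntegral, deriv_verticalLine, integral_mul_const]
    have e1 := integral_prod _ hsw
    have e2 : ∫ z : ℝ × ℝ, bubble m ε P (ν₁ - verticalLine γ₂ z.2) (ν₄ - verticalLine γ₁ z.1) *
          triangleMellin m ε P ν₂ ν₃ ν₅ (verticalLine γ₂ z.2) (verticalLine γ₁ z.1) =
        ∫ z : ℝ × ℝ, bubble m ε P (ν₁ - verticalLine γ₂ z.1) (ν₄ - verticalLine γ₁ z.2) *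
          triangleMellin m ε P ν₂ ν₃ ν₅ (verticalLine γ₂ z.1) (verticalLine γ₁ z.2) :=
      integral_prod_swap (fun z : ℝ × ℝ =>
        bubble m ε P (ν₁ - verticalLine γ₂ z.1) (ν₄ - verticalLine γ₁ z.2) *
          triangleMellin m ε P ν₂ ν₃ ν₅ (verticalLine γ₂ z.1) (verticalLine γ₁ z.2))
    simp only [hprod] at e2
    rw [integral_const_mul] at e2
    rw [← e1]
    refine Eq.trans ?_ (congrArg (fun v : ℂ => 1 / (2 * (Real.pi : ℂ) * I) ^ 2 * (v * I * I)) e2.symm)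
    rw [twoLoop_eq hP, heq, ← mul_assoc, ← hc]
    have hpi : (Real.pi : ℂ) ≠ 0 := by exact_mod_cast Real.pi_ne_zero
    generalize (∫ z : ℝ × ℝ, shiftMellin (m - ε) ν₁ ν₄ (verticalLine γ₂ z.1) (verticalLine γ₁ z.2) *
      ∫ w, triWeight (m - ε) ν₂ ν₃ ν₅ w *
        ((triA w : ℂ) ^ verticalLine γ₂ z.1 * (triB w : ℂ) ^ verticalLine γ₁ z.2)) = V
    clear_value c
    -- The two factors `I` from `dσ` and `dτ` turn `(2πi)⁻²` into the `(2π)⁻²` of Fourier inversion.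
    have hI : I ^ 2 = -1 := I_sq
    rw [mul_assoc (c * V), ← pow_two, hI, mul_pow _ I, hI]
    field_simp

/-! ### The continued integral on the region of convergence -/

section Swap

/-- The reflection of the two-loop diagram that exchanges the loops. -/
def loopSwap : Equiv.Perm (Fin 5) where
  toFun := ![1, 0, 3, 2, 4]
  invFun := ![1, 0, 3, 2, 4]
  left_inv i := by fin_cases i <;> rfl
  right_inv i := by fin_cases i <;> rfl

lemma piCongrLeft_loopSwap (α : Fin 5 → ℝ) :
    MeasurableEquiv.piCongrLeft (fun _ => ℝ) loopSwap α = ![α 1, α 0, α 3, α 2, α 4] := by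
  ext i
  fin_cases i <;> rfl

variable {m : ℤ} {ε ν₁ ν₂ ν₃ ν₄ ν₅ : ℂ} {P : ℝ}

lemma twoLoopConverges_swap (hP : 0 < P) : TwoLoopConverges m ε P ν₂ ν₁ ν₄ ν₃ ν₅ ↔
    TwoLoopConverges m ε P ν₁ ν₂ ν₃ ν₄ ν₅ := by
  have h := fun ν => loopConverges_mul_iff (m - ε) twoLoopA twoLoopB (fun _ _ => 1) ν hP
  simp only [mul_one] at h
  rw [TwoLoopConverges, TwoLoopConverges, h, h, loopConverges_iff, loopConverges_iff,
    ← (volume_measurePreserving_piCongrLeft (fun _ : Fin 5 => ℝ) loopSwap).integrable_comp_emb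
      (MeasurableEquiv.measurableEmbedding _)]
  simp only [Function.comp_def, piCongrLeft_loopSwap, logIntegrand_twoLoop_swap]

lemma twoLoop_swap (hP : 0 < P) : twoLoop m ε P ν₂ ν₁ ν₄ ν₃ ν₅ = twoLoop m ε P ν₁ ν₂ ν₃ ν₄ ν₅ := by
  have h := fun ν => loopIntegral_mul (m - ε) twoLoopA twoLoopB (fun _ _ => 1) ν hP
  simp only [mul_one] at h
  rw [twoLoop, twoLoop, h, h, loopIntegral_eq, loopIntegral_eq,
    ← (volume_measurePreserving_piCongrLeft (fun _ : Fin 5 => ℝ) loopSwap).integral_comp'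
      (g := logIntegrand (m - ε) twoLoopA twoLoopB (fun _ _ => 1) ![ν₂, ν₁, ν₄, ν₃, ν₅])]
  simp only [piCongrLeft_loopSwap, logIntegrand_twoLoop_swap, Fin.sum_univ_five, Fin.prod_univ_five,
    Matrix.cons_val_zero, Matrix.cons_val_one, Matrix.cons_val]
  rw [show ν₂ + ν₁ + ν₄ + ν₃ + ν₅ = ν₁ + ν₂ + ν₃ + ν₄ + ν₅ by ring]
  ring

end Swap

variable {m : ℤ}

/-- The parameters of the reflected diagram. -/
def swapParam (ν : Fin 5 → ℂ) : Fin 5 → ℂ := ν ∘ loopSwap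

lemma swapParam_mem {ε : ℂ} {ν : Fin 5 → ℂ} (h : (ε, ν) ∈ convergenceRegion m) :
    (ε, swapParam ν) ∈ convergenceRegion m := by
  obtain ⟨h1, h2, h3, h4, h5, h6⟩ := h
  refine ⟨fun j => h1 _, ?_, ?_, ?_, ?_, ?_⟩ <;>
    simp only [swapParam, Function.comp_apply, loopSwap, Equiv.coe_fn_mk, Matrix.cons_val_zero,
      Matrix.cons_val_one, Matrix.cons_val, add_re] at * <;> linarith

lemma isOpen_convergenceRegion (m : ℤ) : IsOpen (convergenceRegion m) := by
  simp only [convergenceRegion, setOf_and, setOf_forall]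
  refine (isOpen_iInter_of_finite fun j => IsOpen.inter ?_ ?_).inter (IsOpen.inter ?_ (IsOpen.inter ?_
    (IsOpen.inter ?_ (IsOpen.inter ?_ ?_)))) <;> exact isOpen_lt (by fun_prop) (by fun_prop)

/-- Straight contours that separate the poles. -/
lemma exists_separatingLines {q : ℂ × (Fin 5 → ℂ)} (hq : q ∈ convergenceRegion m)
    (h : (q.2 1 + q.2 2 + q.2 4).re < 2 * ((m : ℂ) - q.1).re) :
    ∃ γ₁ γ₂ : ℝ, SeparatingLines m q.1 (q.2 0) (q.2 1) (q.2 2) (q.2 3) (q.2 4) γ₁ γ₂ := by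
  obtain ⟨h0, h1, h2, h3, h4, h5⟩ := hq
  have k0 := h0 0
  have k1 := h0 1
  have k2 := h0 2
  have k3 := h0 3
  have k4 := h0 4
  have e2 : ∀ z : ℂ, (2 * z).re = 2 * z.re := fun z => by simp
  rw [e2] at h1 h2 h5
  generalize hM : ((m : ℂ) - q.1).re = M at *
  simp only [add_re] at *
  generalize q.2 0 = ν₁ at *
  generalize q.2 1 = ν₂ at *
  generalize q.2 2 = ν₃ at *
  generalize q.2 3 = ν₄ at *
  generalize q.2 4 = ν₅ at *
  -- In real parts the conditions say that `γ₁` lies in `(ν₄ - M, s)`, `γ₂` in `(ν₁ - M, t)` and `γ₁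
  -- + γ₂` in `(-r, ν₁ + ν₄ - M)`. All combinations of the extrema leave room; `ν₂₃₅ < 2M` is what
  -- makes `s + t + r` positive when neither `s` nor `t` is `0` and `r = ν₅`.
  obtain ⟨s, hs0, hs1, hs⟩ : ∃ s : ℝ, s ≤ 0 ∧ s ≤ M - ν₃.re - ν₅.re ∧
      (s = 0 ∨ s = M - ν₃.re - ν₅.re) := ⟨_, min_le_left _ _, min_le_right _ _, min_choice _ _⟩
  obtain ⟨t, ht0, ht1, ht⟩ : ∃ t : ℝ, t ≤ 0 ∧ t ≤ M - ν₂.re - ν₅.re ∧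
      (t = 0 ∨ t = M - ν₂.re - ν₅.re) := ⟨_, min_le_left _ _, min_le_right _ _, min_choice _ _⟩
  obtain ⟨r, hr0, hr1, hr⟩ : ∃ r : ℝ, r ≤ ν₂.re + ν₃.re + ν₅.re - M ∧ r ≤ ν₅.re ∧
      (r = ν₂.re + ν₃.re + ν₅.re - M ∨ r = ν₅.re) :=
    ⟨_, min_le_left _ _, min_le_right _ _, min_choice _ _⟩
  have hsum : 0 < s + t + r := by
    rcases hs with rfl | rfl <;> rcases ht with rfl | rfl <;> rcases hr with rfl | rfl <;> linarith
  have cs : 0 < s + (M - ν₄.re) := by rcases hs with rfl | rfl <;> linarith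
  have ct : 0 < t + (M - ν₁.re) := by rcases ht with rfl | rfl <;> linarith
  have cr : 0 < r + (ν₁.re + ν₄.re - M) := by rcases hr with rfl | rfl <;> linarith
  have hM0 : 0 < M := by linarith
  -- Both lines are placed at the fraction `θ` of their intervals. The three interval lengths add up
  -- to `M + (s + t + r)`, so with this `θ` the sum `γ₁ + γ₂` lies at the fraction `1 - θ` of its
  -- own interval.
  set θ := M / (M + (s + t + r)) with hθ
  have hθ0 : 0 < θ := by positivity
  have hθ1 : θ < 1 := by rw [hθ, div_lt_one (by positivity)]; linarith
  have hθe : θ * (M + (s + t + r)) = M := div_mul_cancel₀ _ (by positivity)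
  have as := mul_pos hθ0 cs
  have at' := mul_pos hθ0 ct
  have ar := mul_pos hθ0 cr
  have bs := mul_pos (sub_pos.2 hθ1) cs
  have bt := mul_pos (sub_pos.2 hθ1) ct
  have br := mul_pos (sub_pos.2 hθ1) cr
  have hm : ((m : ℝ)) = M + q.1.re := by rw [← hM]; simp
  refine ⟨-(M - ν₄.re) + θ * (s + (M - ν₄.re)), -(M - ν₁.re) + θ * (t + (M - ν₁.re)),
    ?_, ?_, ?_, ?_, ?_, ?_, ?_, ?_, ?_⟩ <;>
  (try simp only [add_re, sub_re, neg_re, intCast_re, hm]) <;> linarith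

/-- The two-loop integral is given by the continued formula if straight contours exist. -/
lemma twoLoopContinued_eq_of_separatingLines {ε ν₁ ν₂ ν₃ ν₄ ν₅ : ℂ} {P γ₁ γ₂ : ℝ} (hP : 0 < P)
    (hq : (ε, ![ν₁, ν₂, ν₃, ν₄, ν₅]) ∈ genericRegion m) (h₁ : 0 < ν₁.re) (h₄ : 0 < ν₄.re)
    (h : SeparatingLines m ε ν₁ ν₂ ν₃ ν₄ ν₅ γ₁ γ₂) :
    twoLoopContinued m (ε, ![ν₁, ν₂, ν₃, ν₄, ν₅]) = twoLoop m ε P ν₁ ν₂ ν₃ ν₄ ν₅ := by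
  obtain ⟨-, -, hg, -, he⟩ := convolution_straight hP h₁ h₄ h
  obtain ⟨a1, a2, a3, a4, a5, a6, a7, a8, a9⟩ := h
  simp only [add_re, sub_re, neg_re, intCast_re] at a1 a2 a3 a4 a5 a6 a7 a8 a9
  have ho : SeparatesOuter m ε ν₂ ν₃ ν₄ ν₅ (verticalLine γ₁) := fun k => by
    have hk : (0 : ℝ) ≤ k := k.cast_nonneg
    refine ⟨liesRight_verticalLine ?_, liesRight_verticalLine ?_, liesLeft_verticalLine ?_,
      liesLeft_verticalLine ?_, liesLeft_verticalLine ?_, liesLeft_verticalLine ?_,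
      liesLeft_verticalLine ?_⟩ <;>
    simp only [add_re, sub_re, neg_re, intCast_re, natCast_re] <;> linarith
  have hi : ∀ s : ℝ, IsIndentedLine (verticalLine γ₂) ∧
      SeparatesInner m ε ν₁ ν₂ ν₃ ν₄ ν₅ (verticalLine γ₁ s) (verticalLine γ₂) := fun s =>
    ⟨isIndentedLine_verticalLine γ₂, fun k => by
      have hk : (0 : ℝ) ≤ k := k.cast_nonneg
      refine ⟨liesRight_verticalLine ?_, liesRight_verticalLine ?_, liesRight_verticalLine ?_,
        liesLeft_verticalLine ?_, liesLeft_verticalLine ?_, liesLeft_verticalLine ?_⟩ <;>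
      simp only [add_re, sub_re, neg_re, intCast_re, natCast_re, verticalLine_re] <;> linarith⟩
  rw [(twoLoopContinued_eq hq (isIndentedLine_verticalLine γ₁) ho hi).2.2, he]
  congr 1
  refine integral_congr_ae (Eventually.of_forall fun s => ?_)
  simp only []
  congr 1
  unfold contourIntegral
  refine integral_congr_ae (Eventually.of_forall fun t => ?_)
  obtain ⟨-, b2, -, b4⟩ := hg (verticalLine γ₁ s) (verticalLine γ₂ t) (by simp) (by simp)
  simp only [b2, b4]

lemma ne_neg_natCast_of_re_pos {z : ℂ} (h : 0 < z.re) (k : ℕ) : z ≠ -(k : ℂ) := fun e => by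
  have := congrArg Complex.re e
  simp only [neg_re, natCast_re] at this
  linarith [(Nat.cast_nonneg k : (0 : ℝ) ≤ k)]

/-- In the region of convergence only two of the conditions of genericity are nontrivial. -/
lemma mem_genericRegion {q : ℂ × (Fin 5 → ℂ)} (hq : q ∈ convergenceRegion m)
    (hε : ∀ k : ℕ, 1 - 2 * q.1 ≠ -(k : ℂ))
    (h : ∀ k : ℕ, 2 * ((m : ℂ) - q.1) - (q.2 1 + q.2 2 + q.2 4) ≠ -(k : ℂ)) :
    q ∈ genericRegion m := fun k => by
  obtain ⟨h0, h1, h2, h3, h4, h5⟩ := hq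
  refine ⟨hε k, fun j => ne_neg_natCast_of_re_pos ?_ k, ne_neg_natCast_of_re_pos (h0 1).1 k,
    ne_neg_natCast_of_re_pos (h0 2).1 k, ne_neg_natCast_of_re_pos (h0 4).1 k,
    ne_neg_natCast_of_re_pos ?_ k, ne_neg_natCast_of_re_pos ?_ k, h k,
    ne_neg_natCast_of_re_pos ?_ k, ne_neg_natCast_of_re_pos ?_ k, ne_neg_natCast_of_re_pos ?_ k⟩
  · rw [sub_re]; linarith [(h0 j).2]
  all_goals rw [sub_re]; linarith

lemma twoLoopContinued_eq_twoLoop_of_lt {ε : ℂ} {ν : Fin 5 → ℂ} {P : ℝ} (hP : 0 < P)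
    (hq : (ε, ν) ∈ convergenceRegion m) (hε : ∀ k : ℕ, 1 - 2 * ε ≠ -(k : ℂ))
    (h : (ν 1 + ν 2 + ν 4).re < 2 * ((m : ℂ) - ε).re) :
    TwoLoopConverges m ε P (ν 0) (ν 1) (ν 2) (ν 3) (ν 4) ∧
    twoLoopContinued m (ε, ν) = twoLoop m ε P (ν 0) (ν 1) (ν 2) (ν 3) (ν 4) := by
  have hν : ν = ![ν 0, ν 1, ν 2, ν 3, ν 4] := by ext i; fin_cases i <;> rfl
  have hg : (ε, ν) ∈ genericRegion m := mem_genericRegion hq hε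
    (ne_neg_natCast_of_re_pos (by rw [sub_re]; simp at h ⊢; linarith))
  obtain ⟨γ₁, γ₂, hs⟩ := exists_separatingLines hq h
  have h1 := (hq.1 0).1
  have h4 := (hq.1 3).1
  rw [hν] at hg
  refine ⟨(convolution_straight hP h1 h4 hs).1, ?_⟩
  have := twoLoopContinued_eq_of_separatingLines hP hg h1 h4 hs
  rwa [← hν] at this

/-- Straight separating lines require `Re ν₂₃₅ < 2 Re M`. Adding the conditions on `ν₁₂₅` and `ν₃₄₅`
gives `Re (ν₁₄₅ + ν₂₃₅) < 4 Re M`, so otherwise the reflected diagram has such lines. -/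
lemma twoLoopConverges_of_mem {ε : ℂ} {ν : Fin 5 → ℂ} {P : ℝ} (hP : 0 < P)
    (hq : (ε, ν) ∈ convergenceRegion m) :
    TwoLoopConverges m ε P (ν 0) (ν 1) (ν 2) (ν 3) (ν 4) := by
  rcases lt_or_ge (ν 1 + ν 2 + ν 4).re (2 * ((m : ℂ) - ε).re) with h | h
  · obtain ⟨γ₁, γ₂, hs⟩ := exists_separatingLines hq h
    exact (convolution_straight hP (hq.1 0).1 (hq.1 3).1 hs).1
  · have hq' := swapParam_mem hq
    obtain ⟨γ₁, γ₂, hs⟩ := exists_separatingLines hq' (by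
      obtain ⟨h1, h2, h3, -⟩ := hq
      have := (h1 4).1
      have := (h1 4).2
      simp [swapParam, loopSwap] at *
      linarith)
    exact (twoLoopConverges_swap hP).1 (convolution_straight hP (hq'.1 0).1 (hq'.1 3).1 hs).1

/-- The Gamma function of `2M - ν₂₃₅` has cancelled in the continued formula. Hence the hyperplanes
where its argument is a nonpositive integer are not singular, and the continuation may cross them
inside the region of convergence. -/
lemma differentiableAt_twoLoopContinued {q : ℂ × (Fin 5 → ℂ)} (hq : q ∈ convergenceRegion m)
    (hε : ∀ k : ℕ, 1 - 2 * q.1 ≠ -(k : ℂ)) : DifferentiableAt ℂ (twoLoopContinued m) q := by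
  obtain ⟨h0, h1, h2, h3, h4, h5⟩ := hq
  have hG : ∀ {f : ℂ × (Fin 5 → ℂ) → ℂ}, DifferentiableAt ℂ f q → (∀ k : ℕ, f q ≠ -(k : ℂ)) →
      DifferentiableAt ℂ (fun q => Complex.Gamma (f q)) q := fun hf h =>
    (Complex.differentiableAt_Gamma _ h).comp q hf
  have hI : ∀ {f : ℂ × (Fin 5 → ℂ) → ℂ}, DifferentiableAt ℂ f q →
      DifferentiableAt ℂ (fun q => (Complex.Gamma (f q))⁻¹) q := fun hf =>
    (differentiable_inv_Gamma _).comp q hf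
  unfold twoLoopContinued
  refine DifferentiableAt.mul (DifferentiableAt.mul (DifferentiableAt.const_mul
    (DifferentiableAt.fun_pow (((hG (by fun_prop) hε).mul (hI (by fun_prop))).mul
      ((hI (by fun_prop)).fun_pow _)) _) _) (DifferentiableAt.mul ?_
        ((((DifferentiableAt.mul ?_ ?_).mul ?_).mul ?_).mul ?_)))
    (((differentiable_barnesReg (isBarnesFactor_outerFactor m)) _).comp q
      (differentiable_outerParam m q))
  · exact differentiableAt_prod fun j _ => hG (by fun_prop) (ne_neg_natCast_of_re_pos (by
      have := (h0 j).2
      rw [sub_re]; linarith))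
  all_goals exact hG (by fun_prop) (ne_neg_natCast_of_re_pos (by rw [sub_re]; linarith))

/-- The continued two-loop integral is symmetric under the reflection of the diagram. -/
lemma twoLoopContinued_swap {ε : ℂ} {ν : Fin 5 → ℂ} (hq : (ε, ν) ∈ convergenceRegion m)
    (hε : ∀ k : ℕ, 1 - 2 * ε ≠ -(k : ℂ)) :
    twoLoopContinued m (ε, swapParam ν) = twoLoopContinued m (ε, ν) := by
  -- A segment starts at the point with all indices equal to `M / 2` and stays in the region of
  -- convergence. At its start `ν₂₃₅` and `ν₁₄₅` both equal `3M/2`, so near it both continuations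
  -- are given by convergent integrals, which agree by reflection. The identity theorem carries this
  -- to the end of the segment.
  set b : ℂ := ((m : ℂ) - ε) / 2 with hb
  set ℓ : ℂ → Fin 5 → ℂ := fun z j => b + z * (ν j - b) with hℓ
  have hbre : b.re = ((m : ℂ) - ε).re / 2 := by rw [hb]; simp
  have hM0 : 0 < ((m : ℂ) - ε).re := (hq.1 0).1.trans (hq.1 0).2
  have h2 : ∀ z : ℂ, (2 * z).re = 2 * z.re := fun z => by simp
  have hℓR : ∀ r ∈ Icc (0 : ℝ) 1, (ε, ℓ r) ∈ convergenceRegion m := fun r hr => by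
    obtain ⟨h0, h1, h2', h3, h4, h5⟩ := hq
    have key : ∀ x y : ℝ, 0 < x → 0 < y → 0 < (1 - r) * x + r * y := fun x y hx hy => by
      rcases hr.1.eq_or_lt with rfl | h
      · simpa using hx
      · have := mul_pos h hy
        have := mul_nonneg (sub_nonneg.2 hr.2) hx.le
        linarith
    have hre : ∀ j, (ℓ r j).re = (1 - r) * b.re + r * (ν j).re := fun j => by
      simp [hℓ]; ring
    simp only [convergenceRegion, mem_setOf_eq, add_re, h2, hre, hbre] at *
    refine ⟨fun j => ⟨?_, ?_⟩, ?_, ?_, ?_, ?_, ?_⟩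
    · linarith [key _ _ (half_pos hM0) (h0 j).1]
    · linarith [key _ _ (half_pos hM0) (sub_pos.2 (h0 j).2)]
    · linarith [key _ _ (half_pos hM0) (sub_pos.2 h1)]
    · linarith [key _ _ (half_pos hM0) (sub_pos.2 h2')]
    · linarith [key _ _ (half_pos hM0) (sub_pos.2 h3)]
    · linarith [key _ _ (half_pos hM0) (sub_pos.2 h4)]
    · linarith [key _ _ (half_pos hM0) (sub_pos.2 h5)]
  have hℓd : Differentiable ℂ fun z => (ε, ℓ z) := by
    refine (differentiable_const _).prodMk (differentiable_pi.2 fun j => ?_)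
    simp only [hℓ]; fun_prop
  have hℓd' : Differentiable ℂ fun z => (ε, swapParam (ℓ z)) := by
    refine (differentiable_const _).prodMk (differentiable_pi.2 fun j => ?_)
    simp only [hℓ, swapParam, Function.comp_apply]; fun_prop
  set U : Set ℂ := {z | (ε, ℓ z) ∈ convergenceRegion m} with hU
  have hUo : IsOpen U := (isOpen_convergenceRegion m).preimage hℓd.continuous
  have hf : AnalyticOnNhd ℂ (fun z => twoLoopContinued m (ε, ℓ z)) U :=
    DifferentiableOn.analyticOnNhd (fun z hz =>
      (DifferentiableAt.comp (g := twoLoopContinued m) z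
        (differentiableAt_twoLoopContinued hz hε) (hℓd z)).differentiableWithinAt) hUo
  have hf' : AnalyticOnNhd ℂ (fun z => twoLoopContinued m (ε, swapParam (ℓ z))) U :=
    DifferentiableOn.analyticOnNhd (fun z hz =>
      (DifferentiableAt.comp (g := twoLoopContinued m) z
        (differentiableAt_twoLoopContinued (swapParam_mem hz) hε) (hℓd' z)).differentiableWithinAt) hUo
  set S : Set ℂ := (fun r : ℝ => (r : ℂ)) '' Icc 0 1 with hS
  have hSU : S ⊆ U := by
    rintro _ ⟨r, hr, rfl⟩
    exact hℓR r hr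
  have hSc : IsPreconnected S := isPreconnected_Icc.image _ Complex.continuous_ofReal.continuousOn
  have h0S : (0 : ℂ) ∈ S := ⟨0, by simp, by simp⟩
  have h1S : (1 : ℂ) ∈ S := ⟨1, by simp, by simp⟩
  have hloc : (fun z => twoLoopContinued m (ε, swapParam (ℓ z))) =ᶠ[𝓝 0]
      fun z => twoLoopContinued m (ε, ℓ z) := by
    have c1 : Continuous fun z => (ℓ z 1 + ℓ z 2 + ℓ z 4).re := by simp only [hℓ]; fun_prop
    have c2 : Continuous fun z => (ℓ z 0 + ℓ z 3 + ℓ z 4).re := by simp only [hℓ]; fun_prop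
    have e0 : ∀ j, ℓ 0 j = b := fun j => by simp [hℓ]
    have n1 : ∀ᶠ z in 𝓝 (0 : ℂ), (ℓ z 1 + ℓ z 2 + ℓ z 4).re < 2 * ((m : ℂ) - ε).re :=
      c1.continuousAt.eventually (gt_mem_nhds (by simp only [e0, add_re, hbre]; linarith))
    have n2 : ∀ᶠ z in 𝓝 (0 : ℂ), (ℓ z 0 + ℓ z 3 + ℓ z 4).re < 2 * ((m : ℂ) - ε).re :=
      c2.continuousAt.eventually (gt_mem_nhds (by simp only [e0, add_re, hbre]; linarith))
    filter_upwards [hUo.mem_nhds (hSU h0S), n1, n2] with z hz h1 h2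
    rw [(twoLoopContinued_eq_twoLoop_of_lt one_pos hz hε h1).2,
      (twoLoopContinued_eq_twoLoop_of_lt one_pos (swapParam_mem hz) hε h2).2]
    exact twoLoop_swap one_pos
  have := (hf'.mono hSU).eqOn_of_preconnected_of_eventuallyEq (hf.mono hSU) hSc h0S hloc h1S
  have e1 : ℓ 1 = ν := by ext j; simp [hℓ]
  simpa only [e1] using this

lemma twoLoopContinued_eq_twoLoop {ε : ℂ} {ν : Fin 5 → ℂ} {P : ℝ} (hP : 0 < P)
    (hq : (ε, ν) ∈ convergenceRegion m) (hε : ∀ k : ℕ, 1 - 2 * ε ≠ -(k : ℂ)) :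
    twoLoopContinued m (ε, ν) = twoLoop m ε P (ν 0) (ν 1) (ν 2) (ν 3) (ν 4) := by
  rcases lt_or_ge (ν 1 + ν 2 + ν 4).re (2 * ((m : ℂ) - ε).re) with h | h
  · exact (twoLoopContinued_eq_twoLoop_of_lt hP hq hε h).2
  · rw [← twoLoopContinued_swap hq hε, (twoLoopContinued_eq_twoLoop_of_lt hP (swapParam_mem hq) hε (by
      obtain ⟨h1, h2, h3, -⟩ := hq
      have := (h1 4).1
      have := (h1 4).2
      simp [swapParam, loopSwap] at *
      linarith)).2]
    exact twoLoop_swap hP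

/-! ### A bound for the triangle at small momenta -/

variable {M ν₂ ν₃ ν₅ : ℂ}

/-- The parameters for which the triangle converges. -/
structure TriConv (M ν₂ ν₃ ν₅ : ℂ) : Prop where
  h₂ : 0 < ν₂.re
  h₂' : ν₂.re < M.re
  h₃ : 0 < ν₃.re
  h₃' : ν₃.re < M.re
  h₅ : 0 < ν₅.re
  h₅' : ν₅.re < M.re
  h : M.re < (ν₂ + ν₃ + ν₅).re

lemma norm_triWeight (w : ℝ × ℝ × ℝ) : ‖triWeight M ν₂ ν₃ ν₅ w‖ =
    Real.exp (ν₂.re * w.1 + ν₃.re * w.2.1 + ν₅.re * w.2.2 - M.re * Real.log (triS w)) *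
      Real.exp (-(Real.exp (w.1 + w.2.1) / triS w)) := by
  rw [triWeight, norm_mul, norm_mul, norm_ofReal_cpow (triS_pos w), Complex.norm_exp,
    Complex.norm_exp, Real.rpow_def_of_pos (triS_pos w), ← Real.exp_add, ← Complex.ofReal_neg,
    Complex.ofReal_re]
  congr 2
  simp
  ring

lemma norm_triWeight_add (N a b c : ℝ) (w : ℝ × ℝ × ℝ) :
    ‖triWeight (M + N) (ν₂ + (N * a : ℝ)) (ν₃ + (N * b : ℝ)) (ν₅ + (N * c : ℝ)) w‖ =
      ‖triWeight M ν₂ ν₃ ν₅ w‖ *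
        Real.exp (N * (a * w.1 + b * w.2.1 + c * w.2.2 - Real.log (triS w))) := by
  rw [norm_triWeight, norm_triWeight, mul_right_comm]
  congr 1
  rw [← Real.exp_add]
  congr 1
  simp only [add_re, ofReal_re]
  ring

lemma exists_triRegion (h : TriConv M ν₂ ν₃ ν₅) (h' : (ν₂ + ν₃ + ν₅).re < 2 * M.re) {κ : ℝ}
    (hκ : 0 < κ) (hκ' : (ν₂ + ν₅).re - M.re < κ) :
    ∃ κ' lam : ℝ, 0 ≤ κ' ∧ κ' ≤ κ ∧ 0 ≤ lam ∧ TriRegion M ν₂ ν₃ ν₅ (-κ' : ℝ) (-lam : ℝ) := by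
  obtain ⟨a2, b2, a3, b3, a5, b5, a⟩ := h
  simp only [add_re] at *
  obtain ⟨s, hs0, hs1, hs⟩ : ∃ s : ℝ, 0 ≤ s ∧ ν₂.re + ν₅.re - M.re ≤ s ∧
      (s = 0 ∨ s = ν₂.re + ν₅.re - M.re) := ⟨_, le_max_left _ _, le_max_right _ _, max_choice _ _⟩
  obtain ⟨t, ht0, ht1, ht⟩ : ∃ t : ℝ, 0 ≤ t ∧ ν₃.re + ν₅.re - M.re ≤ t ∧
      (t = 0 ∨ t = ν₃.re + ν₅.re - M.re) := ⟨_, le_max_left _ _, le_max_right _ _, max_choice _ _⟩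
  obtain ⟨r, hr0, hr1, hr⟩ : ∃ r : ℝ, r ≤ ν₂.re + ν₃.re + ν₅.re - M.re ∧ r ≤ ν₅.re ∧
      (r = ν₂.re + ν₃.re + ν₅.re - M.re ∨ r = ν₅.re) :=
    ⟨_, min_le_left _ _, min_le_right _ _, min_choice _ _⟩
  have hsum : 0 < r - s - t := by
    rcases hs with rfl | rfl <;> rcases ht with rfl | rfl <;> rcases hr with rfl | rfl <;> linarith
  have hsκ : 0 < κ - s := by rcases hs with rfl | rfl <;> linarith
  -- Both exponents exceed their lower bounds by `e`; a third of the gap `r - s - t` keeps their sum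
  -- strictly below `r`.
  obtain ⟨e, he0, he1, he2⟩ : ∃ e : ℝ, 0 < e ∧ e ≤ (r - s - t) / 3 ∧ e ≤ κ - s :=
    ⟨_, lt_min (by linarith) hsκ, min_le_left _ _, min_le_right _ _⟩
  refine ⟨s + e, t + e, by linarith, by linarith, by linarith, ?_⟩
  constructor <;> simp only [add_re, ofReal_re] <;> linarith

/-- The absolute integral of the triangle is `O(u^{-κ})`. -/
def TriBound (M ν₂ ν₃ ν₅ : ℂ) (κ U v₁ C : ℝ) : Prop :=
  ∀ u v : ℝ, 0 < u → u ≤ U → v₁ ≤ v → Integrable (triangleLog M ν₂ ν₃ ν₅ u v) ∧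
    ∫ w, ‖triangleLog M ν₂ ν₃ ν₅ u v w‖ ≤ C * u ^ (-κ)

lemma triBound_of_lt (h : TriConv M ν₂ ν₃ ν₅) (h' : (ν₂ + ν₃ + ν₅).re < 2 * M.re) {κ : ℝ}
    (hκ : 0 < κ) (hκ' : (ν₂ + ν₅).re - M.re < κ) {U v₁ : ℝ} (hv₁ : 0 < v₁) :
    ∃ C, TriBound M ν₂ ν₃ ν₅ κ U v₁ C := by
  obtain ⟨κ', lam, k0, k1, l0, hr⟩ := exists_triRegion h h' hκ hκ'
  set I₀ := ∫ w, ‖triWeight M ν₂ ν₃ ν₅ w‖ * (triA w ^ (-κ') * triB w ^ (-lam)) with hI₀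
  have hi : Integrable fun w => ‖triWeight M ν₂ ν₃ ν₅ w‖ * (triA w ^ (-κ') * triB w ^ (-lam)) := by
    simpa using hr.integrable_norm
  have hI₀0 : 0 ≤ I₀ := integral_nonneg fun w => by
    have := triA_pos w
    have := triB_pos w
    positivity
  set c := Real.exp (κ' * Real.log κ') * Real.exp (lam * Real.log lam) with hc
  refine ⟨c * U ^ (κ - κ') * v₁ ^ (-lam) * I₀, fun u v hu huU hv => ?_⟩
  have hv0 : 0 < v := hv₁.trans_le hv
  have hU : 0 < U := hu.trans_le huU
  have hint := integrable_triangleLog k0 l0 hr hu hv0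
  refine ⟨hint, ?_⟩
  calc ∫ w, ‖triangleLog M ν₂ ν₃ ν₅ u v w‖
      ≤ ∫ w, c * u ^ (-κ') * v ^ (-lam) *
        (‖triWeight M ν₂ ν₃ ν₅ w‖ * (triA w ^ (-κ') * triB w ^ (-lam))) :=
        integral_mono hint.norm (hi.const_mul _) fun w => norm_triangleLog_le hu hv0 k0 l0 w
    _ = c * u ^ (-κ') * v ^ (-lam) * I₀ := integral_const_mul _ _
    _ ≤ c * (U ^ (κ - κ') * u ^ (-κ)) * v₁ ^ (-lam) * I₀ := by
        have e1 : u ^ (-κ') = u ^ (κ - κ') * u ^ (-κ) := by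
          rw [← Real.rpow_add hu]; ring_nf
        have e2 : u ^ (κ - κ') ≤ U ^ (κ - κ') := Real.rpow_le_rpow hu.le huU (by linarith)
        have e3 : v ^ (-lam) ≤ v₁ ^ (-lam) :=
          Real.rpow_le_rpow_of_nonpos hv₁ hv (by linarith)
        rw [e1]
        gcongr
    _ = _ := by ring

/-- The largest of the three Schwinger parameters is at least a third of their sum. Inserting this
inequality multiplies the weight by `(α_i / S) ^ N`, that is, raises `M` and one index by `N`. -/
lemma one_le_sum_exp {N : ℝ} (hN : 0 < N) (w : ℝ × ℝ × ℝ) :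
    1 ≤ Real.exp (N * Real.log 3) * (Real.exp (N * (w.1 - Real.log (triS w))) +
      Real.exp (N * (w.2.1 - Real.log (triS w))) + Real.exp (N * (w.2.2 - Real.log (triS w)))) := by
  obtain ⟨x, hx, hmax⟩ : ∃ x : ℝ, (x = w.1 ∨ x = w.2.1 ∨ x = w.2.2) ∧
      w.1 ≤ x ∧ w.2.1 ≤ x ∧ w.2.2 ≤ x := by
    rcases le_total w.1 w.2.1 with h1 | h1 <;> rcases le_total w.2.1 w.2.2 with h2 | h2 <;>
      rcases le_total w.1 w.2.2 with h3 | h3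
    exacts [⟨w.2.2, by simp, h3, h2, le_rfl⟩, ⟨w.2.2, by simp, h1.trans h2, h2, le_rfl⟩,
      ⟨w.2.1, by simp, h1, le_rfl, h2⟩, ⟨w.2.1, by simp, h1, le_rfl, h2⟩,
      ⟨w.2.2, by simp, h3, h2, le_rfl⟩, ⟨w.1, by simp, le_rfl, h1, h3⟩,
      ⟨w.1, by simp, le_rfl, h1, h2.trans h1⟩, ⟨w.1, by simp, le_rfl, h1, h3⟩]
  have hS : Real.log (triS w) ≤ Real.log 3 + x := by
    rw [← Real.log_exp x, ← Real.log_mul (by norm_num) (Real.exp_pos _).ne']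
    refine Real.log_le_log (triS_pos w) ?_
    have := Real.exp_le_exp.2 hmax.1
    have := Real.exp_le_exp.2 hmax.2.1
    have := Real.exp_le_exp.2 hmax.2.2
    unfold triS
    linarith
  have h1 : 1 ≤ Real.exp (N * Real.log 3) * Real.exp (N * (x - Real.log (triS w))) := by
    rw [← Real.exp_add, ← mul_add]
    exact Real.one_le_exp (mul_nonneg hN.le (by linarith))
  refine h1.trans (mul_le_mul_of_nonneg_left ?_ (Real.exp_pos _).le)
  have p1 := Real.exp_pos (N * (w.1 - Real.log (triS w)))
  have p2 := Real.exp_pos (N * (w.2.1 - Real.log (triS w)))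
  have p3 := Real.exp_pos (N * (w.2.2 - Real.log (triS w)))
  rcases hx with rfl | rfl | rfl <;> linarith

/-- A shift of the dimension by `N = Re M` removes the restriction `Re ν₂₃₅ < 2 Re M`. From `Re ν₂₃₅
< 3 Re M` the raised indices sum to less than `4 Re M`, twice the raised `Re M`, while the value of
`Re (ν₂ + ν₅) - Re M` does not increase. -/
lemma exists_triBound (h : TriConv M ν₂ ν₃ ν₅) {κ : ℝ}
    (hκ : 0 < κ) (hκ' : (ν₂ + ν₅).re - M.re < κ) {U v₁ : ℝ} (hv₁ : 0 < v₁) :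
    ∃ C, TriBound M ν₂ ν₃ ν₅ κ U v₁ C := by
  obtain ⟨a2, b2, a3, b3, a5, b5, a⟩ := h
  have hM : 0 < M.re := a2.trans b2
  simp only [add_re] at *
  set N := M.re with hN
  have key : ∀ a b c : ℝ, (a = 1 ∧ b = 0 ∧ c = 0) ∨ (a = 0 ∧ b = 1 ∧ c = 0) ∨
      (a = 0 ∧ b = 0 ∧ c = 1) → ∃ C, TriBound (M + N) (ν₂ + (N * a : ℝ)) (ν₃ + (N * b : ℝ))
        (ν₅ + (N * c : ℝ)) κ U v₁ C := fun a b c habc => by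
    refine triBound_of_lt ?_ ?_ hκ ?_ hv₁
    · rcases habc with ⟨rfl, rfl, rfl⟩ | ⟨rfl, rfl, rfl⟩ | ⟨rfl, rfl, rfl⟩ <;>
        constructor <;> simp only [add_re, ofReal_re] <;> linarith
    all_goals rcases habc with ⟨rfl, rfl, rfl⟩ | ⟨rfl, rfl, rfl⟩ | ⟨rfl, rfl, rfl⟩ <;>
        simp only [add_re, ofReal_re] <;> linarith
  obtain ⟨C2, h2⟩ := key 1 0 0 (by simp)
  obtain ⟨C3, h3⟩ := key 0 1 0 (by simp)
  obtain ⟨C5, h5⟩ := key 0 0 1 (by simp)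
  set c := Real.exp (N * Real.log 3) with hc
  refine ⟨c * (C2 + C3 + C5), fun u v hu huU hv => ?_⟩
  obtain ⟨i2, e2⟩ := h2 u v hu huU hv
  obtain ⟨i3, e3⟩ := h3 u v hu huU hv
  obtain ⟨i5, e5⟩ := h5 u v hu huU hv
  have hb : ∀ w, ‖triangleLog M ν₂ ν₃ ν₅ u v w‖ ≤ c *
      (‖triangleLog (M + N) (ν₂ + (N * 1 : ℝ)) (ν₃ + (N * 0 : ℝ)) (ν₅ + (N * 0 : ℝ)) u v w‖ +
      ‖triangleLog (M + N) (ν₂ + (N * 0 : ℝ)) (ν₃ + (N * 1 : ℝ)) (ν₅ + (N * 0 : ℝ)) u v w‖ +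
      ‖triangleLog (M + N) (ν₂ + (N * 0 : ℝ)) (ν₃ + (N * 0 : ℝ)) (ν₅ + (N * 1 : ℝ)) u v w‖) :=
    fun w => by
    have h1 := one_le_sum_exp hM w
    simp only [norm_triangleLog, norm_triWeight_add, zero_mul, one_mul, add_zero, zero_add]
    refine (le_mul_of_one_le_right (by positivity) h1).trans_eq ?_
    ring
  have hi := ((i2.norm.add i3.norm).add i5.norm).const_mul c
  have hint : Integrable (triangleLog M ν₂ ν₃ ν₅ u v) := Integrable.mono' hi
    (measurable_triangleLog u v).aestronglyMeasurable (Eventually.of_forall hb)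
  refine ⟨hint, (integral_mono hint.norm hi hb).trans ?_⟩
  rw [integral_const_mul]
  have e := integral_add (i2.norm.add i3.norm) i5.norm
  have e' := integral_add i2.norm i3.norm
  simp only [Pi.add_apply] at e e' ⊢
  rw [e, e', mul_assoc]
  refine mul_le_mul_of_nonneg_left ?_ (Real.exp_pos _).le
  linarith

/-! ### Fourier inversion at a point of Hölder continuity -/

/-- The Fourier transform without normalization. -/
def lineFourier (g : ℝ → ℂ) (s : ℝ) : ℂ := ∫ t : ℝ, cexp (-(s * t : ℝ) * I) * g t

lemma norm_cexp_mul_I (r : ℝ) : ‖cexp (r * I)‖ = 1 := Complex.norm_exp_ofReal_mul_I r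

lemma integrable_lineFourier {g : ℝ → ℂ} (hg : Integrable g) (s : ℝ) :
    Integrable fun t : ℝ => cexp (-(s * t : ℝ) * I) * g t := by
  refine hg.bdd_mul (c := 1) (Continuous.aestronglyMeasurable (by fun_prop))
    (Eventually.of_forall fun t => ?_)
  rw [← Complex.ofReal_neg, norm_cexp_mul_I]

lemma continuous_lineFourier {g : ℝ → ℂ} (hg : Integrable g) : Continuous (lineFourier g) := by
  refine continuous_of_dominated (bound := fun t => ‖g t‖)
    (fun s => (integrable_lineFourier hg s).aestronglyMeasurable)
    (fun s => Eventually.of_forall fun t => ?_) hg.norm (Eventually.of_forall fun t => by fun_prop)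
  rw [norm_mul, ← Complex.ofReal_neg, norm_cexp_mul_I, one_mul]

lemma tendsto_lineFourier (g : ℝ → ℂ) {l : Filter ℝ} {f : ℝ → ℝ}
    (hf : Tendsto f l (cocompact ℝ)) : Tendsto (fun T => lineFourier g (f T)) l (𝓝 0) := by
  have h1 := (Real.tendsto_integral_exp_smul_cocompact g).comp
    (((Homeomorph.mulRight₀ (2 * Real.pi)⁻¹
      (inv_ne_zero (by positivity))).isClosedEmbedding.tendsto_cocompact).comp hf)
  refine h1.congr fun T => ?_
  unfold lineFourier
  refine integral_congr_ae (Eventually.of_forall fun t => ?_)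
  have hpi : (Real.pi : ℂ) ≠ 0 := by exact_mod_cast Real.pi_ne_zero
  simp only [Circle.smul_def, Real.fourierChar_apply, smul_eq_mul, Function.comp_apply,
    Homeomorph.coe_mulRight₀]
  congr 2
  push_cast
  field_simp

lemma intervalIntegral_exp_mul_I (T t : ℝ) (ht : t ≠ 0) :
    ∫ s in (-T)..T, cexp (-(s * t : ℝ) * I) =
      (I * t)⁻¹ * (cexp (-((-T) * t : ℝ) * I) - cexp (-(T * t : ℝ) * I)) := by
  have ht' : (t : ℂ) ≠ 0 := by exact_mod_cast ht
  have h := integral_exp_mul_complex (a := -T) (b := T) (c := -(t * I))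
    (neg_ne_zero.2 (mul_ne_zero ht' I_ne_zero))
  have e : ∀ s : ℝ, cexp (-(s * t : ℝ) * I) = cexp (-(t * I) * s) := fun s => by
    push_cast; ring_nf
  simp only [e]
  rw [h]
  field_simp
  ring

/-- The symmetric partial integrals of the Fourier transform tend to zero under Dini's condition. -/
lemma tendsto_integral_lineFourier_of_dini {k : ℝ → ℂ} (hk : Integrable k)
    (hD : Integrable fun t : ℝ => (t : ℂ)⁻¹ * k t) :
    Tendsto (fun T => ∫ s in (-T)..T, lineFourier k s) atTop (𝓝 0) := by
  set d : ℝ → ℂ := fun t => (t : ℂ)⁻¹ * k t with hd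
  -- Integrating the exponential over `s` divides by `t`, leaving the Fourier transform of `k t / t`
  -- at `-T` and `T`. Riemann and Lebesgue send both to zero.
  have key : ∀ T : ℝ, 0 < T → ∫ s in (-T)..T, lineFourier k s =
      I⁻¹ * (lineFourier d (-T) - lineFourier d T) := fun T hT => by
    have hle : -T ≤ T := by linarith
    rw [intervalIntegral.integral_of_le hle]
    unfold lineFourier
    have hi : Integrable (Function.uncurry fun s t : ℝ => cexp (-(s * t : ℝ) * I) * k t)
        ((volume.restrict (Ioc (-T) T)).prod volume) := by
      have h1 : Integrable (fun p : ℝ × ℝ => ‖k p.2‖) ((volume.restrict (Ioc (-T) T)).prod volume) := by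
        have := (integrable_const (1 : ℝ) (μ := volume.restrict (Ioc (-T) T))).mul_prod hk.norm
        simpa using this
      refine Integrable.mono' h1 (AEStronglyMeasurable.mul (Continuous.aestronglyMeasurable
        (by fun_prop)) hk.aestronglyMeasurable.comp_snd) (Eventually.of_forall fun p => ?_)
      simp only [Function.uncurry]
      rw [norm_mul, ← Complex.ofReal_neg, norm_cexp_mul_I, one_mul]
    rw [integral_integral_swap hi, ← integral_sub (integrable_lineFourier hD _)
      (integrable_lineFourier hD _), ← integral_const_mul]
    refine integral_congr_ae ?_
    filter_upwards [Measure.ae_ne volume (0 : ℝ)] with t ht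
    rw [integral_mul_const, ← intervalIntegral.integral_of_le hle, intervalIntegral_exp_mul_I T t ht]
    simp only [hd, mul_inv]
    push_cast
    ring
  have h1 := (tendsto_lineFourier d (tendsto_neg_atTop_atBot.mono_right atBot_le_cocompact)).sub
    (tendsto_lineFourier d (tendsto_id.mono_right atTop_le_cocompact))
  have h2 := h1.const_mul I⁻¹
  rw [sub_zero, mul_zero] at h2
  refine h2.congr' ?_
  filter_upwards [eventually_gt_atTop 0] with T hT
  exact (key T hT).symm

lemma lineFourier_gaussian (s : ℝ) :
    lineFourier (fun t => ((Real.exp (-1 * t ^ 2) : ℝ) : ℂ)) s =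
      ((√Real.pi * Real.exp (-(1 / 4) * s ^ 2) : ℝ) : ℂ) := by
  have h := fourierIntegral_gaussian (b := 1) (by simp) (-s : ℂ)
  unfold lineFourier
  have e : ∀ t : ℝ, cexp (-(s * t : ℝ) * I) * ((Real.exp (-1 * t ^ 2) : ℝ) : ℂ) =
      cexp (I * -s * t) * cexp (-1 * t ^ 2) := fun t => by
    push_cast; ring_nf
  simp only [e]
  rw [h, Real.sqrt_eq_rpow, Complex.ofReal_mul, Complex.ofReal_cpow Real.pi_pos.le]
  push_cast
  ring_nf

lemma tendsto_integral_lineFourier_gaussian :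
    Tendsto (fun T => ∫ s in (-T)..T, lineFourier (fun t => ((Real.exp (-1 * t ^ 2) : ℝ) : ℂ)) s)
      atTop (𝓝 (2 * Real.pi)) := by
  simp only [lineFourier_gaussian]
  have hi : Integrable fun s : ℝ => √Real.pi * Real.exp (-(1 / 4) * s ^ 2) :=
    (integrable_exp_neg_mul_sq (by norm_num)).const_mul _
  have hi' : Integrable fun s : ℝ => ((√Real.pi * Real.exp (-(1 / 4) * s ^ 2) : ℝ) : ℂ) := hi.ofReal
  have h := intervalIntegral_tendsto_integral hi' tendsto_neg_atTop_atBot tendsto_id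
  have e : ∫ s : ℝ, √Real.pi * Real.exp (-(1 / 4) * s ^ 2) = 2 * Real.pi := by
    rw [integral_const_mul, integral_gaussian, ← Real.sqrt_mul Real.pi_pos.le,
      show Real.pi * (Real.pi / (1 / 4)) = (2 * Real.pi) ^ 2 by ring,
      Real.sqrt_sq (by positivity)]
  rw [show (∫ s : ℝ, ((√Real.pi * Real.exp (-(1 / 4) * s ^ 2) : ℝ) : ℂ)) =
    ((∫ s : ℝ, √Real.pi * Real.exp (-(1 / 4) * s ^ 2) : ℝ) : ℂ) from integral_ofReal, e] at h
  simpa using h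

lemma integrable_inv_mul_of_hoelder {k : ℝ → ℂ} (hk : Integrable k) {C δ r : ℝ} (hδ : 0 < δ)
    (hr : 0 < r) (h : ∀ t, |t| ≤ r → ‖k t‖ ≤ C * |t| ^ δ) :
    Integrable fun t : ℝ => (t : ℂ)⁻¹ * k t := by
  have h1 : IntegrableOn (fun x : ℝ => C * x ^ (δ - 1)) (Ioc 0 r) := by
    have := (intervalIntegral.intervalIntegrable_rpow' (a := 0) (b := r) (r := δ - 1)
      (by linarith)).const_mul C
    rwa [intervalIntegrable_iff_integrableOn_Ioc_of_le hr.le] at this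
  have h2 : IntegrableOn (fun x : ℝ => (Ioc 0 r).indicator (fun x : ℝ => C * x ^ (δ - 1)) x) (Ioi 0) :=
    (h1.integrable_indicator measurableSet_Ioc).integrableOn
  have h3 : IntegrableOn (fun t : ℝ => (Ioc 0 r).indicator (fun x : ℝ => C * x ^ (δ - 1)) |t|)
      (Ioi 0) := h2.congr_fun (fun t ht => by simp only [abs_of_pos (mem_Ioi.1 ht)]) measurableSet_Ioi
  have h4 : IntegrableOn (fun t : ℝ => (Ioc 0 r).indicator (fun x : ℝ => C * x ^ (δ - 1)) |t|)
      (Iio 0) := by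
    have := (Measure.measurePreserving_neg (volume : Measure ℝ)).integrableOn_comp_preimage
      (MeasurableEquiv.neg ℝ).measurableEmbedding (s := Ioi 0)
      (f := fun t : ℝ => (Ioc 0 r).indicator (fun x : ℝ => C * x ^ (δ - 1)) |t|)
    have h5 := this.2 h3
    simpa [Function.comp_def, abs_neg] using h5
  have h6 : Integrable (fun t : ℝ => (Ioc 0 r).indicator (fun x : ℝ => C * x ^ (δ - 1)) |t|) := by
    have h7 := h4.union h3
    rw [← integrableOn_univ]
    refine h7.congr_set_ae ?_
    rw [Iio_union_Ioi]
    exact (ae_eq_univ.2 (by simp)).symm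
  have hm : AEStronglyMeasurable (fun t : ℝ => (t : ℂ)⁻¹ * k t) volume :=
    AEStronglyMeasurable.mul (Measurable.aestronglyMeasurable (by fun_prop)) hk.aestronglyMeasurable
  refine Integrable.mono' (h6.add (hk.norm.const_mul r⁻¹)) hm (Eventually.of_forall fun t => ?_)
  simp only [Pi.add_apply]
  rw [norm_mul, norm_inv, Complex.norm_real, Real.norm_eq_abs]
  by_cases ht : |t| ≤ r
  · rcases eq_or_ne t 0 with rfl | ht0
    · simp; positivity
    · have h0 : 0 < |t| := abs_pos.2 ht0
      rw [indicator_of_mem (show |t| ∈ Ioc 0 r from ⟨h0, ht⟩)]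
      have h8 := mul_le_mul_of_nonneg_left (h t ht) (inv_pos.2 h0).le
      have h9 : |t|⁻¹ * (C * |t| ^ δ) = C * |t| ^ (δ - 1) := by
        rw [Real.rpow_sub_one h0.ne']; ring
      have : 0 ≤ r⁻¹ * ‖k t‖ := by positivity
      linarith
  · push Not at ht
    rw [indicator_of_notMem (fun h => absurd h.2 (not_le.2 ht)), zero_add]
    gcongr

/-- Fourier inversion, as a principal value, at a point of Hölder continuity. -/
lemma tendsto_integral_lineFourier {g : ℝ → ℂ} (hg : Integrable g) {t₀ C δ r : ℝ} (hδ : 0 < δ)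
    (hr : 0 < r) (h : ∀ t, |t - t₀| ≤ r → ‖g t - g t₀‖ ≤ C * |t - t₀| ^ δ) :
    Tendsto (fun T => ∫ s in (-T)..T, cexp ((s * t₀ : ℝ) * I) * lineFourier g s) atTop
      (𝓝 (2 * Real.pi * g t₀)) := by
  -- A multiple of a Gaussian centred at `t₀` with the value `g t₀` there is subtracted. Its
  -- inversion is explicit, and the remainder is of order `|t - t₀| ^ δ'` near `t₀`, which is Dini's
  -- condition.
  set G : ℝ → ℂ := fun t => ((Real.exp (-1 * t ^ 2) : ℝ) : ℂ) with hG
  have hGi : Integrable G := (integrable_exp_neg_mul_sq one_pos).ofReal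
  set k : ℝ → ℂ := fun t => g (t + t₀) - g t₀ * G t with hk
  have hg' : Integrable fun t => g (t + t₀) := hg.comp_add_right t₀
  have hki : Integrable k := hg'.sub (hGi.const_mul _)
  set δ' := min δ 1 with hδ'
  set r' := min r 1 with hr'
  have hd' : 0 < δ' := lt_min hδ one_pos
  have hr0 : 0 < r' := lt_min hr one_pos
  have hC : 0 ≤ C := by
    have h1 := h (t₀ + r) (by simp [abs_of_pos hr])
    have h2 : 0 < |t₀ + r - t₀| ^ δ := Real.rpow_pos_of_pos (by simpa using hr.ne') _
    exact nonneg_of_mul_nonneg_left ((norm_nonneg _).trans h1) h2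
  have hkh : ∀ t, |t| ≤ r' → ‖k t‖ ≤ (C + ‖g t₀‖) * |t| ^ δ' := fun t ht => by
    have h1 : |t| ≤ 1 := ht.trans (min_le_right _ _)
    have e1 := h (t + t₀) (by simpa using ht.trans (min_le_left _ _))
    rw [add_sub_cancel_right] at e1
    have e2 : |t| ^ δ ≤ |t| ^ δ' := by
      rcases eq_or_ne t 0 with rfl | h0
      · simp [Real.zero_rpow hδ.ne', Real.zero_rpow hd'.ne']
      · exact Real.rpow_le_rpow_of_exponent_ge (abs_pos.2 h0) h1 (min_le_left _ _)
    have e3 : |t| ^ (2 : ℝ) ≤ |t| ^ δ' := by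
      rcases eq_or_ne t 0 with rfl | h0
      · simp [Real.zero_rpow hd'.ne']
      · exact Real.rpow_le_rpow_of_exponent_ge (abs_pos.2 h0) h1
          ((min_le_right _ _).trans (by norm_num))
    have e4 : ‖1 - G t‖ ≤ |t| ^ (2 : ℝ) := by
      rw [hG, ← Complex.ofReal_one, ← Complex.ofReal_sub, Complex.norm_real, Real.norm_eq_abs,
        Real.rpow_two, sq_abs, abs_of_nonneg]
      · have := Real.add_one_le_exp (-1 * t ^ 2)
        linarith
      · have : Real.exp (-1 * t ^ 2) ≤ 1 := Real.exp_le_one_iff.2 (by nlinarith [sq_nonneg t])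
        linarith
    have e5 : k t = (g (t + t₀) - g t₀) + g t₀ * (1 - G t) := by simp only [hk]; ring
    rw [e5]
    refine (norm_add_le _ _).trans ?_
    rw [norm_mul, add_mul]
    have := mul_le_mul_of_nonneg_left e2 hC
    have := mul_le_mul_of_nonneg_left (e4.trans e3) (norm_nonneg (g t₀))
    linarith
  have h1 := tendsto_integral_lineFourier_of_dini hki (integrable_inv_mul_of_hoelder hki hd' hr0 hkh)
  have h2 := h1.add (tendsto_integral_lineFourier_gaussian.const_mul (g t₀))
  have e : ∀ s, cexp ((s * t₀ : ℝ) * I) * lineFourier g s =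
      lineFourier k s + g t₀ * lineFourier G s := fun s => by
    have e1 : lineFourier k s = lineFourier (fun t => g (t + t₀)) s - g t₀ * lineFourier G s := by
      unfold lineFourier
      rw [← integral_const_mul, ← integral_sub (integrable_lineFourier hg' s)
        ((integrable_lineFourier hGi s).const_mul _)]
      refine integral_congr_ae (Eventually.of_forall fun t => ?_)
      simp only [hk]; ring
    have e2 : lineFourier (fun t => g (t + t₀)) s = cexp ((s * t₀ : ℝ) * I) * lineFourier g s := by
      unfold lineFourier
      rw [← integral_add_right_eq_self (fun t : ℝ => cexp (-(s * t : ℝ) * I) * g t) t₀,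
        ← integral_const_mul]
      refine integral_congr_ae (Eventually.of_forall fun t => ?_)
      simp only []
      rw [← mul_assoc, ← Complex.exp_add]
      congr 2
      push_cast; ring
    rw [e1, e2]; ring
  simp only [e]
  rw [zero_add] at h2
  have e3 : g t₀ * (2 * (Real.pi : ℂ)) = 2 * Real.pi * g t₀ := by ring
  rw [e3] at h2
  refine h2.congr fun T => ?_
  rw [← intervalIntegral.integral_const_mul, intervalIntegral.integral_add]
  · exact (continuous_lineFourier hki).intervalIntegrable _ _
  · exact ((continuous_lineFourier hGi).const_mul _).intervalIntegrable _ _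

/-! ### The bubble as a Laplace transform -/

/-- The square `u` of the first distance as a function of the logarithm of the square of the second
distance and of the cosine of an angle. -/
def modU (t w : ℝ) : ℝ := 1 + 2 * Real.exp (t / 2) * w + Real.exp t

/-- The density of the angular variable. -/
def rho (M : ℂ) (w : ℝ) : ℂ := ((1 - w ^ 2 : ℝ) : ℂ) ^ (M - 3 / 2)

lemma exp_half_sq (t : ℝ) : Real.exp (t / 2) ^ 2 = Real.exp t := by
  rw [← Real.exp_nat_mul]; ring_nf

lemma one_sub_sq_pos {w : ℝ} (hw : w ∈ Ioo (-1 : ℝ) 1) : 0 < 1 - w ^ 2 := by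
  nlinarith [hw.1, hw.2]

lemma modU_eq (t w : ℝ) : modU t w = (1 + Real.exp (t / 2) * w) ^ 2 + Real.exp t * (1 - w ^ 2) := by
  rw [modU]; linear_combination (-(w ^ 2)) * exp_half_sq t

lemma modU_pos (t : ℝ) {w : ℝ} (hw : w ∈ Ioo (-1 : ℝ) 1) : 0 < modU t w := by
  rw [modU_eq]
  have := mul_pos (Real.exp_pos t) (one_sub_sq_pos hw)
  positivity

/-- The measure in the logarithm of the distance and the cosine of the angle. -/
def angleMeasure : Measure (ℝ × ℝ) := (volume : Measure ℝ).prod (volume.restrict (Ioo (-1) 1))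

lemma angleMeasure_eq : angleMeasure = volume.restrict (univ ×ˢ Ioo (-1 : ℝ) 1) := by
  rw [angleMeasure, ← Measure.restrict_univ (μ := (volume : Measure ℝ)), Measure.prod_restrict,
    Measure.restrict_univ]
  rfl

instance : SFinite angleMeasure := by unfold angleMeasure; infer_instance

/-- The coordinates parallel and orthogonal to the external momentum. -/
def angleMap (p : ℝ × ℝ) : ℝ × ℝ := (1 + Real.exp (p.1 / 2) * p.2, p.1 + Real.log (1 - p.2 ^ 2))

/-- The derivative of `angleMap`. -/
def fderivAngleMap (p : ℝ × ℝ) : ℝ × ℝ →L[ℝ] ℝ × ℝ :=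
  (Matrix.toLin (.finTwoProd ℝ) (.finTwoProd ℝ)
    !![Real.exp (p.1 / 2) * (1 / 2) * p.2, Real.exp (p.1 / 2);
      1, -(2 * p.2) / (1 - p.2 ^ 2)]).toContinuousLinearMap

lemma hasFDerivAt_angleMap {p : ℝ × ℝ} (hp : p.2 ∈ Ioo (-1 : ℝ) 1) :
    HasFDerivAt angleMap (fderivAngleMap p) p := by
  have h0 := one_sub_sq_pos hp
  have h1 : HasDerivAt (fun t : ℝ => Real.exp (t / 2)) (Real.exp (p.1 / 2) * (1 / 2)) p.1 :=
    ((hasDerivAt_id p.1).div_const 2).exp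
  have h2 : HasDerivAt (fun w : ℝ => Real.log (1 - w ^ 2)) (-(2 * p.2) / (1 - p.2 ^ 2)) p.2 := by
    have := (((hasDerivAt_id p.2).pow 2).const_sub 1).log h0.ne'
    simpa using this
  have h3 := (((h1.comp_hasFDerivAt p hasFDerivAt_fst).mul
    (hasFDerivAt_snd (𝕜 := ℝ) (p := p))).const_add 1).prodMk
    ((hasFDerivAt_fst (𝕜 := ℝ) (p := p)).add (h2.comp_hasFDerivAt p hasFDerivAt_snd))
  refine h3.congr_fderiv ?_
  unfold fderivAngleMap
  rw [Matrix.toLin_finTwoProd_toContinuousLinearMap]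
  ext <;> simp
  ring

lemma abs_det_fderivAngleMap {p : ℝ × ℝ} (hp : p.2 ∈ Ioo (-1 : ℝ) 1) :
    |(fderivAngleMap p).det| = Real.exp (p.1 / 2) / (1 - p.2 ^ 2) := by
  have h0 := one_sub_sq_pos hp
  have h : (fderivAngleMap p).det = -(Real.exp (p.1 / 2) / (1 - p.2 ^ 2)) := by
    unfold fderivAngleMap
    simp only [LinearMap.det_toContinuousLinearMap, LinearMap.det_toLin, Matrix.det_fin_two_of]
    field_simp
    ring
  rw [h, abs_neg, abs_of_pos (div_pos (Real.exp_pos _) h0)]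

lemma angleMap_sq {p : ℝ × ℝ} (hp : p.2 ∈ Ioo (-1 : ℝ) 1) :
    ((angleMap p).1 - 1) ^ 2 + Real.exp (angleMap p).2 = Real.exp p.1 := by
  simp only [angleMap]
  rw [Real.exp_add, Real.exp_log (one_sub_sq_pos hp), add_sub_cancel_left, mul_pow, exp_half_sq]
  ring

lemma injOn_angleMap : InjOn angleMap (univ ×ˢ Ioo (-1 : ℝ) 1) := by
  intro p hp q hq h
  have e1 := angleMap_sq hp.2
  rw [h, angleMap_sq hq.2] at e1
  have e2 := Real.exp_injective e1
  have e3 := congrArg Prod.fst h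
  simp only [angleMap, e2] at e3
  exact Prod.ext e2.symm (mul_left_cancel₀ (Real.exp_pos _).ne' (add_left_cancel e3))

lemma image_angleMap : angleMap '' (univ ×ˢ Ioo (-1 : ℝ) 1) = univ := by
  refine eq_univ_of_forall fun q => ?_
  have hz := Real.exp_pos q.2
  set v := (q.1 - 1) ^ 2 + Real.exp q.2 with hv
  have hv0 : 0 < v := by positivity
  have hs : 0 < √v := Real.sqrt_pos.2 hv0
  have hsq : √v ^ 2 = v := Real.sq_sqrt hv0.le
  have hw : 1 - ((q.1 - 1) / √v) ^ 2 = Real.exp q.2 / v := by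
    rw [div_pow, hsq, eq_div_iff hv0.ne', sub_mul, div_mul_cancel₀ _ hv0.ne', hv]; ring
  have hw2 : ((q.1 - 1) / √v) ^ 2 < 1 := by
    have : 0 < Real.exp q.2 / v := by positivity
    linarith
  have he : Real.exp (Real.log v / 2) = √v := by
    rw [← Real.log_sqrt hv0.le, Real.exp_log hs]
  refine ⟨(Real.log v, (q.1 - 1) / √v), ⟨mem_univ _, abs_lt.1 ((sq_lt_one_iff_abs_lt_one _).1 hw2)⟩, ?_⟩
  simp only [angleMap, he, hw]
  refine Prod.ext ?_ ?_
  · simp only []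
    rw [mul_div_cancel₀ _ hs.ne']; ring
  · simp only []
    rw [Real.log_div hz.ne' hv0.ne', Real.log_exp]; ring

/-- The integrand of the Laplace representation. -/
def laplaceKernel (M : ℂ) (a b : ℝ) (p : ℝ × ℝ) : ℂ :=
  cexp (M * p.1) * rho M p.2 * cexp (-((a * modU p.1 p.2 + b * Real.exp p.1 : ℝ) : ℂ))

lemma gauss_line {a b : ℝ} (h : 0 < a + b) :
    Integrable (fun ξ : ℝ => cexp (-((a * ξ ^ 2 + b * (ξ - 1) ^ 2 : ℝ) : ℂ))) ∧
    ∫ ξ : ℝ, cexp (-((a * ξ ^ 2 + b * (ξ - 1) ^ 2 : ℝ) : ℂ)) =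
      ((√(Real.pi / (a + b)) * Real.exp (-(a * b / (a + b))) : ℝ) : ℂ) := by
  have e : ∀ ξ : ℝ, cexp (-((a * ξ ^ 2 + b * (ξ - 1) ^ 2 : ℝ) : ℂ)) =
      ((Real.exp (-(a + b) * (ξ - b / (a + b)) ^ 2) * Real.exp (-(a * b / (a + b))) : ℝ) : ℂ) :=
    fun ξ => by
    rw [← Real.exp_add, ← Complex.ofReal_neg, ← Complex.ofReal_exp]
    congr 2
    field_simp
    ring
  simp only [e]
  have hi := ((integrable_exp_neg_mul_sq h).comp_sub_right (b / (a + b))).mul_const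
    (Real.exp (-(a * b / (a + b))))
  refine ⟨hi.ofReal, ?_⟩
  rw [show ∫ ξ : ℝ, ((Real.exp (-(a + b) * (ξ - b / (a + b)) ^ 2) *
      Real.exp (-(a * b / (a + b))) : ℝ) : ℂ) = ((∫ ξ : ℝ, Real.exp (-(a + b) *
      (ξ - b / (a + b)) ^ 2) * Real.exp (-(a * b / (a + b))) : ℝ) : ℂ) from integral_ofReal,
    integral_mul_const, integral_sub_right_eq_self (fun ξ : ℝ => Real.exp (-(a + b) * ξ ^ 2)),
    integral_gaussian]

/-- The constant of the Laplace representation. -/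
def laplaceConst (M : ℂ) : ℂ := Complex.Gamma (M - 1 / 2) * √Real.pi

lemma laplaceConst_ne_zero {M : ℂ} (hM : 1 / 2 < M.re) : laplaceConst M ≠ 0 := by
  refine mul_ne_zero (Complex.Gamma_ne_zero_of_re_pos ?_) ?_
  · simp at hM ⊢; linarith
  · exact_mod_cast (Real.sqrt_pos.2 Real.pi_pos).ne'

/-- The Laplace representation of the bubble. -/
lemma laplace_bubble {M : ℂ} (hM : 1 / 2 < M.re) {a b : ℝ} (h : 0 < a + b) :
    Integrable (laplaceKernel M a b) angleMeasure ∧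
    ∫ p, laplaceKernel M a b p ∂angleMeasure = laplaceConst M * Phi M a b := by
  have hM' : 0 < (M - 1 / 2).re := by simp at hM ⊢; linarith
  obtain ⟨g1, g2⟩ := gauss_line h
  obtain ⟨s1, s2⟩ := integrable_and_integral_exp_mul_exp_neg hM' h
  -- This is the Gaussian integral over Euclidean momenta in dimension `2M`, in the coordinate along
  -- `p` and the logarithm of the square of the orthogonal part. The latter has `2M - 1` dimensions,
  -- whence the exponent `M - 1/2`. Passing to polar coordinates around `p` by `angleMap` gives the
  -- Laplace kernel.
  set f : ℝ × ℝ → ℂ := fun q => cexp (-((a * q.1 ^ 2 + b * (q.1 - 1) ^ 2 : ℝ) : ℂ)) *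
    (cexp ((M - 1 / 2) * q.2) * cexp (-(((a + b) * Real.exp q.2 : ℝ) : ℂ))) with hf
  have hfi : Integrable f := g1.mul_prod s1
  have hfe : ∫ q, f q = _ := (integral_prod_mul (μ := (volume : Measure ℝ))
    (ν := (volume : Measure ℝ)) (fun ξ : ℝ => cexp (-((a * ξ ^ 2 + b * (ξ - 1) ^ 2 : ℝ) : ℂ)))
    (fun z : ℝ => cexp ((M - 1 / 2) * z) * cexp (-(((a + b) * Real.exp z : ℝ) : ℂ)))).trans
    (by rw [g2, s2])
  have hmeas : MeasurableSet (univ ×ˢ Ioo (-1 : ℝ) 1 : Set (ℝ × ℝ)) :=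
    MeasurableSet.univ.prod measurableSet_Ioo
  have hd : ∀ p ∈ (univ ×ˢ Ioo (-1 : ℝ) 1 : Set (ℝ × ℝ)),
      HasFDerivWithinAt angleMap (fderivAngleMap p) (univ ×ˢ Ioo (-1 : ℝ) 1) p := fun p hp =>
    (hasFDerivAt_angleMap hp.2).hasFDerivWithinAt
  have hK : ∀ p ∈ (univ ×ˢ Ioo (-1 : ℝ) 1 : Set (ℝ × ℝ)),
      |(fderivAngleMap p).det| • f (angleMap p) = laplaceKernel M a b p := fun p hp => by
    have h0 := one_sub_sq_pos hp.2
    have e1 : a * modU p.1 p.2 + b * Real.exp p.1 =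
        (a * (angleMap p).1 ^ 2 + b * ((angleMap p).1 - 1) ^ 2) +
          (a + b) * Real.exp (angleMap p).2 := by
      rw [modU_eq]
      simp only [angleMap]
      rw [Real.exp_add, Real.exp_log h0]
      linear_combination (-(b * p.2 ^ 2)) * exp_half_sq p.1
    rw [abs_det_fderivAngleMap hp.2, laplaceKernel, e1, rho, ofReal_cpow_eq_exp h0,
      Complex.ofReal_add (a * _ + _), neg_add, Complex.exp_add, Complex.real_smul]
    have e2 : ((Real.exp (p.1 / 2) / (1 - p.2 ^ 2) : ℝ) : ℂ) * cexp ((M - 1 / 2) * (angleMap p).2) =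
        cexp (M * p.1) * cexp ((M - 3 / 2) * Real.log (1 - p.2 ^ 2)) := by
      have e3 : Real.exp (p.1 / 2) / (1 - p.2 ^ 2) =
          Real.exp (p.1 / 2 - Real.log (1 - p.2 ^ 2)) := by
        rw [Real.exp_sub, Real.exp_log h0]
      rw [e3, Complex.ofReal_exp, ← Complex.exp_add, ← Complex.exp_add]
      congr 1
      simp only [angleMap]
      push_cast; ring
    rw [← e2]
    simp only [hf]
    ring
  have i1 := integrableOn_image_iff_integrableOn_abs_det_fderiv_smul volume hmeas hd injOn_angleMap f
  have i2 := integral_image_eq_integral_abs_det_fderiv_smul volume hmeas hd injOn_angleMap f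
  rw [image_angleMap, integrableOn_univ] at i1
  rw [image_angleMap, setIntegral_univ, setIntegral_congr_fun hmeas hK, ← angleMeasure_eq, hfe] at i2
  have i3 := (integrableOn_congr_fun hK hmeas).1 (i1.1 hfi)
  rw [IntegrableOn, ← angleMeasure_eq] at i3
  refine ⟨i3, i2.symm.trans ?_⟩
  rw [Phi, laplaceConst, ofReal_cpow_eq_exp h, ofReal_cpow_eq_exp h, Real.sqrt_div Real.pi_pos.le]
  have e4 : √(a + b) = Real.exp (1 / 2 * Real.log (a + b)) := by
    rw [Real.sqrt_eq_rpow, Real.rpow_def_of_pos h, mul_comm]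
  rw [e4]
  have e5 : cexp (-(M - 1 / 2) * Real.log (a + b)) =
      cexp (-M * Real.log (a + b)) * cexp (1 / 2 * Real.log (a + b)) := by
    rw [← Complex.exp_add]; ring_nf
  rw [e5]
  push_cast
  have := Complex.exp_ne_zero (1 / 2 * ((Real.log (a + b) : ℝ) : ℂ))
  field_simp

lemma integral_norm_laplaceKernel {M : ℂ} (hM : 1 / 2 < M.re) {a b : ℝ} (h : 0 < a + b) :
    ∫ p, ‖laplaceKernel M a b p‖ ∂angleMeasure =
      Real.Gamma (M.re - 1 / 2) * √Real.pi * ‖Phi M a b‖ := by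
  have h1 := (laplace_bubble (M := (M.re : ℂ)) (by simpa using hM) h).2
  apply Complex.ofReal_injective
  rw [← integral_complex_ofReal]
  have e1 : ∫ p, ((‖laplaceKernel M a b p‖ : ℝ) : ℂ) ∂angleMeasure =
      ∫ p, laplaceKernel (M.re : ℂ) a b p ∂angleMeasure := by
    rw [angleMeasure_eq]
    refine setIntegral_congr_fun (MeasurableSet.univ.prod measurableSet_Ioo) fun p hp => ?_
    have h0 := one_sub_sq_pos hp.2
    simp only [laplaceKernel, rho, norm_mul, norm_ofReal_cpow h0, Complex.norm_exp]
    push_cast [Complex.ofReal_cpow h0.le]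
    simp
  have e2 : ((‖Phi M a b‖ : ℝ) : ℂ) = Phi (M.re : ℂ) a b := by
    rw [norm_Phi h, Phi, Complex.ofReal_mul, Complex.ofReal_cpow h.le, Complex.ofReal_exp]
    simp
  rw [e1, h1, Complex.ofReal_mul, e2, laplaceConst, Complex.ofReal_mul, ← Complex.Gamma_ofReal]
  push_cast
  rfl

section Mellin

variable {Ω : Type*} [MeasurableSpace Ω] {μ : Measure Ω} [SFinite μ]

lemma measurable_modU : Measurable fun p : ℝ × ℝ => modU p.1 p.2 := by unfold modU; fun_prop

lemma measurable_rho (M : ℂ) : Measurable (rho M) := by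
  unfold rho
  exact Measurable.pow_const (by fun_prop) _

/-- Mellin transforms of integrals over the shifted bubble. -/
lemma laplace_mellin {M ν₁ ν₄ : ℂ} (hM : 1 / 2 < M.re) (h₁ : 0 < ν₁.re) (h₄ : 0 < ν₄.re)
    {g : Ω → ℂ} (hg : Measurable g) {A B : Ω → ℝ} (hA : Measurable A) (hB : Measurable B)
    (hA0 : ∀ y, 0 ≤ A y) (hB0 : ∀ y, 0 ≤ B y)
    (hint : Integrable (fun p : Ω × ℝ × ℝ => g p.1 * (cexp (ν₁ * p.2.1 + ν₄ * p.2.2) *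
      Phi M (Real.exp p.2.1 + A p.1) (Real.exp p.2.2 + B p.1))) (μ.prod volume)) :
    Integrable (fun p : Ω × ℝ × ℝ => g p.1 *
      cexp (-((A p.1 * modU p.2.1 p.2.2 + B p.1 * Real.exp p.2.1 : ℝ) : ℂ)) *
      (cexp ((M - ν₄) * p.2.1) * (rho M p.2.2 * (modU p.2.1 p.2.2 : ℂ) ^ (-ν₁))))
      (μ.prod angleMeasure) ∧
    laplaceConst M * ∫ p : Ω × ℝ × ℝ, g p.1 * (cexp (ν₁ * p.2.1 + ν₄ * p.2.2) *
      Phi M (Real.exp p.2.1 + A p.1) (Real.exp p.2.2 + B p.1)) ∂(μ.prod volume) =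
    Complex.Gamma ν₁ * Complex.Gamma ν₄ * ∫ p : Ω × ℝ × ℝ, g p.1 *
      cexp (-((A p.1 * modU p.2.1 p.2.2 + B p.1 * Real.exp p.2.1 : ℝ) : ℂ)) *
      (cexp ((M - ν₄) * p.2.1) * (rho M p.2.2 * (modU p.2.1 p.2.2 : ℂ) ^ (-ν₁)))
      ∂(μ.prod angleMeasure) := by
  have hpos : ∀ (y : Ω) (x : ℝ × ℝ), 0 < Real.exp x.1 + A y + (Real.exp x.2 + B y) := fun y x => by
    have := hA0 y
    have := hB0 y
    positivity
  have mU := measurable_modU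
  have mR := measurable_rho M
  -- After inserting the Laplace representation the exponent is linear in `exp x.1` and `exp x.2`,
  -- with coefficients `u` and `v`. Integrating over `x` first restores the propagators `u ^ (-ν₁)`
  -- and `v ^ (-ν₄)`.
  set big : Ω → (ℝ × ℝ) → (ℝ × ℝ) → ℂ := fun y x q => g y * cexp (ν₁ * x.1 + ν₄ * x.2) *
    laplaceKernel M (Real.exp x.1 + A y) (Real.exp x.2 + B y) q with hbig
  have hbm : Measurable fun p : (Ω × ℝ × ℝ) × ℝ × ℝ => big p.1.1 p.1.2 p.2 := by
    simp only [hbig, laplaceKernel]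
    have h1 : Measurable fun p : (Ω × ℝ × ℝ) × ℝ × ℝ => modU p.2.1 p.2.2 := mU.comp measurable_snd
    fun_prop
  have hbi : Integrable (fun p : (Ω × ℝ × ℝ) × ℝ × ℝ => big p.1.1 p.1.2 p.2)
      ((μ.prod volume).prod angleMeasure) := by
    rw [integrable_prod_iff hbm.aestronglyMeasurable]
    refine ⟨Eventually.of_forall fun p => (laplace_bubble hM (hpos p.1 p.2)).1.const_mul
      (g p.1 * cexp (ν₁ * p.2.1 + ν₄ * p.2.2)), ?_⟩
    refine (hint.norm.const_mul (Real.Gamma (M.re - 1 / 2) * √Real.pi)).congr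
      (Eventually.of_forall fun p => ?_)
    simp only [hbig, norm_mul]
    rw [integral_const_mul, integral_norm_laplaceKernel hM (hpos p.1 p.2)]
    ring
  have e1 : ∫ p : (Ω × ℝ × ℝ) × ℝ × ℝ, big p.1.1 p.1.2 p.2 ∂((μ.prod volume).prod angleMeasure) =
      laplaceConst M * ∫ p : Ω × ℝ × ℝ, g p.1 * (cexp (ν₁ * p.2.1 + ν₄ * p.2.2) *
        Phi M (Real.exp p.2.1 + A p.1) (Real.exp p.2.2 + B p.1)) ∂(μ.prod volume) := by
    rw [integral_prod _ hbi, ← integral_const_mul]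
    refine integral_congr_ae (Eventually.of_forall fun p => ?_)
    simp only [hbig]
    rw [integral_const_mul, (laplace_bubble hM (hpos p.1 p.2)).2]
    ring
  -- regroup the variables
  have r1 := measurePreserving_prodAssoc μ (volume : Measure (ℝ × ℝ)) angleMeasure
  have r2 : MeasurePreserving (MeasurableEquiv.prodCongr (MeasurableEquiv.refl Ω)
      (MeasurableEquiv.prodComm (α := ℝ × ℝ) (β := ℝ × ℝ)))
      (μ.prod ((volume : Measure (ℝ × ℝ)).prod angleMeasure))
      (μ.prod (angleMeasure.prod (volume : Measure (ℝ × ℝ)))) :=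
    (MeasurePreserving.id μ).prod Measure.measurePreserving_swap
  have r3 := (measurePreserving_prodAssoc μ angleMeasure (volume : Measure (ℝ × ℝ))).symm _
  have r := r3.comp (r2.comp r1)
  set E := (MeasurableEquiv.prodAssoc (α := Ω) (β := ℝ × ℝ) (γ := ℝ × ℝ)).trans
    ((MeasurableEquiv.prodCongr (MeasurableEquiv.refl Ω)
      (MeasurableEquiv.prodComm (α := ℝ × ℝ) (β := ℝ × ℝ))).trans
      (MeasurableEquiv.prodAssoc (α := Ω) (β := ℝ × ℝ) (γ := ℝ × ℝ)).symm) with hE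
  have rE : MeasurePreserving E ((μ.prod volume).prod angleMeasure)
    ((μ.prod angleMeasure).prod volume) := r
  have hbi' : Integrable (fun p : (Ω × ℝ × ℝ) × ℝ × ℝ => big p.1.1 p.2 p.1.2)
      ((μ.prod angleMeasure).prod volume) :=
    (rE.integrable_comp_emb E.measurableEmbedding).1 hbi
  have e2 : ∫ p : (Ω × ℝ × ℝ) × ℝ × ℝ, big p.1.1 p.2 p.1.2 ∂((μ.prod angleMeasure).prod volume) =
      ∫ p : (Ω × ℝ × ℝ) × ℝ × ℝ, big p.1.1 p.1.2 p.2 ∂((μ.prod volume).prod angleMeasure) :=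
    (rE.integral_comp' (fun p : (Ω × ℝ × ℝ) × ℝ × ℝ => big p.1.1 p.2 p.1.2)).symm
  have hae : ∀ᵐ p ∂(μ.prod angleMeasure), p.2.2 ∈ Ioo (-1 : ℝ) 1 := by
    have h1 : ∀ᵐ q ∂angleMeasure, q.2 ∈ Ioo (-1 : ℝ) 1 :=
      Measure.quasiMeasurePreserving_snd.ae (ae_restrict_mem measurableSet_Ioo)
    exact Measure.quasiMeasurePreserving_snd.ae h1
  have hfib : ∀ᵐ p ∂(μ.prod angleMeasure), ∫ x : ℝ × ℝ, big p.1 x p.2 =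
      Complex.Gamma ν₁ * Complex.Gamma ν₄ * (g p.1 *
      cexp (-((A p.1 * modU p.2.1 p.2.2 + B p.1 * Real.exp p.2.1 : ℝ) : ℂ)) *
      (cexp ((M - ν₄) * p.2.1) * (rho M p.2.2 * (modU p.2.1 p.2.2 : ℂ) ^ (-ν₁)))) := by
    filter_upwards [hae] with p hp
    have s1 := (integrable_and_integral_exp_mul_exp_neg h₁ (modU_pos p.2.1 hp)).2
    have s4 := (integrable_and_integral_exp_mul_exp_neg h₄ (Real.exp_pos p.2.1)).2
    have s := integral_prod_mul (μ := (volume : Measure ℝ)) (ν := (volume : Measure ℝ))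
      (fun x : ℝ => cexp (ν₁ * x) * cexp (-((modU p.2.1 p.2.2 * Real.exp x : ℝ) : ℂ)))
      (fun x : ℝ => cexp (ν₄ * x) * cexp (-((Real.exp p.2.1 * Real.exp x : ℝ) : ℂ)))
    rw [s1, s4, ofReal_exp_cpow] at s
    have e3 : ∀ x : ℝ × ℝ, big p.1 x p.2 = (g p.1 * cexp (M * p.2.1) * rho M p.2.2 *
        cexp (-((A p.1 * modU p.2.1 p.2.2 + B p.1 * Real.exp p.2.1 : ℝ) : ℂ))) *
        ((cexp (ν₁ * x.1) * cexp (-((modU p.2.1 p.2.2 * Real.exp x.1 : ℝ) : ℂ))) *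
          (cexp (ν₄ * x.2) * cexp (-((Real.exp p.2.1 * Real.exp x.2 : ℝ) : ℂ)))) := fun x => by
      simp only [hbig, laplaceKernel]
      have e4 : (Real.exp x.1 + A p.1) * modU p.2.1 p.2.2 + (Real.exp x.2 + B p.1) * Real.exp p.2.1 =
          (A p.1 * modU p.2.1 p.2.2 + B p.1 * Real.exp p.2.1) +
          (modU p.2.1 p.2.2 * Real.exp x.1 + Real.exp p.2.1 * Real.exp x.2) := by ring
      rw [e4, Complex.ofReal_add (_ + _) (_ + _), Complex.ofReal_add (modU _ _ * _), neg_add, neg_add,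
        Complex.exp_add, Complex.exp_add, Complex.exp_add]
      ring
    simp only [e3]
    rw [integral_const_mul]
    refine (congrArg _ s).trans ?_
    rw [sub_mul, sub_eq_add_neg, Complex.exp_add, ← neg_mul]
    ring
  have hGG : Complex.Gamma ν₁ * Complex.Gamma ν₄ ≠ 0 :=
    mul_ne_zero (Complex.Gamma_ne_zero_of_re_pos h₁) (Complex.Gamma_ne_zero_of_re_pos h₄)
  refine ⟨?_, ?_⟩
  · exact (integrable_const_mul_iff (isUnit_iff_ne_zero.2 hGG) _).1
      (hbi'.integral_prod_left.congr hfib)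
  · rw [← e1, ← e2, integral_prod _ hbi', integral_congr_ae hfib, integral_const_mul]

end Mellin

/-! ### The bubble and the two-loop integral as Fourier integrals in the second index -/

/-- The integral over the angular variable. -/
def angular (M : ℂ) (V : ℝ → ℝ → ℂ) (t : ℝ) : ℂ :=
  ∫ w in Ioo (-1 : ℝ) 1, rho M w * V (modU t w) (Real.exp t)

/-- The index `ν₄` occurs only in the exponential, so along a vertical line the integral is a
Fourier transform in `t = log v` of the angular average. -/
lemma mellin_eq_angular {Ω : Type*} [MeasurableSpace Ω] {μ : Measure Ω} [SFinite μ] {M ν₁ ν₄ : ℂ}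
    (hM : 1 / 2 < M.re) (h₁ : 0 < ν₁.re) (h₄ : 0 < ν₄.re)
    {g : Ω → ℂ} (hg : Measurable g) {A B : Ω → ℝ} (hA : Measurable A) (hB : Measurable B)
    (hA0 : ∀ y, 0 ≤ A y) (hB0 : ∀ y, 0 ≤ B y)
    (hint : Integrable (fun p : Ω × ℝ × ℝ => g p.1 * (cexp (ν₁ * p.2.1 + ν₄ * p.2.2) *
      Phi M (Real.exp p.2.1 + A p.1) (Real.exp p.2.2 + B p.1))) (μ.prod volume))
    {V : ℝ → ℝ → ℂ} (hV : ∀ u v : ℝ, V u v =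
      (u : ℂ) ^ (-ν₁) * ∫ y, g y * cexp (-((A y * u + B y * v : ℝ) : ℂ)) ∂μ) :
    Integrable (fun t : ℝ => cexp ((M - ν₄) * t) * angular M V t) ∧
    (Complex.Gamma ν₁)⁻¹ * (Complex.Gamma ν₄)⁻¹ * ∫ p : Ω × ℝ × ℝ, g p.1 *
      (cexp (ν₁ * p.2.1 + ν₄ * p.2.2) *
      Phi M (Real.exp p.2.1 + A p.1) (Real.exp p.2.2 + B p.1)) ∂(μ.prod volume) =
    (laplaceConst M)⁻¹ * ∫ t : ℝ, cexp ((M - ν₄) * t) * angular M V t := by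
  obtain ⟨i, e⟩ := laplace_mellin hM h₁ h₄ hg hA hB hA0 hB0 hint
  have hfib : ∀ q : ℝ × ℝ, ∫ y, g y *
      cexp (-((A y * modU q.1 q.2 + B y * Real.exp q.1 : ℝ) : ℂ)) *
      (cexp ((M - ν₄) * q.1) * (rho M q.2 * (modU q.1 q.2 : ℂ) ^ (-ν₁))) ∂μ =
      cexp ((M - ν₄) * q.1) * (rho M q.2 * V (modU q.1 q.2) (Real.exp q.1)) := fun q => by
    rw [integral_mul_const, hV]
    ring
  have i1 := i.integral_prod_right
  simp only [hfib] at i1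
  have e1 := integral_prod_symm _ i
  simp only [hfib] at e1
  rw [e1] at e
  rw [angleMeasure] at i1 e
  have i2 := i1.integral_prod_left
  rw [integral_prod _ i1] at e
  simp only [integral_const_mul] at i2 e
  refine ⟨i2, ?_⟩
  have hZ := laplaceConst_ne_zero hM
  have h1 := Complex.Gamma_ne_zero_of_re_pos h₁
  have h4 := Complex.Gamma_ne_zero_of_re_pos h₄
  simp only [angular]
  generalize (∫ p : Ω × ℝ × ℝ, g p.1 * (cexp (ν₁ * p.2.1 + ν₄ * p.2.2) *
      Phi M (Real.exp p.2.1 + A p.1) (Real.exp p.2.2 + B p.1)) ∂(μ.prod volume)) = X at e ⊢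
  generalize (∫ t : ℝ, cexp ((M - ν₄) * t) * _) = Y at e ⊢
  generalize Complex.Gamma ν₁ = G₁ at *
  generalize Complex.Gamma ν₄ = G₄ at *
  field_simp
  linear_combination e

variable {m : ℤ} {ε ν₁ ν₂ ν₃ ν₄ ν₅ : ℂ} {P : ℝ}

/-- The bubble is the case of a one-point parameter space without shifts. The factor `1` brings it
to the form shared with the two-loop integral, where the triangle stands in its place. -/
lemma bubble_eq_angular (hP : 0 < P) (hM : 1 / 2 < ((m : ℂ) - ε).re)
    (h : ((m : ℂ) - ε).re < (ν₁ + ν₄).re)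
    (h₁ : ν₁.re < ((m : ℂ) - ε).re) (h₄ : ν₄.re < ((m : ℂ) - ε).re) :
    Integrable (fun t : ℝ => cexp ((m - ε - ν₄) * t) *
      angular (m - ε) (fun u _ => (u : ℂ) ^ (-ν₁) * 1) t) ∧
    bubble m ε P ν₁ ν₄ = (cGamma ε)⁻¹ * (laplaceConst (m - ε))⁻¹ *
      ∫ t : ℝ, cexp ((m - ε - ν₄) * t) *
        angular (m - ε) (fun u _ => (u : ℂ) ^ (-ν₁) * 1) t := by
  have hb := (bubbleConverges_iff hP).1 (bubble_converges_and_eq hP h h₁ h₄).1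
  have hpos : 0 < ν₁.re ∧ 0 < ν₄.re := by rw [add_re] at h; constructor <;> linarith
  have k := mellin_eq_angular (μ := Measure.dirac ()) (g := fun _ => 1) (A := fun _ => 0)
    (B := fun _ => 0) hM hpos.1 hpos.2 measurable_const measurable_const measurable_const
    (fun _ => le_rfl) (fun _ => le_rfl)
    (by simpa only [one_mul, add_zero, bubbleLog] using hb.comp_snd (Measure.dirac ()))
    (V := fun u _ => (u : ℂ) ^ (-ν₁) * 1) (fun u v => by simp)
  refine ⟨k.1, ?_⟩
  rw [bubble_eq hP, mul_assoc (cGamma ε)⁻¹, ← k.2]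
  simp only [one_mul, add_zero]
  rw [integral_fun_snd (μ := Measure.dirac ()) (fun x : ℝ × ℝ => cexp (ν₁ * x.1 + ν₄ * x.2) *
      Phi (m - ε) (Real.exp x.1) (Real.exp x.2))]
  simp [bubbleLog]

lemma twoLoop_eq_angular (hP : 0 < P) (hM : 1 / 2 < ((m : ℂ) - ε).re)
    (hq : (ε, ![ν₁, ν₂, ν₃, ν₄, ν₅]) ∈ convergenceRegion m) :
    Integrable (fun t : ℝ => cexp ((m - ε - ν₄) * t) * angular (m - ε)
      (fun u v => (u : ℂ) ^ (-ν₁) * ∫ w, triangleLog (m - ε) ν₂ ν₃ ν₅ u v w) t) ∧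
    twoLoop m ε P ν₁ ν₂ ν₃ ν₄ ν₅ = (cGamma ε ^ 2)⁻¹ * ((Complex.Gamma ν₂)⁻¹ *
      (Complex.Gamma ν₃)⁻¹ * (Complex.Gamma ν₅)⁻¹) * (laplaceConst (m - ε))⁻¹ *
      ∫ t : ℝ, cexp ((m - ε - ν₄) * t) * angular (m - ε)
        (fun u v => (u : ℂ) ^ (-ν₁) * ∫ w, triangleLog (m - ε) ν₂ ν₃ ν₅ u v w) t := by
  have hb := (twoLoopConverges_iff hP).1 (twoLoopConverges_of_mem hP hq)
  have k := mellin_eq_angular (μ := volume) (g := triWeight (m - ε) ν₂ ν₃ ν₅) (A := triA)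
    (B := triB) hM (hq.1 0).1 (hq.1 3).1 (measurable_triWeight _ _ _ _) measurable_triA
    measurable_triB (fun y => (triA_pos y).le) (fun y => (triB_pos y).le) hb
    (V := fun u v => (u : ℂ) ^ (-ν₁) * ∫ w, triangleLog (m - ε) ν₂ ν₃ ν₅ u v w) (fun u v => rfl)
  refine ⟨k.1, ?_⟩
  have k2 := k.2
  rw [twoLoop_eq hP, mul_assoc ((cGamma ε ^ 2)⁻¹ * _) _ (∫ _, _)]
  refine Eq.trans ?_ (congrArg _ k2)
  change _ = _ * ((Complex.Gamma ν₁)⁻¹ * (Complex.Gamma ν₄)⁻¹ *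
    ∫ p, twoLoopLog (m - ε) ν₁ ν₂ ν₃ ν₄ ν₅ p)
  ring

/-! ### Functions of two distances with a power-like singularity in the first one -/

/-- `V u v` grows at most like `u ^ (-κ)` for small `u`, locally uniformly in `v > 0`, with a
corresponding Lipschitz estimate. -/
structure Tame (V : ℝ → ℝ → ℂ) (κ : ℝ) : Prop where
  measurable : Measurable fun p : ℝ × ℝ => V p.1 p.2
  bound : ∀ U v₁ : ℝ, 0 < v₁ → ∃ C, 0 ≤ C ∧ ∀ u v : ℝ, 0 < u → u ≤ U → v₁ ≤ v →
    ‖V u v‖ ≤ C * u ^ (-κ)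
  lipschitz : ∀ U v₁ : ℝ, 0 < v₁ → ∃ C, 0 ≤ C ∧ ∀ a u u' v v' : ℝ, 0 < a → a ≤ u → a ≤ u' →
    u ≤ U → u' ≤ U → v₁ ≤ v → v₁ ≤ v' →
    ‖V u v - V u' v'‖ ≤ C * a ^ (-κ) * (|u - u'| / a + |v - v'|)

lemma tame_const (c : ℂ) {κ : ℝ} (hκ : 0 ≤ κ) : Tame (fun _ _ => c) κ where
  measurable := measurable_const
  bound U v₁ _ := ⟨‖c‖ * |U| ^ κ, by positivity, fun u v hu hU _ => by
    have h1 : 1 ≤ |U| ^ κ * u ^ (-κ) := by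
      rw [Real.rpow_neg hu.le, ← div_eq_mul_inv, ← Real.div_rpow (abs_nonneg _) hu.le]
      refine Real.one_le_rpow ?_ hκ
      rw [one_le_div hu]
      exact hU.trans (le_abs_self _)
    calc ‖c‖ = ‖c‖ * 1 := (mul_one _).symm
      _ ≤ ‖c‖ * (|U| ^ κ * u ^ (-κ)) := by gcongr
      _ = _ := by ring⟩
  lipschitz U v₁ _ := ⟨0, le_rfl, fun a u u' v v' _ _ _ _ _ _ _ => by simp⟩

lemma norm_cpow_neg_sub_le {ν : ℂ} (hν : 0 ≤ ν.re) {a u u' : ℝ} (ha : 0 < a) (hu : a ≤ u)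
    (hu' : a ≤ u') : ‖(u : ℂ) ^ (-ν) - (u' : ℂ) ^ (-ν)‖ ≤ ‖ν‖ * a ^ (-ν.re - 1) * |u - u'| := by
  have h := Convex.norm_image_sub_le_of_norm_hasDerivWithin_le (𝕜 := ℝ) (s := Ici a)
    (f := fun x : ℝ => (x : ℂ) ^ (-ν)) (f' := fun x : ℝ => -ν * (x : ℂ) ^ (-ν - 1))
    (C := ‖ν‖ * a ^ (-ν.re - 1)) (x := u') (y := u) (fun x hx => ?_) (fun x hx => ?_)
    (convex_Ici a) hu' hu
  · simpa only [Real.norm_eq_abs] using h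
  · have hx0 : 0 < x := ha.trans_le hx
    have h1 : HasDerivAt (fun z : ℂ => z ^ (-ν)) (-ν * (x : ℂ) ^ (-ν - 1) * 1) (x : ℂ) :=
      (hasDerivAt_id _).cpow_const (Or.inl (by simpa using hx0))
    simpa using h1.comp_ofReal.hasDerivWithinAt
  · have hx0 : 0 < x := ha.trans_le hx
    rw [norm_mul, norm_neg, norm_ofReal_cpow hx0]
    have : (-ν - 1).re = -ν.re - 1 := by simp
    rw [this]
    gcongr ‖ν‖ * ?_
    exact Real.rpow_le_rpow_of_nonpos ha hx (by linarith)

lemma Tame.cpow_mul {V : ℝ → ℝ → ℂ} {κ : ℝ} (h : Tame V κ) (hκ : 0 ≤ κ) {ν : ℂ} (hν : 0 ≤ ν.re) :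
    Tame (fun u v => (u : ℂ) ^ (-ν) * V u v) (ν.re + κ) where
  measurable := ((Complex.measurable_ofReal.comp measurable_fst).pow_const _).mul h.measurable
  bound U v₁ hv₁ := by
    obtain ⟨C, hC, hb⟩ := h.bound U v₁ hv₁
    refine ⟨C, hC, fun u v hu hU hv => ?_⟩
    rw [norm_mul, norm_ofReal_cpow hu, neg_re, neg_add, Real.rpow_add hu]
    calc u ^ (-ν.re) * ‖V u v‖ ≤ u ^ (-ν.re) * (C * u ^ (-κ)) := by
          gcongr; exact hb u v hu hU hv
      _ = _ := by ring
  lipschitz U v₁ hv₁ := by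
    obtain ⟨C, hC, hb⟩ := h.bound U v₁ hv₁
    obtain ⟨L, hL, hl⟩ := h.lipschitz U v₁ hv₁
    refine ⟨‖ν‖ * C + L, by positivity, fun a u u' v v' ha hu hu' hU hU' hv hv' => ?_⟩
    have hu0 := ha.trans_le hu
    have hu0' := ha.trans_le hu'
    have e : (u : ℂ) ^ (-ν) * V u v - (u' : ℂ) ^ (-ν) * V u' v' =
        ((u : ℂ) ^ (-ν) - (u' : ℂ) ^ (-ν)) * V u v + (u' : ℂ) ^ (-ν) * (V u v - V u' v') := by ring
    have h1 := norm_cpow_neg_sub_le hν ha hu hu'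
    have h2 : ‖V u v‖ ≤ C * a ^ (-κ) := (hb u v hu0 hU hv).trans (by
      gcongr ?_ * ?_
      exact Real.rpow_le_rpow_of_nonpos ha hu (by linarith))
    have h3 : ‖(u' : ℂ) ^ (-ν)‖ ≤ a ^ (-ν.re) := by
      rw [norm_ofReal_cpow hu0', neg_re]
      exact Real.rpow_le_rpow_of_nonpos ha hu' (by linarith)
    have h4 := hl a u u' v v' ha hu hu' hU hU' hv hv'
    have p1 := Real.rpow_pos_of_pos ha (-ν.re)
    have p2 := Real.rpow_pos_of_pos ha (-κ)
    rw [e]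
    refine (norm_add_le _ _).trans ?_
    rw [norm_mul, norm_mul]
    refine (add_le_add (mul_le_mul h1 h2 (norm_nonneg _) (by positivity))
      (mul_le_mul h3 h4 (norm_nonneg _) p1.le)).trans ?_
    rw [Real.rpow_sub_one ha.ne', neg_add, Real.rpow_add ha]
    set X := |u - u'| / a
    have hX : 0 ≤ X := by positivity
    have hY := abs_nonneg (v - v')
    calc ‖ν‖ * (a ^ (-ν.re) / a) * |u - u'| * (C * a ^ (-κ)) +
          a ^ (-ν.re) * (L * a ^ (-κ) * (X + |v - v'|))
        = (a ^ (-ν.re) * a ^ (-κ)) * (‖ν‖ * C * X + L * (X + |v - v'|)) := by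
          simp only [X]; ring
      _ ≤ (a ^ (-ν.re) * a ^ (-κ)) * (‖ν‖ * C * (X + |v - v'|) + L * (X + |v - v'|)) := by
          gcongr; linarith
      _ = _ := by ring

lemma abs_exp_neg_sub_le {b x y : ℝ} (hx : b ≤ x) (hy : b ≤ y) :
    |Real.exp (-x) - Real.exp (-y)| ≤ Real.exp (-b) * |x - y| := by
  have h := Convex.norm_image_sub_le_of_norm_hasDerivWithin_le (𝕜 := ℝ) (s := Ici b)
    (f := fun x : ℝ => Real.exp (-x)) (f' := fun x : ℝ => Real.exp (-x) * -1)
    (C := Real.exp (-b)) (x := y) (y := x)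
    (fun z _ => ((hasDerivAt_neg z).exp).hasDerivWithinAt) (fun z hz => ?_) (convex_Ici b) hy hx
  · simpa only [Real.norm_eq_abs] using h
  · rw [norm_mul, norm_neg, norm_one, mul_one, Real.norm_eq_abs, Real.abs_exp]
    exact Real.exp_le_exp.2 (neg_le_neg hz)

variable {M ν₂ ν₃ ν₅ : ℂ}

/-- Differences of the exponential bring down `triA` or `triB`; these are absorbed by half of the
exponential decay, hence the halved arguments on the right. -/
lemma norm_triangleLog_sub_le {a v₁ u u' v v' : ℝ} (ha : 0 < a) (hv₁ : 0 < v₁) (hu : a ≤ u)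
    (hu' : a ≤ u') (hv : v₁ ≤ v) (hv' : v₁ ≤ v') (w : ℝ × ℝ × ℝ) :
    ‖triangleLog M ν₂ ν₃ ν₅ u v w - triangleLog M ν₂ ν₃ ν₅ u' v' w‖ ≤
      ‖triangleLog M ν₂ ν₃ ν₅ (a / 2) (v₁ / 2) w‖ * ((2 + 2 / v₁) * (|u - u'| / a + |v - v'|)) := by
  have hA := triA_pos w
  have hB := triB_pos w
  rw [triangleLog, triangleLog, ← mul_sub, norm_mul, norm_triangleLog, mul_assoc]
  gcongr ‖triWeight _ _ _ _ _‖ * ?_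
  set A := triA w
  set B := triB w
  have e : cexp (-((A * u + B * v : ℝ) : ℂ)) - cexp (-((A * u' + B * v' : ℝ) : ℂ)) =
      ((Real.exp (-(A * u + B * v)) - Real.exp (-(A * u' + B * v')) : ℝ) : ℂ) := by push_cast; ring
  rw [e, Complex.norm_real, Real.norm_eq_abs]
  refine (abs_exp_neg_sub_le (b := A * a + B * v₁) (by gcongr) (by gcongr)).trans ?_
  have h1 : |A * u + B * v - (A * u' + B * v')| ≤ A * |u - u'| + B * |v - v'| := by
    rw [show A * u + B * v - (A * u' + B * v') = A * (u - u') + B * (v - v') by ring]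
    refine (abs_add_le _ _).trans ?_
    rw [abs_mul, abs_mul, abs_of_pos hA, abs_of_pos hB]
  set E := A * (a / 2) + B * (v₁ / 2) with hE
  have h2 : E ≤ Real.exp E := by linarith [Real.add_one_le_exp E]
  have h3 : Real.exp (-(A * a + B * v₁)) = Real.exp (-E) * Real.exp (-E) := by
    rw [← Real.exp_add]; congr 1; rw [hE]; ring
  have h4 : Real.exp (-E) * Real.exp E = 1 := by rw [← Real.exp_add]; simp
  have hX : 0 ≤ |u - u'| / a := by positivity
  have hY := abs_nonneg (v - v')
  have h5 : A * |u - u'| + B * |v - v'| ≤ Real.exp E * ((2 + 2 / v₁) * (|u - u'| / a + |v - v'|)) := by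
    have k1 : A * |u - u'| = (A * (a / 2)) * (2 * (|u - u'| / a)) := by field_simp
    have k2 : B * |v - v'| = (B * (v₁ / 2)) * (2 / v₁ * |v - v'|) := by field_simp
    have k3 : A * (a / 2) ≤ Real.exp E := le_trans (by rw [hE]; nlinarith) h2
    have k4 : B * (v₁ / 2) ≤ Real.exp E := le_trans (by rw [hE]; nlinarith) h2
    have hv2 : 0 ≤ 2 / v₁ := by positivity
    rw [k1, k2]
    refine (add_le_add (mul_le_mul_of_nonneg_right k3 (by positivity))
      (mul_le_mul_of_nonneg_right k4 (by positivity))).trans ?_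
    rw [← mul_add]
    gcongr
    nlinarith [mul_nonneg hv2 hX]
  rw [h3]
  calc Real.exp (-E) * Real.exp (-E) * |A * u + B * v - (A * u' + B * v')|
      ≤ Real.exp (-E) * Real.exp (-E) *
        (Real.exp E * ((2 + 2 / v₁) * (|u - u'| / a + |v - v'|))) := by
        gcongr; exact h1.trans h5
    _ = Real.exp (-E) * (Real.exp (-E) * Real.exp E) *
        ((2 + 2 / v₁) * (|u - u'| / a + |v - v'|)) := by ring
    _ = _ := by rw [h4, mul_one]

lemma tame_triangle (h : TriConv M ν₂ ν₃ ν₅) {κ : ℝ} (hκ : 0 < κ)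
    (hκ' : (ν₂ + ν₅).re - M.re < κ) :
    Tame (fun u v => ∫ w, triangleLog M ν₂ ν₃ ν₅ u v w) κ where
  measurable := by
    have m1 := measurable_triA
    have m2 := measurable_triB
    have m3 := measurable_triWeight M ν₂ ν₃ ν₅
    have : Measurable fun p : (ℝ × ℝ) × ℝ × ℝ × ℝ => triangleLog M ν₂ ν₃ ν₅ p.1.1 p.1.2 p.2 := by
      unfold triangleLog
      fun_prop
    exact this.stronglyMeasurable.integral_prod_right.measurable
  bound U v₁ hv₁ := by
    obtain ⟨C, hC⟩ := exists_triBound h hκ hκ' (U := U) hv₁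
    refine ⟨max C 0, le_max_right _ _, fun u v hu hU hv => ?_⟩
    refine (norm_integral_le_integral_norm _).trans ((hC u v hu hU hv).2.trans ?_)
    gcongr
    exact le_max_left _ _
  lipschitz U v₁ hv₁ := by
    obtain ⟨C, hC⟩ := exists_triBound h hκ hκ' (U := U) (half_pos hv₁)
    refine ⟨max C 0 * 2 ^ κ * (2 + 2 / v₁), by positivity,
      fun a u u' v v' ha hu hu' hU hU' hv hv' => ?_⟩
    have i1 := (hC u v (ha.trans_le hu) hU (by linarith)).1
    have i2 := (hC u' v' (ha.trans_le hu') hU' (by linarith)).1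
    obtain ⟨i3, b3⟩ := hC (a / 2) (v₁ / 2) (half_pos ha) (by linarith) le_rfl
    rw [← integral_sub i1 i2]
    refine (norm_integral_le_of_norm_le (i3.norm.mul_const _) (Eventually.of_forall fun w =>
      norm_triangleLog_sub_le ha hv₁ hu hu' hv hv' w)).trans ?_
    rw [integral_mul_const]
    have e : (a / 2) ^ (-κ) = a ^ (-κ) * 2 ^ κ := by
      rw [Real.div_rpow ha.le two_pos.le, Real.rpow_neg two_pos.le, div_inv_eq_mul]
    rw [e] at b3
    have hp := Real.rpow_pos_of_pos ha (-κ)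
    calc _ ≤ max C 0 * (a ^ (-κ) * 2 ^ κ) * ((2 + 2 / v₁) * (|u - u'| / a + |v - v'|)) := by
          gcongr
          exact b3.trans (by gcongr; exact le_max_left _ _)
      _ = _ := by ring

/-! ### Hölder continuity at a point -/

/-- Hölder continuity at a point with some positive exponent. -/
def HoelderAt (g : ℝ → ℂ) (t₀ : ℝ) : Prop :=
  ∃ δ : ℝ, 0 < δ ∧ (fun t => g t - g t₀) =O[𝓝 t₀] fun t => |t - t₀| ^ δ

lemma isBigO_abs_rpow (t₀ : ℝ) {δ δ' : ℝ} (h : δ ≤ δ') (hδ : 0 < δ) :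
    (fun t : ℝ => |t - t₀| ^ δ') =O[𝓝 t₀] fun t => |t - t₀| ^ δ := by
  refine Asymptotics.IsBigO.of_bound 1 ?_
  filter_upwards [Metric.ball_mem_nhds t₀ one_pos] with t ht
  rw [Metric.mem_ball, Real.dist_eq] at ht
  have h0 := abs_nonneg (t - t₀)
  rw [Real.norm_of_nonneg (by positivity), Real.norm_of_nonneg (by positivity), one_mul]
  rcases h0.eq_or_lt with h1 | h1
  · rw [← h1, Real.zero_rpow hδ.ne', Real.zero_rpow (hδ.trans_le h).ne']
  · exact Real.rpow_le_rpow_of_exponent_ge h1 ht.le h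

lemma HoelderAt.continuousAt {g : ℝ → ℂ} {t₀ : ℝ} (h : HoelderAt g t₀) : ContinuousAt g t₀ := by
  obtain ⟨δ, hδ, h⟩ := h
  have h1 : Tendsto (fun t : ℝ => |t - t₀| ^ δ) (𝓝 t₀) (𝓝 0) := by
    have : ContinuousAt (fun t : ℝ => |t - t₀| ^ δ) t₀ :=
      ContinuousAt.rpow_const (by fun_prop) (Or.inr hδ.le)
    simpa [ContinuousAt, hδ.ne'] using this
  have h2 := (h.trans_tendsto h1).add_const (g t₀)
  simpa [ContinuousAt] using h2

lemma HoelderAt.mul {f g : ℝ → ℂ} {t₀ : ℝ} (hf : HoelderAt f t₀) (hg : HoelderAt g t₀) :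
    HoelderAt (fun t => f t * g t) t₀ := by
  have hc : g =O[𝓝 t₀] fun _ => (1 : ℝ) := hg.continuousAt.isBigO_one ℝ
  obtain ⟨δ₁, h₁, hf⟩ := hf
  obtain ⟨δ₂, h₂, hg⟩ := hg
  refine ⟨min δ₁ δ₂, lt_min h₁ h₂, ?_⟩
  have e : (fun t => f t * g t - f t₀ * g t₀) =
      fun t => (f t - f t₀) * g t + f t₀ * (g t - g t₀) := by funext t; ring
  rw [e]
  have k1 := (hf.trans (isBigO_abs_rpow t₀ (min_le_left δ₁ δ₂) (lt_min h₁ h₂))).mul hc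
  simp only [mul_one] at k1
  exact k1.add ((hg.trans (isBigO_abs_rpow t₀ (min_le_right δ₁ δ₂) (lt_min h₁ h₂))).const_mul_left _)

lemma HoelderAt.congr {f g : ℝ → ℂ} {t₀ : ℝ} (hf : HoelderAt f t₀) (h : f =ᶠ[𝓝 t₀] g) :
    HoelderAt g t₀ := by
  obtain ⟨δ, hδ, hf⟩ := hf
  refine ⟨δ, hδ, hf.congr' ?_ EventuallyEq.rfl⟩
  filter_upwards [h] with t ht
  rw [ht, h.eq_of_nhds]

lemma hoelderAt_of_isBigO {g : ℝ → ℂ} {t₀ : ℝ}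
    (h : (fun t => g t - g t₀) =O[𝓝 t₀] fun t => t - t₀) : HoelderAt g t₀ :=
  ⟨1, one_pos, by simpa only [Real.rpow_one] using h.abs_right⟩

lemma hoelderAt_of_differentiableAt {g : ℝ → ℂ} {t₀ : ℝ} (h : DifferentiableAt ℝ g t₀) :
    HoelderAt g t₀ := hoelderAt_of_isBigO h.isBigO_sub

lemma hasVerticalIntegral_of_lineFourier {G : ℝ → ℂ} (hG : Integrable G) {t₀ : ℝ}
    (h : HoelderAt G t₀) {γ : ℝ} {f : ℂ → ℂ} {a : ℂ}
    (hf : ∀ s : ℝ, f (verticalLine γ s) = a * (cexp ((s * t₀ : ℝ) * I) * lineFourier G s)) :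
    HasVerticalIntegral γ f (2 * Real.pi * I * (a * G t₀)) := by
  simp only [HasVerticalIntegral, hf]
  have hc := continuous_lineFourier hG
  refine ⟨fun T => (by fun_prop : Continuous _).intervalIntegrable _ _, ?_⟩
  obtain ⟨δ, hδ, h⟩ := h
  obtain ⟨C, hC⟩ := h.bound
  obtain ⟨r, hr, hb⟩ := Metric.eventually_nhds_iff.1 hC
  have k := tendsto_integral_lineFourier hG hδ (half_pos hr) (C := C) (t₀ := t₀) fun t ht => by
    have := hb (y := t) (by rw [Real.dist_eq]; linarith)
    rwa [Real.norm_of_nonneg (by positivity)] at this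
  have k2 := k.const_mul (a * I)
  rw [show a * I * (2 * Real.pi * G t₀) = 2 * Real.pi * I * (a * G t₀) by ring] at k2
  refine k2.congr fun T => ?_
  rw [← intervalIntegral.integral_const_mul]
  congr 1
  funext s
  ring

/-! ### Hölder continuity of the angular integral -/

lemma integrableOn_jacobi {p q : ℝ} (hp : -1 < p) (hq : -1 < q) :
    IntegrableOn (fun w : ℝ => (1 - w) ^ p * (1 + w) ^ q) (Ioo (-1) 1) := by
  have h := (Complex.betaIntegral_convergent (u := ((q + 1 : ℝ) : ℂ)) (v := ((p + 1 : ℝ) : ℂ))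
    (by rw [Complex.ofReal_re]; linarith) (by rw [Complex.ofReal_re]; linarith)).norm
  have h1 := (h.comp_mul_left (c := 1 / 2)).comp_add_right 1
  norm_num only at h1
  rw [intervalIntegrable_iff_integrableOn_Ioo_of_le (by norm_num)] at h1
  refine IntegrableOn.congr_fun (h1.const_mul (2 ^ q * 2 ^ p)) (fun w hw => ?_) measurableSet_Ioo
  have e1 : (0 : ℝ) < 1 / 2 * (w + 1) := by linarith [hw.1]
  have e2 : (0 : ℝ) < 1 - 1 / 2 * (w + 1) := by linarith [hw.2]
  have e3 : (1 : ℂ) - ((1 / 2 * (w + 1) : ℝ) : ℂ) = ((1 - 1 / 2 * (w + 1) : ℝ) : ℂ) := by push_cast; ring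
  rw [norm_mul, e3, norm_ofReal_cpow e1, norm_ofReal_cpow e2]
  simp only [sub_re, Complex.ofReal_re, one_re, add_sub_cancel_right]
  rw [show (1 : ℝ) - w = 2 * (1 - 1 / 2 * (w + 1)) by ring, show (1 : ℝ) + w = 2 * (1 / 2 * (w + 1)) by ring,
    Real.mul_rpow two_pos.le e2.le, Real.mul_rpow two_pos.le e1.le]
  ring

lemma norm_rho (M : ℂ) {w : ℝ} (hw : w ∈ Ioo (-1 : ℝ) 1) :
    ‖rho M w‖ = (1 - w) ^ (M.re - 3 / 2) * (1 + w) ^ (M.re - 3 / 2) := by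
  rw [rho, norm_ofReal_cpow (one_sub_sq_pos hw), ← Real.mul_rpow (by linarith [hw.2])
    (by linarith [hw.1])]
  congr 1
  · ring
  · simp

/-- A convex combination of the values at `w = 1` and `w = -1`: on the closed interval it vanishes
only for `t = 0` and `w = -1`. -/
lemma modU_eq' (t w : ℝ) : modU t w =
    (1 + w) / 2 * (1 + Real.exp (t / 2)) ^ 2 + (1 - w) / 2 * (1 - Real.exp (t / 2)) ^ 2 := by
  rw [modU]; linear_combination -exp_half_sq t

/-- For `t₀ ≠ 0` the function `modU t₀` is bounded away from zero and only the angular density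
matters. For `t₀ = 0` it equals `2 (1 + w)`, and integrability at `w = -1` requires `θ + δ < Re M -
1/2`; this is the origin of the condition at `y = 1`. -/
lemma exists_modU_weight {M : ℂ} (hM : 1 / 2 < M.re) {θ t₀ : ℝ}
    (h : t₀ ≠ 0 ∨ θ < M.re - 1 / 2) : ∃ δ, 0 < δ ∧ δ ≤ 1 ∧
      IntegrableOn (fun w => ‖rho M w‖ * modU t₀ w ^ (-(θ + δ))) (Ioo (-1) 1) := by
  have hp : -1 < M.re - 3 / 2 := by linarith
  have hm : ∀ δ : ℝ, AEStronglyMeasurable (fun w => ‖rho M w‖ * modU t₀ w ^ (-(θ + δ)))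
      (volume.restrict (Ioo (-1) 1)) := fun δ => by
    have h1 := measurable_rho M
    have h2 : Measurable fun w => modU t₀ w := measurable_modU.comp (measurable_const.prodMk measurable_id)
    exact (by fun_prop : Measurable _).aestronglyMeasurable
  by_cases ht : t₀ = 0
  · replace h := h.resolve_left (not_not.2 ht)
    refine ⟨min 1 ((M.re - 1 / 2 - θ) / 2), lt_min one_pos (by linarith), min_le_left _ _, ?_⟩
    set δ := min 1 ((M.re - 1 / 2 - θ) / 2) with hδ
    have hδ' : δ ≤ (M.re - 1 / 2 - θ) / 2 := min_le_right _ _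
    refine IntegrableOn.congr_fun ((integrableOn_jacobi hp (q := M.re - 3 / 2 - (θ + δ))
      (by linarith)).const_mul (2 ^ (-(θ + δ)))) (fun w hw => ?_) measurableSet_Ioo
    have h1 : 0 < 1 + w := by linarith [hw.1]
    rw [norm_rho M hw, ht, show modU 0 w = 2 * (1 + w) by simp [modU]; ring,
      Real.mul_rpow two_pos.le h1.le, sub_eq_add_neg (M.re - 3 / 2) (θ + δ), Real.rpow_add h1]
    ring
  · refine ⟨1, one_pos, le_rfl, ?_⟩
    have hr : Real.exp (t₀ / 2) ≠ 1 := by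
      rw [Ne, Real.exp_eq_one_iff]; simpa using ht
    set c := (1 - Real.exp (t₀ / 2)) ^ 2 with hc
    have hc0 : 0 < c := by have : 1 - Real.exp (t₀ / 2) ≠ 0 := sub_ne_zero.2 hr.symm
                           positivity
    have hb : ∀ w ∈ Ioo (-1 : ℝ) 1, c ≤ modU t₀ w ∧ modU t₀ w ≤ (1 + Real.exp (t₀ / 2)) ^ 2 :=
      fun w hw => by
      have := Real.exp_pos (t₀ / 2)
      rw [modU, ← exp_half_sq t₀]
      exact ⟨by rw [hc]; nlinarith [hw.1], by nlinarith [hw.2]⟩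
    refine Integrable.mono' ((integrableOn_jacobi hp hp).mul_const
      (c ^ (-(θ + 1)) + ((1 + Real.exp (t₀ / 2)) ^ 2) ^ (-(θ + 1)))) (hm 1) ?_
    filter_upwards [ae_restrict_mem measurableSet_Ioo] with w hw
    obtain ⟨b1, b2⟩ := hb w hw
    have b0 := hc0.trans_le b1
    rw [norm_mul, norm_norm, norm_rho M hw, Real.norm_of_nonneg (by positivity)]
    have h1 : 0 ≤ 1 - w := by linarith [hw.2]
    have h2 : 0 ≤ 1 + w := by linarith [hw.1]
    gcongr ?_ * ?_
    rcases le_total 0 (-(θ + 1)) with h3 | h3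
    · exact (Real.rpow_le_rpow b0.le b2 h3).trans (le_add_of_nonneg_left (by positivity))
    · exact (Real.rpow_le_rpow_of_nonpos hc0 b1 h3).trans (le_add_of_nonneg_right (by positivity))

/-- The two end values in `modU_eq'` change little near `t₀`, so the comparison is uniform up to the
ends of the interval, even where `modU t₀` tends to zero. -/
lemma eventually_modU_le (t₀ : ℝ) :
    ∀ᶠ t in 𝓝 t₀, ∀ w ∈ Ioo (-1 : ℝ) 1, modU t₀ w ≤ 4 * modU t w := by
  have h1 : ∀ᶠ t in 𝓝 t₀, (1 + Real.exp (t₀ / 2)) ^ 2 ≤ 4 * (1 + Real.exp (t / 2)) ^ 2 := by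
    have hc : ContinuousAt (fun t : ℝ => 4 * (1 + Real.exp (t / 2)) ^ 2) t₀ := by fun_prop
    have hp : 0 < (1 + Real.exp (t₀ / 2)) ^ 2 := by positivity
    filter_upwards [hc.eventually (lt_mem_nhds (a := (1 + Real.exp (t₀ / 2)) ^ 2)
      (by linarith))] with t ht using ht.le
  have h2 : ∀ᶠ t in 𝓝 t₀, (1 - Real.exp (t₀ / 2)) ^ 2 ≤ 4 * (1 - Real.exp (t / 2)) ^ 2 := by
    rcases eq_or_ne (1 - Real.exp (t₀ / 2)) 0 with h0 | h0
    · filter_upwards with t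
      rw [h0, zero_pow two_ne_zero]; positivity
    have hc : ContinuousAt (fun t : ℝ => 4 * (1 - Real.exp (t / 2)) ^ 2) t₀ := by fun_prop
    have hp : 0 < (1 - Real.exp (t₀ / 2)) ^ 2 := by positivity
    filter_upwards [hc.eventually (lt_mem_nhds (a := (1 - Real.exp (t₀ / 2)) ^ 2)
      (by linarith))] with t ht using ht.le
  filter_upwards [h1, h2] with t k1 k2 w hw
  rw [modU_eq', modU_eq' t]
  nlinarith [mul_le_mul_of_nonneg_left k1 (by linarith [hw.1] : 0 ≤ (1 + w) / 2),
    mul_le_mul_of_nonneg_left k2 (by linarith [hw.2] : 0 ≤ (1 - w) / 2)]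

lemma abs_exp_sub_le {b x y : ℝ} (hx : x ≤ b) (hy : y ≤ b) :
    |Real.exp x - Real.exp y| ≤ Real.exp b * |x - y| := by
  have := abs_exp_neg_sub_le (neg_le_neg hx) (neg_le_neg hy)
  simpa [abs_sub_comm, neg_add_eq_sub] using this

/-- The Lipschitz estimate costs one extra power of `1 / u`, which the angular weight need not
afford. Interpolating it with the plain bound, as `min X 1 ≤ X ^ δ` for `X = |t - t₀| / a`, reduces
the cost to `u ^ (-δ)`. The scale `a = modU t₀ w / 4` lies below both distances that are compared.
-/
lemma hoelderAt_angular {M : ℂ} (hM : 1 / 2 < M.re) {θ t₀ : ℝ} (hθ : 0 ≤ θ)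
    (h : t₀ ≠ 0 ∨ θ < M.re - 1 / 2) {V : ℝ → ℝ → ℂ} (hV : Tame V θ) :
    HoelderAt (angular M V) t₀ := by
  obtain ⟨δ, hδ, hδ1, hi⟩ := exists_modU_weight hM h
  set E := Real.exp (|t₀| + 1) with hE
  have hE0 : 0 < E := Real.exp_pos _
  obtain ⟨C, hC, hb⟩ := hV.bound (1 + 3 * E) (Real.exp (-(|t₀| + 1))) (Real.exp_pos _)
  obtain ⟨L, hL, hl⟩ := hV.lipschitz (1 + 3 * E) (Real.exp (-(|t₀| + 1))) (Real.exp_pos _)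
  set K := 2 * C + L * (2 * E + E * (1 + 3 * E)) with hK
  have hloc : ∀ t, |t - t₀| ≤ 1 → ∀ w ∈ Ioo (-1 : ℝ) 1, modU t w ≤ 1 + 3 * E ∧
      Real.exp (-(|t₀| + 1)) ≤ Real.exp t ∧ |modU t w - modU t₀ w| ≤ 2 * E * |t - t₀| ∧
      |Real.exp t - Real.exp t₀| ≤ E * |t - t₀| := fun t ht w hw => by
    obtain ⟨ht1, ht2⟩ := abs_le.1 ht
    have a1 := le_abs_self t₀
    have a2 := neg_abs_le t₀
    have b1 : Real.exp (t / 2) ≤ E := Real.exp_le_exp.2 (by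
      linarith [abs_nonneg t₀])
    have b2 : Real.exp t ≤ E := Real.exp_le_exp.2 (by linarith)
    have b3 := abs_exp_sub_le (b := |t₀| + 1) (x := t) (y := t₀) (by linarith) (by linarith)
    have b4 := abs_exp_sub_le (b := |t₀| + 1) (x := t / 2) (y := t₀ / 2)
      (by linarith [abs_nonneg t₀]) (by linarith [abs_nonneg t₀])
    have b5 := Real.exp_pos (t / 2)
    have hw1 : |w| ≤ 1 := abs_le.2 ⟨hw.1.le, hw.2.le⟩
    refine ⟨by rw [modU]; nlinarith [hw.2], Real.exp_le_exp.2 (by linarith), ?_, b3⟩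
    have e : modU t w - modU t₀ w = 2 * (Real.exp (t / 2) - Real.exp (t₀ / 2)) * w +
      (Real.exp t - Real.exp t₀) := by rw [modU, modU]; ring
    rw [← sub_div, abs_div, abs_two] at b4
    rw [e]
    refine (abs_add_le _ _).trans ?_
    rw [abs_mul, abs_mul, abs_two]
    have := mul_le_of_le_one_right (a := 2 * |Real.exp (t / 2) - Real.exp (t₀ / 2)|)
      (by positivity) hw1
    linarith
  have hpt : ∀ t, |t - t₀| ≤ 1 → ∀ w ∈ Ioo (-1 : ℝ) 1, modU t₀ w ≤ 4 * modU t w →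
      ‖V (modU t w) (Real.exp t)‖ ≤
        C * (1 + 3 * E) ^ δ * 4 ^ (θ + δ) * modU t₀ w ^ (-(θ + δ)) ∧
      ‖V (modU t w) (Real.exp t) - V (modU t₀ w) (Real.exp t₀)‖ ≤
        K * 4 ^ (θ + δ) * modU t₀ w ^ (-(θ + δ)) * |t - t₀| ^ δ := fun t ht w hw h4 => by
    obtain ⟨c1, c2, c3, c4⟩ := hloc t ht w hw
    obtain ⟨d1, d2, -, -⟩ := hloc t₀ (by simp) w hw
    have hU := modU_pos t hw
    have hU₀ := modU_pos t₀ hw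
    set a := modU t₀ w / 4 with ha
    have ha0 : 0 < a := by positivity
    have e1 : 4 ^ (θ + δ) * modU t₀ w ^ (-(θ + δ)) = a ^ (-θ) * a ^ (-δ) := by
      rw [← Real.rpow_add ha0, ← neg_add, ha, Real.div_rpow hU₀.le (by norm_num),
        Real.rpow_neg (by norm_num : (0 : ℝ) ≤ 4), div_inv_eq_mul, mul_comm]
    have ha1 : a ≤ modU t w := by linarith
    have ha2 : a ≤ modU t₀ w := by linarith
    have pa := Real.rpow_pos_of_pos ha0 (-θ)
    have pb := Real.rpow_pos_of_pos ha0 (-δ)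
    have f1 : ‖V (modU t w) (Real.exp t)‖ ≤ C * a ^ (-θ) := (hb _ _ hU c1 c2).trans (by
      gcongr ?_ * ?_
      exact Real.rpow_le_rpow_of_nonpos ha0 ha1 (by linarith))
    have f2 : ‖V (modU t₀ w) (Real.exp t₀)‖ ≤ C * a ^ (-θ) := (hb _ _ hU₀ d1 d2).trans (by
      gcongr ?_ * ?_
      exact Real.rpow_le_rpow_of_nonpos ha0 ha2 (by linarith))
    constructor
    · rw [mul_assoc _ (4 ^ _), e1]
      refine f1.trans ?_
      have f3 : 1 ≤ (1 + 3 * E) ^ δ * a ^ (-δ) := by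
        rw [Real.rpow_neg ha0.le, ← div_eq_mul_inv, ← Real.div_rpow (by positivity) ha0.le]
        exact Real.one_le_rpow ((one_le_div ha0).2 (ha1.trans c1)) hδ.le
      calc C * a ^ (-θ) = C * a ^ (-θ) * 1 := (mul_one _).symm
        _ ≤ C * a ^ (-θ) * ((1 + 3 * E) ^ δ * a ^ (-δ)) := by gcongr
        _ = _ := by ring
    · set X := |t - t₀| / a with hX
      have hX0 : 0 ≤ X := by positivity
      have e2 : K * 4 ^ (θ + δ) * modU t₀ w ^ (-(θ + δ)) * |t - t₀| ^ δ = K * a ^ (-θ) * X ^ δ := by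
        rw [mul_assoc K, e1, hX, Real.div_rpow (abs_nonneg _) ha0.le, Real.rpow_neg ha0.le δ]
        ring
      rw [e2]
      have hK0 : 0 ≤ K := by positivity
      rcases le_total X 1 with h1 | h1
      · have hXδ : X ≤ X ^ δ := Real.self_le_rpow_of_le_one hX0 h1 hδ1
        have g1 := hl a _ _ _ _ ha0 ha1 ha2 c1 d1 c2 d2
        have ht' : |t - t₀| = X * a := by rw [hX]; field_simp
        have g2 : |modU t w - modU t₀ w| / a ≤ 2 * E * X := by
          rw [div_le_iff₀ ha0]
          calc _ ≤ 2 * E * |t - t₀| := c3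
            _ = _ := by rw [ht']; ring
        have g3 : |Real.exp t - Real.exp t₀| ≤ E * (1 + 3 * E) * X := by
          refine c4.trans ?_
          rw [ht']
          have : X * a ≤ X * (1 + 3 * E) := by gcongr; exact ha1.trans c1
          nlinarith
        refine g1.trans ?_
        calc _ ≤ L * a ^ (-θ) * (2 * E * X + E * (1 + 3 * E) * X) := by gcongr
          _ = (L * (2 * E + E * (1 + 3 * E))) * a ^ (-θ) * X := by ring
          _ ≤ K * a ^ (-θ) * X ^ δ := by gcongr; rw [hK]; linarith
      · have hXδ : 1 ≤ X ^ δ := Real.one_le_rpow h1 hδ.le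
        refine (norm_sub_le _ _).trans ((add_le_add f1 f2).trans ?_)
        calc C * a ^ (-θ) + C * a ^ (-θ) = 2 * C * a ^ (-θ) * 1 := by ring
          _ ≤ K * a ^ (-θ) * X ^ δ := by
            gcongr
            rw [hK]
            have : 0 ≤ L * (2 * E + E * (1 + 3 * E)) := by positivity
            linarith
  have hint : ∀ t, |t - t₀| ≤ 1 → (∀ w ∈ Ioo (-1 : ℝ) 1, modU t₀ w ≤ 4 * modU t w) →
      IntegrableOn (fun w => rho M w * V (modU t w) (Real.exp t)) (Ioo (-1) 1) := fun t ht h4 => by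
    have h1 := measurable_rho M
    have h2 : Measurable fun w => modU t w := measurable_modU.comp (measurable_const.prodMk measurable_id)
    have h3 : Measurable fun w => V (modU t w) (Real.exp t) :=
      hV.measurable.comp (h2.prodMk measurable_const)
    refine Integrable.mono' (hi.const_mul (C * (1 + 3 * E) ^ δ * 4 ^ (θ + δ)))
      (h1.mul h3).aestronglyMeasurable ?_
    filter_upwards [ae_restrict_mem measurableSet_Ioo] with w hw
    rw [norm_mul]
    calc _ ≤ ‖rho M w‖ * (C * (1 + 3 * E) ^ δ * 4 ^ (θ + δ) * modU t₀ w ^ (-(θ + δ))) := by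
          gcongr; exact (hpt t ht w hw (h4 w hw)).1
      _ = _ := by ring
  refine ⟨δ, hδ, Asymptotics.IsBigO.of_bound
    (K * 4 ^ (θ + δ) * ∫ w in Ioo (-1 : ℝ) 1, ‖rho M w‖ * modU t₀ w ^ (-(θ + δ))) ?_⟩
  filter_upwards [eventually_modU_le t₀, Metric.ball_mem_nhds t₀ one_pos] with t h4 ht
  rw [Metric.mem_ball, Real.dist_eq] at ht
  rw [angular, angular, ← integral_sub (hint t ht.le h4) (hint t₀ (by simp) fun w hw => by
    linarith [modU_pos t₀ hw]), Real.norm_of_nonneg (by positivity)]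
  refine (norm_integral_le_of_norm_le (hi.const_mul (K * 4 ^ (θ + δ) * |t - t₀| ^ δ)) ?_).trans ?_
  · filter_upwards [ae_restrict_mem measurableSet_Ioo] with w hw
    rw [← mul_sub, norm_mul]
    calc _ ≤ ‖rho M w‖ * (K * 4 ^ (θ + δ) * modU t₀ w ^ (-(θ + δ)) * |t - t₀| ^ δ) := by
          gcongr; exact (hpt t ht.le w hw (h4 w hw)).2
      _ = _ := by ring
  · rw [integral_const_mul]
    apply le_of_eq; ring

/-! ### The angular integral as a Fourier integral in the first index -/

lemma HoelderAt.comp_differentiableAt {g : ℝ → ℂ} {φ : ℝ → ℝ} {t₀ : ℝ} (hg : HoelderAt g (φ t₀))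
    (hφ : DifferentiableAt ℝ φ t₀) : HoelderAt (fun t => g (φ t)) t₀ := by
  obtain ⟨δ, hδ, hg⟩ := hg
  refine ⟨δ, hδ, (hg.comp_tendsto hφ.continuousAt).trans ?_⟩
  have h := hφ.isBigO_sub.abs_abs
  exact h.rpow hδ.le (Eventually.of_forall fun _ => abs_nonneg _)

/-- Away from the edges `w₀ ^ 2 = 1` the function is smooth or zero. At an edge it vanishes with
exponent `Re M - 3/2`, positive only under the second alternative. -/
lemma hoelderAt_indicator_rho {M : ℂ} {w₀ : ℝ} (h : w₀ ^ 2 ≠ 1 ∨ 3 / 2 < M.re) :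
    HoelderAt ((Ioo (-1 : ℝ) 1).indicator (rho M)) w₀ := by
  rcases lt_trichotomy (w₀ ^ 2) 1 with h1 | h1 | h1
  · have hw : w₀ ∈ Ioo (-1 : ℝ) 1 := abs_lt.1 ((sq_lt_one_iff_abs_lt_one _).1 h1)
    have h0 : 0 < 1 - w₀ ^ 2 := by linarith
    refine HoelderAt.congr (f := rho M) (hoelderAt_of_differentiableAt ?_) ?_
    · have k1 : HasDerivAt (fun z : ℂ => z ^ (M - 3 / 2)) _ ((1 - w₀ ^ 2 : ℝ) : ℂ) :=
        (hasDerivAt_id _).cpow_const (Or.inl (by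
          rw [id, Complex.ofReal_re]; exact h0))
      exact (k1.comp_ofReal.scomp w₀ (((hasDerivAt_id w₀).pow 2).const_sub 1)).differentiableAt
    · filter_upwards [isOpen_Ioo.mem_nhds hw] with w hw'
      rw [indicator_of_mem hw']
  · have hM := h.resolve_left (not_not.2 h1)
    have hn : w₀ ∉ Ioo (-1 : ℝ) 1 := fun hw => by have := one_sub_sq_pos hw; linarith
    refine ⟨M.re - 3 / 2, by linarith, ?_⟩
    rw [indicator_of_notMem hn]
    simp only [sub_zero]
    have k1 : (fun w : ℝ => |1 - w ^ 2| ^ (M.re - 3 / 2)) =O[𝓝 w₀]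
        fun w => |w - w₀| ^ (M.re - 3 / 2) := by
      have hd : DifferentiableAt ℝ (fun w : ℝ => 1 - w ^ 2) w₀ := by fun_prop
      have := hd.isBigO_sub
      simp only [h1, sub_self, sub_zero] at this
      exact this.abs_abs.rpow (by linarith) (Eventually.of_forall fun _ => abs_nonneg _)
    refine (Asymptotics.IsBigO.of_bound 1 (Eventually.of_forall fun w => ?_)).trans k1
    rw [Real.norm_of_nonneg (by positivity), one_mul]
    by_cases hw : w ∈ Ioo (-1 : ℝ) 1
    · have h0 := one_sub_sq_pos hw
      rw [indicator_of_mem hw, rho, norm_ofReal_cpow h0, abs_of_pos h0]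
      simp
    · rw [indicator_of_notMem hw, norm_zero]
      positivity
  · refine HoelderAt.congr (f := fun _ => 0)
      (hoelderAt_of_differentiableAt (differentiableAt_const _)) ?_
    have : ContinuousAt (fun w : ℝ => w ^ 2) w₀ := by fun_prop
    filter_upwards [this.eventually (lt_mem_nhds h1)] with w hw
    rw [indicator_of_notMem fun hw' => by have := one_sub_sq_pos hw'; linarith]

lemma Tame.hoelderAt {W : ℝ → ℝ → ℂ} {κ : ℝ} (h : Tame W κ) {u v : ℝ} (hu : 0 < u) (hv : 0 < v) :
    HoelderAt (fun u => W u v) u := by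
  obtain ⟨L, -, hL⟩ := h.lipschitz (2 * u) v hv
  refine hoelderAt_of_isBigO (Asymptotics.IsBigO.of_bound (L * (u / 2) ^ (-κ) / (u / 2)) ?_)
  filter_upwards [Ioo_mem_nhds (half_lt_self hu) (show u < 2 * u by linarith)] with z hz
  have := hL (u / 2) z u v v (half_pos hu) hz.1.le (half_le_self hu.le) hz.2.le (by linarith) le_rfl
    le_rfl
  rw [sub_self v, abs_zero, add_zero] at this
  rw [Real.norm_eq_abs]
  refine this.trans (le_of_eq ?_)
  ring

/-- The cosine of the angle as a function of the logarithms of the squares of the distances. -/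
def cosAngle (t q : ℝ) : ℝ := (Real.exp q - 1 - Real.exp t) / (2 * Real.exp (t / 2))

lemma modU_cosAngle (t q : ℝ) : modU t (cosAngle t q) = Real.exp q := by
  have := Real.exp_pos (t / 2)
  rw [modU, cosAngle, mul_div_cancel₀ _ (by positivity)]
  ring

lemma hasDerivAt_cosAngle (t q : ℝ) :
    HasDerivAt (cosAngle t) (Real.exp q / (2 * Real.exp (t / 2))) q :=
  (((Real.hasDerivAt_exp q).sub_const 1).sub_const (Real.exp t)).div_const _

lemma injective_cosAngle (t : ℝ) : Function.Injective (cosAngle t) := fun q q' h => by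
  have := congrArg (modU t) h
  rw [modU_cosAngle, modU_cosAngle] at this
  exact Real.exp_injective this

lemma image_cosAngle (t : ℝ) : cosAngle t '' (cosAngle t ⁻¹' Ioo (-1) 1) = Ioo (-1) 1 := by
  refine (image_preimage_subset _ _).antisymm fun w hw => ?_
  have h := Real.exp_log (modU_pos t hw)
  have e : cosAngle t (Real.log (modU t w)) = w := by
    have := Real.exp_pos (t / 2)
    rw [cosAngle, h, modU]
    field_simp
    ring
  exact ⟨_, by rwa [mem_preimage, e], e⟩

/-- The angular integral of `u ^ (-ν) * W u v` is the Fourier transform of this function of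
`log u`. -/
def angularDensity (M : ℂ) (γ : ℝ) (W : ℝ → ℝ → ℂ) (t q : ℝ) : ℂ :=
  ((Real.exp q / (2 * Real.exp (t / 2)) : ℝ) : ℂ) * cexp (-(γ * q)) *
    (Ioo (-1 : ℝ) 1).indicator (rho M) (cosAngle t q) * W (Real.exp q) (Real.exp t)

lemma hoelderAt_angularDensity {M : ℂ} {γ κ t q : ℝ} {W : ℝ → ℝ → ℂ} (hW : Tame W κ)
    (h : cosAngle t q ^ 2 ≠ 1 ∨ 3 / 2 < M.re) : HoelderAt (angularDensity M γ W t) q := by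
  have hd := (hasDerivAt_cosAngle t q).differentiableAt
  have h1 : DifferentiableAt ℝ (fun q : ℝ =>
      ((Real.exp q / (2 * Real.exp (t / 2)) : ℝ) : ℂ) * cexp (-(γ * q))) q := by
    have k : HasDerivAt (fun q : ℝ => ((Real.exp q / (2 * Real.exp (t / 2)) : ℝ) : ℂ)) _ q :=
      HasDerivAt.ofReal_comp ((Real.hasDerivAt_exp q).div_const (2 * Real.exp (t / 2)))
    have k' : HasDerivAt (fun q : ℝ => cexp (-(γ * q))) _ q :=
      (((Complex.ofRealCLM.hasDerivAt (x := q)).const_mul (γ : ℂ)).neg).cexp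
    exact k.differentiableAt.mul k'.differentiableAt
  exact ((hoelderAt_of_differentiableAt h1).mul
    ((hoelderAt_indicator_rho h).comp_differentiableAt hd)).mul
    ((hW.hoelderAt (Real.exp_pos q) (Real.exp_pos t)).comp_differentiableAt
      Real.differentiableAt_exp)

lemma integrableOn_angular {M : ℂ} (hM : 1 / 2 < M.re) {θ t₀ : ℝ}
    (h : t₀ ≠ 0 ∨ θ < M.re - 1 / 2) {V : ℝ → ℝ → ℂ} (hV : Tame V θ) :
    IntegrableOn (fun w => rho M w * V (modU t₀ w) (Real.exp t₀)) (Ioo (-1) 1) := by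
  obtain ⟨δ, hδ, -, hi⟩ := exists_modU_weight hM h
  set U := 1 + 2 * Real.exp (t₀ / 2) + Real.exp t₀ with hU
  obtain ⟨C, hC, hb⟩ := hV.bound U (Real.exp t₀) (Real.exp_pos _)
  have h1 := measurable_rho M
  have h2 : Measurable fun w => modU t₀ w :=
    measurable_modU.comp (measurable_const.prodMk measurable_id)
  have h3 : Measurable fun w => V (modU t₀ w) (Real.exp t₀) :=
    hV.measurable.comp (h2.prodMk measurable_const)
  refine Integrable.mono' (hi.const_mul (C * U ^ δ)) (h1.mul h3).aestronglyMeasurable ?_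
  filter_upwards [ae_restrict_mem measurableSet_Ioo] with w hw
  have hp := modU_pos t₀ hw
  have hle : modU t₀ w ≤ U := by
    rw [modU, hU]; nlinarith [hw.2, Real.exp_pos (t₀ / 2)]
  have h4 : 1 ≤ U ^ δ * modU t₀ w ^ (-δ) := by
    rw [Real.rpow_neg hp.le, ← div_eq_mul_inv, ← Real.div_rpow (hp.le.trans hle) hp.le]
    exact Real.one_le_rpow ((one_le_div hp).2 hle) hδ.le
  have h5 := Real.rpow_pos_of_pos hp (-θ)
  rw [norm_mul, neg_add, Real.rpow_add hp]
  calc _ ≤ ‖rho M w‖ * (C * modU t₀ w ^ (-θ) * 1) := by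
        rw [mul_one]; gcongr; exact hb _ _ hp hle le_rfl
    _ ≤ ‖rho M w‖ * (C * modU t₀ w ^ (-θ) * (U ^ δ * modU t₀ w ^ (-δ))) := by gcongr
    _ = _ := by ring

lemma cpow_mul_eq_angularDensity (M : ℂ) (γ s t q : ℝ) (W : ℝ → ℝ → ℂ) :
    (cosAngle t ⁻¹' Ioo (-1) 1).indicator (fun q => |Real.exp q / (2 * Real.exp (t / 2))| •
      (rho M (cosAngle t q) * ((modU t (cosAngle t q) : ℂ) ^ (-verticalLine γ s) *
        W (modU t (cosAngle t q)) (Real.exp t)))) q =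
      cexp (-(s * q : ℝ) * I) * angularDensity M γ W t q := by
  by_cases hq : cosAngle t q ∈ Ioo (-1 : ℝ) 1
  · have e : cexp (-(verticalLine γ s) * q) = cexp (-(s * q : ℝ) * I) * cexp (-(γ * q)) := by
      rw [← Complex.exp_add, verticalLine]
      congr 1
      push_cast
      ring
    rw [indicator_of_mem (show q ∈ cosAngle t ⁻¹' Ioo (-1) 1 from hq), angularDensity,
      indicator_of_mem hq, modU_cosAngle, ofReal_exp_cpow, e, abs_of_pos (by positivity),
      Complex.real_smul]
    ring
  · rw [indicator_of_notMem (show q ∉ cosAngle t ⁻¹' Ioo (-1) 1 from hq), angularDensity,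
      indicator_of_notMem hq]
    ring

/-- At fixed `t` the cosine is replaced by `q = log u`. Then `u ^ (-ν₁)` splits into a real
exponential, which goes into the density, and the Fourier character of `Im ν₁`. -/
lemma angular_eq_lineFourier (M : ℂ) (γ s t : ℝ) (W : ℝ → ℝ → ℂ) :
    angular M (fun u v => (u : ℂ) ^ (-verticalLine γ s) * W u v) t =
      lineFourier (angularDensity M γ W t) s := by
  have hm : MeasurableSet (cosAngle t ⁻¹' Ioo (-1) 1) := by
    have : Measurable (cosAngle t) := by unfold cosAngle; fun_prop
    exact this measurableSet_Ioo
  have h := integral_image_eq_integral_abs_deriv_smul hm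
    (fun q _ => (hasDerivAt_cosAngle t q).hasDerivWithinAt) (injective_cosAngle t).injOn
    (fun w => rho M w * ((modU t w : ℂ) ^ (-verticalLine γ s) * W (modU t w) (Real.exp t)))
  rw [image_cosAngle, ← integral_indicator hm] at h
  simp only [cpow_mul_eq_angularDensity] at h
  exact h

lemma integrable_angularDensity {M : ℂ} (hM : 1 / 2 < M.re) {γ κ t : ℝ} (hγ : 0 ≤ γ) (hκ : 0 ≤ κ)
    (h : t ≠ 0 ∨ γ + κ < M.re - 1 / 2) {W : ℝ → ℝ → ℂ} (hW : Tame W κ) :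
    Integrable (angularDensity M γ W t) := by
  have hm : MeasurableSet (cosAngle t ⁻¹' Ioo (-1) 1) := by
    have : Measurable (cosAngle t) := by unfold cosAngle; fun_prop
    exact this measurableSet_Ioo
  have hr : (verticalLine γ 0).re = γ := by simp [verticalLine]
  have i := integrableOn_angular hM (by rwa [hr]) (hW.cpow_mul hκ (ν := verticalLine γ 0) (by
    rwa [hr]))
  rw [← image_cosAngle t, integrableOn_image_iff_integrableOn_abs_deriv_smul hm
    (fun q _ => (hasDerivAt_cosAngle t q).hasDerivWithinAt) (injective_cosAngle t).injOn,
    ← integrable_indicator_iff hm] at i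
  have e : ∀ q, _ = _ := fun q => cpow_mul_eq_angularDensity M γ 0 t q W
  refine i.congr (Eventually.of_forall fun q => (e q).trans ?_)
  simp

/-! ### Double inverse Mellin transforms and the product formula -/

/-- The inverse Mellin transform of the bubble in terms of `x` and `y`, up to a constant. -/
def angularFactor (M : ℂ) (x y : ℝ) : ℂ :=
  cexp (M * (-Real.log y : ℝ)) *
    ((Real.exp (-Real.log x) / (2 * Real.exp (-Real.log y / 2)) : ℝ) : ℂ) *
    (Ioo (-1 : ℝ) 1).indicator (rho M) (cosAngle (-Real.log y) (-Real.log x))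

lemma ofReal_cpow_neg_verticalLine {x : ℝ} (hx : 0 < x) (γ s : ℝ) :
    (x : ℂ) ^ (-verticalLine γ s) =
      cexp (γ * (-Real.log x : ℝ)) * cexp ((s * -Real.log x : ℝ) * I) := by
  rw [ofReal_cpow_eq_exp hx, ← Complex.exp_add, verticalLine]
  congr 1
  push_cast
  ring

lemma sq_cosAngle_eq_one {x y : ℝ} (hx : 0 < x) (hy : 0 < y)
    (h : cosAngle (-Real.log y) (-Real.log x) ^ 2 = 1) :
    (1 + 1 / x - 1 / y) ^ 2 = 4 * (1 / x) := by
  have h1 := exp_half_sq (-Real.log y)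
  rw [cosAngle, div_pow, div_eq_one_iff_eq (by positivity), mul_pow, h1, Real.exp_neg, Real.exp_neg,
    Real.exp_log hx, Real.exp_log hy] at h
  rw [one_div, one_div]
  linear_combination h

/-- Two pointwise Fourier inversions. The one in `ν₄`, at `t = -log y`, evaluates the angular
average at `v = 1/y`; the one in `ν₁`, at `q = -log x`, evaluates its density at `u = 1/x`.
Everything except `c` and the value of `W` depends only on `M`, `x` and `y`. -/
theorem hasDoubleInverseMellin_of_angular {M : ℂ} (hM : 1 / 2 < M.re) {γ₃ γ₄ x y κ : ℝ}
    (hx : 0 < x) (hy : 0 < y) (hγ : 0 ≤ γ₃) (hκ : 0 ≤ κ) {W : ℝ → ℝ → ℂ} (hW : Tame W κ)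
    {f : ℂ → ℂ → ℂ} {c : ℂ}
    (hf : ∀ ν₁ ν₄ : ℂ, ν₁.re = γ₃ → ν₄.re = γ₄ →
      Integrable (fun t : ℝ => cexp ((M - ν₄) * t) *
        angular M (fun u v => (u : ℂ) ^ (-ν₁) * W u v) t) ∧
      f ν₁ ν₄ = c * ∫ t : ℝ, cexp ((M - ν₄) * t) *
        angular M (fun u v => (u : ℂ) ^ (-ν₁) * W u v) t)
    (h₁ : y ≠ 1 ∨ γ₃ + κ < M.re - 1 / 2)
    (h₂ : (1 + 1 / x - 1 / y) ^ 2 ≠ 4 * (1 / x) ∨ 3 / 2 < M.re) :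
    HasDoubleInverseMellin γ₃ γ₄ f x y (c * angularFactor M x y * W x⁻¹ y⁻¹) := by
  have hre : ∀ γ s : ℝ, (verticalLine γ s).re = γ := fun γ s => by simp [verticalLine]
  set t₀ := -Real.log y with ht₀
  set q₀ := -Real.log x with hq₀
  have ht : t₀ ≠ 0 ∨ γ₃ + κ < M.re - 1 / 2 := h₁.imp_left fun h h' => h
    (Real.eq_one_of_pos_of_log_eq_zero hy (neg_eq_zero.1 h'))
  have hq : cosAngle t₀ q₀ ^ 2 ≠ 1 ∨ 3 / 2 < M.re :=
    h₂.imp_left fun h h' => h (sq_cosAngle_eq_one hx hy h')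
  set A : ℂ → ℝ → ℂ := fun ν₁ => angular M fun u v => (u : ℂ) ^ (-ν₁) * W u v with hA
  set G : ℂ → ℝ → ℂ := fun ν₁ t => cexp ((M - γ₄) * t) * A ν₁ t with hG
  have hGs : ∀ (ν₁ : ℂ) (s t : ℝ), cexp ((M - verticalLine γ₄ s) * t) * A ν₁ t =
      cexp (-(s * t : ℝ) * I) * G ν₁ t := fun ν₁ s t => by
    rw [hG, ← mul_assoc, ← Complex.exp_add, verticalLine]
    congr 2
    push_cast
    ring
  set h : ℂ → ℂ := fun ν₁ => 2 * Real.pi * I *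
    ((x : ℂ) ^ (-ν₁) * cexp (γ₄ * t₀) * c * G ν₁ t₀) with hh
  have inner : ∀ s : ℝ, HasVerticalIntegral γ₄ (fun ν₄ => (x : ℂ) ^ (-(verticalLine γ₃ s)) *
      (y : ℂ) ^ (-ν₄) * f (verticalLine γ₃ s) ν₄) (h (verticalLine γ₃ s)) := fun s => by
    have i0 := (hf (verticalLine γ₃ s) (verticalLine γ₄ 0) (hre _ _) (hre _ _)).1
    have hi : Integrable (G (verticalLine γ₃ s)) := i0.congr (Eventually.of_forall fun t =>
      (hGs _ _ _).trans (by simp))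
    refine hasVerticalIntegral_of_lineFourier hi ?_ fun r => ?_
    · have hT := hW.cpow_mul hκ (ν := verticalLine γ₃ s) (by rwa [hre])
      rw [hre] at hT
      refine (hoelderAt_of_differentiableAt ?_).mul (hoelderAt_angular hM (by positivity) ht hT)
      exact (((Complex.ofRealCLM.hasDerivAt (x := t₀)).const_mul (M - γ₄)).cexp).differentiableAt
    · rw [(hf _ _ (hre γ₃ s) (hre γ₄ r)).2, ofReal_cpow_neg_verticalLine hy, lineFourier]
      simp only [← hGs]
      ring
  have hD := integrable_angularDensity hM hγ hκ ht hW
  have outer : HasVerticalIntegral γ₃ h (2 * Real.pi * I * ((2 * Real.pi * I * cexp (γ₃ * q₀) *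
      cexp (γ₄ * t₀) * c * cexp ((M - γ₄) * t₀)) * angularDensity M γ₃ W t₀ q₀)) :=
    hasVerticalIntegral_of_lineFourier hD (hoelderAt_angularDensity hW hq) fun s => by
      simp only [hh, hG, hA]
      rw [angular_eq_lineFourier, ofReal_cpow_neg_verticalLine hx]
      ring
  refine ⟨h, _, inner, outer, ?_⟩
  have e1 : cexp (M * t₀) = cexp (γ₄ * t₀) * cexp ((M - γ₄) * t₀) := by
    rw [← Complex.exp_add]; congr 1; ring
  have e2 : cexp (γ₃ * q₀) * cexp (-(γ₃ * q₀)) = 1 := by rw [← Complex.exp_add]; simp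
  have e3 : Real.exp q₀ = x⁻¹ := by rw [hq₀, Real.exp_neg, Real.exp_log hx]
  have e4 : Real.exp t₀ = y⁻¹ := by rw [ht₀, Real.exp_neg, Real.exp_log hy]
  have e5 : (2 * Real.pi * I : ℂ) ≠ 0 := Complex.two_pi_I_ne_zero
  rw [angularFactor, angularDensity, ← ht₀, ← hq₀, e1, e4, ← e3]
  generalize (2 * Real.pi * I : ℂ) = z at e5 ⊢
  generalize ((Real.exp q₀ / (2 * Real.exp (t₀ / 2)) : ℝ) : ℂ) = a
  generalize (Ioo (-1 : ℝ) 1).indicator (rho M) (cosAngle t₀ q₀) = b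
  generalize W (Real.exp q₀) y⁻¹ = d
  generalize cexp (γ₃ * q₀) = g at e2 ⊢
  generalize cexp (-(γ₃ * q₀)) = g' at e2 ⊢
  generalize cexp (γ₄ * t₀) = k
  generalize cexp ((M - γ₄) * t₀) = l
  have e6 : 1 / z ^ 2 * (z * (z * g * k * c * l * (a * g' * b * d))) =
      (g * g') * (c * (k * l * a * b) * d) * (1 / z ^ 2 * z ^ 2) := by ring
  rw [e6, e2, one_div_mul_cancel (pow_ne_zero 2 e5)]
  ring

/-- With `W = 1` for the bubble and `W` the integral of the triangle for the two-loop diagram, the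
same factor `angularFactor` appears in both transforms. When `√u`, `√v` and `1` do not form a
triangle, that factor and both transforms vanish. -/
theorem product_formula {m : ℤ} {ε ν₂ ν₃ ν₅ : ℂ} {P γ₃ γ₄ x y : ℝ} (hP : 0 < P) (hx : 0 < x)
    (hy : 0 < y) (hM : 1 / 2 < ((m : ℂ) - ε).re) (hT : TriConv (m - ε) ν₂ ν₃ ν₅)
    (h₃ : γ₃ < ((m : ℂ) - ε).re) (h₄ : γ₄ < ((m : ℂ) - ε).re) (h : ((m : ℂ) - ε).re < γ₃ + γ₄)
    (h₃' : γ₃ + (ν₂ + ν₅).re < 2 * ((m : ℂ) - ε).re)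
    (h₄' : γ₄ + (ν₃ + ν₅).re < 2 * ((m : ℂ) - ε).re)
    (hy1 : y ≠ 1 ∨ (γ₃ < ((m : ℂ) - ε).re - 1 / 2 ∧
      γ₃ + (ν₂ + ν₅).re < 2 * ((m : ℂ) - ε).re - 1 / 2))
    (hg : (1 + 1 / x - 1 / y) ^ 2 ≠ 4 * (1 / x) ∨ 3 / 2 < ((m : ℂ) - ε).re) :
    TriangleConverges m ε P ν₂ ν₃ ν₅ x y ∧
      ∃ I₁₂ I₂₅ : ℂ,
        HasDoubleInverseMellin γ₃ γ₄ (fun ν₁ ν₄ => bubble m ε P ν₁ ν₄) x y I₁₂ ∧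
        HasDoubleInverseMellin γ₃ γ₄ (fun ν₁ ν₄ => twoLoop m ε P ν₁ ν₂ ν₃ ν₄ ν₅) x y I₂₅ ∧
        I₂₅ = I₁₂ * triangle m ε P ν₂ ν₃ ν₅ x y := by
  have hγ : 0 < γ₃ := by linarith
  have hγ' : 0 < γ₄ := by linarith
  -- The triangle may grow like `u ^ (-κ)` as `u → 0`. At `y = 1` the exponent `γ₃ + κ` must stay
  -- below `Re M - 1/2`; the two inequalities assumed there leave room for such a `κ`.
  obtain ⟨κ, hκ, hκ', hκy⟩ : ∃ κ : ℝ, 0 < κ ∧ (ν₂ + ν₅).re - ((m : ℂ) - ε).re < κ ∧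
      (y ≠ 1 ∨ γ₃ + κ < ((m : ℂ) - ε).re - 1 / 2) := by
    rcases hy1 with h1 | ⟨h1, h2⟩
    · exact ⟨max 0 ((ν₂ + ν₅).re - ((m : ℂ) - ε).re) + 1, by positivity, by
        linarith [le_max_right 0 ((ν₂ + ν₅).re - ((m : ℂ) - ε).re)], Or.inl h1⟩
    · obtain ⟨κ, k1, k2⟩ := exists_between (a₁ := max 0 ((ν₂ + ν₅).re - ((m : ℂ) - ε).re))
        (a₂ := ((m : ℂ) - ε).re - 1 / 2 - γ₃) (max_lt (by linarith) (by linarith))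
      exact ⟨κ, (le_max_left _ _).trans_lt k1, (le_max_right _ _).trans_lt k1, Or.inr (by linarith)⟩
  have hb := hasDoubleInverseMellin_of_angular hM hx hy hγ.le hκ.le (tame_const 1 hκ.le)
    (f := fun ν₁ ν₄ => bubble m ε P ν₁ ν₄) (γ₄ := γ₄)
    (fun ν₁ ν₄ e₁ e₄ => bubble_eq_angular hP hM (by rwa [add_re, e₁, e₄]) (by rwa [e₁])
      (by rwa [e₄])) hκy hg
  have ht := hasDoubleInverseMellin_of_angular hM hx hy hγ.le hκ.le (tame_triangle hT hκ hκ')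
    (f := fun ν₁ ν₄ => twoLoop m ε P ν₁ ν₂ ν₃ ν₄ ν₅) (γ₄ := γ₄)
    (fun ν₁ ν₄ e₁ e₄ => twoLoop_eq_angular hP hM (by
      obtain ⟨a2, b2, a3, b3, a5, b5, a⟩ := hT
      have hMM : (2 * ((m : ℂ) - ε)).re = 2 * ((m : ℂ) - ε).re := by simp
      refine ⟨fun j => ?_, ?_, ?_, ?_, ?_, ?_⟩
      · fin_cases j
        · exact ⟨by simpa [e₁] using hγ, by simpa [e₁] using h₃⟩
        · exact ⟨a2, b2⟩
        · exact ⟨a3, b3⟩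
        · exact ⟨by simpa [e₄] using hγ', by simpa [e₄] using h₄⟩
        · exact ⟨a5, b5⟩
      all_goals
        simp only [hMM]
        simp only [Matrix.cons_val, add_re, e₁, e₄] at *
        linarith)) hκy hg
  obtain ⟨C, hC⟩ := exists_triBound hT hκ hκ' (U := x⁻¹) (inv_pos.2 hy)
  refine ⟨(triangleConverges_iff hP).2 (hC x⁻¹ y⁻¹ (inv_pos.2 hx) le_rfl le_rfl).1, _, _, hb, ht, ?_⟩
  rw [triangle_eq hP]
  ring

end FeynmanMB

end

/-! ### The three statements together -/

theorem mainTheorem2 (m : ℤ) :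
    -- the convolution formula with straight contours that separate the poles
    (∀ (ε ν₁ ν₂ ν₃ ν₄ ν₅ : ℂ) (P γ₁ γ₂ : ℝ), 0 < P → 0 < ν₁.re → 0 < ν₄.re →
      FeynmanMB.SeparatingLines m ε ν₁ ν₂ ν₃ ν₄ ν₅ γ₁ γ₂ →
      FeynmanMB.TwoLoopConverges m ε P ν₁ ν₂ ν₃ ν₄ ν₅ ∧
      (∀ x y : ℝ, 0 < x → 0 < y → FeynmanMB.TriangleConverges m ε P ν₂ ν₃ ν₅ x y) ∧
      (∀ σ τ : ℂ, σ.re = γ₁ → τ.re = γ₂ →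
        FeynmanMB.BubbleConverges m ε P (ν₁ - τ) (ν₄ - σ) ∧
        FeynmanMB.bubble m ε P (ν₁ - τ) (ν₄ - σ)
          = FeynmanMB.bubbleGamma m ε (ν₁ - τ) (ν₄ - σ) ∧
        FeynmanMB.TriangleMellinConverges m ε P ν₂ ν₃ ν₅ τ σ ∧
        FeynmanMB.triangleMellin m ε P ν₂ ν₃ ν₅ τ σ
          = FeynmanMB.triangleGamma m ε ν₂ ν₃ ν₅ τ σ) ∧
      MeasureTheory.Integrable (fun z : ℝ × ℝ =>
        FeynmanMB.bubble m ε P (ν₁ - FeynmanMB.verticalLine γ₂ z.2)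
            (ν₄ - FeynmanMB.verticalLine γ₁ z.1) *
          FeynmanMB.triangleMellin m ε P ν₂ ν₃ ν₅ (FeynmanMB.verticalLine γ₂ z.2)
            (FeynmanMB.verticalLine γ₁ z.1)) ∧
      FeynmanMB.twoLoop m ε P ν₁ ν₂ ν₃ ν₄ ν₅ =
        1 / (2 * Real.pi * Complex.I) ^ 2 *
          FeynmanMB.contourIntegral (FeynmanMB.verticalLine γ₁) (fun σ =>
            FeynmanMB.contourIntegral (FeynmanMB.verticalLine γ₂) (fun τ =>
              FeynmanMB.bubble m ε P (ν₁ - τ) (ν₄ - σ) *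
                FeynmanMB.triangleMellin m ε P ν₂ ν₃ ν₅ τ σ))) ∧
    -- the convolution formula for the dimensionally continued integral, with indented contours
    (∃ F : ℂ × (Fin 5 → ℂ) → ℂ,
      DifferentiableOn ℂ F (FeynmanMB.genericRegion m) ∧
      (∀ q ∈ FeynmanMB.convergenceRegion m, ∀ P : ℝ, 0 < P →
        FeynmanMB.TwoLoopConverges m q.1 P (q.2 0) (q.2 1) (q.2 2) (q.2 3) (q.2 4) ∧
        (q ∈ FeynmanMB.genericRegion m →
          F q = FeynmanMB.twoLoop m q.1 P (q.2 0) (q.2 1) (q.2 2) (q.2 3) (q.2 4))) ∧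
      (∀ (ε ν₁ ν₂ ν₃ ν₄ ν₅ : ℂ),
        (ε, ![ν₁, ν₂, ν₃, ν₄, ν₅]) ∈ FeynmanMB.genericRegion m →
        ∀ (cσ : ℝ → ℂ) (cτ : ℝ → ℝ → ℂ), FeynmanMB.IsIndentedLine cσ →
        FeynmanMB.SeparatesOuter m ε ν₂ ν₃ ν₄ ν₅ cσ →
        (∀ s : ℝ, FeynmanMB.IsIndentedLine (cτ s) ∧
          FeynmanMB.SeparatesInner m ε ν₁ ν₂ ν₃ ν₄ ν₅ (cσ s) (cτ s)) →
        (∀ s : ℝ, FeynmanMB.ContourIntegrable (cτ s) (fun τ =>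
          FeynmanMB.bubbleGamma m ε (ν₁ - τ) (ν₄ - cσ s) *
            FeynmanMB.triangleGamma m ε ν₂ ν₃ ν₅ τ (cσ s))) ∧
        MeasureTheory.Integrable (fun s : ℝ =>
          FeynmanMB.contourIntegral (cτ s) (fun τ =>
            FeynmanMB.bubbleGamma m ε (ν₁ - τ) (ν₄ - cσ s) *
              FeynmanMB.triangleGamma m ε ν₂ ν₃ ν₅ τ (cσ s)) * deriv cσ s) ∧
        F (ε, ![ν₁, ν₂, ν₃, ν₄, ν₅]) =
          1 / (2 * Real.pi * Complex.I) ^ 2 *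
            ∫ s : ℝ, FeynmanMB.contourIntegral (cτ s) (fun τ =>
              FeynmanMB.bubbleGamma m ε (ν₁ - τ) (ν₄ - cσ s) *
                FeynmanMB.triangleGamma m ε ν₂ ν₃ ν₅ τ (cσ s)) * deriv cσ s)) ∧
    -- the product formula after double inverse Mellin transformation in `ν₁` and `ν₄`
    (∀ (ε ν₂ ν₃ ν₅ : ℂ) (P γ₃ γ₄ x y : ℝ), 0 < P → 0 < x → 0 < y →
      1 / 2 < ((m : ℂ) - ε).re →
      0 < ν₂.re → ν₂.re < ((m : ℂ) - ε).re →
      0 < ν₃.re → ν₃.re < ((m : ℂ) - ε).re →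
      0 < ν₅.re → ν₅.re < ((m : ℂ) - ε).re →
      ((m : ℂ) - ε).re < (ν₂ + ν₃ + ν₅).re →
      γ₃ < ((m : ℂ) - ε).re → γ₄ < ((m : ℂ) - ε).re → ((m : ℂ) - ε).re < γ₃ + γ₄ →
      γ₃ + (ν₂ + ν₅).re < 2 * ((m : ℂ) - ε).re →
      γ₄ + (ν₃ + ν₅).re < 2 * ((m : ℂ) - ε).re →
      -- points at which one of the iterated integrals need not converge
      (y ≠ 1 ∨ (γ₃ < ((m : ℂ) - ε).re - 1 / 2 ∧
        γ₃ + (ν₂ + ν₅).re < 2 * ((m : ℂ) - ε).re - 1 / 2)) →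
      ((1 + 1 / x - 1 / y) ^ 2 ≠ 4 * (1 / x) ∨ 3 / 2 < ((m : ℂ) - ε).re) →
      FeynmanMB.TriangleConverges m ε P ν₂ ν₃ ν₅ x y ∧
      ∃ I₁₂ I₂₅ : ℂ,
        FeynmanMB.HasDoubleInverseMellin γ₃ γ₄
          (fun ν₁ ν₄ => FeynmanMB.bubble m ε P ν₁ ν₄) x y I₁₂ ∧
        FeynmanMB.HasDoubleInverseMellin γ₃ γ₄
          (fun ν₁ ν₄ => FeynmanMB.twoLoop m ε P ν₁ ν₂ ν₃ ν₄ ν₅) x y I₂₅ ∧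
        I₂₅ = I₁₂ * FeynmanMB.triangle m ε P ν₂ ν₃ ν₅ x y) := by
  refine ⟨fun ε ν₁ ν₂ ν₃ ν₄ ν₅ P γ₁ γ₂ hP h₁ h₄ h =>
    FeynmanMB.convolution_straight hP h₁ h₄ h,
    ⟨FeynmanMB.twoLoopContinued m, FeynmanMB.differentiableOn_twoLoopContinued m,
      fun q hq P hP => ⟨FeynmanMB.twoLoopConverges_of_mem hP hq, fun hg =>
        FeynmanMB.twoLoopContinued_eq_twoLoop hP hq fun k => (hg k).1⟩,
      fun ε ν₁ ν₂ ν₃ ν₄ ν₅ hq cσ cτ hc hs h => FeynmanMB.twoLoopContinued_eq hq hc hs h⟩, ?_⟩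
  intro ε ν₂ ν₃ ν₅ P γ₃ γ₄ x y hP hx hy hM a2 b2 a3 b3 a5 b5 a h₃ h₄ h h₃' h₄' hy1 hg
  exact FeynmanMB.product_formula hP hx hy hM ⟨a2, b2, a3, b3, a5, b5, a⟩ h₃ h₄ h h₃' h₄' hy1 hg
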